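/- **Conventions.** Let $d\ge 3$ (the supersymmetric cases are $d=3,4,6,10$). We work in Euclidean signature on $\mathbb R^d$; repeated indices are summed, and $[\ldots]$ denotes antisymmetrisation with weight one. Let $f^{abc}$ be real, totally antisymmetric structure constants (indices in a finite non-empty set) satisfying the Jacobi identity and $f^{acd}f^{bcd}=N\delta^{ab}$ with $N>0$. Let $C(x)=\frac{\Gamma(d/2-1)}{4\pi^{d/2}}|x|^{2-d}$, so that $\Box C=-\delta$; $\partial C(x-y)$ denotes the derivative of $C$ evaluated at $x-y$. Put $F^a_{\mu\nu}=\partial_\mu A^a_\nu-\partial_\nu A^a_\mu+gf^{abc}A^b_\mu A^c_\nu$. For a gauge field $A^a_\mu$ define the map $\mathcal T_g A$, truncated after order $g^3$, by $$\begin{aligned} (\mathcal T_gA)^a_\mu(x)&=A^a_\mu(x)+g f^{abc}\!\int\! dy\,\partial^\rho C(x-y)A^b_\mu(y)A^c_\rho(y)\\ &+\tfrac{3g^2}{2}f^{abc}f^{bde}\!\int\! dy\,dz\,\partial^\rho C(x-y)A^{c\lambda}(y)\,\partial_{[\rho}C(y-z)A^d_\mu(z)A^e_{\lambda]}(z)\\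 &+\tfrac{g^3}{2}f^{abc}f^{bde}f^{cfg}\!\int\! dy\,dz\,dw\,\partial^\rho C(x-y)\,\partial^\lambda C(y-z)A^d_\lambda(z)A^{e\sigma}(z)\,\partial_{[\rho}C(y-w)A^f_\mu(w)A^g_{\sigma]}(w)\\ &+g^3f^{abc}f^{bde}f^{dfg}\!\int\! dy\,dz\,dw\,\partial^\rho C(x-y)A^{c\lambda}(y)\big\{-\partial^\sigma C(y-z)A^e_\sigma(z)\,\partial_{[\rho}C(z-w)A^f_\mu(w)A^g_{\lambda]}(w)\\ &\qquad+\partial_{[\rho}C(y-z)A^e_\mu(z)\,\partial^\sigma C(z-w)A^f_{\lambda]}(w)A^g_\sigma(w)\big\}\\ &+\tfrac{g^3}{3}f^{abc}f^{bde}f^{dfg}\!\int\! dy\,dz\,dw\,\big\{6\,\partial_\rho C(x-y)A^{c\lambda}(y)\,\partial^{[\rho}C(y-z)A^{e\sigma]}(z)\,\partial_{[\lambda}C(z-w)A^f_\mu(w)A^g_{\sigma]}(w)\\ &\qquad-6\,\partial^\rho C(x-y)A^c_\lambda(y)\,\partial^{[\lambda}C(y-z)A^{e\sigma]}(z)\,\partial_{[\rho}C(z-w)A^f_\mu(w)A^g_{\sigma]}(w)\\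 &\qquad-6\,\partial_\rho C(x-y)A^c_\lambda(y)\,\partial_{[\sigma}C(y-z)A^e_{\mu]}(z)\,\partial^{[\rho}C(z-w)A^{f\lambda}(w)A^{\sigma]g}(w)\\ &\qquad+2\,\partial^\rho C(x-y)A^c_{[\rho}(y)\,\partial_{\mu]}C(y-z)A^{e\lambda}(z)\,\partial^\sigma C(z-w)A^f_\lambda(w)A^g_\sigma(w)\\ &\qquad-\partial_\mu C(x-y)\,\partial^\rho\big(A^c_\rho(y)C(y-z)\big)A^{e\lambda}(z)\,\partial^\sigma C(z-w)A^f_\lambda(w)A^g_\sigma(w)\big\}\\ &-\tfrac{g^3}{3}f^{abc}f^{bde}f^{dfg}\!\int\! dy\,dz\,A^c_\mu(x)C(x-y)A^{e\rho}(y)\,\partial^\lambda C(y-z)A^f_\rho(z)A^g_\lambda(z). \end{aligned}$$ (A superscript $g$ on $A$ or $f$ is a colour index; $g$ elsewhere is the coupling.) **Statement.** 0. If all $A^a_\mu$ are smooth with compact support, then all integrals in the formula converge absolutely and $\mathcal T_gA$ is smooth for every $g\in\mathbb R$. 1. *Gauge condition.* For such $A$, $\partial^\mu(\mathcal T_gA)^a_\mu=\partial^\mu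 A^a_\mu$ for every $g$; in particular this holds up to $O(g^4)$. 2. *Free action.* For such $A$, with $A'=\mathcal T_gA$, the following integrals converge absolutely and, as $g\to0$, $$\tfrac12\int d^dx\,A'^a_\mu(\Box\,\eta^{\mu\nu}-\partial^\mu\partial^\nu)A'^a_\nu=-\tfrac14\int d^dx\,F^a_{\mu\nu}F^{a\,\mu\nu}+O(g^4).$$ 3. *Determinants.* Let $\Delta_{\rm FP}=\det(\partial^\mu D_\mu)$ and let $\Delta_{\rm MSS}$ be the Pfaffian (square root of the determinant) of $\gamma^\mu D_\mu$ in the adjoint representation, $(D_\mu X)^a=\partial_\mu X^a+gf^{abc}A^b_\mu X^c$, both normalised to $1$ at $g=0$. Here the $\gamma^\mu$ are any complex matrices of positive size with $\{\gamma^\mu,\gamma^\nu\}=2\delta^{\mu\nu}$, and the spinor trace is rescaled so that $\operatorname{tr}1=r$, where $r\in\mathbb R$. Expand $\log\det(\delta\mathcal T_gA/\delta A)$, $\log\Delta_{\rm MSS}$ and $\log\Delta_{\rm FP}$ in powers of $g$ through $\log\det=\operatorname{Tr}\log$. For fields $A$ that are finite sums of plane waves $\epsilon\,e^{ip\cdot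 x}$ with $p\neq0$, each functional trace occurring in a coefficient is a formal one-loop integral $\int d^dk\,I(k)$ per unit volume, where $I(k)$ is the sum of the diagonal matrix elements of the operator on the plane waves $e^{ik\cdot x}$. Two formal integrals are called equal if the difference of their integrands agrees, off a null set, with a finite linear combination of functions $R(k+q)-R(k)$ and $R(-k)-R(k)$, with $q\in\mathbb R^d$ and $R$ in the linear span of the functions $P(k)/\prod_j (k+q_j)^2$ ($P$ a complex polynomial, finitely many $q_j\in\mathbb R^d$, repetitions allowed). Then $$\log\det\Big(\frac{\delta\mathcal T_gA}{\delta A}\Big)=\log\big(\Delta_{\rm MSS}\,\Delta_{\rm FP}\big)$$ holds at each of the orders $g,g^2,g^3$ for all such $A$ with $\partial^\mu A^a_\mu=0$ if and only if $r=2(d-2)$. -/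

import Mathlib

namespace NicolaiMap

noncomputable section

open scoped BigOperators

/-- Euclidean space-time of dimension `d`; the metric is `δ_{μν}`, so upper and lower
indices coincide and repeated indices are summed. -/
abbrev Spacetime (d : ℕ) := EuclideanSpace ℝ (Fin d)

/-- Structure constants of a compact gauge algebra in an orthonormal basis: totally
antisymmetric, Jacobi identity, and normalisation `f^{acd} f^{bcd} = N δ^{ab}`
(for `su(N)` in the usual normalisation this `N` is the number of colours). -/
structure IsStructureConstants {ι : Type*} [Fintype ι] [DecidableEq ι]
    (f : ι → ι → ι → ℝ) (N : ℝ) : Prop where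
  antisymm_left : ∀ a b c, f b a c = - f a b c
  antisymm_right : ∀ a b c, f a c b = - f a b c
  jacobi : ∀ a b c e, ∑ x, (f a b x * f x c e + f b c x * f x a e + f c a x * f x b e) = 0
  casimir : ∀ a b, ∑ c, ∑ e, f a c e * f b c e = if a = b then N else 0

/-! ### Operations on fields -/

/-- The linear operations on scalar fields that occur in the Nicolai map, collected so that
one formula for the map can be read both on functions and on plane waves:
`D μ X = ∂_μ X`, `G X (x) = ∫ C(x-y) X(y) dy` and `dG μ X (x) = ∫ (∂_μ C)(x-y) X(y) dy`.
Only the instances `positionSpace`, `planeWaves` and `FieldCalculus.dual planeWaves`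
constructed below are used. -/
structure FieldCalculus (d : ℕ) (R : Type*) where
  D : Fin d → R → R
  G : R → R
  dG : Fin d → R → R

/-- A multiplet of gauge fields `A_μ^a` (first argument: colour `a`, second: index `μ`). -/
abbrev GaugeField (ι : Type*) (d : ℕ) (R : Type*) := ι → Fin d → R

/-- The weight-one antisymmetrisation `X_{[μν]}`. -/
def alt2 {d : ℕ} {R : Type*} [AddCommGroup R] [Module ℝ R]
    (X : Fin d → Fin d → R) (μ ν : Fin d) : R :=
  (1 / 2 : ℝ) • (X μ ν - X ν μ)

/-- The weight-one antisymmetrisation `X_{[μνρ]}`. -/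
def alt3 {d : ℕ} {R : Type*} [AddCommGroup R] [Module ℝ R]
    (X : Fin d → Fin d → Fin d → R) (μ ν ρ : Fin d) : R :=
  (1 / 6 : ℝ) • (X μ ν ρ + X ν ρ μ + X ρ μ ν - X ν μ ρ - X μ ρ ν - X ρ ν μ)

section Formula

variable {ι : Type*} [Fintype ι] {d : ℕ} {R : Type*} [CommRing R] [Algebra ℝ R]

/-- `∂_{[ρ} C(y-z) A_μ^d(z) A_{λ]}^e(z)`, integrated over `z`, as a function of `y`. -/
def tripleAlt (S : FieldCalculus d R) (A : GaugeField ι d R) (d' e : ι) (ρ μ l : Fin d) : R :=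
  alt3 (fun ρ μ l => S.dG ρ (A d' μ * A e l)) ρ μ l

/-- `A^{e λ}(z) ∂^σ C(z-w) A_λ^f(w) A_σ^g(w)`, integrated over `w`, as a function of `z`. -/
def tailTerm (S : FieldCalculus d R) (A : GaugeField ι d R) (e f' g' : ι) : R :=
  ∑ l, ∑ σ, A e l * S.dG σ (A f' l * A g' σ)

/-- The coefficient of `g` in `(T_g A)_μ^a`. -/
def nicolai₁ (f : ι → ι → ι → ℝ) (S : FieldCalculus d R) (A : GaugeField ι d R) :
    GaugeField ι d R := fun a μ =>
  ∑ b, ∑ c, f a b c • ∑ ρ, S.dG ρ (A b μ * A c ρ)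

/-- The coefficient of `g²` in `(T_g A)_μ^a`. -/
def nicolai₂ (f : ι → ι → ι → ℝ) (S : FieldCalculus d R) (A : GaugeField ι d R) :
    GaugeField ι d R := fun a μ =>
  (3 / 2 : ℝ) • ∑ b, ∑ c, ∑ d', ∑ e, (f a b c * f b d' e) •
    ∑ ρ, ∑ l, S.dG ρ (A c l * tripleAlt S A d' e ρ μ l)

/-- The coefficient of `g³` in `(T_g A)_μ^a`. -/
def nicolai₃ (f : ι → ι → ι → ℝ) (S : FieldCalculus d R) (A : GaugeField ι d R) :
    GaugeField ι d R := fun a μ =>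
  (1 / 2 : ℝ) • (∑ b, ∑ c, ∑ d', ∑ e, ∑ f', ∑ g', (f a b c * f b d' e * f c f' g') •
      ∑ ρ, ∑ l, ∑ σ, S.dG ρ (S.dG l (A d' l * A e σ) * tripleAlt S A f' g' ρ μ σ))
  + (∑ b, ∑ c, ∑ d', ∑ e, ∑ f', ∑ g', (f a b c * f b d' e * f d' f' g') •
      ∑ ρ, ∑ l, S.dG ρ (A c l *
        (- (∑ σ, S.dG σ (A e σ * tripleAlt S A f' g' ρ μ l))
         + ∑ σ, alt3 (fun ρ μ l => S.dG ρ (A e μ * S.dG σ (A f' l * A g' σ))) ρ μ l)))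
  + (1 / 3 : ℝ) • (∑ b, ∑ c, ∑ d', ∑ e, ∑ f', ∑ g', (f a b c * f b d' e * f d' f' g') •
      ((6 : ℝ) • (∑ ρ, ∑ l, ∑ σ, S.dG ρ (A c l *
            alt2 (fun ρ σ' => S.dG ρ (A e σ' * tripleAlt S A f' g' l μ σ)) ρ σ))
        - (6 : ℝ) • (∑ ρ, ∑ l, ∑ σ, S.dG ρ (A c l *
            alt2 (fun l σ' => S.dG l (A e σ' * tripleAlt S A f' g' ρ μ σ)) l σ))
        - (6 : ℝ) • (∑ ρ, ∑ l, ∑ σ, S.dG ρ (A c l *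
            alt2 (fun σ' μ => S.dG σ' (A e μ * tripleAlt S A f' g' ρ l σ)) σ μ))
        + (2 : ℝ) • (∑ ρ, S.dG ρ
            (alt2 (fun ρ μ => A c ρ * S.dG μ (tailTerm S A e f' g')) ρ μ))
        - S.dG μ (∑ ρ, S.D ρ (A c ρ * S.G (tailTerm S A e f' g')))))
  - (1 / 3 : ℝ) • (∑ b, ∑ c, ∑ d', ∑ e, ∑ f', ∑ g', (f a b c * f b d' e * f d' f' g') •
      (A c μ * S.G (tailTerm S A e f' g')))

/-- The coefficient of `g^n` (`n ≤ 3`) in `T_g A`. -/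
def nicolaiCoeff (f : ι → ι → ι → ℝ) (S : FieldCalculus d R) :
    ℕ → GaugeField ι d R → GaugeField ι d R
  | 0, A => A
  | 1, A => nicolai₁ f S A
  | 2, A => nicolai₂ f S A
  | 3, A => nicolai₃ f S A
  | _, _ => 0

/-- The Nicolai map `T_g A`, truncated after the third order in `g`. -/
def nicolaiMap (f : ι → ι → ι → ℝ) (S : FieldCalculus d R) (g : ℝ) (A : GaugeField ι d R) :
    GaugeField ι d R :=
  ∑ n ∈ Finset.range 4, g ^ n • nicolaiCoeff f S n A

/-- `∂^μ A_μ^a`. -/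
def divergence (S : FieldCalculus d R) (A : GaugeField ι d R) : ι → R := fun a =>
  ∑ μ, S.D μ (A a μ)

/-- `½ A_μ^a (□ η^{μν} - ∂^μ ∂^ν) A_ν^a`. -/
def freeLagrangian (S : FieldCalculus d R) (A : GaugeField ι d R) : R :=
  (1 / 2 : ℝ) • ∑ a, ∑ μ, A a μ *
    ((∑ ν, S.D ν (S.D ν (A a μ))) - S.D μ (∑ ν, S.D ν (A a ν)))

/-- `F_{μν}^a = ∂_μ A_ν^a - ∂_ν A_μ^a + g f^{abc} A_μ^b A_ν^c`. -/
def fieldStrength (f : ι → ι → ι → ℝ) (S : FieldCalculus d R) (g : ℝ) (A : GaugeField ι d R)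
    (a : ι) (μ ν : Fin d) : R :=
  S.D μ (A a ν) - S.D ν (A a μ) + g • ∑ b, ∑ c, f a b c • (A b μ * A c ν)

/-- `-¼ F_{μν}^a F^{a μν}`. -/
def yangMillsLagrangian (f : ι → ι → ι → ℝ) (S : FieldCalculus d R) (g : ℝ)
    (A : GaugeField ι d R) : R :=
  (- (1 / 4) : ℝ) • ∑ a, ∑ μ, ∑ ν, fieldStrength f S g A a μ ν * fieldStrength f S g A a μ ν

end Formula

/-! ### Position space -/

/-- The massless propagator `C(x) = Γ(d/2 - 1) / (4 π^{d/2}) |x|^{2-d}`, the Green function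
vanishing at infinity of `□ C = -δ` in dimension `d ≥ 3`. -/
def propagator (d : ℕ) (x : Spacetime d) : ℝ :=
  Real.Gamma ((d : ℝ) / 2 - 1) / (4 * Real.pi ^ ((d : ℝ) / 2)) * ‖x‖ ^ (2 - (d : ℝ))

/-- `∂_μ X`. -/
def partialDeriv {d : ℕ} (μ : Fin d) (X : Spacetime d → ℝ) (x : Spacetime d) : ℝ :=
  fderiv ℝ X x (EuclideanSpace.single μ 1)

/-- The field operations on functions on space-time. -/
def positionSpace (d : ℕ) : FieldCalculus d (Spacetime d → ℝ) where
  D := partialDeriv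
  G X x := ∫ y, propagator d (x - y) * X y
  dG μ X x := ∫ y, partialDeriv μ (propagator d) (x - y) * X y

/-- Test fields: smooth and compactly supported. -/
def IsTestField {ι : Type*} {d : ℕ} (A : GaugeField ι d (Spacetime d → ℝ)) : Prop :=
  ∀ a μ, ContDiff ℝ (⊤ : ℕ∞) (A a μ) ∧ HasCompactSupport (A a μ)

/-- The integral `∫ C(x-y) X(y) dy` converges absolutely for every `x`. -/
def ConvergesG {d : ℕ} (X : Spacetime d → ℝ) : Prop :=
  ∀ x, MeasureTheory.Integrable fun y => propagator d (x - y) * X y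

/-- The integrals `∫ ∂_μ C(x-y) X(y) dy` converge absolutely for every `x` and `μ`. -/
def ConvergesDG {d : ℕ} (X : Spacetime d → ℝ) : Prop :=
  ∀ μ x, MeasureTheory.Integrable fun y => partialDeriv μ (propagator d) (x - y) * X y

/-- All the (iterated) integrals that occur in the formula for `T_g A` up to order `g³`
converge absolutely. -/
structure IntegralsConverge {ι : Type*} {d : ℕ} (A : GaugeField ι d (Spacetime d → ℝ)) :
    Prop where
  level₁ : ∀ a b α β, ConvergesDG (A a α * A b β)
  level₂ : ∀ a b c α β γ μ, ConvergesDG (A a α * (positionSpace d).dG μ (A b β * A c γ))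
  level₂G : ∀ a b c α β γ μ, ConvergesG (A a α * (positionSpace d).dG μ (A b β * A c γ))
  level₃ : ∀ a b c e α β γ δ μ ν, ConvergesDG
    (A a α * (positionSpace d).dG μ (A b β * (positionSpace d).dG ν (A c γ * A e δ)))
  level₃_prod : ∀ a b c e α β γ δ μ ν, ConvergesDG
    ((positionSpace d).dG μ (A a α * A b β) * (positionSpace d).dG ν (A c γ * A e δ))
  level₃_deriv : ∀ a b c e α β γ δ μ ν, ConvergesDG ((positionSpace d).D μ
    (A a α * (positionSpace d).G (A b β * (positionSpace d).dG ν (A c γ * A e δ))))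

/-! ### Plane waves

The determinants are treated in perturbation theory: each coefficient of their logarithm is a
one-loop functional, multilinear in the Fourier modes of `A`.  It is therefore evaluated on
finite superpositions of plane waves, with arbitrary momenta and amplitudes. -/

/-- Finite superpositions `∑_p c_p e^{ip·x}` of plane waves, with pointwise multiplication;
the basis element of `p` is `e^{ip·x}`. -/
abbrev PlaneWaves (d : ℕ) := AddMonoidAlgebra ℂ (Spacetime d)

/-- The Fourier multiplier `e^{ip·x} ↦ m(p) e^{ip·x}`. -/
def fourierMultiplier {d : ℕ} (m : Spacetime d → ℂ) (X : PlaneWaves d) : PlaneWaves d :=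
  X.coeff.sum fun p c => AddMonoidAlgebra.single p (m p * c)

/-- The field operations on plane waves: `∂_μ` is multiplication by `i p_μ`, and convolution
with `C` is multiplication by `1/p²`.  (At `p = 0`, where the propagator does not exist, the
value is `0`; fields without zero mode never meet it with a nonzero coefficient in what
follows.) -/
def planeWaves (d : ℕ) : FieldCalculus d (PlaneWaves d) where
  D μ := fourierMultiplier fun p => Complex.I * (p μ : ℂ)
  G := fourierMultiplier fun p => ((‖p‖ ^ 2 : ℝ) : ℂ)⁻¹
  dG μ := fourierMultiplier fun p => Complex.I * (p μ : ℂ) * ((‖p‖ ^ 2 : ℝ) : ℂ)⁻¹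

/-- The same (linear) operations on first-order perturbations `X + ε Y`, `ε² = 0`. -/
def FieldCalculus.dual {d : ℕ} {R : Type*} [CommRing R] (S : FieldCalculus d R) :
    FieldCalculus d (DualNumber R) where
  D μ X := TrivSqZeroExt.inl (S.D μ X.fst) + TrivSqZeroExt.inr (S.D μ X.snd)
  G X := TrivSqZeroExt.inl (S.G X.fst) + TrivSqZeroExt.inr (S.G X.snd)
  dG μ X := TrivSqZeroExt.inl (S.dG μ X.fst) + TrivSqZeroExt.inr (S.dG μ X.snd)

/-- Transversal background fields without zero mode: `∂^μ A_μ^a = 0`. -/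
def IsLandauField {ι : Type*} {d : ℕ} (A : GaugeField ι d (PlaneWaves d)) : Prop :=
  (∀ a, divergence (planeWaves d) A a = 0) ∧ ∀ a μ, (A a μ).coeff 0 = 0

/-! ### Formal loop integrals -/

/-- Loop integrands: the span of the functions `P(k) / ∏_j (k+q_j)²` of the loop momentum `k`,
with `P` a polynomial. -/
def loopIntegrands (d : ℕ) : Submodule ℂ (Spacetime d → ℂ) :=
  Submodule.span ℂ {F | ∃ (P : MvPolynomial (Fin d) ℂ) (s : Multiset (Spacetime d)),
    F = fun k => MvPolynomial.eval (fun j => (k j : ℂ)) P *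
      ((s.map fun q => ((‖k + q‖ ^ 2 : ℝ) : ℂ)).prod)⁻¹}

/-- The integrands whose formal integral `∫ d^dk` vanishes because of the invariance of the
integral under shifts `k ↦ k + q` and under the reflection `k ↦ -k`. -/
def nullIntegrands (d : ℕ) : Submodule ℂ (Spacetime d → ℂ) :=
  Submodule.span ℂ ({H | ∃ F ∈ loopIntegrands d, ∃ q : Spacetime d,
      H = fun k => F (k + q) - F k} ∪
    {H | ∃ F ∈ loopIntegrands d, H = fun k => F (-k) - F k})

/-- Equality of the formal (in general divergent) loop integrals `∫ d^dk F₁(k)` and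
`∫ d^dk F₂(k)`: away from the poles, the integrands agree up to shifts and reflections of the
loop momentum. -/
def LoopEq {d : ℕ} (F₁ F₂ : Spacetime d → ℂ) : Prop :=
  ∃ H ∈ nullIntegrands d, F₁ - F₂ =ᵐ[MeasureTheory.volume] H

/-- The functional trace of an operator `M` on multiplets of fields with index set `κ`, as a
formal loop integral: `Tr M = ∫ dx ∑_i M_{ii}(x,x) = ∫ d^dk ∑_i ∫ dx e^{-ik·x} (M (e^{ik·x} v_i))_i(x)`
(per unit volume), where `v_i` are the unit vectors.  The value is the integrand at `k`. -/
def traceIntegrand {κ : Type*} [Fintype κ] [DecidableEq κ] {d : ℕ}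
    (M : (κ → PlaneWaves d) → κ → PlaneWaves d) (k : Spacetime d) : ℂ :=
  ∑ i, (M (Pi.single i (AddMonoidAlgebra.single k 1)) i).coeff k

/-- The coefficient of `g^n`, `n = 1, 2, 3`, in
`log det (1 + g M₁ + g² M₂ + g³ M₃ + ⋯) = Tr log (1 + g M₁ + g² M₂ + g³ M₃ + ⋯)`. -/
def logDetCoeff {κ : Type*} [Fintype κ] [DecidableEq κ] {d : ℕ}
    (M : ℕ → (κ → PlaneWaves d) → κ → PlaneWaves d) : ℕ → Spacetime d → ℂ
  | 1 => traceIntegrand (M 1)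
  | 2 => traceIntegrand (M 2) - (1 / 2 : ℂ) • traceIntegrand (M 1 ∘ M 1)
  | 3 => traceIntegrand (M 3)
      - (1 / 2 : ℂ) • (traceIntegrand (M 1 ∘ M 2) + traceIntegrand (M 2 ∘ M 1))
      + (1 / 3 : ℂ) • traceIntegrand (M 1 ∘ M 1 ∘ M 1)
  | _ => 0

section Determinants

variable {ι : Type*} [Fintype ι] [DecidableEq ι] {d : ℕ}

/-- The order `g^n` part of the functional derivative `δ(T_g A)_μ^a(x) / δA_ν^b(y)`, as the
operator sending a variation `h` to the coefficient of `ε` in `T_g (A + ε h)`. -/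
def jacobianCoeff (f : ι → ι → ι → ℝ) (A : GaugeField ι d (PlaneWaves d)) (n : ℕ)
    (h : ι × Fin d → PlaneWaves d) : ι × Fin d → PlaneWaves d := fun i =>
  (nicolaiCoeff f (planeWaves d).dual n
    (fun a μ => TrivSqZeroExt.inl (A a μ) + TrivSqZeroExt.inr (h (a, μ))) i.1 i.2).snd

/-- The order `g^n` part of `log det (δ(T_g A) / δA)`. -/
def logJacobian (f : ι → ι → ι → ℝ) (A : GaugeField ι d (PlaneWaves d)) (n : ℕ) :
    Spacetime d → ℂ :=
  logDetCoeff (jacobianCoeff f A) n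

/-- The ghost operator `∂^μ D_μ`, `(D_μ c)^a = ∂_μ c^a + g f^{abc} A_μ^b c^c`, relative to the
free one is `□⁻¹ ∂^μ D_μ = 1 + g M`; this is `M`, with `□⁻¹` given by `-C`. -/
def ghostOperator (f : ι → ι → ι → ℝ) (A : GaugeField ι d (PlaneWaves d))
    (c : ι → PlaneWaves d) : ι → PlaneWaves d := fun a =>
  - (planeWaves d).G (∑ μ, (planeWaves d).D μ (∑ b, ∑ e, f a b e • (A b μ * c e)))

/-- The order `g^n` part of `log Δ_FP`, where `Δ_FP = det (∂^μ D_μ)`, normalised at `g = 0`. -/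
def logFP (f : ι → ι → ι → ℝ) (A : GaugeField ι d (PlaneWaves d)) (n : ℕ) :
    Spacetime d → ℂ :=
  logDetCoeff (fun j => if j = 1 then ghostOperator f A else 0) n

/-- The Dirac operator `γ^μ D_μ` in the adjoint representation relative to the free one is
`(γ^ν ∂_ν)⁻¹ γ^μ D_μ = 1 + g M`; this is `M`, with `(γ^ν ∂_ν)⁻¹ = γ^ν ∂_ν □⁻¹`. -/
def diracOperator {m : ℕ} (γ : Fin d → Matrix (Fin m) (Fin m) ℂ) (f : ι → ι → ι → ℝ)
    (A : GaugeField ι d (PlaneWaves d)) (ψ : ι × Fin m → PlaneWaves d) :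
    ι × Fin m → PlaneWaves d := fun i =>
  - ∑ ν, ∑ β, γ ν i.2 β • (planeWaves d).D ν ((planeWaves d).G
      (∑ μ, ∑ δ, γ μ β δ • ∑ b, ∑ e, f i.1 b e • (A b μ * ψ (e, δ))))

/-- The Clifford relations `γ^μ γ^ν + γ^ν γ^μ = 2 δ^{μν}`. -/
def IsGammaMatrices {m : ℕ} (γ : Fin d → Matrix (Fin m) (Fin m) ℂ) : Prop :=
  ∀ μ ν, γ μ * γ ν + γ ν * γ μ = if μ = ν then 2 else 0

/-- The order `g^n` part of `log Δ_MSS`, where `Δ_MSS` is the Pfaffian of the Dirac operator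
(the square root of its determinant), normalised at `g = 0`.  The spinor trace is normalised
to `tr 1 = r`: the trace over the `m` components of the representation `γ` is multiplied by
`r / m`, which accounts for chirality and for the number of spinors. -/
def logMSS {m : ℕ} (γ : Fin d → Matrix (Fin m) (Fin m) ℂ) (r : ℝ) (f : ι → ι → ι → ℝ)
    (A : GaugeField ι d (PlaneWaves d)) (n : ℕ) : Spacetime d → ℂ :=
  ((1 / 2 : ℂ) * ((r / (m : ℝ) : ℝ) : ℂ)) •
    logDetCoeff (fun j => if j = 1 then diracOperator γ f A else 0) n

end Determinants

end

end NicolaiMap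

/-! Write `[X, Y]^a = f^{abc} X^b Y^c` and treat fields as multiplets. In this notation the map is
`A + g A₁ + g² A₂ + g³ A₃`, and on decaying fields each correction is `∑_ρ ∂_ρ C * Z_{ρμ}` (`coexact
Z`) for an antisymmetric two-form `Z`: minus `[A, A]`, half the contraction of the three-form `X =
dC * [A, A]` with `A`, and `thirdForm` (`first_eq`, `second_eq`, `third_eq`). Derivatives commute,
so such corrections are divergence free; this is the gauge condition.

The free action is `-1/4 |dA'|²`, the Yang-Mills action `-1/4 |dA + g [A, A]|²`. Since `□ C = -δ`,
one has `d(coexact Z) = -Z - (codifferential of dC * Z)`, and exact two-forms are orthogonal to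
coexact ones. Hence `⟨da, d(coexact Z)⟩ = -⟨da, Z⟩` (`pair₂_ext_coexact`), which strips one
propagator off every pairing. The orders `g`, `g²`, `g³` then follow by integration by parts
(`pair₂_codiff_wedge`), the Jacobi identity (`pair₂_comm_contr`) and `⟨F, [θ, F]⟩ = 0`. The analytic
input is a scale of decay rates `2d - 2`, `d - 1`, `0`, stable under the products and convolutions
that occur, together with the Green function property `sum_partialDeriv_convolve`.

For the determinants, formal loop integrals are a quotient of the space of integrands. On operators
built from derivatives, propagators and background fields the resulting trace is cyclic because of
shift invariance and invariant under transposition because of reflection invariance; `TraceCalculus`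
and `Background` axiomatise this. In Landau gauge the traces of the varied map reduce to cyclic
words in `∂C A`: contributions of the nested fields `X`, `A₁` and `θ` vanish or cancel (`x_trace`,
`trace_zz`, `scalarTrace_vScalar`). What remains at order `n = 2, 3` is `-(d - 2)/n` times a fixed
combination of words, plus the ghost term (`quadratic_identity`, `cubic_identity`). The gamma matrix
trace produces the same combination with `-r/(2n)`, so `r = 2(d - 2)` suffices.

Conversely, order two determines `r` once the combination `spinorSquare` is nonzero for some
transversal field. For a standing wave it is a vacuum polarisation bubble. To see that this formal
integral does not vanish, integrands are continued to complex momenta in a plane spanned by two null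
vectors; the sum of the residues over all poles is unchanged by shifts and reflections, and it is
nonzero for the bubble (`finsum_residue_eq_zero`, `loopIntegral_bubble_ne_zero`). -/

namespace NicolaiMap

noncomputable section

open scoped BigOperators

/-! ### Colour sums -/

section Colour

variable {ι : Type*} [Fintype ι] {R : Type*} [CommRing R] [Algebra ℝ R] (f : ι → ι → ι → ℝ)

/-- The bracket `[X, Y]^a = f^{abc} X^b Y^c` of two multiplets. -/
def bracket : (ι → R) →ₗ[ℝ] (ι → R) →ₗ[ℝ] (ι → R) :=
  LinearMap.mk₂ ℝ (fun X Y a => ∑ b, ∑ c, f a b c • (X b * Y c))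
    (fun X X' Y => by ext a; simp [add_mul, Finset.sum_add_distrib])
    (fun r X Y => by ext a; simp [Finset.smul_sum, smul_comm r])
    (fun X Y Y' => by ext a; simp [mul_add, Finset.sum_add_distrib])
    (fun r X Y => by ext a; simp [Finset.smul_sum, smul_comm r])

lemma bracket_apply (X Y : ι → R) (a : ι) :
    bracket f X Y a = ∑ b, ∑ c, f a b c • (X b * Y c) := rfl

/-- `f^{abc} Φ_{bc}`. -/
def colour₁ (a : ι) (Φ : ι → ι → R) : R := ∑ b, ∑ c, f a b c • Φ b c

/-- `f^{abc} f^{bde} Φ_{cde}`. -/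
def colour₂ (a : ι) (Φ : ι → ι → ι → R) : R :=
  ∑ b, ∑ c, ∑ d', ∑ e, (f a b c * f b d' e) • Φ c d' e

/-- `f^{abc} f^{bde} f^{cfg} Φ_{defg}`. -/
def colour₃ (a : ι) (Φ : ι → ι → ι → ι → R) : R :=
  ∑ b, ∑ c, ∑ d', ∑ e, ∑ f', ∑ g', (f a b c * f b d' e * f c f' g') • Φ d' e f' g'

/-- `f^{abc} f^{bde} f^{dfg} Φ_{cefg}`. -/
def colour₃' (a : ι) (Φ : ι → ι → ι → ι → R) : R :=
  ∑ b, ∑ c, ∑ d', ∑ e, ∑ f', ∑ g', (f a b c * f b d' e * f d' f' g') • Φ c e f' g'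

lemma colour₁_add (a : ι) (Φ Ψ : ι → ι → R) :
    colour₁ f a (fun b c => Φ b c + Ψ b c) = colour₁ f a Φ + colour₁ f a Ψ := by
  simp only [colour₁, smul_add, Finset.sum_add_distrib]

lemma colour₁_smul (a : ι) (r : ℝ) (Φ : ι → ι → R) :
    colour₁ f a (fun b c => r • Φ b c) = r • colour₁ f a Φ := by
  simp only [colour₁, Finset.smul_sum, smul_comm r]

lemma colour₁_sub (a : ι) (Φ Ψ : ι → ι → R) :
    colour₁ f a (fun b c => Φ b c - Ψ b c) = colour₁ f a Φ - colour₁ f a Ψ := by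
  simp only [colour₁, smul_sub, Finset.sum_sub_distrib]

lemma colour₁_sum {κ : Type*} (s : Finset κ) (a : ι) (Φ : κ → ι → ι → R) :
    colour₁ f a (fun b c => ∑ i ∈ s, Φ i b c) = ∑ i ∈ s, colour₁ f a (Φ i) := by
  classical
  induction s using Finset.induction_on with
  | empty => simp [colour₁]
  | insert i s hi ih => simp only [Finset.sum_insert hi, colour₁_add, ih]

lemma colour₁_map (a : ι) (T : R →ₗ[ℝ] R) (Φ : ι → ι → R) :
    colour₁ f a (fun b c => T (Φ b c)) = T (colour₁ f a Φ) := by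
  simp only [colour₁, map_sum, map_smul]

lemma colour₂_add (a : ι) (Φ Ψ : ι → ι → ι → R) :
    colour₂ f a (fun b c e => Φ b c e + Ψ b c e) = colour₂ f a Φ + colour₂ f a Ψ := by
  simp only [colour₂, smul_add, Finset.sum_add_distrib]

lemma colour₂_smul (a : ι) (r : ℝ) (Φ : ι → ι → ι → R) :
    colour₂ f a (fun b c e => r • Φ b c e) = r • colour₂ f a Φ := by
  simp only [colour₂, Finset.smul_sum, smul_comm r]

lemma colour₂_neg (a : ι) (Φ : ι → ι → ι → R) :
    colour₂ f a (fun b c e => - Φ b c e) = - colour₂ f a Φ := by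
  simp only [colour₂, smul_neg, Finset.sum_neg_distrib]

lemma colour₂_sub (a : ι) (Φ Ψ : ι → ι → ι → R) :
    colour₂ f a (fun b c e => Φ b c e - Ψ b c e) = colour₂ f a Φ - colour₂ f a Ψ := by
  simp only [colour₂, smul_sub, Finset.sum_sub_distrib]

lemma colour₂_sum {κ : Type*} (s : Finset κ) (a : ι) (Φ : κ → ι → ι → ι → R) :
    colour₂ f a (fun b c e => ∑ i ∈ s, Φ i b c e) = ∑ i ∈ s, colour₂ f a (Φ i) := by
  classical
  induction s using Finset.induction_on with
  | empty => simp [colour₂]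
  | insert i s hi ih => simp only [Finset.sum_insert hi, colour₂_add, ih]

lemma colour₂_map (a : ι) (T : R →ₗ[ℝ] R) (Φ : ι → ι → ι → R) :
    colour₂ f a (fun b c e => T (Φ b c e)) = T (colour₂ f a Φ) := by
  simp only [colour₂, map_sum, map_smul]

lemma colour₃_add (a : ι) (Φ Ψ : ι → ι → ι → ι → R) :
    colour₃ f a (fun b c e g => Φ b c e g + Ψ b c e g) = colour₃ f a Φ + colour₃ f a Ψ := by
  simp only [colour₃, smul_add, Finset.sum_add_distrib]

lemma colour₃_sum {κ : Type*} (s : Finset κ) (a : ι) (Φ : κ → ι → ι → ι → ι → R) :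
    colour₃ f a (fun b c e g => ∑ i ∈ s, Φ i b c e g) = ∑ i ∈ s, colour₃ f a (Φ i) := by
  classical
  induction s using Finset.induction_on with
  | empty => simp [colour₃]
  | insert i s hi ih => simp only [Finset.sum_insert hi, colour₃_add, ih]

lemma colour₃_map (a : ι) (T : R →ₗ[ℝ] R) (Φ : ι → ι → ι → ι → R) :
    colour₃ f a (fun b c e g => T (Φ b c e g)) = T (colour₃ f a Φ) := by
  simp only [colour₃, map_sum, map_smul]

lemma colour₃'_add (a : ι) (Φ Ψ : ι → ι → ι → ι → R) :
    colour₃' f a (fun b c e g => Φ b c e g + Ψ b c e g) = colour₃' f a Φ + colour₃' f a Ψ := by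
  simp only [colour₃', smul_add, Finset.sum_add_distrib]

lemma colour₃'_smul (a : ι) (r : ℝ) (Φ : ι → ι → ι → ι → R) :
    colour₃' f a (fun b c e g => r • Φ b c e g) = r • colour₃' f a Φ := by
  simp only [colour₃', Finset.smul_sum, smul_comm r]

lemma colour₃'_sub (a : ι) (Φ Ψ : ι → ι → ι → ι → R) :
    colour₃' f a (fun b c e g => Φ b c e g - Ψ b c e g) = colour₃' f a Φ - colour₃' f a Ψ := by
  simp only [colour₃', smul_sub, Finset.sum_sub_distrib]

lemma colour₃'_sum {κ : Type*} (s : Finset κ) (a : ι) (Φ : κ → ι → ι → ι → ι → R) :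
    colour₃' f a (fun b c e g => ∑ i ∈ s, Φ i b c e g) = ∑ i ∈ s, colour₃' f a (Φ i) := by
  classical
  induction s using Finset.induction_on with
  | empty => simp [colour₃']
  | insert i s hi ih => simp only [Finset.sum_insert hi, colour₃'_add, ih]

lemma colour₃'_map (a : ι) (T : R →ₗ[ℝ] R) (Φ : ι → ι → ι → ι → R) :
    colour₃' f a (fun b c e g => T (Φ b c e g)) = T (colour₃' f a Φ) := by
  simp only [colour₃', map_sum, map_smul]

lemma colour₁_mul (a : ι) (X Y : ι → R) :
    colour₁ f a (fun b c => X b * Y c) = bracket f X Y a := rfl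

/-- The inner constant `f^{bde}` closes the pair `(d, e)` into a multiplet with index `b`, which
`f^{abc}` then brackets with `X`. The nested factor stands on the left because `b` precedes `c`;
this fixes the orientation of the iterated brackets below. -/
lemma colour₂_mul (a : ι) (X : ι → R) (Ψ : ι → ι → R) :
    colour₂ f a (fun c d' e => X c * Ψ d' e) = bracket f (fun b => colour₁ f b Ψ) X a := by
  simp only [colour₂, bracket_apply, colour₁, Finset.sum_mul, Finset.smul_sum, smul_mul_assoc,
    smul_smul, mul_comm (X _)]

lemma colour₃_mul (a : ι) (Φ Ψ : ι → ι → R) :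
    colour₃ f a (fun d' e f' g' => Φ d' e * Ψ f' g') =
      bracket f (fun b => colour₁ f b Φ) (fun c => colour₁ f c Ψ) a := by
  simp only [colour₃, bracket_apply, colour₁, Finset.sum_mul_sum, Finset.smul_sum, smul_mul_smul_comm,
    smul_smul]
  refine Finset.sum_congr rfl fun b _ => Finset.sum_congr rfl fun c _ =>
    Finset.sum_congr rfl fun d' _ => ?_
  rw [Finset.sum_comm]
  simp only [mul_assoc]

lemma colour₃'_mul (a : ι) (X : ι → R) (Ψ : ι → ι → ι → R) :
    colour₃' f a (fun c e f' g' => X c * Ψ e f' g') =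
      bracket f (fun b => colour₂ f b Ψ) X a := by
  simp only [colour₃', bracket_apply, colour₂, Finset.sum_mul, Finset.smul_sum, smul_mul_assoc,
    smul_smul, mul_comm (X _), mul_assoc]

end Colour

/-! ### Linear field calculi -/

/-- A field calculus whose operations are linear. -/
structure LinearCalculus (d : ℕ) (R : Type*) [CommRing R] [Algebra ℝ R] where
  D : Fin d → R →ₗ[ℝ] R
  G : R →ₗ[ℝ] R
  dG : Fin d → R →ₗ[ℝ] R

namespace LinearCalculus

variable {ι : Type*} {d : ℕ} {R : Type*} [CommRing R] [Algebra ℝ R]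

/-- The underlying operations. -/
def toCalculus (L : LinearCalculus d R) : FieldCalculus d R where
  D μ := L.D μ
  G := L.G
  dG μ := L.dG μ

@[simp] lemma toCalculus_D (L : LinearCalculus d R) (μ : Fin d) (X : R) :
    L.toCalculus.D μ X = L.D μ X := rfl
@[simp] lemma toCalculus_G (L : LinearCalculus d R) (X : R) : L.toCalculus.G X = L.G X := rfl
@[simp] lemma toCalculus_dG (L : LinearCalculus d R) (μ : Fin d) (X : R) :
    L.toCalculus.dG μ X = L.dG μ X := rfl

end LinearCalculus

/-- The bracket and the linear operations on multiplets of fields. -/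
structure MultipletCalculus (d : ℕ) (V : Type*) [AddCommGroup V] [Module ℝ V] where
  br : V →ₗ[ℝ] V →ₗ[ℝ] V
  D : Fin d → V →ₗ[ℝ] V
  G : V →ₗ[ℝ] V
  dG : Fin d → V →ₗ[ℝ] V

/-- The componentwise operations on multiplets. -/
def LinearCalculus.multiplet {ι : Type*} [Fintype ι] {d : ℕ} {R : Type*} [CommRing R]
    [Algebra ℝ R] (L : LinearCalculus d R) (f : ι → ι → ι → ℝ) :
    MultipletCalculus d (ι → R) where
  br := bracket f
  D μ := (L.D μ).compLeft ι
  G := L.G.compLeft ι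
  dG μ := (L.dG μ).compLeft ι

namespace MultipletCalculus

variable {d : ℕ} {V : Type*} [AddCommGroup V] [Module ℝ V] (M : MultipletCalculus d V)
  (A : Fin d → V)

/-- The commutator term `[A_μ, A_ν]` of the field strength. -/
def comm (μ ν : Fin d) : V := M.br (A μ) (A ν)

/-- The three-form `dG Z`, for a two-form `Z`. -/
def curl (Z : Fin d → Fin d → V) (ρ μ l : Fin d) : V :=
  M.dG ρ (Z μ l) + M.dG μ (Z l ρ) + M.dG l (Z ρ μ)

/-- The three-form `dG [A, A]`. -/
def three (ρ μ l : Fin d) : V := M.curl (M.comm A) ρ μ l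

/-- The first order of the Nicolai map. -/
def first (μ : Fin d) : V := ∑ ρ, M.dG ρ (M.comm A μ ρ)

/-- The contraction of the three-form with the gauge field. -/
def contr (μ l : Fin d) : V := ∑ σ, M.br (M.three A μ l σ) (A σ)

/-- The second order of the Nicolai map. -/
def second (μ : Fin d) : V := (1 / 2 : ℝ) • ∑ ρ, M.dG ρ (M.contr A ρ μ)

/-- The first variation of `[A_μ, A_l]` along `first`. -/
def comm' (μ l : Fin d) : V := M.br (A μ) (M.first A l) - M.br (A l) (M.first A μ)

/-- The four-form `dG [A, A] ∧ A`. -/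
def four (ρ μ l σ : Fin d) : V :=
  M.br (M.three A ρ μ σ) (A l) + M.br (M.three A μ l σ) (A ρ) + M.br (M.three A l ρ σ) (A μ)
    - M.br (M.three A ρ μ l) (A σ)

/-- The divergence of the four-form. -/
def divFour (ρ μ l : Fin d) : V := ∑ σ, M.dG σ (M.four A ρ μ l σ)

/-- The scalar `G [A₁_l, A_l]`. -/
def scalar : V := M.G (∑ l, M.br (M.first A l) (A l))

/-- The two-form whose divergence is the main part of the third order. -/
def twoForm (ρ μ : Fin d) : V := ∑ l,
  ((1 / 6 : ℝ) • M.br (M.three A ρ μ l) (M.first A l)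
    - (1 / 6 : ℝ) • M.br (M.curl (M.comm' A) ρ μ l) (A l)
    - (1 / 3 : ℝ) • M.br (M.curl (M.contr A) ρ μ l) (A l)
    + (1 / 3 : ℝ) • M.br (M.divFour A ρ μ l) (A l))

/-- The terms of third order that involve `scalar`. -/
def scalarPart (μ : Fin d) : V :=
  (1 / 3 : ℝ) • (∑ ρ, M.dG ρ (M.br (M.dG μ (∑ l, M.br (M.first A l) (A l))) (A ρ)
      - M.br (M.dG ρ (∑ l, M.br (M.first A l) (A l))) (A μ)))
  - (1 / 3 : ℝ) • M.dG μ (∑ ρ, M.D ρ (M.br (M.scalar A) (A ρ)))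
  - (1 / 3 : ℝ) • M.br (M.scalar A) (A μ)

/-- The third order of the Nicolai map. -/
def third (μ : Fin d) : V := (∑ ρ, M.dG ρ (M.twoForm A ρ μ)) + M.scalarPart A μ

end MultipletCalculus

/-! ### The first two orders in bracket notation -/

section BracketForm

variable {ι : Type*} [Fintype ι] {d : ℕ} {R : Type*} [CommRing R] [Algebra ℝ R]
  (f : ι → ι → ι → ℝ) (L : LinearCalculus d R) (A : GaugeField ι d R)

@[simp] lemma multiplet_br : (L.multiplet f).br = bracket f := rfl
@[simp] lemma multiplet_D (μ : Fin d) : (L.multiplet f).D μ = (L.D μ).compLeft ι := rfl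
@[simp] lemma multiplet_G : (L.multiplet f).G = L.G.compLeft ι := rfl
@[simp] lemma multiplet_dG (μ : Fin d) : (L.multiplet f).dG μ = (L.dG μ).compLeft ι := rfl

lemma nicolai₁_eq (a : ι) (μ : Fin d) :
    nicolai₁ f L.toCalculus A a μ = (L.multiplet f).first (fun μ a => A a μ) μ a := by
  change colour₁ f a (fun b c => ∑ ρ, L.dG ρ (A b μ * A c ρ)) = _
  simp only [colour₁_sum, colour₁_map, colour₁_mul f a (fun b => A b μ) (fun c => A c _)]
  simp [MultipletCalculus.first, MultipletCalculus.comm]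

/-- Contraction with `f` makes the products `A_μ A_l` antisymmetric, so the six signed terms of the
weight-one antisymmetrisation coincide in pairs: three remain, with weight `2/6`. -/
lemma colour₁_tripleAlt (b : ι) (ρ μ l : Fin d) (hf : ∀ a b c, f a c b = - f a b c) :
    colour₁ f b (fun d' e => tripleAlt L.toCalculus A d' e ρ μ l) =
      (1 / 3 : ℝ) • (L.multiplet f).three (fun μ a => A a μ) ρ μ l b := by
  have h (μ ν : Fin d) (ρ : Fin d) : colour₁ f b (fun d' e => L.dG ρ (A d' μ * A e ν)) =
      L.dG ρ (bracket f (fun a => A a μ) (fun a => A a ν) b) := by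
    rw [colour₁_map, colour₁_mul f b (fun b => A b μ) (fun c => A c ν)]
  have anti (μ ν : Fin d) : bracket f (fun a => A a μ) (fun a => A a ν) b =
      - bracket f (fun a => A a ν) (fun a => A a μ) b := by
    simp only [bracket_apply]
    rw [Finset.sum_comm, ← Finset.sum_neg_distrib]
    refine Finset.sum_congr rfl fun x _ => ?_
    rw [← Finset.sum_neg_distrib]
    refine Finset.sum_congr rfl fun y _ => ?_
    rw [hf, neg_smul, mul_comm]
  simp only [tripleAlt, alt3, LinearCalculus.toCalculus_dG, colour₁_smul, colour₁_add, colour₁_sub, h,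
    MultipletCalculus.three, MultipletCalculus.curl, MultipletCalculus.comm, multiplet_br,
    multiplet_dG, Pi.add_apply, LinearMap.compLeft_apply, Function.comp_apply]
  rw [anti l μ, anti μ ρ, anti ρ l]
  simp only [map_neg]
  module

/-- The coefficient `3/2` meets the `1/3` of `colour₁_tripleAlt`, which leaves the `1/2` of
`second`. -/
lemma nicolai₂_eq (hf : ∀ a b c, f a c b = - f a b c) (a : ι) (μ : Fin d) :
    nicolai₂ f L.toCalculus A a μ = (L.multiplet f).second (fun μ a => A a μ) μ a := by
  have : nicolai₂ f L.toCalculus A a μ = (3 / 2 : ℝ) • colour₂ f a (fun c d' e =>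
    ∑ ρ, ∑ l, L.dG ρ (A c l * tripleAlt L.toCalculus A d' e ρ μ l)) := rfl
  rw [this]
  simp only [colour₂_sum, colour₂_map, colour₂_mul f a (fun c => A c _),
    colour₁_tripleAlt f L A _ _ _ _ hf]
  simp only [MultipletCalculus.second, MultipletCalculus.contr, Finset.smul_sum, Finset.sum_apply,
    Pi.smul_apply, multiplet_dG, LinearMap.compLeft_apply, Function.comp_apply, multiplet_br,
    map_sum]
  refine Finset.sum_congr rfl fun ρ _ => Finset.sum_congr rfl fun l _ => ?_
  rw [show (fun b => (1 / 3 : ℝ) • (L.multiplet f).three (fun μ a => A a μ) ρ μ l b) =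
    (1 / 3 : ℝ) • (L.multiplet f).three (fun μ a => A a μ) ρ μ l from rfl]
  simp only [map_smul, LinearMap.smul_apply, Pi.smul_apply, smul_smul]
  norm_num

end BracketForm

end

end NicolaiMap

namespace NicolaiMap

noncomputable section

open scoped BigOperators

/-! ### The third order in bracket notation -/

section ThirdOrder

variable {ι : Type*} [Fintype ι] {d : ℕ} {R : Type*} [CommRing R] [Algebra ℝ R]
  (f : ι → ι → ι → ℝ) (L : LinearCalculus d R) (A : GaugeField ι d R)

lemma bracket_antisymm (hf : ∀ a b c, f a c b = - f a b c) (X Y : ι → R) :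
    bracket f X Y = - bracket f Y X := by
  ext a
  simp only [bracket_apply, Pi.neg_apply]
  rw [Finset.sum_comm, ← Finset.sum_neg_distrib]
  refine Finset.sum_congr rfl fun x _ => ?_
  rw [← Finset.sum_neg_distrib]
  refine Finset.sum_congr rfl fun y _ => ?_
  rw [hf, neg_smul, mul_comm]

lemma colour₂_mul_tripleAlt (hf : ∀ a b c, f a c b = - f a b c) (b : ι) (σ ρ μ l : Fin d) :
    colour₂ f b (fun e f' g' => A e σ * tripleAlt L.toCalculus A f' g' ρ μ l) =
      ((1 / 3 : ℝ) • (L.multiplet f).br ((L.multiplet f).three (fun μ a => A a μ) ρ μ l)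
        (fun a => A a σ)) b := by
  rw [colour₂_mul f b (fun e => A e σ)]
  simp only [colour₁_tripleAlt f L A _ _ _ _ hf]
  rw [← LinearMap.smul_apply, ← map_smul]
  rfl

lemma colour₂_mul_dG (b : ι) (μ l σ : Fin d) :
    colour₂ f b (fun e f' g' => A e μ * L.dG σ (A f' l * A g' σ)) =
      (L.multiplet f).br ((L.multiplet f).dG σ ((L.multiplet f).comm (fun μ a => A a μ) l σ))
        (fun a => A a μ) b := by
  rw [colour₂_mul f b (fun e => A e μ) (fun f' g' => L.dG σ (A f' l * A g' σ))]
  simp only [colour₁_map]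
  rfl

lemma colour₂_tailTerm (b : ι) :
    colour₂ f b (fun e f' g' => tailTerm L.toCalculus A e f' g') =
      (∑ l, (L.multiplet f).br ((L.multiplet f).first (fun μ a => A a μ) l) (fun a => A a l)) b := by
  simp only [tailTerm, LinearCalculus.toCalculus_dG, colour₂_sum, colour₂_mul_dG]
  simp only [MultipletCalculus.first, map_sum, LinearMap.sum_apply, Finset.sum_apply]

/-- The contraction `f^{abc} f^{bde} f^{cfg}` is a bracket of two brackets. Two transpositions, of
the outer bracket and of `A_l, A_σ` inside, bring the three-form to the left of the first order;
their signs cancel. -/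
lemma nicolai₃_product (hf : ∀ a b c, f a c b = - f a b c) (a : ι) (μ : Fin d) :
    colour₃ f a (fun d' e f' g' => ∑ ρ, ∑ l, ∑ σ, L.dG ρ (L.dG l (A d' l * A e σ) *
      tripleAlt L.toCalculus A f' g' ρ μ σ)) =
    (∑ ρ, (L.multiplet f).dG ρ (∑ σ, (1 / 3 : ℝ) • (L.multiplet f).br
      ((L.multiplet f).three (fun μ a => A a μ) ρ μ σ)
      ((L.multiplet f).first (fun μ a => A a μ) σ))) a := by
  have h (ρ l σ : Fin d) : colour₃ f a (fun d' e f' g' => L.dG l (A d' l * A e σ) *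
      tripleAlt L.toCalculus A f' g' ρ μ σ) =
      ((1 / 3 : ℝ) • (L.multiplet f).br ((L.multiplet f).three (fun μ a => A a μ) ρ μ σ)
      ((L.multiplet f).dG l ((L.multiplet f).comm (fun μ a => A a μ) σ l))) a := by
    rw [colour₃_mul f a (fun d' e => L.dG l (A d' l * A e σ))]
    simp only [colour₁_tripleAlt f L A _ _ _ _ hf, colour₁_map]
    rw [bracket_antisymm f hf]
    simp only [colour₁_mul f _ (fun b => A b l) (fun c => A c σ)]
    rw [bracket_antisymm f hf (fun b => A b l)]
    rw [show (fun c => (1 / 3 : ℝ) • (L.multiplet f).three (fun μ a => A a μ) ρ μ σ c) =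
      (1 / 3 : ℝ) • (L.multiplet f).three (fun μ a => A a μ) ρ μ σ from rfl]
    rw [map_smul, LinearMap.smul_apply]
    rw [show (fun b => L.dG l ((-bracket f (fun c => A c σ) (fun b => A b l)) b)) =
      - ((L.multiplet f).dG l ((L.multiplet f).comm (fun μ a => A a μ) σ l)) by
        ext b; simp [MultipletCalculus.comm]]
    rw [map_neg, smul_neg, neg_neg]
    rfl
  simp only [colour₃_sum, colour₃_map, h, Finset.sum_apply, multiplet_dG, LinearMap.compLeft_apply,
    Function.comp_apply, map_sum, MultipletCalculus.first, Finset.smul_sum]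
  exact Finset.sum_congr rfl fun ρ _ => Finset.sum_comm

lemma bracket_colour₂ (a : ι) (l : Fin d) (Ψ : ι → ι → ι → R) (Z : ι → R)
    (h : ∀ b, colour₂ f b Ψ = Z b) :
    colour₃' f a (fun c e f' g' => A c l * Ψ e f' g') =
      (L.multiplet f).br Z (fun a => A a l) a := by
  rw [colour₃'_mul f a (fun c => A c l), funext h]
  rfl

/-- Summed over `σ`, the factor `∂^σ C A_l A_σ` becomes the first order of the map, so the
antisymmetrised terms assemble into the curl of `comm'`. The other term fits no such pattern; it is
cancelled by a term of `nicolai₃_alt`. -/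
lemma nicolai₃_nested (hf : ∀ a b c, f a c b = - f a b c) (a : ι) (μ : Fin d) :
    colour₃' f a (fun c e f' g' => ∑ ρ, ∑ l, L.dG ρ (A c l *
        (- (∑ σ, L.dG σ (A e σ * tripleAlt L.toCalculus A f' g' ρ μ l))
         + ∑ σ, alt3 (fun ρ μ l => L.dG ρ (A e μ * L.dG σ (A f' l * A g' σ))) ρ μ l))) =
    (∑ ρ, (L.multiplet f).dG ρ (∑ l, (L.multiplet f).br (
      - ((1 / 3 : ℝ) • ∑ σ, (L.multiplet f).dG σ ((L.multiplet f).br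
        ((L.multiplet f).three (fun μ a => A a μ) ρ μ l) (fun a => A a σ)))
      - (1 / 6 : ℝ) • (L.multiplet f).curl ((L.multiplet f).comm' (fun μ a => A a μ)) ρ μ l)
      (fun a => A a l))) a := by
  simp only [colour₃'_sum, colour₃'_map]
  simp only [Finset.sum_apply, multiplet_dG, LinearMap.compLeft_apply, Function.comp_apply, map_sum]
  refine Finset.sum_congr rfl fun ρ _ => Finset.sum_congr rfl fun l _ => congrArg _ ?_
  refine bracket_colour₂ f L A a l _ _ fun b => ?_
  simp only [alt3, colour₂_add, colour₂_sub, colour₂_neg, colour₂_sum, colour₂_map, colour₂_smul,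
    colour₂_mul_tripleAlt f L A hf, colour₂_mul_dG]
  have anti (X Y : ι → R) : (L.multiplet f).br X Y = - (L.multiplet f).br Y X :=
    bracket_antisymm f hf X Y
  simp only [MultipletCalculus.curl, MultipletCalculus.comm', anti (fun a => A a _)]
  simp only [MultipletCalculus.first, map_sum, LinearMap.sum_apply, map_sub, map_neg, map_smul,
    Pi.add_apply, Pi.sub_apply, Pi.neg_apply, Pi.smul_apply, Finset.sum_apply, Finset.smul_sum,
    smul_add, smul_sub, smul_neg, Finset.sum_add_distrib, Finset.sum_sub_distrib, multiplet_dG,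
    LinearMap.compLeft_apply, Function.comp_apply]
  abel

/-- The prefactor `6` is consumed by the `1/2` of each two-index antisymmetrisation and the `1/3` of
each three-form, leaving unit coefficients. The last sum on the right, with the overall factor `1/3`
of these terms, cancels the first term of `nicolai₃_nested`. -/
lemma nicolai₃_alt (hf : ∀ a b c, f a c b = - f a b c) (a : ι) (μ : Fin d) :
    colour₃' f a (fun c e f' g' =>
      (6 : ℝ) • (∑ ρ, ∑ l, ∑ σ, L.dG ρ (A c l *
            alt2 (fun ρ σ' => L.dG ρ (A e σ' * tripleAlt L.toCalculus A f' g' l μ σ)) ρ σ))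
        - (6 : ℝ) • (∑ ρ, ∑ l, ∑ σ, L.dG ρ (A c l *
            alt2 (fun l σ' => L.dG l (A e σ' * tripleAlt L.toCalculus A f' g' ρ μ σ)) l σ))
        - (6 : ℝ) • (∑ ρ, ∑ l, ∑ σ, L.dG ρ (A c l *
            alt2 (fun σ' μ => L.dG σ' (A e μ * tripleAlt L.toCalculus A f' g' ρ l σ)) σ μ))) =
    (∑ ρ, (L.multiplet f).dG ρ (∑ l, (L.multiplet f).br (
      - (L.multiplet f).curl ((L.multiplet f).contr (fun μ a => A a μ)) ρ μ l
      + (L.multiplet f).divFour (fun μ a => A a μ) ρ μ l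
      + ∑ σ, (L.multiplet f).dG σ ((L.multiplet f).br
        ((L.multiplet f).three (fun μ a => A a μ) ρ μ l) (fun a => A a σ)))
      (fun a => A a l))) a := by
  simp only [← Finset.sum_sub_distrib, Finset.smul_sum, ← map_smul, ← map_sub]
  simp only [colour₃'_sum, colour₃'_map]
  simp only [Finset.sum_apply, multiplet_dG, LinearMap.compLeft_apply, Function.comp_apply, map_sum]
  refine Finset.sum_congr rfl fun ρ _ => Finset.sum_congr rfl fun l _ => ?_
  rw [← map_sum, ← colour₃'_sum]
  refine congrArg _ ?_
  simp only [← mul_smul_comm, ← mul_sub, ← Finset.mul_sum]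
  refine bracket_colour₂ f L A a l _ _ fun b => ?_
  simp only [alt2, colour₂_sub, colour₂_sum, colour₂_map, colour₂_smul,
    colour₂_mul_tripleAlt f L A hf]
  have anti (X Y : ι → R) : (L.multiplet f).br X Y = - (L.multiplet f).br Y X :=
    bracket_antisymm f hf X Y
  have t1 (ρ μ l : Fin d) : (L.multiplet f).three (fun μ a => A a μ) μ ρ l =
      - (L.multiplet f).three (fun μ a => A a μ) ρ μ l := by
    simp only [MultipletCalculus.three, MultipletCalculus.curl, MultipletCalculus.comm]
    rw [anti (fun a => A a μ) (fun a => A a ρ), anti (fun a => A a l) (fun a => A a μ),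
      anti (fun a => A a ρ) (fun a => A a l)]
    simp only [map_neg]
    abel
  simp only [MultipletCalculus.curl, MultipletCalculus.contr, MultipletCalculus.divFour,
    MultipletCalculus.four]
  simp only [t1 μ l, t1 l ρ]
  simp only [map_sum, map_sub, map_add, map_neg, map_smul, LinearMap.neg_apply,
    Pi.add_apply, Pi.sub_apply, Pi.neg_apply, Pi.smul_apply, Finset.sum_apply,
    smul_sub, smul_neg, Finset.sum_add_distrib, Finset.sum_sub_distrib, multiplet_dG,
    LinearMap.compLeft_apply, Function.comp_apply, Finset.sum_neg_distrib, smul_smul]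
  norm_num
  abel

lemma nicolai₃_scalar (a : ι) (μ : Fin d) :
    colour₃' f a (fun c e f' g' => (2 : ℝ) • (∑ ρ, L.dG ρ
            (alt2 (fun ρ μ => A c ρ * L.dG μ (tailTerm L.toCalculus A e f' g')) ρ μ))
        - L.dG μ (∑ ρ, L.D ρ (A c ρ * L.G (tailTerm L.toCalculus A e f' g'))))
    - colour₃' f a (fun c e f' g' => A c μ * L.G (tailTerm L.toCalculus A e f' g')) =
    (3 : ℝ) • (L.multiplet f).scalarPart (fun μ a => A a μ) μ a := by
  have h (T : R →ₗ[ℝ] R) (ρ : Fin d) : colour₃' f a (fun c e f' g' => A c ρ *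
      T (tailTerm L.toCalculus A e f' g')) = (L.multiplet f).br (T.compLeft ι
        (∑ l, (L.multiplet f).br ((L.multiplet f).first (fun μ a => A a μ) l) (fun a => A a l)))
        (fun a => A a ρ) a := by
    refine bracket_colour₂ f L A a ρ (fun e f' g' => T (tailTerm L.toCalculus A e f' g')) _ fun b => ?_
    rw [colour₂_map, colour₂_tailTerm]
    rfl
  simp only [alt2, colour₃'_sub, colour₃'_smul, colour₃'_sum, colour₃'_map, h]
  simp only [MultipletCalculus.scalarPart, MultipletCalculus.scalar, multiplet_dG, multiplet_G,
    Pi.sub_apply, Pi.smul_apply, Finset.sum_apply, LinearMap.compLeft_apply, Function.comp_apply,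
    multiplet_D, smul_sub, smul_smul, Finset.smul_sum, map_sub, map_smul]
  norm_num

lemma nicolai₃_eq (hf : ∀ a b c, f a c b = - f a b c) (a : ι) (μ : Fin d) :
    nicolai₃ f L.toCalculus A a μ = (L.multiplet f).third (fun μ a => A a μ) μ a := by
  change (1 / 2 : ℝ) • colour₃ f a (fun d' e f' g' => ∑ ρ, ∑ l, ∑ σ,
      L.dG ρ (L.dG l (A d' l * A e σ) * tripleAlt L.toCalculus A f' g' ρ μ σ))
    + colour₃' f a (fun c e f' g' => ∑ ρ, ∑ l, L.dG ρ (A c l *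
      (- (∑ σ, L.dG σ (A e σ * tripleAlt L.toCalculus A f' g' ρ μ l))
       + ∑ σ, alt3 (fun ρ μ l => L.dG ρ (A e μ * L.dG σ (A f' l * A g' σ))) ρ μ l)))
    + (1 / 3 : ℝ) • colour₃' f a (fun c e f' g' =>
      ((6 : ℝ) • (∑ ρ, ∑ l, ∑ σ, L.dG ρ (A c l *
          alt2 (fun ρ σ' => L.dG ρ (A e σ' * tripleAlt L.toCalculus A f' g' l μ σ)) ρ σ))
      - (6 : ℝ) • (∑ ρ, ∑ l, ∑ σ, L.dG ρ (A c l *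
          alt2 (fun l σ' => L.dG l (A e σ' * tripleAlt L.toCalculus A f' g' ρ μ σ)) l σ))
      - (6 : ℝ) • (∑ ρ, ∑ l, ∑ σ, L.dG ρ (A c l *
          alt2 (fun σ' μ => L.dG σ' (A e μ * tripleAlt L.toCalculus A f' g' ρ l σ)) σ μ))
      + (2 : ℝ) • (∑ ρ, L.dG ρ
          (alt2 (fun ρ μ => A c ρ * L.dG μ (tailTerm L.toCalculus A e f' g')) ρ μ))
      - L.dG μ (∑ ρ, L.D ρ (A c ρ * L.G (tailTerm L.toCalculus A e f' g')))))
    - (1 / 3 : ℝ) • colour₃' f a (fun c e f' g' =>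
      A c μ * L.G (tailTerm L.toCalculus A e f' g')) = _
  simp only [add_sub_assoc _ ((2 : ℝ) • _)]
  rw [colour₃'_add f a (fun c e f' g' => (6 : ℝ) • (∑ ρ, ∑ l, ∑ σ, L.dG ρ (A c l *
          alt2 (fun ρ σ' => L.dG ρ (A e σ' * tripleAlt L.toCalculus A f' g' l μ σ)) ρ σ))
      - (6 : ℝ) • (∑ ρ, ∑ l, ∑ σ, L.dG ρ (A c l *
          alt2 (fun l σ' => L.dG l (A e σ' * tripleAlt L.toCalculus A f' g' ρ μ σ)) l σ))
      - (6 : ℝ) • (∑ ρ, ∑ l, ∑ σ, L.dG ρ (A c l *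
          alt2 (fun σ' μ => L.dG σ' (A e μ * tripleAlt L.toCalculus A f' g' ρ l σ)) σ μ)))]
  rw [smul_add, ← add_assoc, add_sub_assoc, ← smul_sub, nicolai₃_scalar f L A a μ,
    nicolai₃_product f L A hf, nicolai₃_nested f L A hf, nicolai₃_alt f L A hf, smul_smul,
    show (1 / 3 : ℝ) * 3 = 1 by norm_num, one_smul]
  -- The scalar terms match on both sides. The rest is compared under the common `∑ ρ, dG ρ`; the
  -- coefficient `1/6` of the product term arises as `1/2 * 1/3`.
  rw [MultipletCalculus.third, Pi.add_apply, add_left_inj]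
  refine congrFun (?_ : (1 / 2 : ℝ) • (∑ ρ, (L.multiplet f).dG ρ _) + (∑ ρ, (L.multiplet f).dG ρ _)
    + (1 / 3 : ℝ) • (∑ ρ, (L.multiplet f).dG ρ _) = _) a
  simp only [Finset.smul_sum, ← map_smul, ← Finset.sum_add_distrib, ← map_add]
  refine Finset.sum_congr rfl fun ρ _ => congrArg _ ?_
  simp only [MultipletCalculus.twoForm]
  refine Finset.sum_congr rfl fun l _ => ?_
  simp only [← Finset.smul_sum, smul_smul, map_add, map_sub, map_neg, map_smul,
    LinearMap.add_apply, LinearMap.sub_apply, LinearMap.neg_apply, LinearMap.smul_apply, smul_add]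
  module

end ThirdOrder

end

end NicolaiMap

namespace NicolaiMap

noncomputable section

open scoped BigOperators

/-! ### Antisymmetry of the forms built from the bracket -/

namespace MultipletCalculus

variable {d : ℕ} {V : Type*} [AddCommGroup V] [Module ℝ V] (M : MultipletCalculus d V)
  (A : Fin d → V)

lemma eq_zero_of_eq_neg_self {y : V} (h : y = - y) : y = 0 := by
  rw [eq_neg_iff_add_eq_zero, ← two_smul ℝ] at h
  exact (smul_eq_zero_iff_right two_ne_zero).1 h

lemma curl_swap {Z : Fin d → Fin d → V} (hZ : ∀ μ l, Z l μ = - Z μ l) (ρ μ l : Fin d) :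
    M.curl Z μ ρ l = - M.curl Z ρ μ l := by
  simp only [curl, hZ ρ l, hZ l μ, hZ μ ρ, map_neg]
  abel

lemma curl_swap' {Z : Fin d → Fin d → V} (hZ : ∀ μ l, Z l μ = - Z μ l) (ρ μ l : Fin d) :
    M.curl Z ρ l μ = - M.curl Z ρ μ l := by
  simp only [curl, hZ ρ l, hZ l μ, hZ μ ρ, map_neg]
  abel

lemma curl_diag {Z : Fin d → Fin d → V} (hZ : ∀ μ l, Z l μ = - Z μ l) (ρ μ : Fin d) :
    M.curl Z ρ μ μ = 0 :=
  eq_zero_of_eq_neg_self (M.curl_swap' hZ ρ μ μ)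

variable {M} (hM : ∀ X Y, M.br X Y = - M.br Y X)
include hM

lemma comm_swap (μ l : Fin d) : M.comm A l μ = - M.comm A μ l := hM _ _

lemma three_swap (ρ μ l : Fin d) : M.three A μ ρ l = - M.three A ρ μ l :=
  M.curl_swap (comm_swap A hM) ρ μ l

lemma three_swap' (ρ μ l : Fin d) : M.three A ρ l μ = - M.three A ρ μ l :=
  M.curl_swap' (comm_swap A hM) ρ μ l

lemma contr_swap (μ l : Fin d) : M.contr A l μ = - M.contr A μ l := by
  simp only [contr, three_swap A hM μ, map_neg, LinearMap.neg_apply, Finset.sum_neg_distrib]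

omit hM in
lemma comm'_swap (μ l : Fin d) : M.comm' A l μ = - M.comm' A μ l := by
  simp only [comm', neg_sub]

lemma four_swap (ρ μ l σ : Fin d) : M.four A ρ l μ σ = - M.four A ρ μ l σ := by
  simp only [four, three_swap A hM l μ, three_swap' A hM ρ μ l, three_swap A hM ρ l,
    three_swap A hM ρ μ, map_neg, LinearMap.neg_apply]
  abel

lemma divFour_swap (ρ μ l : Fin d) : M.divFour A ρ l μ = - M.divFour A ρ μ l := by
  simp only [divFour, four_swap A hM ρ μ l, map_neg, Finset.sum_neg_distrib]

end MultipletCalculus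

end

end NicolaiMap

namespace NicolaiMap

noncomputable section

open scoped BigOperators

/-! ### An abstract one-loop calculus -/

/-- An algebra of operators with a trace that is cyclic and invariant under transposition,
derivatives `D μ` and a propagator `G` which inverts the Laplacian inside traces. -/
structure TraceCalculus (d : ℕ) (𝒜 V : Type*) [Ring 𝒜] [Algebra ℂ 𝒜] [AddCommGroup V]
    [Module ℂ V] where
  tr : 𝒜 →ₗ[ℂ] V
  tr_mul_comm : ∀ x y, tr (x * y) = tr (y * x)
  Transp : 𝒜 → 𝒜 → Prop
  transp_mul : ∀ {x x' y y'}, Transp x x' → Transp y y' → Transp (x * y) (y' * x')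
  transp_add : ∀ {x x' y y'}, Transp x x' → Transp y y' → Transp (x + y) (x' + y')
  transp_neg : ∀ {x x'}, Transp x x' → Transp (-x) (-x')
  tr_transp : ∀ {x x'}, Transp x x' → tr x = tr x'
  D : Fin d → 𝒜
  G : 𝒜
  D_comm : ∀ μ ν, D μ * D ν = D ν * D μ
  DG_comm : ∀ μ, D μ * G = G * D μ
  transp_D : ∀ μ, Transp (D μ) (-D μ)
  transp_G : Transp G G
  tr_laplace : ∀ y, tr ((∑ μ, D μ * D μ * G) * y) = - tr y

namespace TraceCalculus

variable {d : ℕ} {𝒜 V : Type*} [Ring 𝒜] [Algebra ℂ 𝒜] [AddCommGroup V] [Module ℂ V]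
  (T : TraceCalculus d 𝒜 V)

/-- The adjoint operators of a Landau field `a`, of the first order `a₁` of its Nicolai map,
of the three-form `x`, of the scalar `θ`, of the zero mode `z` of the two-form `[a, a]`, and
of the remaining three-forms `c`. -/
structure Background where
  a : Fin d → 𝒜
  a₁ : Fin d → 𝒜
  x : Fin d → Fin d → Fin d → 𝒜
  c : Fin d → Fin d → Fin d → 𝒜
  θ : 𝒜
  z : Fin d → Fin d → 𝒜
  e : Fin d → Fin d → 𝒜
  transp_a : ∀ μ, T.Transp (a μ) (-a μ)
  transp_a₁ : ∀ μ, T.Transp (a₁ μ) (-a₁ μ)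
  transp_θ : T.Transp θ (-θ)
  landau : ∑ μ, T.D μ * a μ = ∑ μ, a μ * T.D μ
  landau₁ : ∑ μ, T.D μ * a₁ μ = ∑ μ, a₁ μ * T.D μ
  x_swap : ∀ ρ μ l, x μ ρ l = - x ρ μ l
  x_swap' : ∀ ρ μ l, x ρ l μ = - x ρ μ l
  c_diag : ∀ ρ μ, c ρ μ μ = 0
  div_x : ∀ ρ l, ∑ σ, (T.D σ * x σ ρ l - x σ ρ l * T.D σ) =
    (T.D ρ * a₁ l - a₁ l * T.D ρ - T.D l * a₁ ρ + a₁ ρ * T.D l) - (a ρ * a l - a l * a ρ) + z ρ l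
  z_D : ∀ ρ l σ, z ρ l * T.D σ = T.D σ * z ρ l
  a_eq : ∀ l, a l = ∑ i, (T.D i * e l i - e l i * T.D i)
  box_a₁ : ∀ μ, ∑ ρ, (T.D ρ * T.D ρ * a₁ μ - (2 : ℂ) • (T.D ρ * a₁ μ * T.D ρ)
      + a₁ μ * (T.D ρ * T.D ρ)) =
    - ∑ ρ, (T.D ρ * (a μ * a ρ - a ρ * a μ) - (a μ * a ρ - a ρ * a μ) * T.D ρ)

/-- `tr_laplace` holds only under the trace and at the front of a word, so the Laplacian is rotated
there and back. -/
lemma laplace_left (x y : 𝒜) : ∑ μ, T.tr (x * (T.D μ * T.D μ * T.G) * y) = - T.tr (x * y) := by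
  rw [← map_sum, ← Finset.sum_mul, ← Finset.mul_sum, mul_assoc, T.tr_mul_comm, mul_assoc,
    T.tr_laplace, T.tr_mul_comm]

lemma tr_cyc {w w' x y : 𝒜} (h : w = x * y) (h' : w' = y * x) : T.tr w = T.tr w' := by
  rw [h, h', T.tr_mul_comm]

lemma DG_comm_assoc (μ : Fin d) (x : 𝒜) : T.D μ * (T.G * x) = T.G * (T.D μ * x) := by
  rw [← mul_assoc, T.DG_comm, mul_assoc]

lemma transp_sub {x x' y y' : 𝒜} (h : T.Transp x x') (h' : T.Transp y y') :
    T.Transp (x - y) (x' - y') := by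
  rw [sub_eq_add_neg, sub_eq_add_neg]
  exact T.transp_add h (T.transp_neg h')

lemma DGD (μ ν : Fin d) : T.D μ * T.G * T.D ν = T.D ν * T.G * T.D μ := by
  rw [T.DG_comm, T.DG_comm, mul_assoc, mul_assoc, T.D_comm]

/-- Terms in which the derivative carries the index of `a_l` cancel by the Landau condition (`h1`).
In the others use `2 [D_ρ, b] D_ρ = [D², b] - [D_ρ, [D_ρ, b]]`: each half of `[D², b]` puts `D²`
next to a propagator, which it cancels, and the two results agree after transposition (`h2`, `h3`).
Only the double commutator survives, with factor `-1/2`. -/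
lemma curl_trace (a b : Fin d → 𝒜) (ha : ∀ μ, T.Transp (a μ) (-a μ))
    (hb : ∀ μ, T.Transp (b μ) (-b μ)) (hl : ∑ μ, T.D μ * a μ = ∑ μ, a μ * T.D μ) :
    ∑ ρ, ∑ l, T.tr (a l * T.G *
      (T.D ρ * b l - b l * T.D ρ - T.D l * b ρ + b ρ * T.D l) * (T.D ρ * T.G)) =
    - ((1 / 2 : ℂ) • ∑ l, T.tr (a l * T.G * (∑ ρ, (T.D ρ * T.D ρ * b l
      - (2 : ℂ) • (T.D ρ * b l * T.D ρ) + b l * (T.D ρ * T.D ρ))) * T.G)) := by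
  have h1 : ∑ ρ, ∑ l, T.tr (a l * T.G * (T.D l * b ρ) * (T.D ρ * T.G)) =
      ∑ ρ, ∑ l, T.tr (a l * T.G * (b ρ * T.D l) * (T.D ρ * T.G)) := by
    have e1 (ρ : Fin d) : ∑ l, T.tr (a l * T.G * (T.D l * b ρ) * (T.D ρ * T.G)) =
        T.tr ((∑ l, a l * T.D l) * (T.G * b ρ * (T.D ρ * T.G))) := by
      rw [Finset.sum_mul, map_sum]
      refine Finset.sum_congr rfl fun l _ => congrArg _ ?_
      simp only [← mul_assoc]
      rw [mul_assoc (a l) (T.G), ← T.DG_comm, ← mul_assoc]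
    have e2 (ρ : Fin d) : ∑ l, T.tr (a l * T.G * (b ρ * T.D l) * (T.D ρ * T.G)) =
        T.tr ((∑ l, T.D l * a l) * (T.G * b ρ * (T.D ρ * T.G))) := by
      rw [Finset.sum_mul, map_sum]
      refine Finset.sum_congr rfl fun l _ => ?_
      rw [show a l * T.G * (b ρ * T.D l) * (T.D ρ * T.G) =
        (a l * T.G * b ρ * (T.D ρ * T.G)) * T.D l by
          simp only [mul_assoc]
          rw [← T.DG_comm l, ← mul_assoc (T.D ρ), T.D_comm ρ l, mul_assoc], T.tr_mul_comm]
      simp only [mul_assoc]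
    simp only [e1, e2, hl]
  have h2 (l : Fin d) : ∑ ρ, T.tr (a l * T.G * (T.D ρ * T.D ρ * b l) * T.G) =
      - T.tr (a l * T.G * b l) := by
    have : ∀ ρ, a l * T.G * (T.D ρ * T.D ρ * b l) * T.G =
        a l * (T.D ρ * T.D ρ * T.G) * (b l * T.G) := fun ρ => by
      have e : T.G * (T.D ρ * T.D ρ) = T.D ρ * T.D ρ * T.G := by
        rw [← mul_assoc, ← T.DG_comm, mul_assoc, ← T.DG_comm, mul_assoc]
      simp only [← e, mul_assoc]
    simp only [this, laplace_left]
    rw [← mul_assoc, T.tr_transp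
      (T.transp_mul (T.transp_mul (ha l) (hb l)) T.transp_G)]
    exact congrArg _ (T.tr_cyc (x := T.G * (b l)) (y := a l) (by simp [mul_assoc])
      (by simp [mul_assoc]))
  have h3 (l : Fin d) : ∑ ρ, T.tr (a l * T.G * (b l * (T.D ρ * T.D ρ)) * T.G) =
      - T.tr (a l * T.G * b l) := by
    have := T.laplace_left (a l * T.G * b l) 1
    simpa only [mul_one, mul_assoc] using this
  have h4 (l : Fin d) : T.tr (a l * T.G * (∑ ρ, (T.D ρ * T.D ρ * b l
      - (2 : ℂ) • (T.D ρ * b l * T.D ρ) + b l * (T.D ρ * T.D ρ))) * T.G) =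
      - (2 : ℂ) • T.tr (a l * T.G * b l)
      - (2 : ℂ) • ∑ ρ, T.tr (a l * T.G * (T.D ρ * b l) * (T.D ρ * T.G)) := by
    simp only [Finset.mul_sum, Finset.sum_mul, mul_add, mul_sub, add_mul, sub_mul, map_sum, map_add,
      map_sub, Finset.sum_add_distrib, Finset.sum_sub_distrib, h2, h3, mul_smul_comm,
      smul_mul_assoc, map_smul, ← Finset.smul_sum]
    simp only [mul_assoc]
    module
  have h5 (l : Fin d) : ∑ ρ, T.tr (a l * T.G * (b l * T.D ρ) * (T.D ρ * T.G)) =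
      - T.tr (a l * T.G * b l) := by
    simpa only [mul_assoc] using h3 l
  simp only [h4]
  simp only [mul_add, mul_sub, add_mul, sub_mul, map_add, map_sub, Finset.sum_add_distrib,
    Finset.sum_sub_distrib, h1, smul_sub]
  rw [Finset.sum_comm (f := fun ρ l => T.tr (a l * T.G * (b l * T.D ρ) * (T.D ρ * T.G)))]
  simp only [h5]
  rw [Finset.sum_comm (f := fun ρ l => T.tr (a l * T.G * (T.D ρ * b l) * (T.D ρ * T.G)))]
  simp only [Finset.sum_neg_distrib, ← Finset.smul_sum]
  module

variable {T}

namespace Background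

variable (B : T.Background)

/-- `∑ tr (a_l G [a_ρ, a_l] D_ρ G)`. -/
def bubble : V := ∑ ρ, ∑ l,
  T.tr (B.a l * T.G * (B.a ρ * B.a l - B.a l * B.a ρ) * (T.D ρ * T.G))

/-- By `box_a₁` the double commutator is minus a commutator of `D_ρ` with `[a_l, a_ρ]`.
Transposition relates the terms with the derivative left and right of the bracket; they contribute
equally, hence the `2`. -/
lemma box_trace : ∑ l, T.tr (B.a l * T.G * (∑ ρ, (T.D ρ * T.D ρ * B.a₁ l
      - (2 : ℂ) • (T.D ρ * B.a₁ l * T.D ρ) + B.a₁ l * (T.D ρ * T.D ρ))) * T.G) =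
    - (2 : ℂ) • B.bubble := by
  have h (l ρ : Fin d) : T.tr (B.a l * T.G * (T.D ρ * (B.a l * B.a ρ - B.a ρ * B.a l)) * T.G) =
      - T.tr (B.a l * T.G * (B.a l * B.a ρ - B.a ρ * B.a l) * (T.D ρ * T.G)) := by
    have hb := T.transp_sub (T.transp_mul (B.transp_a l) (B.transp_a ρ))
      (T.transp_mul (B.transp_a ρ) (B.transp_a l))
    rw [T.tr_transp (T.transp_mul (T.transp_mul (T.transp_mul (B.transp_a l) T.transp_G)
      (T.transp_mul (T.transp_D ρ) hb)) T.transp_G), ← map_neg]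
    exact T.tr_cyc (x := T.G * ((B.a l * B.a ρ - B.a ρ * B.a l) * T.D ρ * T.G)) (y := - B.a l)
      (by noncomm_ring) (by rw [T.DG_comm]; noncomm_ring [T.DG_comm])
  simp only [B.box_a₁]
  simp only [Finset.mul_sum, Finset.sum_mul, mul_sub (_ * T.G) (T.D _ * _), sub_mul _ _ T.G, map_sum,
    map_sub, map_neg, mul_neg, neg_mul, h, bubble]
  rw [Finset.sum_comm, Finset.smul_sum]
  simp only [← Finset.sum_neg_distrib, Finset.smul_sum]
  refine Finset.sum_congr rfl fun l _ => Finset.sum_congr rfl fun ρ _ => ?_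
  have e : T.tr (B.a l * T.G * ((B.a l * B.a ρ - B.a ρ * B.a l) * T.D ρ) * T.G) =
      - T.tr (B.a l * T.G * (B.a ρ * B.a l - B.a l * B.a ρ) * (T.D ρ * T.G)) := by
    rw [← map_neg]
    exact congrArg _ (by noncomm_ring)
  have e' : T.tr (B.a l * T.G * (B.a l * B.a ρ - B.a ρ * B.a l) * (T.D ρ * T.G)) =
      - T.tr (B.a l * T.G * (B.a ρ * B.a l - B.a l * B.a ρ) * (T.D ρ * T.G)) := by
    rw [← map_neg]
    exact congrArg _ (by noncomm_ring)
  rw [e, e']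
  module

lemma curl_a₁_trace : ∑ ρ, ∑ l, T.tr (B.a l * T.G *
      (T.D ρ * B.a₁ l - B.a₁ l * T.D ρ - T.D l * B.a₁ ρ + B.a₁ ρ * T.D l) * (T.D ρ * T.G)) =
    B.bubble := by
  rw [T.curl_trace B.a B.a₁ B.transp_a B.transp_a₁ B.landau, box_trace]
  module

/-- The zero mode `z` is constant and commutes with every derivative, while `a_l` is a sum of
commutators `[D_i, e_{li}]`. Since `D_i` commutes with all other factors, this is the trace of a
commutator. -/
lemma zeroMode_trace (l ρ : Fin d) : T.tr (B.a l * T.G * B.z ρ l * (T.D ρ * T.G)) = 0 := by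
  nth_rewrite 1 [B.a_eq l]
  simp only [Finset.sum_mul, map_sum]
  refine Finset.sum_eq_zero fun i _ => ?_
  simp only [sub_mul, map_sub]
  rw [sub_eq_zero]
  refine T.tr_cyc (x := T.D i) (y := B.e l i * T.G * B.z ρ l * (T.D ρ * T.G))
    (by simp only [mul_assoc]) ?_
  simp only [mul_assoc, ← T.DG_comm, DG_comm_assoc]
  simp only [← mul_assoc]
  simp only [mul_assoc]
  congr 2
  rw [← mul_assoc (T.D i), ← B.z_D, mul_assoc, ← mul_assoc (T.D i), T.D_comm, mul_assoc]

/-- The contribution of the three-form `dG [A, A]` to the one-loop trace vanishes. -/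
lemma x_trace : ∑ ρ, ∑ l, ∑ σ, T.tr (T.D ρ * T.G * B.a l * (T.D σ * T.G) * B.x ρ l σ) = 0 := by
  have h1 (ρ l σ : Fin d) : T.tr (T.D ρ * T.G * B.a l * (T.D σ * T.G) * B.x ρ l σ) =
      T.tr (B.a l * T.G * (T.D σ * B.x ρ l σ) * (T.D ρ * T.G)) :=
    T.tr_cyc (x := T.D ρ * T.G) (y := B.a l * (T.D σ * T.G) * B.x ρ l σ)
      (by simp only [mul_assoc]) (by simp only [T.DG_comm σ, mul_assoc])
  have hx (ρ l σ : Fin d) : B.x ρ l σ = B.x σ ρ l := by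
    rw [B.x_swap' ρ σ l, B.x_swap, neg_neg]
  -- The two derivatives are adjacent and commute, whereas `x` is antisymmetric in `ρ` and `σ`.
  have h2 (l : Fin d) : ∑ ρ, ∑ σ, T.tr (B.a l * T.G * (B.x ρ l σ * T.D σ) * (T.D ρ * T.G)) = 0 := by
    have e : ∑ ρ, ∑ σ, T.tr (B.a l * T.G * (B.x ρ l σ * T.D σ) * (T.D ρ * T.G)) =
        - ∑ ρ, ∑ σ, T.tr (B.a l * T.G * (B.x ρ l σ * T.D σ) * (T.D ρ * T.G)) := by
      conv_lhs => rw [Finset.sum_comm]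
      simp only [← Finset.sum_neg_distrib, ← map_neg]
      refine Finset.sum_congr rfl fun ρ _ => Finset.sum_congr rfl fun σ _ => congrArg _ ?_
      rw [show B.x σ l ρ = - B.x ρ l σ by rw [hx, B.x_swap']]
      simp only [mul_assoc, neg_mul, mul_neg, neg_inj]
      rw [← mul_assoc (T.D ρ), T.D_comm, mul_assoc]
    rw [eq_neg_iff_add_eq_zero, ← two_smul ℂ] at e
    exact (smul_eq_zero.1 e).resolve_left two_ne_zero
  -- Commuting `D_σ` past `x` produces the divergence of the three-form: the curl of `a₁`, minus
  -- `[a_ρ, a_l]`, plus a zero mode that does not contribute. After summation the first two both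
  -- give the bubble and cancel.
  have h3 (ρ l : Fin d) : ∑ σ, T.tr (B.a l * T.G * (T.D σ * B.x ρ l σ) * (T.D ρ * T.G)) =
      T.tr (B.a l * T.G * (T.D ρ * B.a₁ l - B.a₁ l * T.D ρ - T.D l * B.a₁ ρ + B.a₁ ρ * T.D l) *
        (T.D ρ * T.G))
      - T.tr (B.a l * T.G * (B.a ρ * B.a l - B.a l * B.a ρ) * (T.D ρ * T.G))
      + ∑ σ, T.tr (B.a l * T.G * (B.x ρ l σ * T.D σ) * (T.D ρ * T.G)) := by
    rw [← map_sub, ← sub_mul, ← mul_sub]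
    rw [← sub_eq_iff_eq_add, ← Finset.sum_sub_distrib]
    simp only [← map_sub, ← sub_mul, ← mul_sub]
    rw [← map_sum, ← Finset.sum_mul, ← Finset.mul_sum,
      (Finset.sum_congr rfl fun σ _ => by rw [hx]).trans (B.div_x ρ l), mul_add, add_mul, map_add,
      B.zeroMode_trace, add_zero]
  simp only [h1, h3, Finset.sum_add_distrib, Finset.sum_sub_distrib, B.curl_a₁_trace]
  rw [Finset.sum_comm (f := fun ρ l => ∑ σ, T.tr (B.a l * T.G * (B.x ρ l σ * T.D σ) * (T.D ρ * T.G)))]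
  simp only [h2, bubble]
  simp

end Background
end TraceCalculus

end

end NicolaiMap

namespace NicolaiMap

noncomputable section

open scoped BigOperators

/-! ### Cyclic words in propagator derivatives and background fields -/

namespace TraceCalculus.Background

variable {d : ℕ} {𝒜 V : Type*} [Ring 𝒜] [Algebra ℂ 𝒜] [AddCommGroup V] [Module ℂ V]
  {T : TraceCalculus d 𝒜 V} (B : T.Background)

lemma sum₃_perm₁₃ {n : ℕ} (F : Fin n → Fin n → Fin n → V) :
    ∑ x, ∑ y, ∑ z, F x y z = ∑ x, ∑ y, ∑ z, F z y x := by
  rw [Finset.sum_comm, (Finset.sum_congr rfl fun y _ => Finset.sum_comm :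
    ∑ y, ∑ x, ∑ z, F x y z = ∑ y, ∑ z, ∑ x, F x y z), Finset.sum_comm]

lemma sum₃_perm₂₃ {n : ℕ} (F : Fin n → Fin n → Fin n → V) :
    ∑ x, ∑ y, ∑ z, F x y z = ∑ x, ∑ y, ∑ z, F x z y :=
  Finset.sum_congr rfl fun _ _ => Finset.sum_comm

lemma sum₃_perm₁₂ {n : ℕ} (F : Fin n → Fin n → Fin n → V) :
    ∑ x, ∑ y, ∑ z, F x y z = ∑ x, ∑ y, ∑ z, F y x z := Finset.sum_comm

lemma sum₃_congr {n : ℕ} {F H : Fin n → Fin n → Fin n → V} (h : ∀ x y z, F x y z = H x y z) :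
    ∑ x, ∑ y, ∑ z, F x y z = ∑ x, ∑ y, ∑ z, H x y z :=
  Finset.sum_congr rfl fun _ _ => Finset.sum_congr rfl fun _ _ => Finset.sum_congr rfl fun _ _ =>
    h _ _ _

variable (T) in
/-- `∂_μ C`. -/
def p (μ : Fin d) : 𝒜 := T.D μ * T.G

/-- `∂_ρ C A_ρ`. -/
def K : 𝒜 := ∑ ρ, p T ρ * B.a ρ

/-- `A_ρ ∂_ρ C`. -/
def κ : 𝒜 := ∑ ρ, B.a ρ * p T ρ

/-- The words `tr (∂_α C A_β ∂_γ C A_δ ∂_ε C A_ζ)`. -/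
def word (α β γ δ ε ζ : Fin d) : V :=
  T.tr (p T α * (B.a β * (p T γ * (B.a δ * (p T ε * B.a ζ)))))

lemma word_cyc (α β γ δ ε ζ : Fin d) : B.word α β γ δ ε ζ = B.word γ δ ε ζ α β :=
  T.tr_cyc (x := p T α * B.a β) (y := p T γ * (B.a δ * (p T ε * B.a ζ)))
    (by simp only [mul_assoc]) (by simp only [mul_assoc])

/-- `∑ tr (∂_ρ C A_l Z_{ρl})`. -/
def pairing (Z : Fin d → Fin d → 𝒜) : V := ∑ ρ, ∑ l, T.tr (p T ρ * (B.a l * Z ρ l))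

lemma pairing_add (Z W : Fin d → Fin d → 𝒜) :
    B.pairing (fun ρ l => Z ρ l + W ρ l) = B.pairing Z + B.pairing W := by
  simp only [pairing, mul_add, map_add, Finset.sum_add_distrib]

lemma pairing_sub (Z W : Fin d → Fin d → 𝒜) :
    B.pairing (fun ρ l => Z ρ l - W ρ l) = B.pairing Z - B.pairing W := by
  simp only [pairing, mul_sub, map_sub, Finset.sum_sub_distrib]

lemma pairing_smul (r : ℂ) (Z : Fin d → Fin d → 𝒜) :
    B.pairing (fun ρ l => r • Z ρ l) = r • B.pairing Z := by
  simp only [pairing, mul_smul_comm, map_smul, Finset.smul_sum]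

lemma pairing_x : B.pairing (fun ρ l => ∑ σ, p T σ * B.x ρ l σ) = 0 := by
  rw [← B.x_trace]
  simp only [pairing, p, Finset.mul_sum, map_sum, mul_assoc]

/-- The cyclic classes of words. -/
def w₀ : V := T.tr (B.K * (B.K * B.K))
def w₁ : V := B.pairing fun ρ l => p T ρ * (B.a l * B.K)
def w₁' : V := B.pairing fun ρ l => p T ρ * (B.κ * B.a l)
def w₂ : V := B.pairing fun ρ l => p T l * (B.a ρ * B.K)
def w₃ : V := B.pairing fun ρ l => ∑ σ, p T σ * (B.a ρ * (p T l * B.a σ))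
def w₄ : V := B.pairing fun ρ l => ∑ σ, p T σ * (B.a ρ * (p T σ * B.a l))

lemma w₀_eq : B.w₀ = ∑ ρ, ∑ l, ∑ σ, B.word ρ ρ l l σ σ := by
  rw [sum₃_perm₁₃]
  simp only [w₀, K, Finset.sum_mul, Finset.mul_sum, map_sum, word, mul_assoc]
lemma w₁_eq : B.w₁ = ∑ ρ, ∑ l, ∑ σ, B.word ρ l ρ l σ σ := by
  simp only [w₁, pairing, K, Finset.mul_sum, map_sum, word]
lemma w₁'_eq : B.w₁' = ∑ ρ, ∑ l, ∑ σ, B.word ρ l ρ σ σ l := by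
  simp only [w₁', pairing, κ, Finset.sum_mul, Finset.mul_sum, map_sum, word, mul_assoc]
lemma w₂_eq : B.w₂ = ∑ ρ, ∑ l, ∑ σ, B.word ρ l l ρ σ σ := by
  simp only [w₂, pairing, K, Finset.mul_sum, map_sum, word]
lemma w₃_eq : B.w₃ = ∑ ρ, ∑ l, ∑ σ, B.word ρ l σ ρ l σ := by
  simp only [w₃, pairing, Finset.mul_sum, map_sum, word]
lemma w₄_eq : B.w₄ = ∑ ρ, ∑ l, ∑ σ, B.word ρ l σ ρ σ l := by
  simp only [w₄, pairing, Finset.mul_sum, map_sum, word]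

/-- The Landau condition in operator form. With `L = ∑ D_ρ a_ρ` one has `κ = L G`, and `K = G L` by
`K_eq`, so powers of the two have equal traces. -/
lemma κ_eq : B.κ = (∑ ρ, T.D ρ * B.a ρ) * T.G := by
  rw [B.landau, κ, Finset.sum_mul]
  simp only [p, mul_assoc]

lemma K_eq : B.K = T.G * (∑ ρ, T.D ρ * B.a ρ) := by
  rw [K, Finset.mul_sum]
  simp only [p, T.DG_comm, mul_assoc]

lemma tr_κ : T.tr (B.κ * (B.κ * B.κ)) = B.w₀ :=
  T.tr_cyc (x := (∑ ρ, T.D ρ * B.a ρ) * T.G * ((∑ ρ, T.D ρ * B.a ρ) * T.G) *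
    (∑ ρ, T.D ρ * B.a ρ)) (y := T.G) (by simp only [κ_eq, mul_assoc])
    (by simp only [K_eq, mul_assoc])

/-- The pairing expands to the contraction `ρ l l σ σ ρ`, which is not a rotation of the one
defining `w₀`. It is the trace of `κ³`, and the Landau condition identifies this with the trace of
`K³`. -/
lemma pairing_κ : B.pairing (fun ρ l => p T l * (B.κ * B.a ρ)) = B.w₀ := by
  have h : T.tr (B.κ * (B.κ * B.κ)) = ∑ ρ, ∑ l, ∑ σ, B.word ρ l l σ σ ρ := by
    have e : T.tr (B.κ * (B.κ * B.κ)) = ∑ σ, ∑ l, ∑ ρ,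
        T.tr (B.a ρ * (p T ρ * (B.a l * (p T l * (B.a σ * p T σ))))) := by
      simp only [κ, Finset.sum_mul, Finset.mul_sum, map_sum, mul_assoc]
    rw [e, sum₃_perm₂₃ fun ρ l σ => B.word ρ l l σ σ ρ]
    exact sum₃_congr fun σ l ρ => T.tr_cyc (x := B.a ρ * (p T ρ * (B.a l * (p T l * B.a σ))))
      (y := p T σ) (by simp only [mul_assoc]) rfl
  rw [← tr_κ, h]
  simp only [pairing, κ, Finset.sum_mul, Finset.mul_sum, map_sum, word, mul_assoc]

lemma pairing_five : B.pairing (fun ρ l => ∑ σ, p T σ * (B.a l * (p T σ * B.a ρ))) = B.w₁' := by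
  rw [w₁'_eq, sum₃_perm₁₃]
  simp only [pairing, Finset.mul_sum, map_sum]
  exact sum₃_congr fun ρ l σ => B.word_cyc ρ l σ l σ ρ

lemma pairing_seven : B.pairing (fun ρ l => ∑ σ, p T ρ * (B.a σ * (p T l * B.a σ))) = B.w₄ := by
  rw [w₄_eq, sum₃_perm₁₃, sum₃_perm₂₃]
  simp only [pairing, Finset.mul_sum, map_sum]
  exact sum₃_congr fun ρ l σ => (B.word_cyc ρ l ρ σ l σ).trans (B.word_cyc ρ σ l σ ρ l)

lemma pairing_eight : B.pairing (fun ρ l => ∑ σ, p T l * (B.a σ * (p T ρ * B.a σ))) = B.w₁' := by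
  rw [w₁'_eq, sum₃_perm₂₃]
  simp only [pairing, Finset.mul_sum, map_sum]
  exact sum₃_congr fun ρ l σ => (B.word_cyc ρ l l σ ρ σ).trans (B.word_cyc l σ ρ σ ρ l)

lemma pairing_nine : B.pairing (fun ρ l => B.K * (p T ρ * B.a l)) = B.w₁ := by
  rw [w₁_eq]
  simp only [pairing, K, Finset.sum_mul, Finset.mul_sum, map_sum, mul_assoc]
  exact sum₃_congr fun ρ l σ => (B.word_cyc ρ l σ σ ρ l).trans (B.word_cyc σ σ ρ l ρ l)

lemma pairing_ten : B.pairing (fun ρ l => B.K * (p T l * B.a ρ)) = B.w₂ := by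
  rw [w₂_eq, sum₃_perm₁₂]
  simp only [pairing, K, Finset.sum_mul, Finset.mul_sum, map_sum, mul_assoc]
  exact sum₃_congr fun ρ l σ => (B.word_cyc ρ l σ σ l ρ).trans (B.word_cyc σ σ l ρ ρ l)

lemma pairing_eleven : B.pairing (fun ρ l => ∑ σ, p T σ * (B.a l * (p T ρ * B.a σ))) = B.w₄ := by
  rw [w₄_eq, sum₃_perm₁₃]
  simp only [pairing, Finset.mul_sum, map_sum]
  exact sum₃_congr fun ρ l σ => B.word_cyc ρ l σ l ρ σ

end TraceCalculus.Background

end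

end NicolaiMap

namespace NicolaiMap

noncomputable section

open scoped BigOperators

/-! ### Variations of the Nicolai map and their index contractions -/

namespace TraceCalculus.Background

variable {d : ℕ} {𝒜 V : Type*} [Ring 𝒜] [Algebra ℂ 𝒜] [AddCommGroup V] [Module ℂ V]
  {T : TraceCalculus d 𝒜 V} (B : T.Background)

/-- The Kronecker delta as an operator. -/
def delta (𝒜 : Type*) [Ring 𝒜] (μ ν : Fin d) : 𝒜 := if μ = ν then 1 else 0

@[simp] lemma sum_mul_delta (F : Fin d → 𝒜) (ν : Fin d) : ∑ μ, F μ * delta 𝒜 μ ν = F ν := by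
  simp [delta]
@[simp] lemma sum_mul_delta' (F : Fin d → 𝒜) (ν : Fin d) : ∑ μ, F μ * delta 𝒜 ν μ = F ν := by
  simp [delta]
@[simp] lemma delta_self (ν : Fin d) : delta 𝒜 ν ν = 1 := by
  simp [delta]

variable (T) in
/-- The variation of `dG Z`, given the variation `W` of the two-form `Z`. -/
def vCurl (W : Fin d → Fin d → Fin d → 𝒜) (ρ μ l ν : Fin d) : 𝒜 :=
  p T ρ * W μ l ν + p T μ * W l ρ ν + p T l * W ρ μ ν

/-- The variation of `[b_μ, b_l]`-type two-forms. -/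
def vComm (b : Fin d → 𝒜) (μ l ν : Fin d) : 𝒜 := b μ * delta 𝒜 l ν - b l * delta 𝒜 μ ν

/-- The variation of the first order of the Nicolai map. -/
def vFirst (μ ν : Fin d) : 𝒜 := p T ν * B.a μ - B.K * delta 𝒜 μ ν

/-- The variation of the three-form `dG [A, A]`. -/
def vThree (ρ μ l ν : Fin d) : 𝒜 := vCurl T (vComm B.a) ρ μ l ν

/-- The variation of the contraction of the three-form with the gauge field. -/
def vContr (μ l ν : Fin d) : 𝒜 := B.x μ l ν - ∑ σ, B.a σ * B.vThree μ l σ ν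

/-- The variation of the second order of the Nicolai map. -/
def vSecond (μ ν : Fin d) : 𝒜 := (1 / 2 : ℂ) • ∑ ρ, p T ρ * B.vContr ρ μ ν

/-- The variation of the first variation of `[A_μ, A_l]`. -/
def vComm' (μ l ν : Fin d) : 𝒜 :=
  vComm B.a₁ μ l ν + (B.a μ * B.vFirst l ν - B.a l * B.vFirst μ ν)

/-- The variation of the four-form. -/
def vFour (ρ μ l σ ν : Fin d) : 𝒜 :=
  B.x ρ μ σ * delta 𝒜 l ν + B.x μ l σ * delta 𝒜 ρ ν + B.x l ρ σ * delta 𝒜 μ ν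
    - B.x ρ μ l * delta 𝒜 σ ν
    - (B.a l * B.vThree ρ μ σ ν + B.a ρ * B.vThree μ l σ ν + B.a μ * B.vThree l ρ σ ν
      - B.a σ * B.vThree ρ μ l ν)

/-- The variation of the two-form of third order. -/
def vTwoForm (ρ μ ν : Fin d) : 𝒜 := ∑ l,
  (B.c ρ μ l * delta 𝒜 l ν
    + (1 / 6 : ℂ) • (B.x ρ μ l * B.vFirst l ν - B.a₁ l * B.vThree ρ μ l ν)
    + (1 / 6 : ℂ) • (B.a l * vCurl T B.vComm' ρ μ l ν)
    + (1 / 3 : ℂ) • (B.a l * vCurl T B.vContr ρ μ l ν)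
    - (1 / 3 : ℂ) • (B.a l * ∑ σ, p T σ * B.vFour ρ μ l σ ν))

/-- The variation of `[A₁_l, A_l]`. -/
def vScalar (ν : Fin d) : 𝒜 := B.a₁ ν - ∑ l, B.a l * B.vFirst l ν

/-- The variation of the terms of third order that involve the scalar. -/
def vScalarPart (μ ν : Fin d) : 𝒜 :=
  (1 / 3 : ℂ) • (∑ ρ, p T ρ *
    (((T.D μ * B.θ - B.θ * T.D μ) * delta 𝒜 ρ ν - B.a ρ * (p T μ * B.vScalar ν))
      - ((T.D ρ * B.θ - B.θ * T.D ρ) * delta 𝒜 μ ν - B.a μ * (p T ρ * B.vScalar ν))))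
  - (1 / 3 : ℂ) • (p T μ * ∑ ρ, T.D ρ * (B.θ * delta 𝒜 ρ ν - B.a ρ * (T.G * B.vScalar ν)))
  - (1 / 3 : ℂ) • (B.θ * delta 𝒜 μ ν - B.a μ * (T.G * B.vScalar ν))

/-- The variation of the third order of the Nicolai map. -/
def vThird (μ ν : Fin d) : 𝒜 := (∑ ρ, p T ρ * B.vTwoForm ρ μ ν) + B.vScalarPart μ ν

/-- The dimension enters the one-loop identities through contractions of this kind, in which a
Kronecker delta is traced over its indices. -/
lemma sum_vFirst : ∑ μ, B.vFirst μ μ = (1 - d : ℂ) • B.K := by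
  simp only [vFirst, Finset.sum_sub_distrib, delta_self, mul_one, Finset.sum_const,
    Finset.card_univ, Fintype.card_fin, sub_smul, one_smul]
  rw [Nat.cast_smul_eq_nsmul, K]

/-- Of the three cyclic terms, two contract the variation index with an index of `W` itself and one
contracts it with the derivative. Traced deltas come only from the former. -/
lemma contract_vCurl (W : Fin d → Fin d → Fin d → 𝒜) (hW : ∀ μ l ν, W l μ ν = - W μ l ν)
    (ρ l : Fin d) : ∑ μ, vCurl T W ρ μ l μ =
      p T ρ * (∑ μ, W μ l μ) - p T l * (∑ μ, W μ ρ μ) + ∑ μ, p T μ * W l ρ μ := by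
  simp only [vCurl, Finset.sum_add_distrib, Finset.mul_sum, hW _ ρ, mul_neg,
    Finset.sum_neg_distrib]
  abel

lemma vCurl_swap (W : Fin d → Fin d → Fin d → 𝒜) (hW : ∀ μ l ν, W l μ ν = - W μ l ν)
    (ρ μ l ν : Fin d) : vCurl T W μ ρ l ν = - vCurl T W ρ μ l ν := by
  simp only [vCurl, hW ρ μ, hW l μ, hW ρ l, mul_neg, neg_add, neg_neg]
  abel

lemma vComm_swap (b : Fin d → 𝒜) (μ l ν : Fin d) : vComm b l μ ν = - vComm b μ l ν := by
  simp only [vComm, neg_sub]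

/-- `∂_ρ C A_l - ∂_l C A_ρ`. -/
def zz (b : Fin d → 𝒜) (ρ l : Fin d) : 𝒜 := p T ρ * b l - p T l * b ρ

lemma contract_vComm (b : Fin d → 𝒜) (l : Fin d) :
    ∑ μ, vComm b μ l μ = (1 - d : ℂ) • b l := by
  simp only [vComm, Finset.sum_sub_distrib, sum_mul_delta', delta_self, mul_one, Finset.sum_const,
    Finset.card_univ, Fintype.card_fin, sub_smul, one_smul]
  rw [Nat.cast_smul_eq_nsmul]

lemma contract_vCurl_vComm (b : Fin d → 𝒜) (ρ l : Fin d) :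
    ∑ μ, vCurl T (vComm b) ρ μ l μ = (2 - d : ℂ) • zz (T := T) b ρ l := by
  rw [contract_vCurl _ (vComm_swap b), contract_vComm, contract_vComm]
  simp only [vComm, mul_sub, ← mul_assoc, Finset.sum_sub_distrib, sum_mul_delta',
    mul_smul_comm, zz]
  module

lemma contract_vThree (ρ l : Fin d) :
    ∑ μ, B.vThree ρ μ l μ = (2 - d : ℂ) • zz (T := T) B.a ρ l :=
  contract_vCurl_vComm B.a ρ l

lemma vThree_swap (ρ μ l ν : Fin d) : B.vThree μ ρ l ν = - B.vThree ρ μ l ν :=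
  vCurl_swap _ (vComm_swap _) _ _ _ _

lemma sum_a_vFirst (l : Fin d) : ∑ μ, B.a μ * B.vFirst l μ = B.κ * B.a l - B.a l * B.K := by
  simp only [vFirst, mul_sub, Finset.sum_sub_distrib, ← mul_assoc, sum_mul_delta', κ,
    Finset.sum_mul]

lemma sum_p_vFirst (y : 𝒜) (ρ : Fin d) : ∑ μ, p T μ * (y * B.vFirst ρ μ) =
    (∑ μ, p T μ * (y * (p T μ * B.a ρ))) - p T ρ * (y * B.K) := by
  simp only [vFirst, mul_sub, Finset.sum_sub_distrib, ← mul_assoc, sum_mul_delta']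

lemma contract_vComm' (ρ l : Fin d) : ∑ μ, vCurl T B.vComm' ρ μ l μ =
    (2 - d : ℂ) • zz (T := T) B.a₁ ρ l + (p T ρ * (B.κ * B.a l) - p T l * (B.κ * B.a ρ))
    + (d - 3 : ℂ) • (p T ρ * (B.a l * B.K) - p T l * (B.a ρ * B.K))
    + ((∑ μ, p T μ * (B.a l * (p T μ * B.a ρ))) - ∑ μ, p T μ * (B.a ρ * (p T μ * B.a l))) := by
  rw [contract_vCurl _ fun μ l ν => by rw [vComm', vComm', vComm_swap]; abel]
  simp only [vComm', Finset.sum_add_distrib, Finset.sum_sub_distrib, sum_a_vFirst, contract_vComm,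
    ← Finset.mul_sum, sum_vFirst, mul_add, mul_sub, sum_p_vFirst]
  simp only [vComm, mul_sub, ← mul_assoc, Finset.sum_sub_distrib, sum_mul_delta',
    mul_smul_comm, zz]
  module

lemma eq_zero_of_eq_neg {y : 𝒜} (h : y = - y) : y = 0 := by
  rw [eq_neg_iff_add_eq_zero, ← two_smul ℂ] at h
  have := congrArg (fun y => (1 / 2 : ℂ) • y) h
  simpa only [smul_smul, smul_zero, one_div, ne_eq, OfNat.ofNat_ne_zero, not_false_eq_true,
    inv_mul_cancel₀, one_smul] using this

lemma x_diag₂₃ (ρ μ : Fin d) : B.x ρ μ μ = 0 := eq_zero_of_eq_neg (B.x_swap' ρ μ μ)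

lemma x_diag₁₂ (ρ μ : Fin d) : B.x μ μ ρ = 0 := eq_zero_of_eq_neg (B.x_swap μ μ ρ)

lemma x_diag₁₃ (ρ μ : Fin d) : B.x μ ρ μ = 0 := by rw [B.x_swap, x_diag₂₃, neg_zero]

/-- The two-index contraction `A_σ ∂_l C A_σ - A_σ ∂_σ C A_l`. -/
def uu (l : Fin d) : 𝒜 := ∑ σ, B.a σ * (p T l * B.a σ) - B.κ * B.a l

lemma sum_a_vThree (l ρ ν : Fin d) : ∑ σ, B.a σ * B.vThree l ρ σ ν =
    B.a ν * (p T l * B.a ρ) - B.a ν * (p T ρ * B.a l)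
      - (B.uu l * delta 𝒜 ρ ν - B.uu ρ * delta 𝒜 l ν) := by
  simp only [vThree, vCurl, vComm, mul_sub, mul_add, Finset.sum_sub_distrib, Finset.sum_add_distrib,
    ← mul_assoc, sum_mul_delta, uu, κ, sub_mul, Finset.sum_mul]
  abel

/-- The three-form `x` survives only under a propagator derivative, in the combination whose pairing
with `a` vanishes by `pairing_x`. -/
lemma contract_vContr (ρ l : Fin d) : ∑ μ, vCurl T B.vContr ρ μ l μ =
    (3 - d : ℂ) • (p T ρ * B.uu l - p T l * B.uu ρ) - (∑ σ, p T σ * B.x ρ l σ)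
    + (B.K * (p T ρ * B.a l) - B.K * (p T l * B.a ρ)) := by
  have h1 (l : Fin d) : ∑ μ, B.vContr μ l μ = (2 - d : ℂ) • B.uu l := by
    simp only [vContr, x_diag₁₃, zero_sub, Finset.sum_neg_distrib]
    rw [Finset.sum_comm]
    simp only [← Finset.mul_sum, B.vThree_swap l, Finset.sum_neg_distrib, contract_vThree, mul_neg,
      neg_neg, zz, mul_smul_comm, mul_sub, ← Finset.smul_sum, Finset.sum_sub_distrib, uu, κ,
      Finset.sum_mul, mul_assoc]
  rw [contract_vCurl _ fun μ l ν => by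
    simp only [vContr, B.x_swap μ l, B.vThree_swap μ l, mul_neg, Finset.sum_neg_distrib]; abel]
  have h2 : ∑ μ, p T μ * B.vContr l ρ μ = - (∑ σ, p T σ * B.x ρ l σ)
      + (p T ρ * B.uu l - p T l * B.uu ρ)
      + (B.K * (p T ρ * B.a l) - B.K * (p T l * B.a ρ)) := by
    simp only [vContr, sum_a_vThree, B.x_swap ρ l, mul_sub, Finset.sum_sub_distrib, mul_neg,
      Finset.sum_neg_distrib, ← mul_assoc, sum_mul_delta', K, Finset.sum_mul]
    abel
  rw [h1, h1, h2]
  simp only [mul_smul_comm]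
  module

/-- For the `x` terms the traced index sits on the three-form in three of the four summands and on
the field in the remaining one: hence `3 - d`. The `a` terms acquire the same factor as `(2 - d) +
1`. -/
lemma contract_vFour (ρ l σ : Fin d) : ∑ μ, B.vFour ρ μ l σ μ =
    (3 - d : ℂ) • (B.x ρ l σ - (B.a l * zz (T := T) B.a ρ σ - B.a ρ * zz (T := T) B.a l σ
      - B.a σ * zz (T := T) B.a ρ l)) := by
  have h : ∑ μ, B.a μ * B.vThree l ρ σ μ = B.a l * zz (T := T) B.a ρ σ
      - B.a ρ * zz (T := T) B.a l σ - B.a σ * zz (T := T) B.a ρ l := by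
    simp only [vThree, vCurl, vComm, mul_sub, mul_add, Finset.sum_sub_distrib,
      Finset.sum_add_distrib, ← mul_assoc, sum_mul_delta', zz]
    abel
  simp only [vFour, Finset.sum_sub_distrib, Finset.sum_add_distrib, sum_mul_delta', h,
    ← Finset.mul_sum, contract_vThree, B.vThree_swap l, Finset.sum_neg_distrib, delta_self, mul_one,
    Finset.sum_const, Finset.card_univ, Fintype.card_fin, B.x_swap ρ l, B.x_swap' ρ l,
    mul_smul_comm, mul_neg]
  rw [← Nat.cast_smul_eq_nsmul ℂ]
  module

/-- The contribution of the scalar to the one-loop trace. -/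
def scalarTrace (v : Fin d → 𝒜) : V :=
  (∑ μ, T.tr (p T μ * (B.κ * v μ))) - (∑ μ, T.tr (B.K * (p T μ * v μ)))
    + (∑ ρ, ∑ μ, T.tr (p T ρ * (B.a μ * (p T ρ * v μ)))) + ∑ μ, T.tr (B.a μ * (T.G * v μ))

/-- An operator that is minus its own transpose is traceless. -/
lemma tr_θ : T.tr B.θ = 0 := by
  have := T.tr_transp B.transp_θ
  rw [map_neg, eq_neg_iff_add_eq_zero, ← two_smul ℂ] at this
  exact (smul_eq_zero.1 this).resolve_left two_ne_zero

lemma sum_tr_p (y : 𝒜) : ∑ ρ, T.tr (p T ρ * (T.D ρ * y)) = - T.tr y := by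
  rw [← T.tr_laplace, Finset.sum_mul, map_sum]
  simp only [p, mul_assoc, T.DG_comm_assoc]

lemma sum_tr_p' (y : 𝒜) : ∑ ρ, T.tr (p T ρ * (y * T.D ρ)) = - T.tr y := by
  rw [← sum_tr_p y]
  exact Finset.sum_congr rfl fun ρ _ => T.tr_cyc (x := p T ρ * y) (y := T.D ρ)
    (by simp only [mul_assoc]) (by simp only [← mul_assoc, p, T.DG_comm])

/-- The two halves of `D θ - θ D` have equal traces against `p`, and the remaining terms in `θ`
reduce to its vanishing trace. Only the variation of the source of `θ` contributes. -/
lemma trace_vScalarPart : ∑ μ, T.tr (B.vScalarPart μ μ) = (1 / 3 : ℂ) • B.scalarTrace B.vScalar := by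
  have h1 : ∑ μ, T.tr (∑ ρ, p T ρ * ((T.D μ * B.θ - B.θ * T.D μ) * delta 𝒜 ρ μ)) = 0 := by
    simp only [← mul_assoc, sum_mul_delta]
    simp only [mul_sub, map_sub, Finset.sum_sub_distrib, sum_tr_p, sum_tr_p', sub_self]
  have h3 : ∑ μ, T.tr (p T μ * ∑ ρ, T.D ρ * (B.θ * delta 𝒜 ρ μ)) = 0 := by
    simp only [← mul_assoc, sum_mul_delta]
    simp only [mul_assoc, sum_tr_p, tr_θ, neg_zero]
  have h4 (μ : Fin d) (y : 𝒜) : p T μ * ∑ ρ, T.D ρ * (B.a ρ * (T.G * y)) = p T μ * (B.κ * y) := by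
    rw [κ_eq]
    simp only [Finset.sum_mul, mul_assoc]
  have h5 (μ : Fin d) (y : 𝒜) : ∑ ρ, p T ρ * (B.a ρ * (p T μ * y)) = B.K * (p T μ * y) := by
    rw [K]
    simp only [Finset.sum_mul, mul_assoc]
  simp only [vScalarPart, map_sub, map_smul, mul_sub, Finset.sum_sub_distrib, h4, h5, h3, h1,
    delta_self, mul_one, tr_θ, ← Finset.smul_sum, scalarTrace, Finset.sum_const_zero]
  simp only [map_sum, sum_tr_p, sum_tr_p', tr_θ, neg_zero, Finset.sum_const_zero]
  rw [Finset.sum_comm (f := fun ρ μ => T.tr (p T ρ * (B.a μ * (p T ρ * B.vScalar μ))))]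
  module

end TraceCalculus.Background

end

end NicolaiMap

namespace NicolaiMap

noncomputable section

open scoped BigOperators

/-! ### Traces of the variations and the one-loop identities -/

namespace TraceCalculus.Background

variable {d : ℕ} {𝒜 V : Type*} [Ring 𝒜] [Algebra ℂ 𝒜] [AddCommGroup V] [Module ℂ V]
  {T : TraceCalculus d 𝒜 V} (B : T.Background)

lemma scalarTrace_sub (v w : Fin d → 𝒜) :
    B.scalarTrace (fun μ => v μ - w μ) = B.scalarTrace v - B.scalarTrace w := by
  simp only [scalarTrace, mul_sub, map_sub, Finset.sum_sub_distrib]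
  abel

/-- Recombining the four traces exhibits the curl of `a` between two propagators, the shape to which
`curl_trace` applies. The trace with a single propagator is `D² G = -1` read backwards. -/
lemma scalarTrace_eq (v : Fin d → 𝒜) : B.scalarTrace v = ∑ ρ, ∑ μ, T.tr (T.D ρ * T.G *
    (T.D μ * B.a ρ - B.a ρ * T.D μ - T.D ρ * B.a μ + B.a μ * T.D ρ) * (T.G * v μ)) := by
  have h1 (μ : Fin d) : T.tr (p T μ * (B.κ * v μ)) =
      ∑ ρ, T.tr (T.D ρ * T.G * (T.D μ * B.a ρ) * (T.G * v μ)) := by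
    simp only [κ_eq, Finset.sum_mul, Finset.mul_sum, map_sum]
    refine Finset.sum_congr rfl fun ρ _ => congrArg _ ?_
    rw [← mul_assoc (T.D ρ * T.G), T.DGD ρ μ]
    simp only [p, mul_assoc]
  have h2 (μ : Fin d) : T.tr (B.K * (p T μ * v μ)) =
      ∑ ρ, T.tr (T.D ρ * T.G * (B.a ρ * T.D μ) * (T.G * v μ)) := by
    simp only [K, p, Finset.sum_mul, map_sum, mul_assoc]
  have h3 (μ : Fin d) : ∑ ρ, T.tr (T.D ρ * T.G * (T.D ρ * B.a μ) * (T.G * v μ)) =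
      - T.tr (B.a μ * (T.G * v μ)) := by
    rw [← sum_tr_p]
    simp only [p, mul_assoc]
  have h4 (ρ μ : Fin d) : T.tr (p T ρ * (B.a μ * (p T ρ * v μ))) =
      T.tr (T.D ρ * T.G * (B.a μ * T.D ρ) * (T.G * v μ)) := by
    simp only [p, mul_assoc]
  simp only [mul_sub, mul_add, sub_mul, add_mul, map_sub, map_add, Finset.sum_sub_distrib,
    Finset.sum_add_distrib, scalarTrace, h1, h2, h4]
  rw [Finset.sum_comm (f := fun ρ μ => T.tr (T.D ρ * T.G * (T.D ρ * B.a μ) * (T.G * v μ)))]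
  simp only [h3, Finset.sum_neg_distrib]
  rw [Finset.sum_comm (f := fun ρ μ => T.tr (T.D ρ * T.G * (B.a ρ * T.D μ) * (T.G * v μ))),
    Finset.sum_comm (f := fun ρ μ => T.tr (T.D ρ * T.G * (T.D μ * B.a ρ) * (T.G * v μ)))]
  abel

/-- The second commutator with the derivative can be moved inside a bubble. -/
lemma bubble_parts (b c : 𝒜) :
    T.tr (b * T.G * (∑ ρ, (T.D ρ * T.D ρ * c - (2 : ℂ) • (T.D ρ * c * T.D ρ) +
      c * (T.D ρ * T.D ρ))) * T.G) =
    T.tr (c * T.G * (∑ ρ, (T.D ρ * T.D ρ * b - (2 : ℂ) • (T.D ρ * b * T.D ρ) +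
      b * (T.D ρ * T.D ρ))) * T.G) := by
  simp only [Finset.mul_sum, Finset.sum_mul, map_sum]
  refine Finset.sum_congr rfl fun ρ _ => ?_
  have hg : T.D ρ * T.D ρ * T.G = T.G * (T.D ρ * T.D ρ) := by
    rw [mul_assoc, T.DG_comm, T.DG_comm_assoc]
  simp only [mul_add, mul_sub, add_mul, sub_mul, map_add, map_sub, mul_smul_comm, smul_mul_assoc,
    map_smul]
  have e1 : T.tr (b * T.G * (T.D ρ * T.D ρ * c) * T.G) = T.tr (c * T.G * (b * (T.D ρ * T.D ρ)) * T.G) :=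
    T.tr_cyc (x := b * T.G * (T.D ρ * T.D ρ)) (y := c * T.G) (by simp only [mul_assoc])
      (by rw [mul_assoc b, ← hg]; simp only [mul_assoc])
  have e2 : T.tr (b * T.G * (T.D ρ * c * T.D ρ) * T.G) = T.tr (c * T.G * (T.D ρ * b * T.D ρ) * T.G) :=
    T.tr_cyc (x := b * T.G * T.D ρ) (y := c * T.D ρ * T.G) (by simp only [mul_assoc])
      (by simp only [mul_assoc, T.DG_comm])
  have e3 : T.tr (b * T.G * (c * (T.D ρ * T.D ρ)) * T.G) = T.tr (c * T.G * (T.D ρ * T.D ρ * b) * T.G) :=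
    T.tr_cyc (x := b * T.G) (y := c * (T.D ρ * T.D ρ) * T.G) (by simp only [mul_assoc])
      (by simp only [mul_assoc, T.DG_comm, T.DG_comm_assoc])
  rw [e1, e2, e3]
  abel

/-- Transposition turns this into `curl_trace` with the roles of `a` and `a₁` exchanged;
`bubble_parts` then moves the double commutator onto `a₁`, where `box_trace` evaluates it. -/
lemma scalarTrace_a₁ : B.scalarTrace B.a₁ = B.bubble := by
  have h := T.curl_trace B.a₁ B.a B.transp_a₁ B.transp_a B.landau₁
  simp only [bubble_parts (T := T) (B.a₁ _)] at h
  rw [box_trace] at h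
  rw [scalarTrace_eq, Finset.sum_comm' (t' := Finset.univ) (s' := fun _ => Finset.univ) (by simp)]
  rw [Finset.sum_comm]
  have e : B.bubble = -((1 / 2 : ℂ) • -(2 : ℂ) • B.bubble) := by module
  rw [e, ← h]
  refine Finset.sum_congr rfl fun ρ _ => Finset.sum_congr rfl fun μ _ => ?_
  have hf := T.transp_add (T.transp_sub (T.transp_sub (T.transp_mul (T.transp_D μ) (B.transp_a ρ))
    (T.transp_mul (B.transp_a ρ) (T.transp_D μ))) (T.transp_mul (T.transp_D ρ) (B.transp_a μ)))
    (T.transp_mul (B.transp_a μ) (T.transp_D ρ))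
  rw [T.tr_transp (T.transp_mul (T.transp_mul (T.transp_mul (T.transp_D ρ) T.transp_G) hf)
    (T.transp_mul T.transp_G (B.transp_a₁ μ)))]
  refine congrArg _ ?_
  rw [T.DG_comm]
  noncomm_ring

lemma scalarTrace_rest : B.scalarTrace (fun μ => (∑ l, B.a l * (p T μ * B.a l)) - B.a μ * B.K) =
    B.bubble - B.w₂ + B.w₁' + B.w₀ - (2 : ℂ) • B.w₁ + B.w₄ := by
  have h1 : ∑ μ, T.tr (p T μ * (B.κ * (B.a μ * B.K))) = B.w₂ := by
    simp only [w₂, pairing, κ, Finset.sum_mul, Finset.mul_sum, map_sum, mul_assoc]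
  have h2 : ∑ μ, T.tr (p T μ * (B.κ * ∑ l, B.a l * (p T μ * B.a l))) = B.w₁' := by
    rw [← pairing_eight]
    simp only [pairing, κ, Finset.sum_mul, map_sum, mul_assoc, Finset.mul_sum (Finset.univ) _ (p T _)]
  have h3 : ∑ μ, T.tr (B.K * (p T μ * (B.a μ * B.K))) = B.w₀ := by
    rw [w₀, ← map_sum, ← Finset.mul_sum]
    nth_rewrite 4 [K]
    simp only [Finset.sum_mul, mul_assoc]
  have h4 : ∑ μ, T.tr (B.K * (p T μ * ∑ l, B.a l * (p T μ * B.a l))) = B.w₁ := by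
    rw [← pairing_nine]
    simp only [pairing, Finset.mul_sum, map_sum]
    exact Finset.sum_congr rfl fun μ _ => Finset.sum_congr rfl fun l _ =>
      T.tr_cyc (x := B.K * (p T μ * B.a l)) (y := p T μ * B.a l) (by simp only [mul_assoc])
        (by simp only [mul_assoc])
  have h5 : ∑ ρ, ∑ μ, T.tr (p T ρ * (B.a μ * (p T ρ * (B.a μ * B.K)))) = B.w₁ := rfl
  have h6 : ∑ ρ, ∑ μ, T.tr (p T ρ * (B.a μ * (p T ρ * ∑ l, B.a l * (p T μ * B.a l)))) = B.w₄ := by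
    rw [← pairing_seven]
    simp only [pairing, Finset.mul_sum, map_sum]
  -- The two terms with a bare propagator, read backwards by transposition, are the two halves of
  -- the bubble.
  have h7 : ∑ μ, T.tr (B.a μ * (T.G * ∑ l, B.a l * (p T μ * B.a l))) -
      ∑ μ, T.tr (B.a μ * (T.G * (B.a μ * B.K))) = B.bubble := by
    have e1 (ρ l : Fin d) : T.tr (B.a l * T.G * (B.a ρ * B.a l) * (T.D ρ * T.G)) =
        T.tr (B.a ρ * (T.G * (B.a l * (p T ρ * B.a l)))) := by
      change _ = T.tr (B.a ρ * (T.G * (B.a l * (T.D ρ * T.G * B.a l))))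
      rw [T.tr_transp (T.transp_mul (B.transp_a ρ) (T.transp_mul T.transp_G (T.transp_mul
        (B.transp_a l) (T.transp_mul (T.transp_mul (T.transp_D ρ) T.transp_G) (B.transp_a l)))))]
      exact T.tr_cyc (x := B.a l * T.G * B.a ρ) (y := B.a l * (T.D ρ * T.G))
        (by simp only [mul_assoc]) (by rw [T.DG_comm]; noncomm_ring)
    have e2 : ∑ ρ, ∑ l, T.tr (B.a l * T.G * (B.a l * B.a ρ) * (T.D ρ * T.G)) =
        ∑ μ, T.tr (B.a μ * (T.G * (B.a μ * B.K))) := by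
      rw [Finset.sum_comm]
      refine Finset.sum_congr rfl fun l _ => ?_
      simp only [K, Finset.mul_sum, map_sum]
      refine Finset.sum_congr rfl fun ρ _ => ?_
      rw [T.tr_transp (T.transp_mul (T.transp_mul (T.transp_mul (B.transp_a l) T.transp_G)
        (T.transp_mul (B.transp_a l) (B.transp_a ρ))) (T.transp_mul (T.transp_D ρ) T.transp_G))]
      exact T.tr_cyc (x := p T ρ * B.a ρ) (y := B.a l * (T.G * B.a l))
        (by rw [p, T.DG_comm]; noncomm_ring) (by simp only [mul_assoc])
    simp only [bubble, mul_sub, sub_mul, map_sub, Finset.sum_sub_distrib, e1, e2]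
    simp only [Finset.mul_sum, map_sum]
  have h8 : B.bubble - B.w₂ + B.w₁' + B.w₀ - (2 : ℂ) • B.w₁ + B.w₄ =
      B.w₁' - B.w₁ + B.w₄ - (B.w₂ - B.w₀ + B.w₁) + B.bubble := by module
  rw [h8, ← h7, scalarTrace_sub]
  simp only [scalarTrace, h1, h2, h3, h4, h5, h6]
  abel

/-- The bubbles of `scalarTrace_a₁` and `scalarTrace_rest` cancel, and only words cubic in `∂C A`
are left. -/
lemma scalarTrace_vScalar : B.scalarTrace B.vScalar =
    B.w₂ - B.w₁' - B.w₀ + (2 : ℂ) • B.w₁ - B.w₄ := by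
  have h : B.vScalar = fun μ => B.a₁ μ - ((∑ l, B.a l * (p T μ * B.a l)) - B.a μ * B.K) := by
    ext μ
    simp only [vScalar, vFirst, mul_sub, Finset.sum_sub_distrib, ← mul_assoc, sum_mul_delta]
  rw [h, scalarTrace_sub, scalarTrace_a₁, scalarTrace_rest]
  module

/-- The delta in `vFirst` contracts two antisymmetric indices of `x`. The other term is a rotation
of `pairing_x`. -/
lemma trace_x_vFirst : ∑ ρ, ∑ μ, ∑ l, T.tr (p T ρ * (B.x ρ μ l * B.vFirst l μ)) = 0 := by
  have h := B.pairing_x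
  simp only [pairing, Finset.mul_sum, map_sum] at h
  rw [← h, sum₃_perm₁₃ fun ρ l σ => T.tr (p T ρ * (B.a l * (p T σ * B.x ρ l σ)))]
  rw [sum₃_perm₂₃ fun ρ l σ => T.tr (p T σ * (B.a l * (p T ρ * B.x σ l ρ)))]
  refine Finset.sum_congr rfl fun ρ _ => ?_
  have h1 : ∑ μ, ∑ l, T.tr (p T ρ * (B.x ρ μ l * (B.K * delta 𝒜 l μ))) = 0 := by
    simp only [← mul_assoc, ← map_sum, sum_mul_delta, x_diag₂₃, mul_zero, zero_mul,
      Finset.sum_const_zero, map_zero]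
  simp only [vFirst, mul_sub, map_sub, Finset.sum_sub_distrib, h1, sub_zero]
  refine Finset.sum_congr rfl fun μ _ => Finset.sum_congr rfl fun l _ => ?_
  rw [show B.x ρ μ l = B.x μ l ρ by rw [B.x_swap μ ρ l, B.x_swap' μ l ρ, neg_neg]]
  exact T.tr_cyc (x := p T ρ * B.x μ l ρ) (y := p T μ * B.a l) (by simp only [mul_assoc])
    (by simp only [mul_assoc])

/-- By this symmetry the two contributions of `a₁` to `trace_vTwoForm`, which carry opposite
coefficients, cancel. -/
lemma trace_zz (b c : Fin d → 𝒜) :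
    ∑ ρ, ∑ l, T.tr (p T ρ * (b l * zz (T := T) c ρ l)) =
      ∑ ρ, ∑ l, T.tr (p T ρ * (c l * zz (T := T) b ρ l)) := by
  simp only [zz, mul_sub, map_sub, Finset.sum_sub_distrib]
  congr 1
  · exact Finset.sum_congr rfl fun ρ _ => Finset.sum_congr rfl fun l _ =>
      T.tr_cyc (x := p T ρ * b l) (y := p T ρ * c l) (by simp only [mul_assoc])
        (by simp only [mul_assoc])
  · rw [Finset.sum_comm]
    exact Finset.sum_congr rfl fun ρ _ => Finset.sum_congr rfl fun l _ =>
      T.tr_cyc (x := p T l * b ρ) (y := p T ρ * c l) (by simp only [mul_assoc])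
        (by simp only [mul_assoc])

lemma pairing_uu : B.pairing (fun ρ l => p T ρ * B.uu l) = B.w₄ - B.w₁' := by
  simp only [uu, mul_sub, pairing_sub, Finset.mul_sum]
  rw [pairing_seven, w₁']

lemma pairing_uu' : B.pairing (fun ρ l => p T l * B.uu ρ) = B.w₁' - B.w₀ := by
  simp only [uu, mul_sub, pairing_sub, Finset.mul_sum]
  rw [pairing_eight, pairing_κ]

/-- Only words remain: `x` enters through `pairing_x` and `trace_x_vFirst`, `a₁` cancels by
`trace_zz`, and `c` is contracted to its vanishing diagonal. The three lines of the result come from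
the curl of `comm'`, the curl of `contr` and the four-form. -/
lemma trace_vTwoForm : ∑ ρ, ∑ μ, T.tr (p T ρ * B.vTwoForm ρ μ μ) =
    (1 / 6 : ℂ) • (B.w₁' - B.w₀ + (d - 3 : ℂ) • (B.w₁ - B.w₂) + (B.w₁' - B.w₄))
    + (1 / 3 : ℂ) • ((3 - d : ℂ) • (B.w₄ - B.w₁' - (B.w₁' - B.w₀)) + (B.w₁ - B.w₂))
    + ((3 - d : ℂ) / 3) • (B.w₄ - B.w₁' - (B.w₃ - B.w₄) - (B.w₁ - B.w₂)) := by
  have hc (ρ : Fin d) : ∑ μ, ∑ l, T.tr (p T ρ * (B.c ρ μ l * delta 𝒜 l μ)) = 0 := by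
    simp only [← mul_assoc, ← map_sum, sum_mul_delta, B.c_diag, mul_zero, Finset.sum_const_zero,
      map_zero]
  have h1 : ∑ ρ, ∑ μ, ∑ l, T.tr (p T ρ * (B.a₁ l * B.vThree ρ μ l μ)) =
      (2 - d : ℂ) • ∑ ρ, ∑ l, T.tr (p T ρ * (B.a₁ l * zz (T := T) B.a ρ l)) := by
    simp only [Finset.smul_sum, ← map_smul]
    refine Finset.sum_congr rfl fun ρ _ => ?_
    rw [Finset.sum_comm]
    simp only [← map_sum, ← Finset.mul_sum, contract_vThree, mul_smul_comm]
  have hp (W : Fin d → Fin d → Fin d → Fin d → 𝒜) :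
      ∑ ρ, ∑ μ, ∑ l, T.tr (p T ρ * (B.a l * W ρ μ l μ)) =
        B.pairing fun ρ l => ∑ μ, W ρ μ l μ := by
    rw [sum₃_perm₂₃]
    simp only [pairing, Finset.mul_sum, map_sum]
  have h2 : (B.pairing fun ρ l => ∑ μ, vCurl T B.vComm' ρ μ l μ) =
      (2 - d : ℂ) • (∑ ρ, ∑ l, T.tr (p T ρ * (B.a l * zz (T := T) B.a₁ ρ l)))
      + (B.w₁' - B.w₀ + (d - 3 : ℂ) • (B.w₁ - B.w₂) + (B.w₁' - B.w₄)) := by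
    simp only [contract_vComm', pairing_add, pairing_sub, pairing_smul, pairing_κ, pairing_five]
    rw [← w₁', ← w₁, ← w₂, ← w₄]
    simp only [pairing]
    module
  have h3 : (B.pairing fun ρ l => ∑ μ, vCurl T B.vContr ρ μ l μ) =
      (3 - d : ℂ) • (B.w₄ - B.w₁' - (B.w₁' - B.w₀)) + (B.w₁ - B.w₂) := by
    simp only [contract_vContr, pairing_add, pairing_sub, pairing_smul, pairing_x, pairing_uu,
      pairing_uu', pairing_nine, pairing_ten, sub_zero]
  have h4 : (B.pairing fun ρ l => ∑ μ, ∑ σ, p T σ * B.vFour ρ μ l σ μ) =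
      - (3 - d : ℂ) • (B.w₄ - B.w₁' - (B.w₃ - B.w₄) - (B.w₁ - B.w₂)) := by
    have e (ρ l : Fin d) : ∑ μ, ∑ σ, p T σ * B.vFour ρ μ l σ μ = (3 - d : ℂ) •
        ((∑ σ, p T σ * B.x ρ l σ) - ((∑ σ, p T σ * (B.a l * (p T ρ * B.a σ)))
          - (∑ σ, p T σ * (B.a l * (p T σ * B.a ρ)))
          - ((∑ σ, p T σ * (B.a ρ * (p T l * B.a σ))) - ∑ σ, p T σ * (B.a ρ * (p T σ * B.a l)))
          - (B.K * (p T ρ * B.a l) - B.K * (p T l * B.a ρ)))) := by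
      rw [Finset.sum_comm]
      simp only [← Finset.mul_sum, contract_vFour, zz, mul_sub, mul_smul_comm, ← Finset.smul_sum,
        Finset.sum_sub_distrib, K, Finset.sum_mul, mul_assoc]
    simp only [e, pairing_smul, pairing_sub, pairing_x, pairing_eleven, pairing_five, pairing_nine,
      pairing_ten]
    rw [← w₃, ← w₄]
    module
  simp only [vTwoForm, Finset.mul_sum (Finset.univ) _ (p T _), map_sum, mul_add, mul_sub, map_add,
    map_sub, mul_smul_comm, map_smul, Finset.sum_add_distrib, Finset.sum_sub_distrib,
    ← Finset.smul_sum, hc, Finset.sum_const_zero, trace_x_vFirst, h1]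
  rw [hp (vCurl T B.vComm'), hp (vCurl T B.vContr)]
  have h5 : ∑ ρ, ∑ μ, ∑ l, T.tr (p T ρ * (B.a l * ∑ σ, p T σ * B.vFour ρ μ l σ μ)) = _ :=
    (hp fun ρ μ l ν => ∑ σ, p T σ * B.vFour ρ μ l σ ν).trans h4
  rw [h2, h3, trace_zz B.a₁ B.a]
  rw [h5]
  module

/-- The gamma matrix trace of the cube of the fermionic operator, in terms of words. -/
def spinorCube : V :=
  (2 : ℂ) • B.w₀ + (3 : ℂ) • (B.w₂ + B.w₄ - B.w₁ - B.w₁') - B.w₃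

/-- `∑ ∂_ρ C (A_σ ∂_ρ C A_σ - A_σ ∂_σ C A_ρ)`. -/
def sumUU : 𝒜 := ∑ ρ, p T ρ * B.uu ρ

lemma vSecond_eq (ρ l : Fin d) : B.vSecond ρ l = (1 / 2 : ℂ) • ((∑ σ, p T σ * B.x ρ l σ)
    - (∑ σ, p T σ * (B.a l * (p T σ * B.a ρ))) + (∑ σ, p T σ * (B.a l * (p T ρ * B.a σ)))
    + B.sumUU * delta 𝒜 ρ l - p T l * B.uu ρ) := by
  have hx (σ : Fin d) : B.x σ ρ l = B.x ρ l σ := by rw [B.x_swap ρ σ, B.x_swap' ρ l, neg_neg]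
  simp only [vSecond, vContr, sum_a_vThree, hx, mul_sub, Finset.sum_sub_distrib, sumUU,
    Finset.sum_mul, ← mul_assoc, sum_mul_delta]
  congr 1
  abel

lemma sum_vSecond : ∑ ρ, B.vSecond ρ ρ = ((d - 2 : ℂ) / 2) • B.sumUU := by
  have h1 : ∑ ρ, ∑ σ, p T σ * (B.a ρ * (p T σ * B.a ρ)) =
      B.sumUU + ∑ ρ, ∑ σ, p T σ * (B.a ρ * (p T ρ * B.a σ)) := by
    rw [Finset.sum_comm (f := fun ρ σ => p T σ * (B.a ρ * (p T σ * B.a ρ))),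
      Finset.sum_comm (f := fun ρ σ => p T σ * (B.a ρ * (p T ρ * B.a σ)))]
    simp only [sumUU, uu, κ, mul_sub, Finset.sum_sub_distrib, Finset.mul_sum, Finset.sum_mul,
      mul_assoc, sub_add_cancel]
  simp only [vSecond_eq, ← Finset.smul_sum, Finset.sum_sub_distrib, Finset.sum_add_distrib,
    x_diag₁₂, delta_self, mul_one, h1, Finset.sum_const, Finset.card_univ, Fintype.card_fin]
  rw [← sumUU, ← Nat.cast_smul_eq_nsmul ℂ]
  simp only [mul_zero, Finset.sum_const_zero]
  module

lemma trace_K_sumUU : T.tr (B.K * B.sumUU) = B.w₁ - B.w₂ := by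
  have h1 : ∑ ρ, ∑ σ, T.tr (B.K * (p T ρ * (B.a σ * (p T ρ * B.a σ)))) = B.w₁ := by
    rw [← pairing_nine]
    exact Finset.sum_congr rfl fun μ _ => Finset.sum_congr rfl fun l _ =>
      T.tr_cyc (x := B.K * (p T μ * B.a l)) (y := p T μ * B.a l) (by simp only [mul_assoc])
        (by simp only [mul_assoc])
  have h2 : ∑ ρ, ∑ σ, T.tr (B.K * (p T ρ * (B.a σ * (p T σ * B.a ρ)))) = B.w₂ :=
    Finset.sum_congr rfl fun μ _ => Finset.sum_congr rfl fun l _ =>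
      T.tr_cyc (x := B.K) (y := p T μ * (B.a l * (p T l * B.a μ))) rfl
        (by simp only [mul_assoc])
  rw [← h1, ← h2]
  simp only [sumUU, uu, κ, mul_sub, Finset.sum_sub_distrib, Finset.mul_sum, Finset.sum_mul,
      mul_assoc, map_sub, map_sum]

lemma trace_vFirst_vSecond : ∑ μ, ∑ ν, T.tr (B.vFirst μ ν * B.vSecond ν μ) =
    (1 / 2 : ℂ) • (B.w₄ - B.w₁' + (B.w₁ - B.w₂) - (B.w₁' - B.w₀) + (2 - d : ℂ) • (B.w₁ - B.w₂)) := by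
  have h1 : ∑ μ, ∑ ν, T.tr (p T ν * (B.a μ * B.vSecond ν μ)) =
      (1 / 2 : ℂ) • (B.w₄ - B.w₁' + (B.w₁ - B.w₂) - (B.w₁' - B.w₀)) := by
    rw [Finset.sum_comm]
    change B.pairing B.vSecond = _
    rw [funext₂ B.vSecond_eq, pairing_smul, pairing_sub, pairing_add, pairing_add, pairing_sub,
      pairing_x, pairing_five, pairing_eleven, pairing_uu']
    have : B.pairing (fun ρ l => B.sumUU * delta 𝒜 ρ l) = T.tr (B.K * B.sumUU) := by
      simp only [pairing, ← map_sum, ← mul_assoc, sum_mul_delta', K, Finset.sum_mul]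
    rw [this, trace_K_sumUU]
    module
  have h2 (μ : Fin d) : ∑ ν, T.tr (B.vFirst μ ν * B.vSecond ν μ) =
      ∑ ν, T.tr (p T ν * (B.a μ * B.vSecond ν μ)) - T.tr (B.K * B.vSecond μ μ) := by
    simp only [vFirst, sub_mul, map_sub, Finset.sum_sub_distrib, mul_assoc]
    congr 1
    rw [← map_sum]
    simp [delta]
  simp only [h2, Finset.sum_sub_distrib, h1]
  rw [← map_sum, ← Finset.mul_sum, sum_vSecond, mul_smul_comm, map_smul, trace_K_sumUU]
  module

/-- In the square of `p_ν a_μ - K δ_{μν}` the two mixed terms each give `-K²`, and the product of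
the deltas gives `d K²`. -/
lemma trace_vFirst_sq (y : 𝒜) : ∑ μ, ∑ ν, T.tr (B.vFirst μ ν * (B.vFirst ν μ * y)) =
    (∑ μ, ∑ ν, T.tr (p T ν * (B.a μ * (p T μ * (B.a ν * y)))))
      + (d - 2 : ℂ) • T.tr (B.K * (B.K * y)) := by
  have h1 (μ : Fin d) : ∑ ν, B.vFirst μ ν * (B.vFirst ν μ * y) =
      (∑ ν, p T ν * (B.a μ * (p T μ * (B.a ν * y)))) - p T μ * (B.a μ * (B.K * y))
        - B.K * (p T μ * (B.a μ * y)) + B.K * (B.K * y) := by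
    have e1 : ∑ ν, p T ν * (B.a μ * (B.K * (delta 𝒜 ν μ * y))) = p T μ * (B.a μ * (B.K * y)) := by
      simp [delta]
    have e2 : ∑ ν, B.K * (delta 𝒜 μ ν * (p T μ * (B.a ν * y))) = B.K * (p T μ * (B.a μ * y)) := by
      simp [delta]
    have e3 : ∑ ν, B.K * (delta 𝒜 μ ν * (B.K * (delta 𝒜 ν μ * y))) = B.K * (B.K * y) := by
      simp [delta]
    simp only [vFirst, sub_mul, mul_sub, Finset.sum_sub_distrib, mul_assoc, e1, e2, e3]
    abel
  have h2 (y : 𝒜) : ∑ μ, p T μ * (B.a μ * y) = B.K * y := by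
    simp only [K, Finset.sum_mul, mul_assoc]
  simp only [← map_sum, h1]
  simp only [Finset.sum_sub_distrib, Finset.sum_add_distrib, h2, ← Finset.mul_sum, Finset.sum_const,
    Finset.card_univ, Fintype.card_fin]
  rw [← Nat.cast_smul_eq_nsmul ℂ, ← map_smul, ← map_add]
  refine congrArg _ ?_
  simp only [mul_smul_comm]
  module

/-- Sorted by the number of deltas: none gives `w₃`, one gives `-w₂` in three positions, two give
`w₀` in three positions, and three give `-d w₀`. -/
lemma trace_vFirst_cube : ∑ μ, ∑ ν, ∑ ρ, T.tr (B.vFirst μ ν * (B.vFirst ν ρ * B.vFirst ρ μ)) =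
    B.w₃ - (3 : ℂ) • B.w₂ + (3 - d : ℂ) • B.w₀ := by
  have h1 (μ ν : Fin d) : ∑ ρ, T.tr (B.vFirst μ ν * (B.vFirst ν ρ * B.vFirst ρ μ)) =
      (∑ ρ, T.tr (B.vFirst μ ν * (B.vFirst ν ρ * (p T μ * B.a ρ))))
        - T.tr (B.vFirst μ ν * (B.vFirst ν μ * B.K)) := by
    have e : ∑ ρ, B.vFirst μ ν * (B.vFirst ν ρ * (B.K * delta 𝒜 ρ μ)) =
        B.vFirst μ ν * (B.vFirst ν μ * B.K) := by
      simp [delta]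
    rw [← e, map_sum, ← Finset.sum_sub_distrib]
    refine Finset.sum_congr rfl fun ρ _ => ?_
    rw [← map_sub, ← mul_sub, ← mul_sub, vFirst, vFirst, vFirst]
  have h2 : ∑ μ, ∑ ν, T.tr (p T ν * (B.a μ * (p T μ * (B.a ν * B.K)))) = B.w₂ := by
    rw [Finset.sum_comm, w₂, pairing]
  have h3 : ∑ μ, ∑ ν, ∑ ρ, T.tr (B.vFirst μ ν * (B.vFirst ν ρ * (p T μ * B.a ρ))) =
      B.w₃ - (2 : ℂ) • B.w₂ + B.w₀ := by
    have e1 : ∑ μ, ∑ ν, ∑ ρ, T.tr (p T ν * (B.a μ * (p T ρ * (B.a ν * (p T μ * B.a ρ))))) = B.w₃ := by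
      rw [w₃_eq, sum₃_perm₁₂]
      exact sum₃_congr fun ρ l σ => rfl
    have e2 : ∑ μ, ∑ ν, ∑ ρ, T.tr (p T ν * (B.a μ * (B.K * (delta 𝒜 ν ρ * (p T μ * B.a ρ))))) =
        B.w₂ := by
      have (μ ν : Fin d) : ∑ ρ, p T ν * (B.a μ * (B.K * (delta 𝒜 ν ρ * (p T μ * B.a ρ)))) =
          p T ν * (B.a μ * (B.K * (p T μ * B.a ν))) := by simp [delta]
      simp only [← map_sum, this]
      simp only [map_sum]
      rw [← pairing_ten, Finset.sum_comm, pairing]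
    have e3 : ∑ μ, ∑ ν, ∑ ρ, T.tr (B.K * (delta 𝒜 μ ν * (p T ρ * (B.a ν * (p T μ * B.a ρ))))) =
        B.w₂ := by
      have (μ : Fin d) : ∑ ν, ∑ ρ, B.K * (delta 𝒜 μ ν * (p T ρ * (B.a ν * (p T μ * B.a ρ)))) =
          ∑ ρ, B.K * (p T ρ * (B.a μ * (p T μ * B.a ρ))) := by
        rw [Finset.sum_comm]
        exact Finset.sum_congr rfl fun ρ _ => by simp [delta]
      simp only [← map_sum, this]
      simp only [map_sum]
      rw [Finset.sum_comm, w₂, pairing]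
      exact Finset.sum_congr rfl fun μ _ => Finset.sum_congr rfl fun l _ =>
        T.tr_cyc (x := B.K) (y := p T μ * (B.a l * (p T l * B.a μ))) rfl
          (by simp only [mul_assoc])
    have e4 : ∑ μ, ∑ ν, ∑ ρ, T.tr (B.K * (delta 𝒜 μ ν * (B.K * (delta 𝒜 ν ρ * (p T μ * B.a ρ))))) =
        B.w₀ := by
      have (μ : Fin d) : ∑ ν, ∑ ρ, B.K * (delta 𝒜 μ ν * (B.K * (delta 𝒜 ν ρ * (p T μ * B.a ρ)))) =
          B.K * (B.K * (p T μ * B.a μ)) := by simp [delta]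
      simp only [← map_sum, this]
      rw [← Finset.mul_sum, ← Finset.mul_sum, ← K, w₀]
    simp only [vFirst, sub_mul, mul_sub, map_sub, Finset.sum_sub_distrib, mul_assoc, e1, e2, e3, e4]
    module
  simp only [h1, Finset.sum_sub_distrib, h3, trace_vFirst_sq, h2, w₀]
  module

/-- The one-loop identity of third order. -/
theorem cubic_identity : ∑ μ, T.tr (B.vThird μ μ) - ∑ μ, ∑ ν, T.tr (B.vFirst μ ν * B.vSecond ν μ)
      + (1 / 3 : ℂ) • ∑ μ, ∑ ν, ∑ ρ, T.tr (B.vFirst μ ν * (B.vFirst ν ρ * B.vFirst ρ μ)) =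
    - ((d - 2 : ℂ) / 3) • B.spinorCube - (1 / 3 : ℂ) • B.w₀ := by
  -- Each of the traces is a combination of the six words `w₀`, `w₁`, `w₁'`, `w₂`, `w₃`, `w₄` with
  -- coefficients affine in `d`, so the identity is a comparison of coefficients.
  rw [trace_vFirst_vSecond, trace_vFirst_cube]
  simp only [vThird, map_add, Finset.sum_add_distrib, trace_vScalarPart, scalarTrace_vScalar,
    map_sum]
  rw [Finset.sum_comm, trace_vTwoForm, spinorCube]
  module

/-- The gamma matrix trace of the square of the fermionic operator. -/
def spinorSquare : V := (2 : ℂ) • T.tr (B.K * B.K) - ∑ ρ, ∑ l, T.tr (p T ρ * (B.a l * (p T ρ * B.a l)))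

/-- Up to a rotation the double sum is the trace of `κ²`, and the Landau condition lets `κ = L G` be
replaced by `K = G L`. -/
lemma trace_κ_sq : ∑ μ, ∑ ν, T.tr (p T ν * (B.a μ * (p T μ * B.a ν))) = T.tr (B.K * B.K) := by
  have h : ∑ μ, ∑ ν, T.tr (p T ν * (B.a μ * (p T μ * B.a ν))) = T.tr (B.κ * B.κ) := by
    simp only [κ, Finset.sum_mul, Finset.mul_sum, map_sum]
    rw [Finset.sum_comm]
    refine Finset.sum_congr rfl fun μ _ => Finset.sum_congr rfl fun ν _ => ?_
    exact T.tr_cyc (x := p T μ) (y := B.a ν * (p T ν * B.a μ)) rfl (by simp only [mul_assoc])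
  rw [h]
  exact T.tr_cyc (x := (∑ ρ, T.D ρ * B.a ρ) * T.G * (∑ ρ, T.D ρ * B.a ρ)) (y := T.G)
    (by simp only [κ_eq, mul_assoc]) (by simp only [K_eq, mul_assoc])

/-- The one-loop identity of second order. -/
theorem quadratic_identity : ∑ μ, T.tr (B.vSecond μ μ)
      - (1 / 2 : ℂ) • ∑ μ, ∑ ν, T.tr (B.vFirst μ ν * B.vFirst ν μ) =
    - ((d - 2 : ℂ) / 2) • B.spinorSquare - (1 / 2 : ℂ) • T.tr (B.K * B.K) := by
  have h1 := B.trace_vFirst_sq 1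
  simp only [mul_one, trace_κ_sq] at h1
  have h2 : T.tr B.sumUU = (∑ ρ, ∑ l, T.tr (p T ρ * (B.a l * (p T ρ * B.a l)))) - T.tr (B.K * B.K) := by
    rw [← trace_κ_sq, Finset.sum_comm (f := fun μ ν => T.tr (p T ν * (B.a μ * (p T μ * B.a ν))))]
    simp only [sumUU, uu, κ, mul_sub, Finset.sum_sub_distrib, Finset.mul_sum, Finset.sum_mul,
      mul_assoc, map_sub, map_sum]
  rw [h1, ← map_sum, sum_vSecond, map_smul, h2, spinorSquare]
  module

end TraceCalculus.Background

end

end NicolaiMap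

namespace NicolaiMap

noncomputable section

open scoped BigOperators

/-! ### Fourier multipliers -/

section Multiplier

variable {d : ℕ}

lemma coeff_fourierMultiplier (m : Spacetime d → ℂ) (X : PlaneWaves d) (p : Spacetime d) :
    (fourierMultiplier m X).coeff p = m p * X.coeff p := by
  classical
  simp only [fourierMultiplier, Finsupp.sum, AddMonoidAlgebra.coeff_sum,
    AddMonoidAlgebra.coeff_single, Finsupp.finsetSum_apply, Finsupp.single_apply]
  rw [Finset.sum_ite_eq']
  split_ifs with h
  · rfl
  · rw [Finsupp.notMem_support_iff.1 h, mul_zero]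

/-- Fourier multipliers as linear maps. -/
def multiplier (m : Spacetime d → ℂ) : PlaneWaves d →ₗ[ℂ] PlaneWaves d where
  toFun := fourierMultiplier m
  map_add' X Y := by ext p; simp [coeff_fourierMultiplier, mul_add]
  map_smul' c X := by ext p; simp [coeff_fourierMultiplier, mul_left_comm]

lemma coeff_multiplier (m : Spacetime d → ℂ) (X : PlaneWaves d) (p : Spacetime d) :
    (multiplier m X).coeff p = m p * X.coeff p := coeff_fourierMultiplier m X p

lemma multiplier_multiplier (m n : Spacetime d → ℂ) (X : PlaneWaves d) :
    multiplier m (multiplier n X) = multiplier (fun p => m p * n p) X := by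
  ext p
  simp only [coeff_multiplier, mul_assoc]

@[simp] lemma multiplier_single (m : Spacetime d → ℂ) (p : Spacetime d) (c : ℂ) :
    multiplier m (AddMonoidAlgebra.single p c) = AddMonoidAlgebra.single p (m p * c) := by
  ext q
  classical
  simp only [coeff_multiplier, AddMonoidAlgebra.coeff_single, Finsupp.single_apply]
  split_ifs with h
  · rw [h]
  · rw [mul_zero]

/-- The linear operations on plane waves. -/
def planeCalculus (d : ℕ) : LinearCalculus d (PlaneWaves d) where
  D μ := (multiplier fun p => Complex.I * (p μ : ℂ)).restrictScalars ℝ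
  G := (multiplier fun p => ((‖p‖ ^ 2 : ℝ) : ℂ)⁻¹).restrictScalars ℝ
  dG μ := (multiplier fun p => Complex.I * (p μ : ℂ) * ((‖p‖ ^ 2 : ℝ) : ℂ)⁻¹).restrictScalars ℝ

lemma planeCalculus_toCalculus : (planeCalculus d).toCalculus = planeWaves d := rfl

/-- The extension of a linear operation to dual numbers. -/
def dualMap {R : Type*} [CommRing R] [Algebra ℝ R] (T : R →ₗ[ℝ] R) :
    DualNumber R →ₗ[ℝ] DualNumber R where
  toFun X := TrivSqZeroExt.inl (T X.fst) + TrivSqZeroExt.inr (T X.snd)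
  map_add' X Y := by ext <;> simp
  map_smul' c X := by ext <;> simp

/-- The operations on dual numbers. -/
def LinearCalculus.dual {R : Type*} [CommRing R] [Algebra ℝ R] (L : LinearCalculus d R) :
    LinearCalculus d (DualNumber R) where
  D μ := dualMap (L.D μ)
  G := dualMap L.G
  dG μ := dualMap (L.dG μ)

lemma planeCalculus_dual_toCalculus : (planeCalculus d).dual.toCalculus = (planeWaves d).dual := rfl

end Multiplier

/-! ### Loop integrands -/

section LoopIntegrands

variable {d : ℕ}

lemma loopIntegrands_basic (P : MvPolynomial (Fin d) ℂ) (s : Multiset (Spacetime d)) :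
    (fun k => MvPolynomial.eval (fun j => (k j : ℂ)) P *
      ((s.map fun q => ((‖k + q‖ ^ 2 : ℝ) : ℂ)).prod)⁻¹) ∈ loopIntegrands d :=
  Submodule.subset_span ⟨P, s, rfl⟩

lemma loopIntegrands_induction {C : (Spacetime d → ℂ) → Prop}
    (hb : ∀ (P : MvPolynomial (Fin d) ℂ) (s : Multiset (Spacetime d)),
      C fun k => MvPolynomial.eval (fun j => (k j : ℂ)) P *
        ((s.map fun q => ((‖k + q‖ ^ 2 : ℝ) : ℂ)).prod)⁻¹)
    (h0 : C 0) (ha : ∀ F H, C F → C H → C (F + H)) (hs : ∀ (c : ℂ) F, C F → C (c • F))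
    {F : Spacetime d → ℂ} (hF : F ∈ loopIntegrands d) : C F := by
  induction hF using Submodule.span_induction with
  | mem x h => obtain ⟨P, s, rfl⟩ := h; exact hb P s
  | zero => exact h0
  | add x y _ _ hx hy => exact ha x y hx hy
  | smul c x _ hx => exact hs c x hx

lemma loopIntegrands_mul {F H : Spacetime d → ℂ} (hF : F ∈ loopIntegrands d)
    (hH : H ∈ loopIntegrands d) : F * H ∈ loopIntegrands d := by
  refine loopIntegrands_induction (C := fun F => F * H ∈ loopIntegrands d) (fun P s => ?_)
    (by simp) (fun F F' h h' => by rw [add_mul]; exact Submodule.add_mem _ h h')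
    (fun c F h => by rw [smul_mul_assoc]; exact Submodule.smul_mem _ c h) hF
  refine loopIntegrands_induction (C := fun H => _ * H ∈ loopIntegrands d) (fun Q t => ?_)
    (by simp) (fun F F' h h' => by rw [mul_add]; exact Submodule.add_mem _ h h')
    (fun c F h => by rw [mul_smul_comm]; exact Submodule.smul_mem _ c h) hH
  convert loopIntegrands_basic (P * Q) (s + t) using 1
  ext k
  simp only [Pi.mul_apply, map_mul, Multiset.map_add, Multiset.prod_add, mul_inv]
  ring

lemma loopIntegrands_one : (fun _ => 1 : Spacetime d → ℂ) ∈ loopIntegrands d := by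
  simpa using loopIntegrands_basic (d := d) 1 0

lemma loopIntegrands_coord (μ : Fin d) :
    (fun k => Complex.I * (k μ : ℂ) : Spacetime d → ℂ) ∈ loopIntegrands d := by
  convert loopIntegrands_basic (d := d) (MvPolynomial.C Complex.I * MvPolynomial.X μ) 0 using 1
  ext k
  rw [map_mul, MvPolynomial.eval_C, MvPolynomial.eval_X, Multiset.map_zero, Multiset.prod_zero,
    inv_one, mul_one]

lemma loopIntegrands_propagator :
    (fun k => ((‖k‖ ^ 2 : ℝ) : ℂ)⁻¹ : Spacetime d → ℂ) ∈ loopIntegrands d := by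
  simpa using loopIntegrands_basic (d := d) 1 {0}

lemma loopIntegrands_shift {F : Spacetime d → ℂ} (hF : F ∈ loopIntegrands d) (q : Spacetime d) :
    (fun k => F (k + q)) ∈ loopIntegrands d := by
  refine loopIntegrands_induction (C := fun F => (fun k => F (k + q)) ∈ loopIntegrands d)
    (fun P s => ?_) (Submodule.zero_mem _) (fun F F' h h' => Submodule.add_mem _ h h')
    (fun c F h => Submodule.smul_mem _ c h) hF
  convert loopIntegrands_basic
    (MvPolynomial.bind₁ (fun j => MvPolynomial.X j + MvPolynomial.C (q j : ℂ)) P)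
    (s.map fun r => q + r) using 1
  ext k
  rw [MvPolynomial.eval, MvPolynomial.eval₂Hom_bind₁]
  simp only [map_add, MvPolynomial.eval₂Hom_X', MvPolynomial.eval₂Hom_C, Multiset.map_map,
    Function.comp_apply, add_assoc, RingHom.id_apply, MvPolynomial.eval, PiLp.add_apply,
    Complex.ofReal_add]

/-- The integrands that represent a vanishing formal integral. -/
def vanishingIntegrands (d : ℕ) : Submodule ℂ (Spacetime d → ℂ) where
  carrier := {F | LoopEq F 0}
  add_mem' := by
    rintro F F' ⟨H, hH, h⟩ ⟨H', hH', h'⟩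
    refine ⟨H + H', Submodule.add_mem _ hH hH', ?_⟩
    rw [sub_zero] at *
    exact h.add h'
  zero_mem' := ⟨0, Submodule.zero_mem _, by rw [sub_zero]⟩
  smul_mem' := by
    rintro c F ⟨H, hH, h⟩
    refine ⟨c • H, Submodule.smul_mem _ c hH, ?_⟩
    rw [sub_zero] at *
    exact h.const_smul c

/-- Formal loop integrals. -/
abbrev LoopIntegral (d : ℕ) := (Spacetime d → ℂ) ⧸ vanishingIntegrands d

/-- The formal loop integral of an integrand. -/
def loopIntegral (d : ℕ) : (Spacetime d → ℂ) →ₗ[ℂ] LoopIntegral d :=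
  (vanishingIntegrands d).mkQ

lemma loopEq_iff (F H : Spacetime d → ℂ) : LoopEq F H ↔ loopIntegral d F = loopIntegral d H := by
  rw [loopIntegral, Submodule.mkQ_apply, Submodule.mkQ_apply, Submodule.Quotient.eq]
  simp only [vanishingIntegrands, Submodule.mem_mk, AddSubmonoid.mem_mk,
    AddSubsemigroup.mem_mk, Set.mem_ofPred_eq, LoopEq, sub_zero]

lemma loopIntegral_shift {F : Spacetime d → ℂ} (hF : F ∈ loopIntegrands d) (q : Spacetime d) :
    loopIntegral d (fun k => F (k + q)) = loopIntegral d F :=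
  (loopEq_iff _ _).1 ⟨_, Submodule.subset_span (.inl ⟨F, hF, q, rfl⟩), .rfl⟩

lemma loopIntegral_neg {F : Spacetime d → ℂ} (hF : F ∈ loopIntegrands d) :
    loopIntegral d (fun k => F (-k)) = loopIntegral d F :=
  (loopEq_iff _ _).1 ⟨_, Submodule.subset_span (.inr ⟨F, hF, rfl⟩), .rfl⟩

lemma loopIntegral_congr_ae {F H : Spacetime d → ℂ} (h : F =ᵐ[MeasureTheory.volume] H) :
    loopIntegral d F = loopIntegral d H :=
  (loopEq_iff _ _).1 ⟨0, Submodule.zero_mem _, by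
    filter_upwards [h] with k hk; simp [hk]⟩

end LoopIntegrands

/-! ### Operators on multiplets of plane waves -/

section Operators

variable {ι : Type*} [Fintype ι] [DecidableEq ι] {d : ℕ}

/-- Multiplication by `F` in momentum space and shift of the momentum by `s`, from colour `b` to
colour `a`. -/
def elementary (s : Spacetime d) (F : Spacetime d → ℂ) (a b : ι) :
    Module.End ℂ (ι → PlaneWaves d) :=
  LinearMap.single ℂ (fun _ => PlaneWaves d) a ∘ₗ
    LinearMap.mulLeft ℂ (AddMonoidAlgebra.single s 1) ∘ₗ multiplier F ∘ₗ LinearMap.proj b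

lemma elementary_single (s : Spacetime d) (F : Spacetime d → ℂ) (a b c : ι) (k : Spacetime d)
    (z : ℂ) : elementary s F a b (Pi.single c (AddMonoidAlgebra.single k z)) =
      if b = c then Pi.single a (AddMonoidAlgebra.single (s + k) (F k * z)) else 0 := by
  simp only [elementary, LinearMap.comp_apply, LinearMap.proj_apply, LinearMap.single_apply]
  split_ifs with h
  · subst h
    simp
  · rw [Pi.single_eq_of_ne h]
    simp

lemma multiplet_ext {M M' : Module.End ℂ (ι → PlaneWaves d)}
    (h : ∀ c k, M (Pi.single c (AddMonoidAlgebra.single k 1)) =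
      M' (Pi.single c (AddMonoidAlgebra.single k 1))) : M = M' := by
  refine LinearMap.pi_ext fun c X => ?_
  induction X using AddMonoidAlgebra.induction_linear with
  | zero => simp
  | add X Y hX hY => rw [Pi.single_add, map_add, map_add, hX, hY]
  | single k z =>
    have : (Pi.single c (AddMonoidAlgebra.single k z) : ι → PlaneWaves d) =
        z • Pi.single c (AddMonoidAlgebra.single k 1) := by
      rw [← Pi.single_smul, AddMonoidAlgebra.smul_single, smul_eq_mul, mul_one]
    rw [this, map_smul, map_smul, h]

lemma elementary_mul (s s' : Spacetime d) (F F' : Spacetime d → ℂ) (a b b' c : ι) :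
    elementary s F a b * elementary s' F' b' c =
      if b = b' then elementary (s + s') (fun k => F (k + s') * F' k) a c else 0 := by
  refine multiplet_ext fun e k => ?_
  rw [Module.End.mul_apply, elementary_single]
  split_ifs with h1 h2 h2
  · rw [elementary_single, elementary_single, if_pos h2, if_pos h1, add_assoc, add_comm k s', mul_assoc]
  · rw [elementary_single, if_neg h2]; rfl
  · rw [elementary_single, if_neg h1, map_zero]
  · rw [map_zero]; rfl

/-- The operators that occur in one-loop integrals. -/
def loopOperators (ι : Type*) [Fintype ι] [DecidableEq ι] (d : ℕ) :
    Submodule ℂ (Module.End ℂ (ι → PlaneWaves d)) :=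
  Submodule.span ℂ {M | ∃ s, ∃ F ∈ loopIntegrands d, ∃ a b : ι, M = elementary s F a b}

lemma elementary_mem (s : Spacetime d) {F : Spacetime d → ℂ} (hF : F ∈ loopIntegrands d) (a b : ι) :
    elementary s F a b ∈ loopOperators ι d :=
  Submodule.subset_span ⟨s, F, hF, a, b, rfl⟩

lemma loopOperators_induction₂ {C : Module.End ℂ (ι → PlaneWaves d) →
      Module.End ℂ (ι → PlaneWaves d) → Prop}
    (hb : ∀ s, ∀ F ∈ loopIntegrands d, ∀ a b, ∀ s', ∀ F' ∈ loopIntegrands d, ∀ a' b',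
      C (elementary s F a b) (elementary s' F' a' b'))
    (h0 : ∀ M, C 0 M) (h0' : ∀ M, C M 0)
    (ha : ∀ M M' L, C M L → C M' L → C (M + M') L)
    (ha' : ∀ M L L', C M L → C M L' → C M (L + L'))
    (hs : ∀ (c : ℂ) M L, C M L → C (c • M) L) (hs' : ∀ (c : ℂ) M L, C M L → C M (c • L))
    {M L : Module.End ℂ (ι → PlaneWaves d)} (hM : M ∈ loopOperators ι d)
    (hL : L ∈ loopOperators ι d) : C M L := by
  induction hM using Submodule.span_induction with
  | mem x h =>
    obtain ⟨s, F, hF, a, b, rfl⟩ := h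
    induction hL using Submodule.span_induction with
    | mem x h => obtain ⟨s', F', hF', a', b', rfl⟩ := h; exact hb s F hF a b s' F' hF' a' b'
    | zero => exact h0' _
    | add x y _ _ hx hy => exact ha' _ _ _ hx hy
    | smul c x _ hx => exact hs' c _ _ hx
  | zero => exact h0 _
  | add x y _ _ hx hy => exact ha _ _ _ hx hy
  | smul c x _ hx => exact hs c _ _ hx

/-- A multiplier acting on every component. -/
def multiplierOp (ι : Type*) (m : Spacetime d → ℂ) : Module.End ℂ (ι → PlaneWaves d) :=
  (multiplier m).compLeft ι

@[simp] lemma multiplierOp_apply (m : Spacetime d → ℂ) (X : ι → PlaneWaves d) (a : ι) :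
    multiplierOp ι m X a = multiplier m (X a) := rfl

lemma multiplierOp_mul (m n : Spacetime d → ℂ) :
    multiplierOp ι m * multiplierOp ι n = multiplierOp ι (fun p => m p * n p) := by
  refine LinearMap.ext fun X => funext fun a => ?_
  simp only [Module.End.mul_apply, multiplierOp_apply, multiplier_multiplier]

lemma multiplierOp_single (m : Spacetime d → ℂ) (c : ι) (k : Spacetime d) (z : ℂ) :
    multiplierOp ι m (Pi.single c (AddMonoidAlgebra.single k z)) =
      Pi.single c (AddMonoidAlgebra.single k (m k * z)) := by
  ext a : 1
  rw [multiplierOp_apply]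
  by_cases h : a = c
  · subst h; simp
  · simp [Pi.single_eq_of_ne h]

lemma multiplierOp_mem {m : Spacetime d → ℂ} (hm : m ∈ loopIntegrands d) :
    multiplierOp ι m ∈ loopOperators ι d := by
  have : multiplierOp ι m = ∑ a : ι, elementary 0 m a a := by
    refine multiplet_ext fun c k => ?_
    simp only [LinearMap.sum_apply, multiplierOp_single, elementary_single, zero_add,
      Finset.sum_ite_eq', Finset.mem_univ, if_true]
  rw [this]
  exact Submodule.sum_mem _ fun a _ => elementary_mem 0 hm a a

/-- The algebra of operators that occur in one-loop integrals. -/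
def loopAlgebra (ι : Type*) [Fintype ι] [DecidableEq ι] (d : ℕ) :
    Subalgebra ℂ (Module.End ℂ (ι → PlaneWaves d)) :=
  (loopOperators ι d).toSubalgebra
    (by
      convert multiplierOp_mem (ι := ι) (d := d) loopIntegrands_one using 1
      refine multiplet_ext fun c k => ?_
      rw [multiplierOp_single, one_mul]; rfl)
    (fun M L hM hL => loopOperators_induction₂ (C := fun M L => M * L ∈ loopOperators ι d)
      (fun s F hF a b s' F' hF' a' b' => by
        rw [elementary_mul]
        split_ifs
        · exact elementary_mem _ (loopIntegrands_mul (loopIntegrands_shift hF s') hF') _ _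
        · exact Submodule.zero_mem _)
      (fun M => by rw [zero_mul]; exact Submodule.zero_mem _)
      (fun M => by rw [mul_zero]; exact Submodule.zero_mem _)
      (fun M M' L h h' => by rw [add_mul]; exact Submodule.add_mem _ h h')
      (fun M M' L h h' => by rw [mul_add]; exact Submodule.add_mem _ h h')
      (fun c M L h => by rw [smul_mul_assoc]; exact Submodule.smul_mem _ _ h)
      (fun c M L h => by rw [mul_smul_comm]; exact Submodule.smul_mem _ _ h) hM hL)

/-- The sum of the diagonal matrix elements on plane waves. -/
def diagonal : Module.End ℂ (ι → PlaneWaves d) →ₗ[ℂ] (Spacetime d → ℂ) where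
  toFun M k := ∑ a, (M (Pi.single a (AddMonoidAlgebra.single k 1)) a).coeff k
  map_add' M L := by ext k; simp [Finset.sum_add_distrib]
  map_smul' c M := by ext k; simp [Finset.mul_sum]

lemma diagonal_apply (M : Module.End ℂ (ι → PlaneWaves d)) (k : Spacetime d) :
    diagonal M k = ∑ a, (M (Pi.single a (AddMonoidAlgebra.single k 1)) a).coeff k := rfl

lemma diagonal_elementary (s : Spacetime d) (F : Spacetime d → ℂ) (a b : ι) :
    diagonal (elementary s F a b) = if a = b ∧ s = 0 then F else 0 := by
  ext k
  simp only [diagonal_apply, elementary_single]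
  rw [Finset.sum_eq_single b]
  · rw [if_pos rfl]
    split_ifs with h
    · obtain ⟨rfl, rfl⟩ := h
      simp
    · by_cases hab : a = b
      · subst hab
        rw [Pi.single_eq_same, AddMonoidAlgebra.coeff_single, Finsupp.single_apply, if_neg]
        · rfl
        · rw [add_eq_right]
          exact fun h' => h ⟨rfl, h'⟩
      · rw [Pi.single_eq_of_ne (Ne.symm hab)]; rfl
  · intro c _ hc
    rw [if_neg (Ne.symm hc)]; rfl
  · simp

/-- Shifts and reflections are divided out only for members of `loopIntegrands`, so diagonals have
to be known to stay there. -/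
lemma diagonal_mem {M : Module.End ℂ (ι → PlaneWaves d)} (hM : M ∈ loopOperators ι d) :
    diagonal M ∈ loopIntegrands d := by
  induction hM using Submodule.span_induction with
  | mem x h =>
    obtain ⟨s, F, hF, a, b, rfl⟩ := h
    rw [diagonal_elementary]
    split_ifs
    · exact hF
    · exact Submodule.zero_mem _
  | zero => rw [map_zero]; exact Submodule.zero_mem _
  | add x y _ _ hx hy => rw [map_add]; exact Submodule.add_mem _ hx hy
  | smul c x _ hx => rw [map_smul]; exact Submodule.smul_mem _ _ hx

/-- For elementary operators whose momentum transfers add up to zero, exchanging the factors shifts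
the loop momentum by the transfer of one of them. Cyclicity is therefore shift invariance of the
formal integral. -/
lemma loopIntegral_diagonal_mul_comm {M L : Module.End ℂ (ι → PlaneWaves d)}
    (hM : M ∈ loopOperators ι d) (hL : L ∈ loopOperators ι d) :
    loopIntegral d (diagonal (M * L)) = loopIntegral d (diagonal (L * M)) := by
  refine loopOperators_induction₂ (C := fun M L =>
    loopIntegral d (diagonal (M * L)) = loopIntegral d (diagonal (L * M)))
    (fun s F hF a b s' F' hF' a' b' => ?_) (fun M => by rw [zero_mul, mul_zero])
    (fun M => by rw [zero_mul, mul_zero])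
    (fun M M' L h h' => by rw [add_mul, mul_add, map_add, map_add, map_add, map_add, h, h'])
    (fun M M' L h h' => by rw [add_mul, mul_add, map_add, map_add, map_add, map_add, h, h'])
    (fun c M L h => by rw [smul_mul_assoc, mul_smul_comm, map_smul, map_smul, map_smul, map_smul, h])
    (fun c M L h => by rw [smul_mul_assoc, mul_smul_comm, map_smul, map_smul, map_smul, map_smul, h])
    hM hL
  rw [elementary_mul, elementary_mul]
  by_cases h1 : b = a'
  · by_cases h2 : b' = a
    · rw [if_pos h1, if_pos h2, diagonal_elementary, diagonal_elementary]
      by_cases h3 : s + s' = 0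
      · rw [if_pos ⟨h2.symm, h3⟩, if_pos ⟨h1.symm, by rw [add_comm, h3]⟩]
        refine Eq.trans ?_
          (loopIntegral_shift (loopIntegrands_mul (loopIntegrands_shift hF' s) hF) s')
        congr 1
        ext k
        simp only [Pi.mul_apply]
        rw [add_assoc, add_comm s', h3, add_zero, mul_comm]
      · rw [if_neg fun h => h3 h.2, if_neg fun h => h3 (by rw [add_comm, h.2])]
    · rw [if_pos h1, if_neg h2, diagonal_elementary, if_neg fun h => h2 h.1.symm, map_zero, map_zero, map_zero]
  · rw [if_neg h1, map_zero, map_zero]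
    split_ifs with h2
    · rw [diagonal_elementary, if_neg fun h => h1 h.1.symm, map_zero]
    · rw [map_zero, map_zero]

end Operators

end

end NicolaiMap

namespace NicolaiMap

noncomputable section

open scoped BigOperators

set_option linter.unusedSectionVars false

/-! ### Transposition and the trace of loop operators -/

section Transposition

variable {ι : Type*} [Fintype ι] [DecidableEq ι] {d : ℕ}

/-- The symmetric bilinear form `∫ X_a Y_a` (per unit volume). -/
def planePairing (X Y : ι → PlaneWaves d) : ℂ := (∑ a, X a * Y a).coeff 0

/-- `M'` is the transpose of `M`. -/
def IsTranspose (M M' : Module.End ℂ (ι → PlaneWaves d)) : Prop :=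
  ∀ X Y, planePairing (M X) Y = planePairing X (M' Y)

lemma planePairing_comm (X Y : ι → PlaneWaves d) : planePairing X Y = planePairing Y X := by
  simp only [planePairing, mul_comm]

lemma planePairing_add_left (X X' Y : ι → PlaneWaves d) :
    planePairing (X + X') Y = planePairing X Y + planePairing X' Y := by
  simp [planePairing, add_mul, Finset.sum_add_distrib]

lemma planePairing_add_right (X Y Y' : ι → PlaneWaves d) :
    planePairing X (Y + Y') = planePairing X Y + planePairing X Y' := by
  simp [planePairing, mul_add, Finset.sum_add_distrib]

lemma planePairing_neg_left (X Y : ι → PlaneWaves d) :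
    planePairing (-X) Y = - planePairing X Y := by
  simp [planePairing]

lemma planePairing_neg_right (X Y : ι → PlaneWaves d) :
    planePairing X (-Y) = - planePairing X Y := by
  simp [planePairing]

lemma coeff_mul_single_neg (X : PlaneWaves d) (k : Spacetime d) :
    (X * AddMonoidAlgebra.single (-k) 1).coeff 0 = X.coeff k := by
  classical
  induction X using AddMonoidAlgebra.induction_linear with
  | zero => simp
  | add X Y hX hY => simp [add_mul, hX, hY]
  | single p z =>
    rw [AddMonoidAlgebra.single_mul_single, AddMonoidAlgebra.coeff_single,
      AddMonoidAlgebra.coeff_single, Finsupp.single_apply, Finsupp.single_apply, mul_one]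
    simp only [add_neg_eq_zero]

lemma planePairing_single (X : ι → PlaneWaves d) (a : ι) (k : Spacetime d) :
    planePairing X (Pi.single a (AddMonoidAlgebra.single (-k) 1)) = (X a).coeff k := by
  rw [planePairing, Finset.sum_eq_single a]
  · rw [Pi.single_eq_same, coeff_mul_single_neg]
  · intro b _ hb
    rw [Pi.single_eq_of_ne hb, mul_zero]
  · simp

/-- The pairing couples `e^{ik·x}` to `e^{-ik·x}`, so transposition reflects the loop momentum.
Reflection invariance of the formal integral then makes the trace invariant under transposition. -/
lemma IsTranspose.diagonal {M M' : Module.End ℂ (ι → PlaneWaves d)} (h : IsTranspose M M')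
    (k : Spacetime d) : diagonal M k = diagonal M' (-k) := by
  simp only [diagonal_apply]
  refine Finset.sum_congr rfl fun a _ => ?_
  rw [← planePairing_single, h, planePairing_comm, ← planePairing_single, neg_neg]

lemma multiplier_mul_pairing (m n : Spacetime d → ℂ) (h : ∀ p, m p = n (-p)) (X Y : PlaneWaves d) :
    (multiplier m X * Y).coeff 0 = (X * multiplier n Y).coeff 0 := by
  classical
  induction X using AddMonoidAlgebra.induction_linear with
  | zero => simp
  | add X X' hX hX' => simp [add_mul, hX, hX']
  | single p z =>
    induction Y using AddMonoidAlgebra.induction_linear with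
    | zero => simp
    | add Y Y' hY hY' => simp only [map_add, mul_add, AddMonoidAlgebra.coeff_add,
        Finsupp.add_apply, hY, hY']
    | single q w =>
      simp only [multiplier_single, AddMonoidAlgebra.single_mul_single,
        AddMonoidAlgebra.coeff_single, Finsupp.single_apply]
      split_ifs with hpq
      · rw [h, eq_neg_of_add_eq_zero_left hpq, neg_neg]
        ring
      · rfl

lemma isTranspose_multiplier (m n : Spacetime d → ℂ) (h : ∀ p, m p = n (-p)) :
    IsTranspose (multiplierOp ι m) (multiplierOp ι n) := fun X Y => by
  simp only [planePairing, multiplierOp_apply, AddMonoidAlgebra.coeff_sum,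
    Finsupp.finsetSum_apply, multiplier_mul_pairing m n h]

end Transposition

lemma multiplierOp_comm {ι : Type*} [Fintype ι] [DecidableEq ι] {d : ℕ} (m n : Spacetime d → ℂ) :
    multiplierOp ι m * multiplierOp ι n = multiplierOp ι n * multiplierOp ι m := by
  simp only [multiplierOp_mul, mul_comm]

/-- The ring of loop operators. -/
def LoopAlgebra (ι : Type*) [Fintype ι] [DecidableEq ι] (d : ℕ) : Type _ := loopAlgebra ι d

instance (ι : Type*) [Fintype ι] [DecidableEq ι] (d : ℕ) : Ring (LoopAlgebra ι d) :=
  inferInstanceAs (Ring (loopAlgebra ι d))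

instance (ι : Type*) [Fintype ι] [DecidableEq ι] (d : ℕ) : Algebra ℂ (LoopAlgebra ι d) :=
  inferInstanceAs (Algebra ℂ (loopAlgebra ι d))

/-- Loop operators as operators. -/
def LoopAlgebra.toEnd {ι : Type*} [Fintype ι] [DecidableEq ι] {d : ℕ} :
    LoopAlgebra ι d →ₐ[ℂ] Module.End ℂ (ι → PlaneWaves d) := (loopAlgebra ι d).val

/-- An operator in the span of the elementary ones as a loop operator. -/
def LoopAlgebra.of {ι : Type*} [Fintype ι] [DecidableEq ι] {d : ℕ}
    (M : Module.End ℂ (ι → PlaneWaves d)) (hM : M ∈ loopOperators ι d) : LoopAlgebra ι d := ⟨M, hM⟩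

@[simp] lemma LoopAlgebra.toEnd_of {ι : Type*} [Fintype ι] [DecidableEq ι] {d : ℕ}
    (M : Module.End ℂ (ι → PlaneWaves d)) (hM : M ∈ loopOperators ι d) :
    toEnd (of M hM) = M := rfl

lemma LoopAlgebra.toEnd_mem {ι : Type*} [Fintype ι] [DecidableEq ι] {d : ℕ}
    (x : LoopAlgebra ι d) : toEnd x ∈ loopOperators ι d := x.2

lemma LoopAlgebra.ext_apply {ι : Type*} [Fintype ι] [DecidableEq ι] {d : ℕ}
    {x y : LoopAlgebra ι d} (h : ∀ X, toEnd x X = toEnd y X) : x = y :=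
  Subtype.ext (LinearMap.ext h)

/-- The one-loop calculus of operators on multiplets of plane waves. -/
def planeTrace (ι : Type*) [Fintype ι] [DecidableEq ι] (d : ℕ) [NeZero d] :
    TraceCalculus d (LoopAlgebra ι d) (LoopIntegral d) where
  tr := loopIntegral d ∘ₗ diagonal ∘ₗ LoopAlgebra.toEnd.toLinearMap
  tr_mul_comm x y := by
    simp only [LinearMap.comp_apply, AlgHom.toLinearMap_apply, map_mul]
    exact loopIntegral_diagonal_mul_comm x.toEnd_mem y.toEnd_mem
  Transp x x' := IsTranspose x.toEnd x'.toEnd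
  transp_mul := fun h h' X Y => by
    rw [map_mul, map_mul]
    exact (h _ _).trans (h' _ _)
  transp_add := fun h h' X Y => by
    rw [map_add, map_add, LinearMap.add_apply, LinearMap.add_apply, planePairing_add_left,
      planePairing_add_right]
    exact congrArg₂ _ (h X Y) (h' X Y)
  transp_neg := fun h X Y => by
    rw [map_neg, map_neg, LinearMap.neg_apply, LinearMap.neg_apply, planePairing_neg_left,
      planePairing_neg_right]
    exact congrArg _ (h X Y)
  tr_transp := fun {x x'} h => by
    exact Eq.trans (congrArg (loopIntegral d) (funext h.diagonal))
      (loopIntegral_neg (diagonal_mem x'.toEnd_mem))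
  D μ := .of (multiplierOp ι fun p => Complex.I * (p μ : ℂ))
    (multiplierOp_mem (loopIntegrands_coord μ))
  G := .of (multiplierOp ι fun p => ((‖p‖ ^ 2 : ℝ) : ℂ)⁻¹)
    (multiplierOp_mem loopIntegrands_propagator)
  D_comm μ ν := Subtype.ext (multiplierOp_comm _ _)
  DG_comm μ := Subtype.ext (multiplierOp_comm _ _)
  transp_D μ X Y := by
    rw [map_neg, LinearMap.neg_apply, planePairing_neg_right]
    have := isTranspose_multiplier (ι := ι) (d := d) (fun p => Complex.I * (p μ : ℂ))
      (fun p => - (Complex.I * (p μ : ℂ))) (by simp) X Y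
    rw [LoopAlgebra.toEnd_of, this, ← planePairing_neg_right]
    congr 1
    ext a p
    simp [coeff_multiplier]
  transp_G := isTranspose_multiplier _ _ (by simp)
  -- The symbol of `□ C` is `-1` except at `k = 0`, where the inverse takes the default value `0`. A
  -- single point is a null set because the space is nontrivial, and formal integrals ignore null
  -- sets.
  tr_laplace y := by
    have hd : Nontrivial (Spacetime d) := by
      have : Nonempty (Fin d) := ⟨0⟩
      infer_instance
    rw [← map_neg]
    refine loopIntegral_congr_ae ?_
    have h0 : ∀ᵐ k : Spacetime d, k ≠ 0 := by
      simp [MeasureTheory.ae_iff]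
    filter_upwards [h0] with k hk
    simp only [LinearMap.comp_apply, AlgHom.toLinearMap_apply,
      diagonal_apply, map_mul, map_sum, map_neg, LoopAlgebra.toEnd_of, Module.End.mul_apply,
      LinearMap.sum_apply, Finset.sum_apply, AddMonoidAlgebra.coeff_sum, Finsupp.finsetSum_apply,
      multiplierOp_apply, coeff_multiplier, Pi.neg_apply]
    rw [← Finset.sum_neg_distrib]
    refine Finset.sum_congr rfl fun a _ => ?_
    have h1 : ((‖k‖ ^ 2 : ℝ) : ℂ) = ∑ μ, (k μ : ℂ) ^ 2 := by
      rw [EuclideanSpace.real_norm_sq_eq]; push_cast; rfl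
    have h2 : ((‖k‖ ^ 2 : ℝ) : ℂ) ≠ 0 := by
      simpa using hk
    set Y := (y.toEnd (Pi.single a (AddMonoidAlgebra.single k 1)) a).coeff k
    have h3 (μ : Fin d) : Complex.I * (k μ : ℂ) * (Complex.I * (k μ : ℂ) *
        (((‖k‖ ^ 2 : ℝ) : ℂ)⁻¹ * Y)) = (k μ : ℂ) ^ 2 * (-((‖k‖ ^ 2 : ℝ) : ℂ)⁻¹ * Y) := by
      linear_combination ((k μ : ℂ) ^ 2 * (((‖k‖ ^ 2 : ℝ) : ℂ)⁻¹ * Y)) * Complex.I_sq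
    simp only [h3, ← Finset.sum_mul, ← h1]
    field_simp

/-! ### The adjoint action -/

section Adjoint

variable {ι : Type*} [Fintype ι] [DecidableEq ι] {N : ℝ} {f : ι → ι → ι → ℝ}

/-- This is the Jacobi identity in the form that `X ↦ [X, ·]` is a representation; it makes
commutators of adjoint operators adjoint operators again. -/
lemma bracket_jacobi (hf : IsStructureConstants f N) {R : Type*} [CommRing R] [Algebra ℝ R]
    (X Y Z : ι → R) : bracket f (bracket f X Y) Z =
      bracket f X (bracket f Y Z) - bracket f Y (bracket f X Z) := by
  have key (a c d' e : ι) : ∑ b, f a b c * f b d' e =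
      ∑ b, f a d' b * f b e c - ∑ b, f a e b * f b d' c := by
    have h := hf.jacobi d' e c a
    have cyc (x y z : ι) : f x y z = f y z x := by
      rw [hf.antisymm_left, hf.antisymm_right, neg_neg]
    rw [← Finset.sum_sub_distrib, ← sub_eq_zero, ← Finset.sum_sub_distrib, ← h]
    refine Finset.sum_congr rfl fun b _ => ?_
    rw [cyc a b c, cyc b d' e, cyc b e c, ← cyc b a d', hf.antisymm_right b a d',
      ← cyc b a e, hf.antisymm_right b a e, cyc b d' c, hf.antisymm_left c d' b]
    ring
  ext a
  simp only [Pi.sub_apply, bracket_apply, Finset.sum_mul, Finset.mul_sum, Finset.smul_sum,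
    smul_mul_assoc, mul_smul_comm, smul_smul]
  have e1 : ∑ b, ∑ c, ∑ d', ∑ e, (f a b c * f b d' e) • (X d' * Y e * Z c) =
      ∑ c, ∑ d', ∑ e, (∑ b, f a b c * f b d' e) • (X d' * Y e * Z c) := by
    rw [Finset.sum_comm]
    refine Finset.sum_congr rfl fun c _ => ?_
    rw [Finset.sum_comm]
    refine Finset.sum_congr rfl fun d' _ => ?_
    rw [Finset.sum_comm]
    simp only [Finset.sum_smul]
  have e2 : ∑ d', ∑ b, ∑ e, ∑ c, (f a d' b * f b e c) • (X d' * (Y e * Z c)) =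
      ∑ c, ∑ d', ∑ e, (∑ b, f a d' b * f b e c) • (X d' * Y e * Z c) := by
    rw [Finset.sum_comm (s := Finset.univ (α := ι)) (f := fun c d' => ∑ e, (∑ b, f a d' b * f b e c) • (X d' * Y e * Z c))]
    refine Finset.sum_congr rfl fun d' _ => ?_
    rw [Finset.sum_comm]
    rw [Finset.sum_comm (f := fun c e => (∑ b, f a d' b * f b e c) • (X d' * Y e * Z c))]
    refine Finset.sum_congr rfl fun e _ => ?_
    rw [Finset.sum_comm]
    simp only [Finset.sum_smul, mul_assoc]
  have e3 : ∑ e, ∑ b, ∑ d', ∑ c, (f a e b * f b d' c) • (Y e * (X d' * Z c)) =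
      ∑ c, ∑ d', ∑ e, (∑ b, f a e b * f b d' c) • (X d' * Y e * Z c) := by
    have : ∑ c, ∑ d', ∑ e, (∑ b, f a e b * f b d' c) • (X d' * Y e * Z c) =
        ∑ e, ∑ d', ∑ c, (∑ b, f a e b * f b d' c) • (X d' * Y e * Z c) := by
      rw [Finset.sum_comm]
      rw [Finset.sum_comm (f := fun e d' => ∑ c, (∑ b, f a e b * f b d' c) • (X d' * Y e * Z c))]
      exact Finset.sum_congr rfl fun d' _ => Finset.sum_comm
    rw [this]
    refine Finset.sum_congr rfl fun e _ => ?_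
    rw [Finset.sum_comm]
    refine Finset.sum_congr rfl fun d' _ => ?_
    rw [Finset.sum_comm]
    simp only [Finset.sum_smul, mul_assoc, mul_left_comm (Y e)]
  refine e1.trans ?_
  rw [e2, e3]
  simp only [← Finset.sum_sub_distrib, ← sub_smul, key]

variable {d : ℕ} (f)

/-- The adjoint action `X ↦ [Φ, X]`. -/
def adjointOp : (ι → PlaneWaves d) →ₗ[ℂ] Module.End ℂ (ι → PlaneWaves d) :=
  LinearMap.mk₂ ℂ (fun Φ X => bracket f Φ X)
    (fun X X' Y => by simp) (fun r X Y => by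
      ext a : 1
      simp only [Pi.smul_apply, bracket_apply, Finset.smul_sum, smul_mul_assoc, smul_comm r])
    (fun X Y Y' => by simp) (fun r X Y => by
      ext a : 1
      simp only [Pi.smul_apply, bracket_apply, Finset.smul_sum, mul_smul_comm, smul_comm r])

lemma adjointOp_apply (Φ X : ι → PlaneWaves d) : adjointOp f Φ X = bracket f Φ X := rfl

/-- Each plane wave of `Φ` shifts the momentum and multiplies by a constant symbol, so it is a
combination of elementary operators. -/
lemma adjointOp_mem (Φ : ι → PlaneWaves d) : adjointOp f Φ ∈ loopOperators ι d := by
  have h (b : ι) (X : PlaneWaves d) : adjointOp f (Pi.single b X) ∈ loopOperators ι d := by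
    induction X using AddMonoidAlgebra.induction_linear with
    | zero => rw [Pi.single_zero, map_zero]; exact Submodule.zero_mem _
    | add X Y hX hY => rw [Pi.single_add, map_add]; exact Submodule.add_mem _ hX hY
    | single s z =>
      have : adjointOp f (Pi.single b (AddMonoidAlgebra.single s z)) =
          ∑ a, ∑ c, ((f a b c : ℂ) * z) • elementary s (fun _ => 1) a c := by
        refine multiplet_ext fun c k => ?_
        simp only [adjointOp_apply, LinearMap.sum_apply, LinearMap.smul_apply, elementary_single,
          smul_ite, smul_zero, Finset.sum_ite_eq', Finset.mem_univ, if_true]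
        ext a : 1
        rw [bracket_apply, Finset.sum_apply, Finset.sum_eq_single b, Finset.sum_eq_single c,
          Finset.sum_eq_single a]
        · simp only [Pi.smul_apply, Pi.single_eq_same, AddMonoidAlgebra.single_mul_single,
            AddMonoidAlgebra.smul_single, mul_one]
          simp
        · intro a' _ ha
          rw [Pi.smul_apply, Pi.single_eq_of_ne (Ne.symm ha), smul_zero]
        · simp
        · intro c' _ hc
          rw [Pi.single_eq_of_ne hc, mul_zero, smul_zero]
        · simp
        · intro b' _ hb
          simp [Pi.single_eq_of_ne hb]
        · simp
      rw [this]
      exact Submodule.sum_mem _ fun a _ => Submodule.sum_mem _ fun c _ =>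
        Submodule.smul_mem _ _ (elementary_mem _ loopIntegrands_one _ _)
  rw [← Finset.univ_sum_single Φ, map_sum]
  exact Submodule.sum_mem _ fun b _ => h b _

/-- The adjoint action, as an element of the algebra of loop operators. -/
def ad : (ι → PlaneWaves d) →ₗ[ℂ] LoopAlgebra ι d where
  toFun Φ := .of (adjointOp f Φ) (adjointOp_mem f Φ)
  map_add' _ _ := Subtype.ext (map_add _ _ _)
  map_smul' _ _ := Subtype.ext (map_smul _ _ _)

lemma toEnd_ad (Φ X : ι → PlaneWaves d) : (ad f Φ).toEnd X = bracket f Φ X := rfl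

variable {f}

lemma ad_bracket (hf : IsStructureConstants f N) (Φ Ψ : ι → PlaneWaves d) :
    ad f (bracket f Φ Ψ) = ad f Φ * ad f Ψ - ad f Ψ * ad f Φ :=
  LoopAlgebra.ext_apply fun X => by
    rw [map_sub, map_mul, map_mul]
    exact bracket_jacobi hf Φ Ψ X

lemma multiplier_D_mul (μ : Fin d) (X Y : PlaneWaves d) :
    multiplier (fun p => Complex.I * (p μ : ℂ)) (X * Y) =
      multiplier (fun p => Complex.I * (p μ : ℂ)) X * Y +
        X * multiplier (fun p => Complex.I * (p μ : ℂ)) Y := by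
  induction X using AddMonoidAlgebra.induction_linear with
  | zero => simp
  | add X X' hX hX' => simp only [add_mul, map_add, hX, hX']; abel
  | single p z =>
    induction Y using AddMonoidAlgebra.induction_linear with
    | zero => simp
    | add Y Y' hY hY' => simp only [map_add, mul_add, hY, hY']; abel
    | single q w =>
      simp only [multiplier_single, AddMonoidAlgebra.single_mul_single]
      rw [← AddMonoidAlgebra.single_add]
      congr 1
      rw [PiLp.add_apply, Complex.ofReal_add]
      ring

lemma D_bracket (μ : Fin d) (Φ X : ι → PlaneWaves d) :
    ((planeCalculus d).multiplet f).D μ (bracket f Φ X) =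
      bracket f (((planeCalculus d).multiplet f).D μ Φ) X +
      bracket f Φ (((planeCalculus d).multiplet f).D μ X) := by
  ext a : 1
  simp only [multiplet_D, Pi.add_apply, bracket_apply, LinearMap.compLeft_apply,
    Function.comp_apply, map_sum, map_smul, ← Finset.sum_add_distrib, ← smul_add]
  simp only [planeCalculus, LinearMap.coe_restrictScalars, multiplier_D_mul]

variable [NeZero d]

lemma toEnd_planeTrace_D (μ : Fin d) (X : ι → PlaneWaves d) :
    ((planeTrace ι d).D μ).toEnd X = ((planeCalculus d).multiplet f).D μ X := rfl

lemma toEnd_planeTrace_G (X : ι → PlaneWaves d) :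
    ((planeTrace ι d).G).toEnd X = ((planeCalculus d).multiplet f).G X := rfl

/-- Leibniz' rule: commuting with `D_μ` differentiates the background field. -/
lemma D_ad (μ : Fin d) (Φ : ι → PlaneWaves d) :
    (planeTrace ι d).D μ * ad f Φ - ad f Φ * (planeTrace ι d).D μ =
      ad f (((planeCalculus d).multiplet f).D μ Φ) :=
  LoopAlgebra.ext_apply fun X => by
    rw [map_sub, map_mul, map_mul, LinearMap.sub_apply, Module.End.mul_apply, Module.End.mul_apply,
      toEnd_ad, toEnd_ad, toEnd_ad, toEnd_planeTrace_D (f := f), toEnd_planeTrace_D (f := f),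
      D_bracket, add_sub_cancel_right]

/-- Total antisymmetry of `f` makes the adjoint action antisymmetric for the invariant form. -/
lemma transp_ad (hf : IsStructureConstants f N) (Φ : ι → PlaneWaves d) :
    (planeTrace ι d).Transp (ad f Φ) (- ad f Φ) := fun X Y => by
  rw [map_neg, LinearMap.neg_apply, toEnd_ad, toEnd_ad, planePairing_neg_right]
  simp only [planePairing, bracket_apply, Finset.sum_mul, Finset.mul_sum, smul_mul_assoc,
    mul_smul_comm]
  rw [← Finsupp.neg_apply, ← AddMonoidAlgebra.coeff_neg, Finset.sum_comm]
  rw [Finset.sum_comm (f := fun a b => ∑ c, f a b c • (X a * (Φ b * Y c)))]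
  simp only [← Finset.sum_neg_distrib]
  congr 3
  refine funext fun b => ?_
  rw [Finset.sum_comm]
  refine Finset.sum_congr rfl fun a _ => Finset.sum_congr rfl fun c _ => ?_
  have : f c b a = - f a b c := by
    rw [hf.antisymm_left, hf.antisymm_right, hf.antisymm_left, neg_neg]
  rw [this, neg_smul]
  congr 2
  ring

end Adjoint

end

end NicolaiMap

namespace NicolaiMap

noncomputable section

open scoped BigOperators

set_option linter.unusedSectionVars false

/-! ### Transversal plane waves as a background -/

section Background

variable {ι : Type*} [Fintype ι] [DecidableEq ι] {N : ℝ} {f : ι → ι → ι → ℝ} {d : ℕ}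

lemma coeff_plane_D (μ : Fin d) (X : PlaneWaves d) (p : Spacetime d) :
    ((planeCalculus d).D μ X).coeff p = Complex.I * (p μ : ℂ) * X.coeff p :=
  coeff_multiplier _ _ _

lemma coeff_plane_G (X : PlaneWaves d) (p : Spacetime d) :
    ((planeCalculus d).G X).coeff p = ((‖p‖ ^ 2 : ℝ) : ℂ)⁻¹ * X.coeff p :=
  coeff_multiplier _ _ _

lemma coeff_plane_dG (μ : Fin d) (X : PlaneWaves d) (p : Spacetime d) :
    ((planeCalculus d).dG μ X).coeff p =
      Complex.I * (p μ : ℂ) * ((‖p‖ ^ 2 : ℝ) : ℂ)⁻¹ * X.coeff p :=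
  coeff_multiplier _ _ _

lemma plane_D_dG (μ ν : Fin d) (X : PlaneWaves d) :
    (planeCalculus d).D μ ((planeCalculus d).dG ν X) =
      (planeCalculus d).dG ν ((planeCalculus d).D μ X) := by
  ext p
  simp only [coeff_plane_D, coeff_plane_dG]
  ring

lemma plane_D_dG_swap (μ ν : Fin d) (X : PlaneWaves d) :
    (planeCalculus d).D μ ((planeCalculus d).dG ν X) =
      (planeCalculus d).D ν ((planeCalculus d).dG μ X) := by
  ext p
  simp only [coeff_plane_D, coeff_plane_dG]
  ring

lemma plane_dG_eq (μ : Fin d) (X : PlaneWaves d) :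
    (planeCalculus d).dG μ X = (planeCalculus d).D μ ((planeCalculus d).G X) := by
  ext p
  simp only [coeff_plane_D, coeff_plane_dG, coeff_plane_G]
  ring

/-- The zero mode. -/
def zeroMode (d : ℕ) : PlaneWaves d →ₗ[ℂ] PlaneWaves d :=
  multiplier fun p => if p = 0 then 1 else 0

lemma sq_norm_eq (p : Spacetime d) : ((‖p‖ ^ 2 : ℝ) : ℂ) = ∑ μ, (p μ : ℂ) ^ 2 := by
  rw [EuclideanSpace.real_norm_sq_eq]
  push_cast
  rfl

/-- The propagator is set to `0` at zero momentum, so it inverts the Laplacian only off the zero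
mode. -/
lemma plane_sum_D_dG (X : PlaneWaves d) :
    ∑ μ, (planeCalculus d).D μ ((planeCalculus d).dG μ X) = zeroMode d X - X := by
  ext p
  simp only [AddMonoidAlgebra.coeff_sum, Finsupp.finsetSum_apply, coeff_plane_D, coeff_plane_dG,
    zeroMode, coeff_multiplier, AddMonoidAlgebra.coeff_sub, Finsupp.sub_apply]
  have h3 (μ : Fin d) : Complex.I * (p μ : ℂ) * (Complex.I * (p μ : ℂ) *
      ((‖p‖ ^ 2 : ℝ) : ℂ)⁻¹ * X.coeff p) = (p μ : ℂ) ^ 2 * (-((‖p‖ ^ 2 : ℝ) : ℂ)⁻¹ * X.coeff p) := by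
    linear_combination ((p μ : ℂ) ^ 2 * (((‖p‖ ^ 2 : ℝ) : ℂ)⁻¹ * X.coeff p)) * Complex.I_sq
  simp only [h3, ← Finset.sum_mul, ← sq_norm_eq]
  by_cases h : p = 0
  · simp [h]
  · have h2 : ((‖p‖ ^ 2 : ℝ) : ℂ) ≠ 0 := by simpa using h
    rw [if_neg h]
    field_simp
    ring

lemma plane_D_zeroMode (μ : Fin d) (X : PlaneWaves d) : (planeCalculus d).D μ (zeroMode d X) = 0 := by
  ext p
  simp only [coeff_plane_D, zeroMode, coeff_multiplier]
  by_cases h : p = 0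
  · simp [h]
  · simp [h]

lemma zeroMode_eq_single (X : PlaneWaves d) :
    zeroMode d X = AddMonoidAlgebra.single 0 (X.coeff 0) := by
  classical
  ext p
  simp only [zeroMode, coeff_multiplier, AddMonoidAlgebra.coeff_single, Finsupp.single_apply]
  by_cases h : p = 0
  · simp [h]
  · simp [h, Ne.symm h]

/-- The multiplet calculus of plane waves. -/
abbrev planeMultiplet (f : ι → ι → ι → ℝ) (d : ℕ) : MultipletCalculus d (ι → PlaneWaves d) :=
  (planeCalculus d).multiplet f

lemma planeMultiplet_D_dG (μ ν : Fin d) (X : ι → PlaneWaves d) :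
    (planeMultiplet f d).D μ ((planeMultiplet f d).dG ν X) =
      (planeMultiplet f d).dG ν ((planeMultiplet f d).D μ X) :=
  funext fun a => plane_D_dG μ ν (X a)

lemma planeMultiplet_D_dG_swap (μ ν : Fin d) (X : ι → PlaneWaves d) :
    (planeMultiplet f d).D μ ((planeMultiplet f d).dG ν X) =
      (planeMultiplet f d).D ν ((planeMultiplet f d).dG μ X) :=
  funext fun a => plane_D_dG_swap μ ν (X a)

lemma planeMultiplet_sum_D_dG (X : ι → PlaneWaves d) :
    ∑ μ, (planeMultiplet f d).D μ ((planeMultiplet f d).dG μ X) =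
      (zeroMode d).compLeft ι X - X := by
  ext a : 1
  rw [Finset.sum_apply]
  exact plane_sum_D_dG (X a)

lemma planeMultiplet_D_zeroMode (μ : Fin d) (X : ι → PlaneWaves d) :
    (planeMultiplet f d).D μ ((zeroMode d).compLeft ι X) = 0 :=
  funext fun a => plane_D_zeroMode μ (X a)

open MultipletCalculus

variable [NeZero d]

lemma planeMultiplet_antisymm (hf : IsStructureConstants f N) (X Y : ι → PlaneWaves d) :
    (planeMultiplet f d).br X Y = - (planeMultiplet f d).br Y X :=
  bracket_antisymm f hf.antisymm_right X Y

lemma ad_real_smul (r : ℝ) (Φ : ι → PlaneWaves d) : ad f (r • Φ) = (r : ℂ) • ad f Φ := by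
  rw [← map_smul]
  congr 1

lemma div_first (hf : IsStructureConstants f N) (A : Fin d → ι → PlaneWaves d) :
    ∑ μ, (planeMultiplet f d).D μ ((planeMultiplet f d).first A μ) = 0 := by
  refine eq_zero_of_eq_neg_self ?_
  conv_lhs => simp only [first, map_sum]
  rw [Finset.sum_comm]
  simp only [first, map_sum, ← Finset.sum_neg_distrib]
  refine Finset.sum_congr rfl fun ρ _ => Finset.sum_congr rfl fun μ _ => ?_
  rw [planeMultiplet_D_dG_swap, comm_swap A (planeMultiplet_antisymm hf) ρ μ, map_neg, map_neg]

/-- The divergence of `dC * [A, A]` splits into the Laplacian acting on `C * [A, A]`, which returns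
`-[A, A]` up to its zero mode, and the terms with a contracted index, which are derivatives of the
first order. This is the origin of the field `z` of the background. -/
lemma div_three (hf : IsStructureConstants f N) (A : Fin d → ι → PlaneWaves d) (ρ l : Fin d) :
    ∑ σ, (planeMultiplet f d).D σ ((planeMultiplet f d).three A σ ρ l) =
      (planeMultiplet f d).D ρ ((planeMultiplet f d).first A l)
      - (planeMultiplet f d).D l ((planeMultiplet f d).first A ρ)
      - (planeMultiplet f d).comm A ρ l
      + (zeroMode d).compLeft ι ((planeMultiplet f d).comm A ρ l) := by
  simp only [three, curl, map_add, Finset.sum_add_distrib, planeMultiplet_sum_D_dG]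
  have h1 : ∑ σ, (planeMultiplet f d).D σ ((planeMultiplet f d).dG ρ
      ((planeMultiplet f d).comm A l σ)) =
      (planeMultiplet f d).D ρ ((planeMultiplet f d).first A l) := by
    simp only [first, map_sum, planeMultiplet_D_dG_swap ρ]
  have h2 : ∑ σ, (planeMultiplet f d).D σ ((planeMultiplet f d).dG l
      ((planeMultiplet f d).comm A σ ρ)) =
      - (planeMultiplet f d).D l ((planeMultiplet f d).first A ρ) := by
    simp only [first, map_sum, planeMultiplet_D_dG_swap l,
      comm_swap A (planeMultiplet_antisymm hf) ρ, map_neg, Finset.sum_neg_distrib]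
  rw [h1, h2]
  abel

/-- No zero mode correction appears, because what it would project is a derivative. -/
lemma box_first (A : Fin d → ι → PlaneWaves d) (μ : Fin d) :
    ∑ ρ, (planeMultiplet f d).D ρ ((planeMultiplet f d).D ρ ((planeMultiplet f d).first A μ)) =
      - ∑ ρ, (planeMultiplet f d).D ρ ((planeMultiplet f d).comm A μ ρ) := by
  simp only [first, map_sum]
  rw [Finset.sum_comm, ← Finset.sum_neg_distrib]
  refine Finset.sum_congr rfl fun ρ _ => ?_
  have (σ : Fin d) : (planeMultiplet f d).D σ ((planeMultiplet f d).D σ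
      ((planeMultiplet f d).dG ρ ((planeMultiplet f d).comm A μ ρ))) =
      (planeMultiplet f d).D σ ((planeMultiplet f d).dG σ
        ((planeMultiplet f d).D ρ ((planeMultiplet f d).comm A μ ρ))) := by
    rw [planeMultiplet_D_dG_swap, planeMultiplet_D_dG ρ σ]
  simp only [this, planeMultiplet_sum_D_dG]
  have h0 (X : ι → PlaneWaves d) :
      (zeroMode d).compLeft ι ((planeMultiplet f d).D ρ X) = 0 := by
    ext a p
    simp only [LinearMap.compLeft_apply, Function.comp_apply, zeroMode, coeff_multiplier,
      multiplet_D, coeff_plane_D]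
    by_cases h : p = 0 <;> simp [h]
  rw [h0, zero_sub]

/-- The three-forms of third order. -/
def thirdForms (f : ι → ι → ι → ℝ) (A : Fin d → ι → PlaneWaves d) (ρ μ l : Fin d) :
    ι → PlaneWaves d :=
  - ((1 / 6 : ℝ) • (planeMultiplet f d).curl ((planeMultiplet f d).comm' A) ρ μ l)
    - (1 / 3 : ℝ) • (planeMultiplet f d).curl ((planeMultiplet f d).contr A) ρ μ l
    + (1 / 3 : ℝ) • (planeMultiplet f d).divFour A ρ μ l

/-- The adjoint operators of a transversal background field. -/
def background (hf : IsStructureConstants f N) {A : GaugeField ι d (PlaneWaves d)}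
    (hA : IsLandauField A) : (planeTrace ι d).Background where
  a μ := ad f fun a => A a μ
  a₁ μ := ad f ((planeMultiplet f d).first (fun μ a => A a μ) μ)
  x ρ μ l := ad f ((planeMultiplet f d).three (fun μ a => A a μ) ρ μ l)
  c ρ μ l := ad f (thirdForms f (fun μ a => A a μ) ρ μ l)
  θ := ad f ((planeMultiplet f d).scalar fun μ a => A a μ)
  z ρ l := ad f ((zeroMode d).compLeft ι ((planeMultiplet f d).comm (fun μ a => A a μ) ρ l))
  e l i := ad f (- (planeMultiplet f d).dG i fun a => A a l)
  transp_a μ := transp_ad hf _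
  transp_a₁ μ := transp_ad hf _
  transp_θ := transp_ad hf _
  landau := by
    rw [← sub_eq_zero, ← Finset.sum_sub_distrib]
    simp only [D_ad]
    rw [← map_sum]
    have h0 : ∑ μ, (planeMultiplet f d).D μ (fun a => A a μ) = 0 := by
      ext a : 1
      rw [Finset.sum_apply]
      exact hA.1 a
    rw [h0, map_zero]
  landau₁ := by
    rw [← sub_eq_zero, ← Finset.sum_sub_distrib]
    simp only [D_ad]
    rw [← map_sum, div_first hf, map_zero]
  x_swap ρ μ l := by rw [three_swap _ (planeMultiplet_antisymm hf) ρ μ l, map_neg]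
  x_swap' ρ μ l := by rw [three_swap' _ (planeMultiplet_antisymm hf) ρ μ l, map_neg]
  c_diag ρ μ := by
    rw [thirdForms, curl_diag _ (comm'_swap _),
      curl_diag _ (contr_swap _ (planeMultiplet_antisymm hf)),
      eq_zero_of_eq_neg_self (divFour_swap _ (planeMultiplet_antisymm hf) ρ μ μ)]
    simp
  div_x ρ l := by
    have h (Φ Ψ : ι → PlaneWaves d) : (planeTrace ι d).D ρ * ad f Φ - ad f Φ * (planeTrace ι d).D ρ
        - (planeTrace ι d).D l * ad f Ψ + ad f Ψ * (planeTrace ι d).D l =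
        ad f ((planeMultiplet f d).D ρ Φ) - ad f ((planeMultiplet f d).D l Ψ) := by
      rw [← D_ad, ← D_ad]
      abel
    have hL (X : Fin d → ι → PlaneWaves d) : ∑ σ, ((planeTrace ι d).D σ * ad f (X σ) -
        ad f (X σ) * (planeTrace ι d).D σ) = ad f (∑ σ, (planeMultiplet f d).D σ (X σ)) := by
      simp only [D_ad, map_sum]
    rw [hL, div_three hf, ← ad_bracket hf, h, map_add, map_sub, map_sub]
    rfl
  z_D ρ l σ := by
    rw [eq_comm, ← sub_eq_zero, D_ad, planeMultiplet_D_zeroMode, map_zero]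
  -- Without zero mode the propagator does invert the Laplacian on `A_l`, so `A_l` is a divergence
  -- and its adjoint operator a sum of commutators.
  a_eq l := by
    simp only [D_ad]
    rw [← map_sum]
    congr 1
    simp only [map_neg, Finset.sum_neg_distrib, planeMultiplet_sum_D_dG]
    ext a : 1
    have : zeroMode d (A a l) = 0 := by
      rw [zeroMode_eq_single, hA.2 a l, AddMonoidAlgebra.single_zero]
    simp [this]
  box_a₁ μ := by
    simp only [← ad_bracket hf]
    have h1 (ρ : Fin d) (Φ : ι → PlaneWaves d) : (planeTrace ι d).D ρ * (planeTrace ι d).D ρ * ad f Φ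
        - (2 : ℂ) • ((planeTrace ι d).D ρ * ad f Φ * (planeTrace ι d).D ρ)
        + ad f Φ * ((planeTrace ι d).D ρ * (planeTrace ι d).D ρ) =
        ad f ((planeMultiplet f d).D ρ ((planeMultiplet f d).D ρ Φ)) := by
      rw [← D_ad, ← D_ad, two_smul]
      noncomm_ring
    simp only [h1, D_ad]
    rw [← map_sum, box_first, map_neg, map_sum]
    rfl

end Background

end

end NicolaiMap

namespace NicolaiMap

noncomputable section

open scoped BigOperators

set_option linter.unusedSectionVars false

/-! ### First-order variations as loop operators -/

section Variation

variable {ι : Type*} [Fintype ι] [DecidableEq ι] {N : ℝ} {f : ι → ι → ι → ℝ} {d : ℕ}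

/-- `Z h` is `Z₀` with first-order variation `∑ W_ν h_ν`. -/
def HasVariation (Z : (ι × Fin d → PlaneWaves d) → ι → DualNumber (PlaneWaves d))
    (Z₀ : ι → PlaneWaves d) (W : Fin d → LoopAlgebra ι d) : Prop :=
  ∀ h, (fun a => (Z h a).fst) = Z₀ ∧
    (fun a => (Z h a).snd) = ∑ ν, (W ν).toEnd fun a => h (a, ν)

/-- The multiplet calculus of perturbed plane waves. -/
abbrev dualMultiplet (f : ι → ι → ι → ℝ) (d : ℕ) :
    MultipletCalculus d (ι → DualNumber (PlaneWaves d)) :=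
  (planeCalculus d).dual.multiplet f

namespace HasVariation

variable {Z Z' : (ι × Fin d → PlaneWaves d) → ι → DualNumber (PlaneWaves d)}
  {Z₀ Z₀' : ι → PlaneWaves d} {W W' : Fin d → LoopAlgebra ι d}

lemma congr (hZ : HasVariation Z Z₀ W) (h : ∀ ν, W ν = W' ν) : HasVariation Z Z₀ W' := by
  obtain rfl : W = W' := funext h
  exact hZ

lemma zero : HasVariation (fun _ => 0) (0 : ι → PlaneWaves d) (fun _ => 0) :=
  fun h => ⟨rfl, by simp; rfl⟩

lemma add (hZ : HasVariation Z Z₀ W) (hZ' : HasVariation Z' Z₀' W') :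
    HasVariation (fun h => Z h + Z' h) (Z₀ + Z₀') (fun ν => W ν + W' ν) := fun h => by
  rw [← (hZ h).1, ← (hZ' h).1]
  simp only [map_add, LinearMap.add_apply, Finset.sum_add_distrib]
  rw [← (hZ h).2, ← (hZ' h).2]
  exact ⟨rfl, rfl⟩

lemma neg (hZ : HasVariation Z Z₀ W) :
    HasVariation (fun h => - Z h) (- Z₀) (fun ν => - W ν) := fun h => by
  rw [← (hZ h).1]
  simp only [map_neg, LinearMap.neg_apply, Finset.sum_neg_distrib]
  rw [← (hZ h).2]
  exact ⟨rfl, rfl⟩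

lemma sub (hZ : HasVariation Z Z₀ W) (hZ' : HasVariation Z' Z₀' W') :
    HasVariation (fun h => Z h - Z' h) (Z₀ - Z₀') (fun ν => W ν - W' ν) := by
  simpa only [sub_eq_add_neg] using hZ.add hZ'.neg

lemma smul (r : ℝ) (hZ : HasVariation Z Z₀ W) :
    HasVariation (fun h => r • Z h) (r • Z₀) (fun ν => (r : ℂ) • W ν) := fun h => by
  rw [← (hZ h).1]
  simp only [map_smul, LinearMap.smul_apply, ← Finset.smul_sum]
  rw [← (hZ h).2]
  exact ⟨rfl, rfl⟩

lemma sum {κ : Type*} (s : Finset κ)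
    {Z : κ → (ι × Fin d → PlaneWaves d) → ι → DualNumber (PlaneWaves d)}
    {Z₀ : κ → ι → PlaneWaves d} {W : κ → Fin d → LoopAlgebra ι d}
    (hZ : ∀ i, HasVariation (Z i) (Z₀ i) (W i)) :
    HasVariation (fun h => ∑ i ∈ s, Z i h) (∑ i ∈ s, Z₀ i) (fun ν => ∑ i ∈ s, W i ν) := by
  classical
  induction s using Finset.induction_on with
  | empty => simpa only [Finset.sum_empty] using zero
  | insert i s hi ih => simpa only [Finset.sum_insert hi] using (hZ i).add ih

variable [NeZero d]

lemma D (μ : Fin d) (hZ : HasVariation Z Z₀ W) :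
    HasVariation (fun h => (dualMultiplet f d).D μ (Z h)) ((planeMultiplet f d).D μ Z₀)
      (fun ν => (planeTrace ι d).D μ * W ν) := fun h => by
  simp only [map_mul, Module.End.mul_apply, ← map_sum]
  rw [← (hZ h).1, ← (hZ h).2]
  exact ⟨by ext a : 1; simp [LinearCalculus.dual, dualMap],
    by ext a : 1; simp [LinearCalculus.dual, dualMap, toEnd_planeTrace_D (f := f)]⟩

lemma G (hZ : HasVariation Z Z₀ W) :
    HasVariation (fun h => (dualMultiplet f d).G (Z h)) ((planeMultiplet f d).G Z₀)
      (fun ν => (planeTrace ι d).G * W ν) := fun h => by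
  simp only [map_mul, Module.End.mul_apply, ← map_sum]
  rw [← (hZ h).1, ← (hZ h).2]
  exact ⟨by ext a : 1; simp [LinearCalculus.dual, dualMap],
    by ext a : 1; simp [LinearCalculus.dual, dualMap, toEnd_planeTrace_G (f := f)]⟩

lemma toEnd_p (μ : Fin d) (X : ι → PlaneWaves d) :
    (TraceCalculus.Background.p (planeTrace ι d) μ).toEnd X = (planeMultiplet f d).dG μ X := by
  rw [TraceCalculus.Background.p, map_mul, Module.End.mul_apply, toEnd_planeTrace_G (f := f),
    toEnd_planeTrace_D (f := f)]
  ext a : 1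
  simp [plane_dG_eq]

lemma dG (μ : Fin d) (hZ : HasVariation Z Z₀ W) :
    HasVariation (fun h => (dualMultiplet f d).dG μ (Z h)) ((planeMultiplet f d).dG μ Z₀)
      (fun ν => TraceCalculus.Background.p (planeTrace ι d) μ * W ν) := fun h => by
  simp only [map_mul, Module.End.mul_apply, ← map_sum]
  rw [← (hZ h).1, ← (hZ h).2]
  exact ⟨by ext a : 1; simp [LinearCalculus.dual, dualMap],
    by ext a : 1; simp [LinearCalculus.dual, dualMap, toEnd_p (f := f)]⟩

/-- The product rule; antisymmetry moves the variation of the first factor into the second slot of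
the bracket, which gives the minus sign. -/
lemma br (hf : IsStructureConstants f N) (hZ : HasVariation Z Z₀ W)
    (hZ' : HasVariation Z' Z₀' W') :
    HasVariation (fun h => (dualMultiplet f d).br (Z h) (Z' h)) ((planeMultiplet f d).br Z₀ Z₀')
      (fun ν => ad f Z₀ * W' ν - ad f Z₀' * W ν) := fun h => by
  simp only [map_mul, map_sub, Module.End.mul_apply, LinearMap.sub_apply,
    Finset.sum_sub_distrib, ← map_sum]
  rw [← (hZ h).1, ← (hZ h).2, ← (hZ' h).1, ← (hZ' h).2]
  have h1 (a : ι) (F : ι → ι → DualNumber (PlaneWaves d)) :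
      (∑ b, ∑ c, f a b c • F b c).fst = ∑ b, ∑ c, f a b c • (F b c).fst := by
    simp only [TrivSqZeroExt.fst_sum, TrivSqZeroExt.fst_smul]
  have h2 (a : ι) (F : ι → ι → DualNumber (PlaneWaves d)) :
      (∑ b, ∑ c, f a b c • F b c).snd = ∑ b, ∑ c, f a b c • (F b c).snd := by
    simp only [TrivSqZeroExt.snd_sum, TrivSqZeroExt.snd_smul]
  refine ⟨?_, ?_⟩
  · ext a : 1
    simp only [multiplet_br, bracket_apply, h1, TrivSqZeroExt.fst_mul]
  · rw [toEnd_ad, toEnd_ad, bracket_antisymm f hf.antisymm_right (fun a => (Z' h a).fst),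
      sub_neg_eq_add]
    ext a : 1
    simp only [multiplet_br, bracket_apply, h2, Pi.add_apply, ← Finset.sum_add_distrib,
      ← smul_add, DualNumber.snd_mul]

end HasVariation

section Orders

open TraceCalculus.Background

variable [NeZero d] (hf : IsStructureConstants f N) {A : GaugeField ι d (PlaneWaves d)}
    (hA : IsLandauField A)

/-- The perturbed field. -/
def perturbed (A : GaugeField ι d (PlaneWaves d)) (h : ι × Fin d → PlaneWaves d) (μ : Fin d)
    (a : ι) : DualNumber (PlaneWaves d) :=
  TrivSqZeroExt.inl (A a μ) + TrivSqZeroExt.inr (h (a, μ))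

lemma variation_field (μ : Fin d) :
    HasVariation (fun h => perturbed A h μ) (fun a => A a μ) (fun ν => delta (LoopAlgebra ι d) μ ν) :=
  fun h => ⟨by ext a : 1; simp [perturbed], by
    ext a : 1
    have (ν : Fin d) : (delta (LoopAlgebra ι d) μ ν).toEnd (fun a => h (a, ν)) =
        if μ = ν then fun a => h (a, ν) else 0 := by
      unfold delta
      split_ifs with e
      · rw [map_one]; rfl
      · rw [map_zero]; rfl
    simp only [this, Finset.sum_ite_eq, Finset.mem_univ, if_true]
    simp [perturbed]⟩

/-- The background fields. -/
local notation "𝔸" => fun μ a => A a μ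

lemma variation_comm (μ l : Fin d) :
    HasVariation (fun h => (dualMultiplet f d).comm (perturbed A h) μ l)
      ((planeMultiplet f d).comm 𝔸 μ l) (vComm (background hf hA).a μ l) :=
  (variation_field μ).br hf (variation_field l)

lemma variation_curl {Z : Fin d → Fin d → (ι × Fin d → PlaneWaves d) → ι → DualNumber (PlaneWaves d)}
    {Z₀ : Fin d → Fin d → ι → PlaneWaves d} {W : Fin d → Fin d → Fin d → LoopAlgebra ι d}
    (hZ : ∀ μ l, HasVariation (Z μ l) (Z₀ μ l) (W μ l)) (ρ μ l : Fin d) :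
    HasVariation (fun h => (dualMultiplet f d).curl (fun μ l => Z μ l h) ρ μ l)
      ((planeMultiplet f d).curl Z₀ ρ μ l) (vCurl (planeTrace ι d) W ρ μ l) :=
  (((hZ μ l).dG ρ).add ((hZ l ρ).dG μ)).add ((hZ ρ μ).dG l)

lemma variation_three (ρ μ l : Fin d) :
    HasVariation (fun h => (dualMultiplet f d).three (perturbed A h) ρ μ l)
      ((planeMultiplet f d).three 𝔸 ρ μ l) ((background hf hA).vThree ρ μ l) :=
  variation_curl (variation_comm hf hA) ρ μ l

lemma variation_first (μ : Fin d) :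
    HasVariation (fun h => (dualMultiplet f d).first (perturbed A h) μ)
      ((planeMultiplet f d).first 𝔸 μ) ((background hf hA).vFirst μ) :=
  (HasVariation.sum Finset.univ fun ρ => (variation_comm hf hA μ ρ).dG ρ).congr fun ν => by
    simp only [vComm, vFirst, mul_sub, ← mul_assoc, Finset.sum_sub_distrib, sum_mul_delta, K,
      Finset.sum_mul]

lemma variation_contr (μ l : Fin d) :
    HasVariation (fun h => (dualMultiplet f d).contr (perturbed A h) μ l)
      ((planeMultiplet f d).contr 𝔸 μ l) ((background hf hA).vContr μ l) :=
  (HasVariation.sum Finset.univ fun σ =>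
    (variation_three hf hA μ l σ).br hf (variation_field σ)).congr fun ν => by
    rw [Finset.sum_sub_distrib, sum_mul_delta, vContr]
    rfl

lemma variation_second (μ : Fin d) :
    HasVariation (fun h => (dualMultiplet f d).second (perturbed A h) μ)
      ((planeMultiplet f d).second 𝔸 μ) ((background hf hA).vSecond μ) :=
  ((HasVariation.sum Finset.univ fun ρ => (variation_contr hf hA ρ μ).dG ρ).smul (1 / 2)).congr
    fun ν => by
      rw [vSecond]
      norm_num

lemma variation_comm' (μ l : Fin d) :
    HasVariation (fun h => (dualMultiplet f d).comm' (perturbed A h) μ l)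
      ((planeMultiplet f d).comm' 𝔸 μ l) ((background hf hA).vComm' μ l) :=
  (((variation_field μ).br hf (variation_first hf hA l)).sub
    ((variation_field l).br hf (variation_first hf hA μ))).congr fun ν => by
    change (background hf hA).a μ * _ - (background hf hA).a₁ l * _ -
      ((background hf hA).a l * _ - (background hf hA).a₁ μ * _) = _
    rw [vComm', vComm]
    abel

lemma variation_four (ρ μ l σ : Fin d) :
    HasVariation (fun h => (dualMultiplet f d).four (perturbed A h) ρ μ l σ)
      ((planeMultiplet f d).four 𝔸 ρ μ l σ) ((background hf hA).vFour ρ μ l σ) :=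
  (((((variation_three hf hA ρ μ σ).br hf (variation_field l)).add
    ((variation_three hf hA μ l σ).br hf (variation_field ρ))).add
    ((variation_three hf hA l ρ σ).br hf (variation_field μ))).sub
    ((variation_three hf hA ρ μ l).br hf (variation_field σ))).congr fun ν => by
    change (background hf hA).x ρ μ σ * _ - (background hf hA).a l * _ +
      ((background hf hA).x μ l σ * _ - (background hf hA).a ρ * _) +
      ((background hf hA).x l ρ σ * _ - (background hf hA).a μ * _) -
      ((background hf hA).x ρ μ l * _ - (background hf hA).a σ * _) = _
    rw [vFour]
    abel

lemma variation_divFour (ρ μ l : Fin d) :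
    HasVariation (fun h => (dualMultiplet f d).divFour (perturbed A h) ρ μ l)
      ((planeMultiplet f d).divFour 𝔸 ρ μ l)
      (fun ν => ∑ σ, p (planeTrace ι d) σ * (background hf hA).vFour ρ μ l σ ν) :=
  HasVariation.sum Finset.univ fun σ => (variation_four hf hA ρ μ l σ).dG σ

lemma variation_twoForm (ρ μ : Fin d) :
    HasVariation (fun h => (dualMultiplet f d).twoForm (perturbed A h) ρ μ)
      ((planeMultiplet f d).twoForm 𝔸 ρ μ) ((background hf hA).vTwoForm ρ μ) :=
  (HasVariation.sum Finset.univ fun l =>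
    (((((variation_three hf hA ρ μ l).br hf (variation_first hf hA l)).smul (1 / 6)).sub
      (((variation_curl (variation_comm' hf hA) ρ μ l).br hf (variation_field l)).smul (1 / 6))).sub
      (((variation_curl (variation_contr hf hA) ρ μ l).br hf (variation_field l)).smul (1 / 3))).add
      (((variation_divFour hf hA ρ μ l).br hf (variation_field l)).smul (1 / 3))).congr fun ν => by
    rw [vTwoForm]
    refine Finset.sum_congr rfl fun l _ => ?_
    -- In every summand but the first the bracket is taken with `A_l` itself, whose variation is a
    -- delta. The three-forms in front of that delta collect in `c`.
    have hc : (background hf hA).c ρ μ l =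
      - ((1 / 6 : ℂ) • ad f ((planeMultiplet f d).curl ((planeMultiplet f d).comm' 𝔸) ρ μ l))
        - (1 / 3 : ℂ) • ad f ((planeMultiplet f d).curl ((planeMultiplet f d).contr 𝔸) ρ μ l)
        + (1 / 3 : ℂ) • ad f ((planeMultiplet f d).divFour 𝔸 ρ μ l) := by
      change ad f (thirdForms f 𝔸 ρ μ l) = _
      rw [thirdForms, map_add, map_sub, map_neg, ad_real_smul, ad_real_smul, ad_real_smul]
      norm_num
    rw [hc]
    have ha : ∀ l, ad f (fun a => A a l) = (background hf hA).a l := fun _ => rfl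
    have ha₁ : ∀ l, ad f ((planeMultiplet f d).first 𝔸 l) = (background hf hA).a₁ l := fun _ => rfl
    have hx : ad f ((planeMultiplet f d).three 𝔸 ρ μ l) = (background hf hA).x ρ μ l := rfl
    rw [ha, ha₁, hx]
    push_cast
    simp only [add_mul, sub_mul, neg_mul, smul_mul_assoc]
    module

lemma variation_source :
    HasVariation (fun h => ∑ l, (dualMultiplet f d).br
      ((dualMultiplet f d).first (perturbed A h) l) (perturbed A h l))
      (∑ l, (planeMultiplet f d).br ((planeMultiplet f d).first 𝔸 l) (fun a => A a l))
      (background hf hA).vScalar :=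
  (HasVariation.sum Finset.univ fun l =>
    (variation_first hf hA l).br hf (variation_field l)).congr fun ν => by
    rw [Finset.sum_sub_distrib, sum_mul_delta]
    rfl

lemma dG_source (μ : Fin d) : (planeMultiplet f d).dG μ
    (∑ l, (planeMultiplet f d).br ((planeMultiplet f d).first 𝔸 l) (fun a => A a l)) =
    (planeMultiplet f d).D μ ((planeMultiplet f d).scalar 𝔸) := by
  ext a : 1
  simp [MultipletCalculus.scalar, plane_dG_eq]

lemma ad_dG_source (μ : Fin d) : ad f ((planeMultiplet f d).dG μ
    (∑ l, (planeMultiplet f d).br ((planeMultiplet f d).first 𝔸 l) (fun a => A a l))) =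
    (planeTrace ι d).D μ * (background hf hA).θ - (background hf hA).θ * (planeTrace ι d).D μ := by
  rw [dG_source, ← D_ad]
  rfl

lemma variation_scalarPart (μ : Fin d) :
    HasVariation (fun h => (dualMultiplet f d).scalarPart (perturbed A h) μ)
      ((planeMultiplet f d).scalarPart 𝔸 μ) ((background hf hA).vScalarPart μ) :=
  ((((HasVariation.sum Finset.univ fun ρ =>
      ((((variation_source hf hA).dG μ).br hf (variation_field ρ)).sub
        (((variation_source hf hA).dG ρ).br hf (variation_field μ))).dG ρ).smul (1 / 3)).sub
    (((HasVariation.sum Finset.univ fun ρ =>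
      ((variation_source hf hA).G.br hf (variation_field ρ)).D ρ).dG μ).smul (1 / 3))).sub
    (((variation_source hf hA).G.br hf (variation_field μ)).smul (1 / 3))).congr fun ν => by
    simp only [ad_dG_source hf hA]
    rw [vScalarPart]
    push_cast
    rfl

lemma variation_third (μ : Fin d) :
    HasVariation (fun h => (dualMultiplet f d).third (perturbed A h) μ)
      ((planeMultiplet f d).third 𝔸 μ) ((background hf hA).vThird μ) :=
  (HasVariation.sum Finset.univ fun ρ => (variation_twoForm hf hA ρ μ).dG ρ).add
    (variation_scalarPart hf hA μ)

end Orders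

end Variation

end

end NicolaiMap

namespace NicolaiMap

noncomputable section

open scoped BigOperators

set_option linter.unusedSectionVars false

/-! ### Traces over colour and over Lorentz or spinor indices -/

section Blocks

variable {ι : Type*} [Fintype ι] [DecidableEq ι] {d : ℕ} {κ σ : Type*} [Fintype κ] [DecidableEq κ]
  [Fintype σ] [DecidableEq σ] {e : κ ≃ ι × σ}

/-- `J` acts on multiplets with index set `κ ≃ ι × σ` as the matrix `M` of loop operators. -/
def IsBlock (e : κ ≃ ι × σ) (J : (κ → PlaneWaves d) → κ → PlaneWaves d)
    (M : Matrix σ σ (LoopAlgebra ι d)) : Prop :=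
  ∀ h s, (fun a => J h (e.symm (a, s))) = ∑ t, (M s t).toEnd fun b => h (e.symm (b, t))

lemma IsBlock.comp {J J' : (κ → PlaneWaves d) → κ → PlaneWaves d}
    {M M' : Matrix σ σ (LoopAlgebra ι d)} (hJ : IsBlock e J M) (hJ' : IsBlock e J' M') :
    IsBlock e (J ∘ J') (M * M') := fun h s => by
  refine (hJ (J' h) s).trans ?_
  simp only [hJ' h, map_sum, Matrix.mul_apply, map_mul, LinearMap.sum_apply, Module.End.mul_apply]
  exact Finset.sum_comm

lemma IsBlock.zero : IsBlock e (0 : (κ → PlaneWaves d) → κ → PlaneWaves d)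
    (0 : Matrix σ σ (LoopAlgebra ι d)) := fun h s => by
  simp
  rfl

variable [NeZero d]

lemma IsBlock.trace {J : (κ → PlaneWaves d) → κ → PlaneWaves d}
    {M : Matrix σ σ (LoopAlgebra ι d)} (hJ : IsBlock e J M) :
    loopIntegral d (traceIntegrand J) = (planeTrace ι d).tr M.trace := by
  rw [Matrix.trace, map_sum]
  simp only [planeTrace, LinearMap.comp_apply]
  rw [← map_sum]
  congr 1
  ext k
  rw [traceIntegrand, ← e.symm.sum_comp, Fintype.sum_prod_type_right, Finset.sum_apply]
  refine Finset.sum_congr rfl fun s _ => ?_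
  rw [AlgHom.toLinearMap_apply, diagonal_apply]
  refine Finset.sum_congr rfl fun a _ => ?_
  rw [show J (Pi.single (e.symm (a, s)) (AddMonoidAlgebra.single k 1)) (e.symm (a, s)) = _ from
    congrFun (hJ _ s) a, Finset.sum_eq_single s]
  · rw [Matrix.diag_apply]
    congr 2
    refine congrFun (congrArg _ (funext fun b => ?_)) a
    by_cases hb : b = a
    · subst hb
      rw [Pi.single_eq_same, Pi.single_eq_same]
    · rw [Pi.single_eq_of_ne hb, Pi.single_eq_of_ne]
      simpa using hb
  · intro t _ ht
    have : (fun b => (Pi.single (e.symm (a, s)) (AddMonoidAlgebra.single k 1) : κ → PlaneWaves d)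
        (e.symm (b, t))) = 0 := by
      ext b : 1
      rw [Pi.single_eq_of_ne, Pi.zero_apply]
      simp [ht]
    rw [this, map_zero]
  · simp

/-- By cyclicity both orderings of the mixed term in `Tr log` have the same formal integral, so its
two coefficients `-1/2` add up to `-1`. -/
lemma loopIntegral_logDetCoeff {J : ℕ → (κ → PlaneWaves d) → κ → PlaneWaves d}
    {M : ℕ → Matrix σ σ (LoopAlgebra ι d)} (hJ : ∀ n ∈ ({1, 2, 3} : Finset ℕ), IsBlock e (J n) (M n)) :
    loopIntegral d (logDetCoeff J 1) = (planeTrace ι d).tr (M 1).trace ∧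
    loopIntegral d (logDetCoeff J 2) = (planeTrace ι d).tr (M 2).trace
      - (1 / 2 : ℂ) • (planeTrace ι d).tr (M 1 * M 1).trace ∧
    loopIntegral d (logDetCoeff J 3) = (planeTrace ι d).tr (M 3).trace
      - (planeTrace ι d).tr (M 1 * M 2).trace
      + (1 / 3 : ℂ) • (planeTrace ι d).tr (M 1 * (M 1 * M 1)).trace := by
  have h1 := hJ 1 (by simp)
  have h2 := hJ 2 (by simp)
  have h3 := hJ 3 (by simp)
  have hc : (planeTrace ι d).tr (M 2 * M 1).trace = (planeTrace ι d).tr (M 1 * M 2).trace := by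
    simp only [Matrix.trace, Matrix.diag_apply, Matrix.mul_apply, map_sum]
    rw [Finset.sum_comm]
    exact Finset.sum_congr rfl fun _ _ => Finset.sum_congr rfl fun _ _ =>
      (planeTrace ι d).tr_mul_comm _ _
  refine ⟨h1.trace, ?_, ?_⟩
  · rw [logDetCoeff, map_sub, map_smul, h2.trace, (h1.comp h1).trace]
  · rw [logDetCoeff, map_add, map_sub, map_smul, map_smul, map_add, h3.trace, (h1.comp h2).trace,
      (h2.comp h1).trace, (h1.comp (h1.comp h1)).trace, hc]
    module

end Blocks

/-! ### The Jacobian and the ghost determinant -/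

section Determinants

open TraceCalculus.Background

variable {ι : Type*} [Fintype ι] [DecidableEq ι] {N : ℝ} {f : ι → ι → ι → ℝ} {d : ℕ} [NeZero d]
  (hf : IsStructureConstants f N) {A : GaugeField ι d (PlaneWaves d)} (hA : IsLandauField A)

/-- The matrices of the variations of the orders of the Nicolai map. -/
def jacobianMatrix : ℕ → Matrix (Fin d) (Fin d) (LoopAlgebra ι d)
  | 1 => Matrix.of (background hf hA).vFirst
  | 2 => Matrix.of (background hf hA).vSecond
  | 3 => Matrix.of (background hf hA).vThird
  | _ => 0

include hf in
lemma isBlock_jacobianCoeff {n : ℕ} (hn : n ∈ ({1, 2, 3} : Finset ℕ)) :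
    IsBlock (Equiv.refl _) (jacobianCoeff f A n) (jacobianMatrix hf hA n) := fun h s => by
  simp only [Finset.mem_insert, Finset.mem_singleton] at hn
  simp only [jacobianCoeff, Equiv.refl_symm, Equiv.refl_apply, ← planeCalculus_dual_toCalculus]
  rcases hn with rfl | rfl | rfl
  · simp only [nicolaiCoeff, nicolai₁_eq]
    exact (variation_first hf hA s h).2
  · simp only [nicolaiCoeff, nicolai₂_eq _ _ _ hf.antisymm_right]
    exact (variation_second hf hA s h).2
  · simp only [nicolaiCoeff, nicolai₃_eq _ _ _ hf.antisymm_right]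
    exact (variation_third hf hA s h).2

/-- One-point functions vanish: a field without zero mode is a sum of commutators with derivatives,
and derivatives commute with `p`. -/
lemma tr_p_a (ρ l : Fin d) : (planeTrace ι d).tr
    (p (planeTrace ι d) ρ * (background hf hA).a l) = 0 := by
  rw [(background hf hA).a_eq, Finset.mul_sum, map_sum]
  refine Finset.sum_eq_zero fun i _ => ?_
  rw [mul_sub, map_sub, sub_eq_zero]
  have hp : p (planeTrace ι d) ρ * (planeTrace ι d).D i =
      (planeTrace ι d).D i * p (planeTrace ι d) ρ := by
    rw [p, (planeTrace ι d).DGD, (planeTrace ι d).DG_comm ρ, mul_assoc]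
  exact (planeTrace ι d).tr_cyc (x := (planeTrace ι d).D i)
    (y := p (planeTrace ι d) ρ * (background hf hA).e l i)
    (by rw [← mul_assoc, hp, mul_assoc]) (by rw [mul_assoc])

lemma tr_K : (planeTrace ι d).tr (background hf hA).K = 0 := by
  rw [K, map_sum]
  exact Finset.sum_eq_zero fun ρ _ => tr_p_a hf hA ρ ρ

include hf in
lemma loopIntegral_logJacobian :
    loopIntegral d (logJacobian f A 1) = 0 ∧
    loopIntegral d (logJacobian f A 2) = - ((d - 2 : ℂ) / 2) • (background hf hA).spinorSquare
      - (1 / 2 : ℂ) • (planeTrace ι d).tr ((background hf hA).K * (background hf hA).K) ∧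
    loopIntegral d (logJacobian f A 3) = - ((d - 2 : ℂ) / 3) • (background hf hA).spinorCube
      - (1 / 3 : ℂ) • (background hf hA).w₀ := by
  obtain ⟨h1, h2, h3⟩ := loopIntegral_logDetCoeff fun n hn => isBlock_jacobianCoeff hf hA hn
  refine ⟨h1.trans ?_, h2.trans ?_, h3.trans ?_⟩
  · rw [Matrix.trace]
    simp only [Matrix.diag_apply, jacobianMatrix, Matrix.of_apply, sum_vFirst, map_smul, tr_K,
      smul_zero]
  · rw [← quadratic_identity]
    simp only [Matrix.trace, Matrix.diag_apply, jacobianMatrix, Matrix.of_apply, Matrix.mul_apply,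
      map_sum]
  · rw [← cubic_identity]
    simp only [Matrix.trace, Matrix.diag_apply, jacobianMatrix, Matrix.of_apply, Matrix.mul_apply,
      map_sum, Finset.mul_sum]

/-- The matrix of the ghost operator. -/
def ghostMatrix (n : ℕ) : Matrix Unit Unit (LoopAlgebra ι d) :=
  if n = 1 then Matrix.of fun _ _ => - (background hf hA).K else 0

lemma ghostMatrix_one : ghostMatrix hf hA 1 = Matrix.of fun _ _ => - (background hf hA).K := if_pos rfl

lemma ghostMatrix_of_ne {n : ℕ} (hn : n ≠ 1) : ghostMatrix hf hA n = 0 := if_neg hn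

lemma toEnd_K (X : ι → PlaneWaves d) : (background hf hA).K.toEnd X = (planeMultiplet f d).G
    (∑ μ, (planeMultiplet f d).D μ (bracket f (fun a => A a μ) X)) := by
  have hK : (background hf hA).K = (planeTrace ι d).G * ∑ μ, (planeTrace ι d).D μ *
    ad f (fun a => A a μ) := K_eq _
  simp only [hK, map_mul, Module.End.mul_apply, toEnd_planeTrace_G (f := f), map_sum,
    LinearMap.sum_apply, toEnd_planeTrace_D (f := f), toEnd_ad]

include hf in
-- The sign of `-K` is that of `□⁻¹ = -C`.
lemma isBlock_ghostOperator (n : ℕ) : IsBlock (Equiv.prodPUnit ι).symm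
    (if n = 1 then ghostOperator f A else 0) (ghostMatrix hf hA n) := by
  by_cases hn : n = 1
  · subst hn
    rw [if_pos rfl, ghostMatrix_one]
    intro h s
    simp only [Finset.univ_unique, Finset.sum_singleton, Matrix.of_apply, map_neg,
      LinearMap.neg_apply, toEnd_K]
    ext a : 1
    simp only [ghostOperator, ← planeCalculus_toCalculus, Pi.neg_apply]
    congr 1
    simp only [multiplet_G, multiplet_D, LinearMap.compLeft_apply, Function.comp_apply,
      Finset.sum_apply]
    rfl
  · rw [if_neg hn, ghostMatrix_of_ne hf hA hn]
    exact IsBlock.zero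

include hf in
lemma loopIntegral_logFP :
    loopIntegral d (logFP f A 1) = 0 ∧
    loopIntegral d (logFP f A 2) =
      - (1 / 2 : ℂ) • (planeTrace ι d).tr ((background hf hA).K * (background hf hA).K) ∧
    loopIntegral d (logFP f A 3) = - (1 / 3 : ℂ) • (background hf hA).w₀ := by
  obtain ⟨h1, h2, h3⟩ := loopIntegral_logDetCoeff fun n _ => isBlock_ghostOperator hf hA n
  refine ⟨h1.trans ?_, h2.trans ?_, h3.trans ?_⟩
  · simp [Matrix.trace, ghostMatrix_one, tr_K]
  · rw [ghostMatrix_of_ne hf hA (n := 2) (by norm_num)]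
    simp [Matrix.trace, ghostMatrix_one, Matrix.mul_apply]
  · rw [ghostMatrix_of_ne hf hA (n := 2) (by norm_num), ghostMatrix_of_ne hf hA (n := 3) (by norm_num)]
    simp [Matrix.trace, ghostMatrix_one, Matrix.mul_apply, w₀]

end Determinants

end

end NicolaiMap

namespace NicolaiMap

noncomputable section

open scoped BigOperators

set_option linter.unusedSectionVars false
set_option linter.unusedSimpArgs false

/-! ### Gamma matrices -/

section Gamma

variable {d m : ℕ} {γ : Fin d → Matrix (Fin m) (Fin m) ℂ} (hγ : IsGammaMatrices γ)

/-- The Kronecker delta with complex values. -/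
def kron {d : ℕ} (μ ν : Fin d) : ℂ := if μ = ν then 1 else 0

include hγ

lemma gamma_anticomm (μ ν : Fin d) : γ μ * γ ν + γ ν * γ μ = (2 * kron μ ν) • 1 := by
  rw [hγ μ ν, kron]
  split_ifs
  · rw [mul_one, two_smul, one_add_one_eq_two]
  · rw [mul_zero, zero_smul]

lemma trace_gamma_two (a b : Fin d) : (γ a * γ b).trace = m * kron a b := by
  have h := congrArg Matrix.trace (gamma_anticomm hγ a b)
  rw [Matrix.trace_add, Matrix.trace_mul_comm (γ b), Matrix.trace_smul, Matrix.trace_one,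
    Fintype.card_fin, smul_eq_mul] at h
  linear_combination h / 2

/-- Moving `γ a` past the three other matrices reverses its sign, and cyclicity brings it back to
the front; twice the trace is therefore the signed sum of the anticommutators met on the way. The
trace of six is found in the same manner. -/
lemma trace_gamma_four (a b c e : Fin d) : (γ a * (γ b * (γ c * γ e))).trace =
    m * (kron a b * kron c e - kron a c * kron b e + kron a e * kron b c) := by
  have h : γ a * (γ b * (γ c * γ e)) + (γ b * (γ c * γ e)) * γ a =
      (γ a * γ b + γ b * γ a) * (γ c * γ e) - γ b * ((γ a * γ c + γ c * γ a) * γ e)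
      + γ b * (γ c * (γ a * γ e + γ e * γ a)) := by noncomm_ring
  have h := congrArg Matrix.trace h
  simp only [gamma_anticomm hγ, smul_mul_assoc, mul_smul_comm, one_mul, mul_one, Matrix.trace_add,
    Matrix.trace_sub, Matrix.trace_smul, trace_gamma_two hγ, smul_eq_mul] at h
  rw [Matrix.trace_mul_comm (γ b * (γ c * γ e))] at h
  linear_combination h / 2

lemma trace_gamma_six (a b c e g i : Fin d) :
    (γ a * (γ b * (γ c * (γ e * (γ g * γ i))))).trace =
    m * (kron a b * (kron c e * kron g i - kron c g * kron e i + kron c i * kron e g)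
      - kron a c * (kron b e * kron g i - kron b g * kron e i + kron b i * kron e g)
      + kron a e * (kron b c * kron g i - kron b g * kron c i + kron b i * kron c g)
      - kron a g * (kron b c * kron e i - kron b e * kron c i + kron b i * kron c e)
      + kron a i * (kron b c * kron e g - kron b e * kron c g + kron b g * kron c e)) := by
  have h : γ a * (γ b * (γ c * (γ e * (γ g * γ i)))) + (γ b * (γ c * (γ e * (γ g * γ i)))) * γ a =
      (γ a * γ b + γ b * γ a) * (γ c * (γ e * (γ g * γ i)))
      - γ b * ((γ a * γ c + γ c * γ a) * (γ e * (γ g * γ i)))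
      + γ b * (γ c * ((γ a * γ e + γ e * γ a) * (γ g * γ i)))
      - γ b * (γ c * (γ e * ((γ a * γ g + γ g * γ a) * γ i)))
      + γ b * (γ c * (γ e * (γ g * (γ a * γ i + γ i * γ a)))) := by noncomm_ring
  have h := congrArg Matrix.trace h
  simp only [gamma_anticomm hγ, smul_mul_assoc, mul_smul_comm, one_mul, mul_one, Matrix.trace_add,
    Matrix.trace_sub, Matrix.trace_smul, trace_gamma_four hγ, smul_eq_mul] at h
  rw [Matrix.trace_mul_comm (γ b * (γ c * (γ e * (γ g * γ i))))] at h
  linear_combination h / 2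

end Gamma

namespace TraceCalculus.Background

variable {d : ℕ} {𝒜 V : Type*} [Ring 𝒜] [Algebra ℂ 𝒜] [AddCommGroup V] [Module ℂ V]
  {T : TraceCalculus d 𝒜 V} (B : T.Background)

/-- The matrix of the Dirac operator relative to the free one. -/
def spinorMatrix {m : ℕ} (γ : Fin d → Matrix (Fin m) (Fin m) ℂ) : Matrix (Fin m) (Fin m) 𝒜 :=
  - ∑ ν, ∑ μ, (γ ν * γ μ).map fun c => c • (p T ν * B.a μ)

lemma map_smul_mul_map_smul {m : ℕ} (M M' : Matrix (Fin m) (Fin m) ℂ) (x y : 𝒜) :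
    (M.map fun c => c • x) * (M'.map fun c => c • y) = (M * M').map fun c => c • (x * y) := by
  ext i j
  simp only [Matrix.mul_apply, Matrix.map_apply, smul_mul_smul_comm, Finset.sum_smul]

lemma tr_trace_map_smul {m : ℕ} (M : Matrix (Fin m) (Fin m) ℂ) (x : 𝒜) :
    T.tr (M.map fun c => c • x).trace = M.trace • T.tr x := by
  simp only [Matrix.trace, Matrix.diag_apply, Matrix.map_apply, map_sum, map_smul, Finset.sum_smul]

lemma spinorMatrix_eq {m : ℕ} (γ : Fin d → Matrix (Fin m) (Fin m) ℂ) : B.spinorMatrix γ =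
    ∑ ν, ∑ μ, (γ ν * γ μ).map fun c => c • (- (p T ν * B.a μ)) := by
  simp only [spinorMatrix, ← Finset.sum_neg_distrib]
  refine Finset.sum_congr rfl fun ν _ => Finset.sum_congr rfl fun μ _ => ?_
  ext i j
  simp only [Matrix.neg_apply, Matrix.map_apply, smul_neg]

/-- Of the three contractions of four gamma matrices two equal the trace of `K²`, one by definition
and one by the Landau condition in `trace_κ_sq`. The third has the opposite sign. -/
lemma trace_spinorMatrix_sq {m : ℕ} {γ : Fin d → Matrix (Fin m) (Fin m) ℂ}
    (hγ : IsGammaMatrices γ) :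
    T.tr (B.spinorMatrix γ * B.spinorMatrix γ).trace = (m : ℂ) • B.spinorSquare := by
  rw [spinorMatrix_eq]
  simp only [Finset.sum_mul]
  simp only [Finset.mul_sum, map_smul_mul_map_smul, neg_mul_neg,
    Matrix.trace_sum, map_sum, tr_trace_map_smul, mul_assoc, trace_gamma_four hγ]
  have hK : T.tr (B.K * B.K) = ∑ ν, ∑ μ, T.tr (p T ν * (B.a ν * (p T μ * B.a μ))) := by
    simp only [K, Finset.sum_mul_sum, map_sum, mul_assoc]
  have hκ : T.tr (B.K * B.K) = ∑ ν, ∑ μ, T.tr (p T ν * (B.a μ * (p T μ * B.a ν))) := by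
    rw [← trace_κ_sq, Finset.sum_comm]
  rw [spinorSquare, two_smul]
  nth_rewrite 2 [hκ]
  rw [hK]
  simp only [kron, mul_ite, mul_one, mul_zero, mul_add, mul_sub,
    add_smul, sub_smul, ite_smul, zero_smul, Finset.sum_add_distrib, Finset.sum_sub_distrib,
    Finset.sum_ite_eq, Finset.mem_univ, if_true, Finset.sum_ite_irrel, Finset.sum_const_zero,
    ← Finset.smul_sum]
  module

lemma sum₃_cyc {n : ℕ} (F : Fin n → Fin n → Fin n → V) :
    ∑ x, ∑ y, ∑ z, F x y z = ∑ x, ∑ y, ∑ z, F z x y := by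
  rw [Finset.sum_comm]
  refine (Finset.sum_congr rfl fun y _ => Finset.sum_comm).trans ?_
  rw [Finset.sum_comm]

/-- The fifteen contractions of six gamma matrices are fifteen words. Rotations sort them into the
classes of `spinorCube`, except that `x y y z z x` joins `w₀` through `pairing_κ`, which is why `w₀`
has coefficient `2`. The overall sign comes from the minus sign of the operator, cubed. -/
lemma trace_spinorMatrix_cube {m : ℕ} {γ : Fin d → Matrix (Fin m) (Fin m) ℂ}
    (hγ : IsGammaMatrices γ) :
    T.tr (B.spinorMatrix γ * (B.spinorMatrix γ * B.spinorMatrix γ)).trace =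
      - ((m : ℂ) • B.spinorCube) := by
  rw [spinorMatrix_eq]
  simp only [Finset.sum_mul]
  simp only [Finset.mul_sum, map_smul_mul_map_smul, neg_mul_neg, neg_mul, mul_neg, neg_neg,
    Matrix.trace_sum, map_sum, tr_trace_map_smul, mul_assoc, trace_gamma_six hγ]
  simp only [map_neg, smul_neg, Finset.sum_neg_distrib]
  congr 1
  have hw (a b c e g i : Fin d) : T.tr (p T a * (B.a b * (p T c * (B.a e * (p T g * B.a i))))) =
    B.word a b c e g i := rfl
  simp only [hw]
  simp only [kron, mul_ite, mul_one, mul_zero, mul_add, mul_sub,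
    add_smul, sub_smul, ite_smul, zero_smul, Finset.sum_add_distrib, Finset.sum_sub_distrib,
    Finset.sum_ite_eq, Finset.mem_univ, if_true, Finset.sum_ite_irrel, Finset.sum_const_zero,
    ← Finset.smul_sum]
  have cyc₂ (a b c e g i : Fin d) : B.word a b c e g i = B.word g i a b c e :=
    (B.word_cyc _ _ _ _ _ _).trans (B.word_cyc _ _ _ _ _ _)
  have h13 : ∑ x, ∑ y, ∑ z, B.word x y y z z x = B.w₀ := by
    rw [← pairing_κ]
    simp only [pairing, κ, Finset.sum_mul, Finset.mul_sum, map_sum, word, mul_assoc]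
  have h2 : ∑ x, ∑ y, ∑ z, B.word x x y z y z = B.w₁ := by
    rw [w₁_eq]
    refine (sum₃_congr fun x y z => B.word_cyc _ _ _ _ _ _).trans ?_
    exact sum₃_cyc _
  have h3 : ∑ x, ∑ y, ∑ z, B.word x x y z z y = B.w₂ := by
    rw [w₂_eq]
    refine (sum₃_congr fun x y z => B.word_cyc _ _ _ _ _ _).trans ?_
    exact sum₃_cyc _
  have h5 : ∑ x, ∑ y, ∑ z, B.word x y x z y z = B.w₄ := by
    rw [w₄_eq]
    refine (sum₃_congr fun x y z => cyc₂ _ _ _ _ _ _).trans ?_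
    exact sum₃_cyc _
  have h10 : ∑ x, ∑ y, ∑ z, B.word x y y z x z = B.w₁' := by
    rw [w₁'_eq]
    refine (sum₃_congr fun x y z => cyc₂ _ _ _ _ _ _).trans ?_
    exact sum₃_perm₂₃ _
  have h11 : ∑ x, ∑ y, ∑ z, B.word x y z y x z = B.w₄ := by
    rw [w₄_eq]
    refine (sum₃_congr fun x y z => B.word_cyc _ _ _ _ _ _).trans ?_
    exact sum₃_perm₁₃ _
  have h12 : ∑ x, ∑ y, ∑ z, B.word x y z z x y = B.w₁ := by
    rw [w₁_eq]
    exact sum₃_congr fun x y z => cyc₂ _ _ _ _ _ _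
  have h14 : ∑ x, ∑ y, ∑ z, B.word x y z y z x = B.w₁' := by
    rw [w₁'_eq]
    refine (sum₃_congr fun x y z => B.word_cyc _ _ _ _ _ _).trans ?_
    exact sum₃_perm₁₃ _
  have h15 : ∑ x, ∑ y, ∑ z, B.word x y z z y x = B.w₂ := by
    rw [w₂_eq]
    refine (sum₃_congr fun x y z => cyc₂ _ _ _ _ _ _).trans ?_
    exact sum₃_perm₁₂ _
  simp only [h13, h2, h3, h5, h10, h11, h12, h14, h15, ← w₀_eq, ← w₁_eq, ← w₁'_eq, ← w₂_eq, ← w₃_eq,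
    ← w₄_eq]
  rw [spinorCube]
  module

end TraceCalculus.Background

/-! ### The fermion determinant and the comparison -/

section Determinants

open TraceCalculus.Background

variable {ι : Type*} [Fintype ι] [DecidableEq ι] {N : ℝ} {f : ι → ι → ι → ℝ} {d : ℕ} [NeZero d]
  (hf : IsStructureConstants f N) {A : GaugeField ι d (PlaneWaves d)} (hA : IsLandauField A)
  {m : ℕ} {γ : Fin d → Matrix (Fin m) (Fin m) ℂ}

include hf in
lemma isBlock_diracOperator :
    IsBlock (Equiv.refl _) (diracOperator γ f A) ((background hf hA).spinorMatrix γ) := fun ψ α => by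
  have hp (ν μ : Fin d) (X : ι → PlaneWaves d) :
      (p (planeTrace ι d) ν * (background hf hA).a μ).toEnd X =
      (planeMultiplet f d).D ν ((planeMultiplet f d).G (bracket f (fun a => A a μ) X)) := by
    rw [map_mul, Module.End.mul_apply, p, map_mul, Module.End.mul_apply,
      toEnd_planeTrace_D (f := f), toEnd_planeTrace_G (f := f)]
    rfl
  simp only [spinorMatrix, Matrix.neg_apply, Matrix.sum_apply, Matrix.map_apply, map_neg, map_sum,
    map_smul, LinearMap.neg_apply, LinearMap.sum_apply, LinearMap.smul_apply, hp,
    Finset.sum_neg_distrib]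
  ext a : 1
  simp only [diracOperator, Equiv.refl_symm, Equiv.refl_apply, Pi.neg_apply]
  congr 1
  have h1 (β : Fin m) : (∑ μ, ∑ δ, γ μ β δ • ∑ b, ∑ e, f a b e • (A b μ * ψ (e, δ))) =
      (∑ μ, ∑ δ, γ μ β δ • bracket f (fun a => A a μ) (fun e => ψ (e, δ))) a := by
    simp only [Finset.sum_apply, Pi.smul_apply, bracket_apply]
  have hD (ν : Fin d) (X : ι → PlaneWaves d) : (planeWaves d).D ν ((planeWaves d).G (X a)) =
      (planeMultiplet f d).D ν ((planeMultiplet f d).G X) a := rfl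
  have hs (ν : Fin d) (c : ℂ) (X : ι → PlaneWaves d) :
      (planeMultiplet f d).D ν ((planeMultiplet f d).G (c • X)) =
      c • (planeMultiplet f d).D ν ((planeMultiplet f d).G X) := by
    rw [← toEnd_planeTrace_G, ← toEnd_planeTrace_D, map_smul, map_smul, toEnd_planeTrace_G (f := f),
      toEnd_planeTrace_D (f := f)]
  simp only [h1, hD, map_sum, hs]
  generalize (fun (ν μ : Fin d) (δ : Fin m) => (planeMultiplet f d).D ν ((planeMultiplet f d).G
    (bracket f (fun a => A a μ) fun e => ψ (e, δ)))) = Y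
  simp only [Finset.sum_apply, Pi.smul_apply, Matrix.mul_apply, Finset.sum_smul, Finset.smul_sum,
    smul_smul]
  rw [Finset.sum_comm (s := Finset.univ (α := Fin m))]
  refine Finset.sum_congr rfl fun ν _ => ?_
  rw [Finset.sum_comm, Finset.sum_comm (s := Finset.univ (α := Fin m))]
  refine Finset.sum_congr rfl fun μ _ => ?_
  rw [Finset.sum_comm]

lemma isBlock_dirac (n : ℕ) : IsBlock (Equiv.refl _)
    (if n = 1 then diracOperator γ f A else 0)
    (if n = 1 then (background hf hA).spinorMatrix γ else 0) := by
  split_ifs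
  · exact isBlock_diracOperator hf hA
  · exact IsBlock.zero

include hf in
-- The spinor traces are `m` times expressions that do not involve `γ`, so the rescaling by `r / m`
-- removes the dependence on the representation.
lemma loopIntegral_logMSS (hm : 0 < m) (hγ : IsGammaMatrices γ) (r : ℝ) :
    loopIntegral d (logMSS γ r f A 1) = 0 ∧
    loopIntegral d (logMSS γ r f A 2) = - (r / 4 : ℂ) • (background hf hA).spinorSquare ∧
    loopIntegral d (logMSS γ r f A 3) = - (r / 6 : ℂ) • (background hf hA).spinorCube := by
  obtain ⟨h1, h2, h3⟩ := loopIntegral_logDetCoeff fun n _ => isBlock_dirac (γ := γ) hf hA n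
  have hm' : (m : ℂ) ≠ 0 := by exact_mod_cast hm.ne'
  simp only [logMSS, map_smul]
  rw [h1, h2, h3]
  simp only [if_true, OfNat.ofNat_ne_one, if_false, trace_spinorMatrix_sq _ hγ,
    trace_spinorMatrix_cube _ hγ, mul_zero, Matrix.trace_zero, map_zero, zero_sub, sub_zero, zero_add]
  refine ⟨?_, ?_, ?_⟩
  · rw [spinorMatrix]
    simp only [Matrix.trace_neg, Matrix.trace_sum, map_neg, map_sum, tr_trace_map_smul, tr_p_a,
      smul_zero, Finset.sum_const_zero, neg_zero]
  · rw [← neg_smul, smul_smul, smul_smul]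
    congr 1
    push_cast
    field_simp
    ring
  · rw [← neg_smul, smul_smul, smul_smul]
    congr 1
    push_cast
    field_simp
    ring

include hf in
-- The ghost terms on both sides cancel. What is left is `(r - 2 (d - 2)) / 4` times one loop
-- integral, so a single field for which this integral is nonzero determines `r`.
lemma loopEq_iff_order_two (hm : 0 < m) (hγ : IsGammaMatrices γ) (r : ℝ) :
    LoopEq (logJacobian f A 2) (logMSS γ r f A 2 + logFP f A 2) ↔
      ((r - 2 * (d - 2) : ℝ) : ℂ) • (background hf hA).spinorSquare = 0 := by
  rw [loopEq_iff, map_add, (loopIntegral_logJacobian hf hA).2.1, (loopIntegral_logFP hf hA).2.1,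
    (loopIntegral_logMSS hf hA hm hγ r).2.1, ← sub_eq_zero]
  have h : -((d - 2 : ℂ) / 2) • (background hf hA).spinorSquare
      - (1 / 2 : ℂ) • (planeTrace ι d).tr ((background hf hA).K * (background hf hA).K) -
      (-(r / 4 : ℂ) • (background hf hA).spinorSquare
      + -(1 / 2 : ℂ) • (planeTrace ι d).tr ((background hf hA).K * (background hf hA).K)) =
      (1 / 4 : ℂ) • (((r - 2 * (d - 2) : ℝ) : ℂ) • (background hf hA).spinorSquare) := by
    push_cast
    module
  rw [h, smul_eq_zero_iff_right (by norm_num)]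

include hf hA in
lemma loopEq_logJacobian (hm : 0 < m) (hγ : IsGammaMatrices γ) {n : ℕ}
    (hn : n ∈ ({1, 2, 3} : Finset ℕ)) :
    LoopEq (logJacobian f A n) (logMSS γ (2 * ((d : ℝ) - 2)) f A n + logFP f A n) := by
  simp only [Finset.mem_insert, Finset.mem_singleton] at hn
  obtain ⟨j1, j2, j3⟩ := loopIntegral_logJacobian hf hA
  obtain ⟨g1, g2, g3⟩ := loopIntegral_logFP hf hA
  obtain ⟨m1, m2, m3⟩ := loopIntegral_logMSS hf hA hm hγ (2 * ((d : ℝ) - 2))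
  rcases hn with rfl | rfl | rfl
  · rw [loopEq_iff, map_add, j1, g1, m1, add_zero]
  · rw [loopEq_iff_order_two hf hA hm hγ]
    simp
  · rw [loopEq_iff, map_add, j3, g3, m3]
    push_cast
    module

end Determinants

end

end NicolaiMap

namespace NicolaiMap

noncomputable section

open scoped BigOperators LaurentSeries

set_option linter.unusedSimpArgs false

/-! ### Residues of loop integrands -/

section Residue

variable {d : ℕ}

/-- The field of rational functions of one complex variable. -/
abbrev Scalars := RatFunc ℂ

/-- Complex constants as power series. -/
def constSeries : ℂ →+* PowerSeries Scalars := PowerSeries.C.comp (algebraMap ℂ Scalars)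

/-- Two complementary null vectors. -/
structure IsNullFrame (n v : Fin d → ℂ) : Prop where
  left : ∑ j, n j * n j = 0
  right : ∑ j, v j * v j = 0
  mixed : ∑ j, n j * v j = 2

variable {n v : Fin d → ℂ} (h : IsNullFrame n v)

/-- The sign as a complex number. -/
def signOf (σ : ℤˣ) : ℂ := ((σ : ℤ) : ℂ)

lemma signOf_neg (σ : ℤˣ) : signOf (-σ) = - signOf σ := by simp [signOf]

lemma signOf_mul_self (σ : ℤˣ) : signOf σ * signOf σ = 1 := by
  rcases Int.units_eq_one_or σ with rfl | rfl <;> simp [signOf]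

/-- The momentum `± (s n + t v) - q`. -/
def complexPoint (n v : Fin d → ℂ) (i : ℤˣ × Spacetime d) (j : Fin d) : PowerSeries Scalars :=
  constSeries (signOf i.1 * n j) * PowerSeries.C RatFunc.X
    + PowerSeries.X * constSeries (signOf i.1 * v j) - constSeries (i.2 j)

/-- Evaluation of polynomials at `± (s n + t v) - q`. -/
def complexEval (n v : Fin d → ℂ) (i : ℤˣ × Spacetime d) :
    MvPolynomial (Fin d) ℂ →+* PowerSeries Scalars :=
  MvPolynomial.eval₂Hom constSeries (complexPoint n v i)

/-- The polynomial `(k + q)²`. -/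
def sqPolynomial (q : Spacetime d) : MvPolynomial (Fin d) ℂ :=
  ∑ j, (MvPolynomial.X j + MvPolynomial.C (q j : ℂ)) * (MvPolynomial.X j + MvPolynomial.C (q j : ℂ))

lemma eval_sqPolynomial (q k : Spacetime d) :
    MvPolynomial.eval (fun j => (k j : ℂ)) (sqPolynomial q) = ((‖k + q‖ ^ 2 : ℝ) : ℂ) := by
  rw [sqPolynomial, EuclideanSpace.real_norm_sq_eq, map_sum]
  push_cast
  refine Finset.sum_congr rfl fun j _ => ?_
  rw [map_mul, map_add, MvPolynomial.eval_X, MvPolynomial.eval_C, PiLp.add_apply]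
  push_cast
  ring

include h in
-- With `n` and `v` null the terms in `s²` and `t²` drop out, and only `n · v = 2` mixes `s` and
-- `t`. For `q = i.2` nothing but `4 s t` remains, a simple zero at `t = 0`.
lemma complexEval_sqPolynomial (i : ℤˣ × Spacetime d) (q : Spacetime d) :
    complexEval n v i (sqPolynomial q) =
      constSeries (∑ j, ((q - i.2) j : ℂ) * ((q - i.2) j : ℂ))
      + constSeries (2 * signOf i.1 * ∑ j, n j * ((q - i.2) j : ℂ)) * PowerSeries.C RatFunc.X
      + PowerSeries.X * (constSeries (2 * signOf i.1 * ∑ j, v j * ((q - i.2) j : ℂ))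
        + constSeries 4 * PowerSeries.C RatFunc.X) := by
  have e (j : Fin d) : complexEval n v i ((MvPolynomial.X j + MvPolynomial.C (q j : ℂ)) *
      (MvPolynomial.X j + MvPolynomial.C (q j : ℂ))) =
      constSeries (((q - i.2) j : ℂ) * ((q - i.2) j : ℂ))
      + constSeries (2 * signOf i.1) * constSeries (n j * ((q - i.2) j : ℂ)) * PowerSeries.C RatFunc.X
      + PowerSeries.X * (constSeries (2 * signOf i.1) * constSeries (v j * ((q - i.2) j : ℂ))
        + constSeries (2 * (signOf i.1 * signOf i.1)) * constSeries (n j * v j) * PowerSeries.C RatFunc.X)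
      + constSeries (n j * n j) * (constSeries (signOf i.1 * signOf i.1) * PowerSeries.C RatFunc.X ^ 2)
      + constSeries (v j * v j) * (constSeries (signOf i.1 * signOf i.1) * PowerSeries.X ^ 2) := by
    simp only [complexEval, map_mul, map_add, MvPolynomial.eval₂Hom_X', MvPolynomial.eval₂Hom_C,
      complexPoint, PiLp.sub_apply, Complex.ofReal_sub, map_sub]
    rw [show (constSeries 2 : PowerSeries Scalars) = 2 from map_ofNat _ 2]
    ring
  rw [sqPolynomial, map_sum]
  simp only [e, Finset.sum_add_distrib, ← Finset.mul_sum, ← Finset.sum_mul, ← map_sum, h.left,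
    h.right, h.mixed, signOf_mul_self, map_zero, zero_mul, add_zero]
  have h4 : (constSeries 4 : PowerSeries Scalars) = constSeries 2 * constSeries 2 := by
    rw [← map_mul]; norm_num
  simp only [map_mul, map_one, mul_one, h4]

lemma linear_ne_zero {α β : ℂ} (hab : α ≠ 0 ∨ β ≠ 0) :
    algebraMap ℂ Scalars α + algebraMap ℂ Scalars β * RatFunc.X ≠ 0 := by
  intro e
  have e' : (Polynomial.C α + Polynomial.C β * Polynomial.X : Polynomial ℂ) = 0 := by
    apply RatFunc.algebraMap_injective ℂ
    rw [map_add, map_mul, RatFunc.algebraMap_X, map_zero]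
    exact e
  have h0 := congrArg (fun P => Polynomial.coeff P 0) e'
  have h1 := congrArg (fun P => Polynomial.coeff P 1) e'
  simp at h0 h1
  rcases hab with h | h
  · exact h h0
  · exact h h1

lemma constantCoeff_constSeries (c : ℂ) :
    PowerSeries.constantCoeff (constSeries c) = algebraMap ℂ Scalars c := by
  rw [constSeries, RingHom.comp_apply, PowerSeries.constantCoeff_C]

include h in
lemma complexEval_sqPolynomial_ne_zero (i : ℤˣ × Spacetime d) (q : Spacetime d) :
    complexEval n v i (sqPolynomial q) ≠ 0 := by
  intro e
  have e1 := congrArg (PowerSeries.coeff 1) e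
  have X_mul_coeff (Y : PowerSeries Scalars) : PowerSeries.coeff 1 (PowerSeries.X * Y) =
      PowerSeries.coeff 0 Y := PowerSeries.coeff_succ_X_mul 0 Y
  rw [complexEval_sqPolynomial h, map_add, map_add] at e1
  have C1 (c : ℂ) : PowerSeries.coeff 1 (constSeries c) = 0 := by
    rw [constSeries, RingHom.comp_apply, PowerSeries.coeff_C, if_neg one_ne_zero]
  have C2 (c : ℂ) : PowerSeries.coeff 1 (constSeries c * PowerSeries.C RatFunc.X) = 0 := by
    rw [constSeries, RingHom.comp_apply, ← map_mul, PowerSeries.coeff_C, if_neg one_ne_zero]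
  rw [C1, C2, X_mul_coeff, PowerSeries.coeff_zero_eq_constantCoeff_apply, map_add,
    map_mul PowerSeries.constantCoeff, constantCoeff_constSeries, constantCoeff_constSeries, PowerSeries.constantCoeff_C, map_zero,
    zero_add, zero_add] at e1
  exact linear_ne_zero (.inr (by norm_num)) e1

include h in
lemma constantCoeff_complexEval (i : ℤˣ × Spacetime d) (q : Spacetime d) :
    PowerSeries.constantCoeff (complexEval n v i (sqPolynomial q)) =
      algebraMap ℂ Scalars (∑ j, ((q - i.2) j : ℂ) * ((q - i.2) j : ℂ))
      + algebraMap ℂ Scalars (2 * signOf i.1 * ∑ j, n j * ((q - i.2) j : ℂ)) * RatFunc.X := by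
  rw [complexEval_sqPolynomial h]
  simp only [map_add, map_mul PowerSeries.constantCoeff, constantCoeff_constSeries,
    PowerSeries.constantCoeff_C, PowerSeries.constantCoeff_X, zero_mul, add_zero]

include h in
-- At `s = t = 0` the value is `|q - i.2|²`, which is nonzero because the external momenta are real.
-- An index therefore sees poles only from propagators with its own momentum.
lemma constantCoeff_complexEval_ne_zero {i : ℤˣ × Spacetime d} {q : Spacetime d} (hq : q ≠ i.2) :
    PowerSeries.constantCoeff (complexEval n v i (sqPolynomial q)) ≠ 0 := by
  rw [constantCoeff_complexEval h]
  refine linear_ne_zero (.inl ?_)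
  have : ∑ j, ((q - i.2) j : ℂ) * ((q - i.2) j : ℂ) = ((‖q - i.2‖ ^ 2 : ℝ) : ℂ) := by
    rw [EuclideanSpace.real_norm_sq_eq]
    push_cast
    simp only [pow_two]
  rw [this]
  simpa using sub_ne_zero.2 hq

/-- The field of Laurent series in the parameter `t`. -/
abbrev Series := Scalars⸨X⸩

lemma series_inv_mul_cancel {x : Series} (hx : x ≠ 0) : x⁻¹ * x = 1 :=
  @inv_mul_cancel₀ Series _ x hx

/-- Evaluation of polynomials as Laurent series. -/
def laurentEval (n v : Fin d → ℂ) (i : ℤˣ × Spacetime d) : MvPolynomial (Fin d) ℂ →+* Series :=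
  (HahnSeries.ofPowerSeries ℤ Scalars).comp (complexEval n v i)

/-- The residue. -/
def residue (x : Series) : Scalars := x.coeff (-1)

lemma residue_add (x y : Series) : residue (x + y) = residue x + residue y := rfl

lemma residue_ofPowerSeries (x : PowerSeries Scalars) :
    residue (HahnSeries.ofPowerSeries ℤ Scalars x) = 0 := by
  rw [residue, HahnSeries.ofPowerSeries_apply]
  refine HahnSeries.embDomain_of_notMem_range ?_
  rintro ⟨m, hm⟩
  simp at hm

lemma laurentEval_C (i : ℤˣ × Spacetime d) (c : ℂ) (x : Series) :
    residue (laurentEval n v i (MvPolynomial.C c) * x) = algebraMap ℂ Scalars c * residue x := by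
  rw [laurentEval, RingHom.comp_apply, complexEval, MvPolynomial.eval₂Hom_C, constSeries,
    RingHom.comp_apply, HahnSeries.ofPowerSeries_C, HahnSeries.C_mul_eq_smul]
  rfl

/-- The usual rule at a simple pole, for `x = W / (t U)`. -/
lemma residue_of_mul_eq {x : Series} {U W : PowerSeries Scalars}
    (hU : PowerSeries.constantCoeff U ≠ 0)
    (hx : x * HahnSeries.ofPowerSeries ℤ Scalars (PowerSeries.X * U) =
      HahnSeries.ofPowerSeries ℤ Scalars W) :
    residue x = PowerSeries.constantCoeff W / PowerSeries.constantCoeff U := by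
  have hU' : U * U⁻¹ = 1 := PowerSeries.mul_inv_cancel U hU
  have h1 : HahnSeries.single (1 : ℤ) (1 : Scalars) * x =
      HahnSeries.ofPowerSeries ℤ Scalars (W * U⁻¹) := by
    rw [map_mul _ W, ← hx, ← HahnSeries.ofPowerSeries_X, mul_assoc, ← map_mul, mul_assoc, hU', mul_one,
      mul_comm]
  have h2 := congrArg (fun y => HahnSeries.coeff y 0) h1
  have h3 : (HahnSeries.single (1 : ℤ) (1 : Scalars) * x).coeff 0 = residue x := by
    have := HahnSeries.coeff_single_mul_add (r := (1 : Scalars)) (x := x) (a := (-1 : ℤ)) (b := 1)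
    simpa [residue] using this
  simp only [h3] at h2
  rw [h2, eq_div_iff hU]
  have h4 := HahnSeries.ofPowerSeries_apply_coeff (Γ := ℤ) (W * U⁻¹) 0
  rw [Nat.cast_zero] at h4
  rw [h4, PowerSeries.coeff_zero_eq_constantCoeff_apply, ← map_mul, mul_assoc, mul_comm U⁻¹, hU',
    mul_one]

/-- `φ` is the continuation of `F` to complex momenta. -/
def IsContinuation (n v : Fin d → ℂ) (F : Spacetime d → ℂ) (φ : ℤˣ × Spacetime d → Series) : Prop :=
  (∃ P Q : MvPolynomial (Fin d) ℂ, (∀ i, laurentEval n v i Q ≠ 0) ∧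
    (∀ᵐ k : Spacetime d, F k * MvPolynomial.eval (fun j => (k j : ℂ)) Q =
      MvPolynomial.eval (fun j => (k j : ℂ)) P) ∧
    ∀ i, φ i * laurentEval n v i Q = laurentEval n v i P) ∧
  (Function.support fun i => residue (φ i)).Finite

/-- Continuity upgrades vanishing almost everywhere to vanishing at all real points, and a
polynomial that vanishes on a product of infinite sets is zero. -/
lemma eq_zero_of_ae_eval_eq_zero {P : MvPolynomial (Fin d) ℂ}
    (hP : ∀ᵐ k : Spacetime d, MvPolynomial.eval (fun j => (k j : ℂ)) P = 0) : P = 0 := by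
  have hc : Continuous fun k : Spacetime d => MvPolynomial.eval (fun j => (k j : ℂ)) P := by
    have h1 := MvPolynomial.continuous_eval P
    have h2 : Continuous fun k : Spacetime d => fun j => (k j : ℂ) := by fun_prop
    exact h1.comp h2
  have h0 := MeasureTheory.Measure.eq_of_ae_eq (μ := MeasureTheory.volume) hP hc continuous_const
  refine MvPolynomial.funext_set (fun _ => Set.range ((↑) : ℝ → ℂ))
    (fun _ => Set.infinite_range_of_injective Complex.ofReal_injective) fun x hx => ?_
  choose y hy using fun j => hx j (Set.mem_univ j)
  rw [map_zero]
  have := congrFun h0 (WithLp.toLp 2 y)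
  simp only [hy] at this
  exact this

namespace IsContinuation

variable {F F' : Spacetime d → ℂ} {φ φ' : ℤˣ × Spacetime d → Series}

/-- This makes the residues depend only on the integrand up to null sets, and not on its
presentation as a fraction. -/
lemma eq_zero (hF : IsContinuation n v F φ) (h0 : F =ᵐ[MeasureTheory.volume] 0) : φ = 0 := by
  obtain ⟨⟨P, Q, hQ, hFP, hφ⟩, -⟩ := hF
  have hP : P = 0 := eq_zero_of_ae_eval_eq_zero <| by
    filter_upwards [hFP, h0] with k hk hk0
    rw [← hk, hk0, Pi.zero_apply, zero_mul]
  ext1 i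
  have := hφ i
  rw [hP, map_zero] at this
  exact (mul_eq_zero.1 this).resolve_right (hQ i)

lemma add (hF : IsContinuation n v F φ) (hF' : IsContinuation n v F' φ') :
    IsContinuation n v (F + F') (φ + φ') := by
  obtain ⟨⟨P, Q, hQ, hFP, hφ⟩, hs⟩ := hF
  obtain ⟨⟨P', Q', hQ', hFP', hφ'⟩, hs'⟩ := hF'
  refine ⟨⟨P * Q' + P' * Q, Q * Q', fun i => ?_, ?_, fun i => ?_⟩, ?_⟩
  · rw [map_mul]
    exact mul_ne_zero (hQ i) (hQ' i)
  · filter_upwards [hFP, hFP'] with k hk hk'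
    simp only [map_mul, map_add, ← hk, ← hk', Pi.add_apply]
    ring
  · simp only [map_mul, map_add, ← hφ, ← hφ', Pi.add_apply]
    ring
  · exact (hs.union hs').subset (Function.support_add _ _)

lemma smul (c : ℂ) (hF : IsContinuation n v F φ) :
    IsContinuation n v (c • F) fun i => laurentEval n v i (MvPolynomial.C c) * φ i := by
  obtain ⟨⟨P, Q, hQ, hFP, hφ⟩, hs⟩ := hF
  refine ⟨⟨MvPolynomial.C c * P, Q, hQ, ?_, fun i => ?_⟩, hs.subset fun i hi => ?_⟩
  · filter_upwards [hFP] with k hk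
    rw [map_mul, MvPolynomial.eval_C, ← hk, Pi.smul_apply, smul_eq_mul, mul_assoc]
  · rw [mul_assoc, hφ, map_mul]
  · rw [Function.mem_support, laurentEval_C] at hi
    exact right_ne_zero_of_mul hi

lemma zero : IsContinuation n v (0 : Spacetime d → ℂ) 0 :=
  ⟨⟨0, 1, by simp, by simp, by simp⟩, by
    refine Set.finite_empty.subset fun i hi => hi rfl⟩

/-- Polynomial substitutions. -/
lemma comp (hF : IsContinuation n v F φ) (g : Spacetime d → Spacetime d)
    (hg : MeasureTheory.Measure.QuasiMeasurePreserving g) (G : Fin d → MvPolynomial (Fin d) ℂ)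
    (hG : ∀ k j, MvPolynomial.eval (fun j => (k j : ℂ)) (G j) = (g k j : ℂ))
    (e : ℤˣ × Spacetime d ≃ ℤˣ × Spacetime d)
    (he : ∀ i j, complexEval n v i (G j) = complexPoint n v (e i) j) :
    IsContinuation n v (fun k => F (g k)) (fun i => φ (e i)) := by
  obtain ⟨⟨P, Q, hQ, hFP, hφ⟩, hs⟩ := hF
  have h1 (R : MvPolynomial (Fin d) ℂ) (k : Spacetime d) :
      MvPolynomial.eval (fun j => (k j : ℂ)) (MvPolynomial.bind₁ G R) =
      MvPolynomial.eval (fun j => (g k j : ℂ)) R := by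
    rw [MvPolynomial.eval, MvPolynomial.eval₂Hom_bind₁]
    change MvPolynomial.eval₂Hom _ (fun j => MvPolynomial.eval _ (G j)) R = _
    simp only [hG]
    rfl
  have h2 (R : MvPolynomial (Fin d) ℂ) (i : ℤˣ × Spacetime d) :
      laurentEval n v i (MvPolynomial.bind₁ G R) = laurentEval n v (e i) R := by
    rw [laurentEval, laurentEval, RingHom.comp_apply, RingHom.comp_apply, complexEval,
      MvPolynomial.eval₂Hom_bind₁]
    change HahnSeries.ofPowerSeries ℤ Scalars
      (MvPolynomial.eval₂Hom _ (fun j => complexEval n v i (G j)) R) = _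
    simp only [he]
    rfl
  refine ⟨⟨MvPolynomial.bind₁ G P, MvPolynomial.bind₁ G Q, fun i => ?_, ?_, fun i => ?_⟩, ?_⟩
  · rw [h2]; exact hQ _
  · filter_upwards [hg.ae hFP] with k hk
    rw [h1, h1]
    exact hk
  · rw [h2, h2]; exact hφ _
  · exact hs.preimage e.injective.injOn

lemma shift (hF : IsContinuation n v F φ) (a : Spacetime d) :
    IsContinuation n v (fun k => F (k + a)) fun i => φ (i.1, i.2 - a) :=
  hF.comp (fun k => k + a) (MeasureTheory.measurePreserving_add_right _ a).quasiMeasurePreserving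
    (fun j => MvPolynomial.X j + MvPolynomial.C (a j : ℂ))
    (fun k j => by
      rw [map_add, MvPolynomial.eval_X, MvPolynomial.eval_C, PiLp.add_apply, Complex.ofReal_add])
    ((Equiv.refl _).prodCongr (Equiv.subRight a)) fun i j => by
      simp only [complexEval, map_add, MvPolynomial.eval₂Hom_X', MvPolynomial.eval₂Hom_C, complexPoint,
        Equiv.prodCongr_apply, Prod.map, Equiv.subRight_apply, PiLp.sub_apply, Complex.ofReal_sub,
        map_sub, Equiv.refl_apply]
      ring

lemma reflect (hF : IsContinuation n v F φ) :
    IsContinuation n v (fun k => F (-k)) fun i => φ (-i.1, -i.2) :=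
  hF.comp (fun k => -k) (MeasureTheory.Measure.measurePreserving_neg _).quasiMeasurePreserving
    (fun j => - MvPolynomial.X j)
    (fun k j => by
      rw [map_neg, MvPolynomial.eval_X, PiLp.neg_apply, Complex.ofReal_neg])
    ((Equiv.neg _).prodCongr (Equiv.neg _)) fun i j => by
      simp only [complexEval, map_neg, MvPolynomial.eval₂Hom_X', complexPoint,
        Equiv.prodCongr_apply, Prod.map, Equiv.neg_apply, PiLp.neg_apply, Complex.ofReal_neg,
        signOf_neg, neg_mul]
      ring

end IsContinuation

include h in
lemma laurentEval_prod_ne_zero (s : Multiset (Spacetime d)) (i : ℤˣ × Spacetime d) :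
    laurentEval n v i (s.map sqPolynomial).prod ≠ 0 := by
  rw [laurentEval, RingHom.comp_apply, map_multiset_prod]
  rw [Ne, map_eq_zero_iff _ HahnSeries.ofPowerSeries_injective, Multiset.prod_eq_zero_iff]
  simp only [Multiset.map_map, Multiset.mem_map, Function.comp_apply, not_exists, not_and]
  exact fun q _ => complexEval_sqPolynomial_ne_zero h i q

include h in
-- Without a propagator at `i.2` the denominator is a unit of the power series ring, so there is no
-- pole.
lemma residue_eq_zero (P : MvPolynomial (Fin d) ℂ) {s : Multiset (Spacetime d)}
    {i : ℤˣ × Spacetime d} (hi : i.2 ∉ s) :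
    residue (laurentEval n v i P * (laurentEval n v i (s.map sqPolynomial).prod)⁻¹) = 0 := by
  have hu : IsUnit (complexEval n v i (s.map sqPolynomial).prod) := by
    rw [PowerSeries.isUnit_iff_constantCoeff, map_multiset_prod, map_multiset_prod,
      isUnit_iff_ne_zero, Ne, Multiset.prod_eq_zero_iff]
    simp only [Multiset.map_map, Multiset.mem_map, Function.comp_apply, not_exists, not_and]
    refine fun q hq => constantCoeff_complexEval_ne_zero h ?_
    rintro rfl
    exact hi hq
  obtain ⟨u, hu⟩ := hu
  have : laurentEval n v i P * (laurentEval n v i (s.map sqPolynomial).prod)⁻¹ =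
      HahnSeries.ofPowerSeries ℤ Scalars (complexEval n v i P * (↑u⁻¹ : PowerSeries Scalars)) := by
    have e := series_inv_mul_cancel (laurentEval_prod_ne_zero h s i)
    have e' : HahnSeries.ofPowerSeries ℤ Scalars (↑u⁻¹ : PowerSeries Scalars) *
        laurentEval n v i (s.map sqPolynomial).prod = 1 := by
      rw [laurentEval, RingHom.comp_apply, ← hu, ← map_mul, Units.inv_mul, map_one]
    rw [map_mul]
    change laurentEval n v i P * _ = laurentEval n v i P * _
    linear_combination laurentEval n v i P * HahnSeries.ofPowerSeries ℤ Scalars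
      (↑u⁻¹ : PowerSeries Scalars) * e - laurentEval n v i P *
      (laurentEval n v i (s.map sqPolynomial).prod)⁻¹ * e'
  rw [this]
  exact residue_ofPowerSeries _

include h in
lemma isContinuation_basic (P : MvPolynomial (Fin d) ℂ) (s : Multiset (Spacetime d)) [NeZero d] :
    IsContinuation n v (fun k => MvPolynomial.eval (fun j => (k j : ℂ)) P *
      ((s.map fun q => ((‖k + q‖ ^ 2 : ℝ) : ℂ)).prod)⁻¹)
      fun i => laurentEval n v i P * (laurentEval n v i (s.map sqPolynomial).prod)⁻¹ := by
  have hd : Nontrivial (Spacetime d) := by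
    have : Nonempty (Fin d) := ⟨0⟩
    infer_instance
  have hQ := laurentEval_prod_ne_zero h s
  refine ⟨⟨P, (s.map sqPolynomial).prod, hQ, ?_, fun i => ?_⟩, ?_⟩
  · have : ∀ᵐ k : Spacetime d, ∀ q ∈ s.toFinset, k ≠ -q := by
      rw [Filter.eventually_all_finset]
      intro q _
      simp [MeasureTheory.ae_iff]
    filter_upwards [this] with k hk
    have e : MvPolynomial.eval (fun j => (k j : ℂ)) (s.map sqPolynomial).prod =
        (s.map fun q => ((‖k + q‖ ^ 2 : ℝ) : ℂ)).prod := by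
      rw [map_multiset_prod, Multiset.map_map]
      simp only [Function.comp_def, eval_sqPolynomial]
    rw [e, mul_assoc, inv_mul_cancel₀, mul_one]
    rw [Ne, Multiset.prod_eq_zero_iff]
    simp only [Multiset.mem_map, not_exists, not_and]
    intro q hq
    have := hk q (Multiset.mem_toFinset.2 hq)
    rw [Ne, ← add_eq_zero_iff_eq_neg] at this
    simpa using this
  · have e : (laurentEval n v i (s.map sqPolynomial).prod)⁻¹ *
        laurentEval n v i (s.map sqPolynomial).prod = 1 := series_inv_mul_cancel (hQ i)
    rw [mul_assoc, e, mul_one]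
  · refine (Set.finite_univ.prod s.toFinset.finite_toSet).subset fun i hi => ?_
    refine ⟨Set.mem_univ _, ?_⟩
    by_contra hi'
    exact hi (residue_eq_zero h P (by simpa using hi'))

include h in
lemma exists_isContinuation [NeZero d] {F : Spacetime d → ℂ} (hF : F ∈ loopIntegrands d) :
    ∃ φ, IsContinuation n v F φ :=
  loopIntegrands_induction (C := fun F => ∃ φ, IsContinuation n v F φ)
    (fun P s => ⟨_, isContinuation_basic h P s⟩) ⟨_, .zero⟩
    (fun _ _ ⟨_, hφ⟩ ⟨_, hφ'⟩ => ⟨_, hφ.add hφ'⟩) (fun c _ ⟨_, hφ⟩ => ⟨_, hφ.smul c⟩) hF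

include h in
-- A shift or reflection of the loop momentum permutes the indices `(sign, q)`, so both terms of a
-- generator have the same sum of residues. The sums are finite because the residues vanish for all
-- but finitely many indices.
lemma exists_isContinuation_null [NeZero d] {H : Spacetime d → ℂ} (hH : H ∈ nullIntegrands d) :
    ∃ φ, IsContinuation n v H φ ∧ ∑ᶠ i, residue (φ i) = 0 := by
  have key {F F' : Spacetime d → ℂ} {φ : ℤˣ × Spacetime d → Series}
      (e : ℤˣ × Spacetime d ≃ ℤˣ × Spacetime d) (hF : IsContinuation n v F φ)
      (hF' : IsContinuation n v F' fun i => φ (e i)) :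
      ∃ φ, IsContinuation n v (fun k => F' k - F k) φ ∧ ∑ᶠ i, residue (φ i) = 0 := by
    refine ⟨fun i => φ (e i) + laurentEval n v i (MvPolynomial.C (-1)) * φ i, ?_, ?_⟩
    · convert hF'.add (hF.smul (-1)) using 1
      · ext k
        simp [sub_eq_add_neg]
      · rfl
    simp only [residue_add, laurentEval_C]
    rw [finsum_add_distrib hF'.2]
    · rw [finsum_comp_equiv e (f := fun i => residue (φ i))]
      simp only [map_neg, map_one, neg_one_mul, finsum_neg_distrib, add_neg_cancel]
    · exact (hF.smul (-1)).2 |>.subset fun i hi => by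
        rwa [Function.mem_support, laurentEval_C]
  induction hH using Submodule.span_induction with
  | mem x hx =>
    rcases hx with ⟨F, hF, q, rfl⟩ | ⟨F, hF, rfl⟩
    · obtain ⟨φ, hφ⟩ := exists_isContinuation h hF
      exact key ((Equiv.refl _).prodCongr (Equiv.subRight q)) hφ (hφ.shift q)
    · obtain ⟨φ, hφ⟩ := exists_isContinuation h hF
      exact key ((Equiv.neg _).prodCongr (Equiv.neg _)) hφ hφ.reflect
  | zero => exact ⟨0, .zero, by simp [residue]⟩
  | add x y _ _ hx hy =>
    obtain ⟨φ, hφ, h0⟩ := hx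
    obtain ⟨φ', hφ', h0'⟩ := hy
    refine ⟨_, hφ.add hφ', ?_⟩
    simp only [Pi.add_apply, residue_add]
    rw [finsum_add_distrib hφ.2 hφ'.2, h0, h0', add_zero]
  | smul c x _ hx =>
    obtain ⟨φ, hφ, h0⟩ := hx
    refine ⟨_, hφ.smul c, ?_⟩
    simp only [laurentEval_C]
    rw [← mul_finsum (fun i => residue (φ i)) _, h0, mul_zero]

include h in
-- The total residue is thus an invariant of the formal integral. It can certify that a formal
-- integral is nonzero although no convergent integral is at hand.
lemma finsum_residue_eq_zero [NeZero d] {F : Spacetime d → ℂ} {φ : ℤˣ × Spacetime d → Series}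
    (hF : IsContinuation n v F φ) (h0 : loopIntegral d F = 0) : ∑ᶠ i, residue (φ i) = 0 := by
  rw [← map_zero (loopIntegral d), ← loopEq_iff] at h0
  obtain ⟨H, hH, hFH⟩ := h0
  obtain ⟨φ', hφ', h'⟩ := exists_isContinuation_null h hH
  have h1 := (hF.add (hφ'.smul (-1))).eq_zero <| by
    filter_upwards [hFH] with k hk
    rw [Pi.sub_apply, Pi.zero_apply, sub_zero] at hk
    simp [hk]
  rw [← h']
  refine finsum_congr fun i => ?_
  have h2 := congrFun h1 i
  simp only [Pi.add_apply, Pi.zero_apply, map_neg, map_one] at h2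
  rw [show φ i = φ' i by linear_combination h2]

end Residue

end

end NicolaiMap

namespace NicolaiMap

noncomputable section

open scoped BigOperators LaurentSeries

set_option linter.unusedSectionVars false
set_option linter.unusedSimpArgs false

/-! ### A background field with nonvanishing vacuum polarisation -/

section VacuumPolarisation

variable {d : ℕ}

/-- The numerator of the vacuum polarisation integrand. -/
def bubblePolynomial (j : Fin d) (p : Spacetime d) : MvPolynomial (Fin d) ℂ :=
  2 * (MvPolynomial.X j * (MvPolynomial.X j + MvPolynomial.C (p j : ℂ)))
    - ∑ l, MvPolynomial.X l * (MvPolynomial.X l + MvPolynomial.C (p l : ℂ))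

/-- The vacuum polarisation integrand. -/
def bubble (j : Fin d) (p : Spacetime d) (k : Spacetime d) : ℂ :=
  MvPolynomial.eval (fun l => (k l : ℂ)) (bubblePolynomial j p) *
    ((({0, p} : Multiset (Spacetime d)).map fun q => ((‖k + q‖ ^ 2 : ℝ) : ℂ)).prod)⁻¹

lemma bubble_mem (j : Fin d) (p : Spacetime d) : bubble j p ∈ loopIntegrands d :=
  loopIntegrands_basic _ _

lemma bubble_eq (j : Fin d) (p k : Spacetime d) :
    bubble j p k = (2 * ((k j : ℂ) * (k + p) j) - ∑ l, (k l : ℂ) * (k + p) l) *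
      (((‖k‖ ^ 2 : ℝ) : ℂ)⁻¹ * ((‖k + p‖ ^ 2 : ℝ) : ℂ)⁻¹) := by
  simp only [bubble, bubblePolynomial, map_sub, map_mul, map_add, map_sum, MvPolynomial.eval_X,
    MvPolynomial.eval_C, map_ofNat, Multiset.insert_eq_cons, Multiset.map_cons,
    Multiset.map_singleton, Multiset.prod_cons, Multiset.prod_singleton, add_zero, mul_inv,
    PiLp.add_apply, Complex.ofReal_add]

lemma bubble_neg (j : Fin d) (p k : Spacetime d) : bubble j p (-k) = bubble j (-p) k := by
  rw [bubble_eq, bubble_eq, show -k + p = -(k + -p) by abel, norm_neg, norm_neg]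
  congr 1
  simp only [PiLp.neg_apply, Complex.ofReal_neg, neg_mul_neg]

lemma constantCoeff_complexPoint (n v : Fin d → ℂ) (i : ℤˣ × Spacetime d) (j : Fin d) :
    PowerSeries.constantCoeff (complexPoint n v i j) =
      algebraMap ℂ Scalars (signOf i.1 * n j) * RatFunc.X - algebraMap ℂ Scalars (i.2 j) := by
  simp only [complexPoint, map_sub, map_add, map_mul PowerSeries.constantCoeff,
    constantCoeff_constSeries, PowerSeries.constantCoeff_C, PowerSeries.constantCoeff_X, zero_mul,
    add_zero]

/-- At `t = 0` either `k` or `k + p` equals `σ s n`, and the polarisation component of the momentum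
vanishes. The numerator is then `-σ s` at the first propagator and `σ s` at the second, and `s`
cancels against the `4 s` of the pole. -/
lemma residue_bubble {n v : Fin d → ℂ} (h : IsNullFrame n v) {j : Fin d} {p : Spacetime d}
    (hp : ∑ l, (p l : ℂ) * (p l : ℂ) = 1) (hn : ∑ l, n l * (p l : ℂ) = 1) (hj : n j = 0) (hpj : p j = 0)
    (σ : ℤˣ) :
    residue (laurentEval n v (σ, 0) (bubblePolynomial j p) *
        (laurentEval n v (σ, 0) ((({0, p} : Multiset (Spacetime d)).map sqPolynomial).prod))⁻¹) =
      - algebraMap ℂ Scalars (signOf σ) /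
        (4 * (1 + 2 * algebraMap ℂ Scalars (signOf σ) * RatFunc.X)) ∧
    residue (laurentEval n v (σ, p) (bubblePolynomial j p) *
        (laurentEval n v (σ, p) ((({0, p} : Multiset (Spacetime d)).map sqPolynomial).prod))⁻¹) =
      algebraMap ℂ Scalars (signOf σ) /
        (4 * (1 - 2 * algebraMap ℂ Scalars (signOf σ) * RatFunc.X)) := by
  have hp' : ∑ l, (-(p l : ℂ)) * (-(p l : ℂ)) = 1 := by simpa using hp
  have hn' : ∑ l, n l * (-(p l : ℂ)) = -1 := by simp [hn]
  have hprod (i : ℤˣ × Spacetime d) :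
      complexEval n v i (({0, p} : Multiset (Spacetime d)).map sqPolynomial).prod =
        complexEval n v i (sqPolynomial 0) * complexEval n v i (sqPolynomial p) := by
    simp only [Multiset.insert_eq_cons, Multiset.map_cons, Multiset.map_singleton,
      Multiset.prod_cons, Multiset.prod_singleton, map_mul]
  have hdiag (q : Spacetime d) : complexEval n v (σ, q) (sqPolynomial q) =
      PowerSeries.X * (constSeries 4 * PowerSeries.C RatFunc.X) := by
    rw [complexEval_sqPolynomial h]
    simp
  have hP (q : Spacetime d) : PowerSeries.constantCoeff
      (complexEval n v (σ, q) (bubblePolynomial j p)) =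
      2 * ((algebraMap ℂ Scalars (signOf σ * n j) * RatFunc.X - algebraMap ℂ Scalars (q j)) *
        (algebraMap ℂ Scalars (signOf σ * n j) * RatFunc.X - algebraMap ℂ Scalars (q j)
          + algebraMap ℂ Scalars (p j))) -
      ∑ l, (algebraMap ℂ Scalars (signOf σ * n l) * RatFunc.X - algebraMap ℂ Scalars (q l)) *
        (algebraMap ℂ Scalars (signOf σ * n l) * RatFunc.X - algebraMap ℂ Scalars (q l)
          + algebraMap ℂ Scalars (p l)) := by
    simp only [complexEval, bubblePolynomial, map_sub, map_mul, map_add, map_sum,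
      MvPolynomial.eval₂Hom_X', MvPolynomial.eval₂Hom_C, constantCoeff_complexPoint, map_ofNat,
      constantCoeff_constSeries]
  have hs : algebraMap ℂ Scalars (signOf σ) * algebraMap ℂ Scalars (signOf σ) = 1 := by
    rw [← map_mul, signOf_mul_self, map_one]
  have hX : (RatFunc.X : Scalars) ≠ 0 := RatFunc.X_ne_zero
  have h4 : (4 : Scalars) ≠ 0 := by simp
  have hu (c : ℂ) (hc : c ≠ 0) : 1 + algebraMap ℂ Scalars c * RatFunc.X ≠ 0 := by
    have := linear_ne_zero (α := 1) (β := c) (.inl one_ne_zero)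
    rwa [map_one] at this
  have hσ : signOf σ ≠ 0 := left_ne_zero_of_mul_eq_one (signOf_mul_self σ)
  constructor
  · have hc := constantCoeff_complexEval h (σ, 0) p
    simp only [sub_zero, hp, hn, mul_one, map_one] at hc
    have hU : PowerSeries.constantCoeff ((constSeries 4 * PowerSeries.C RatFunc.X) *
        complexEval n v (σ, 0) (sqPolynomial p)) =
        4 * RatFunc.X * (1 + algebraMap ℂ Scalars (2 * signOf σ) * RatFunc.X) := by
      rw [map_mul, hc, map_mul, constantCoeff_constSeries, PowerSeries.constantCoeff_C, map_ofNat]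
    have hU0 := hu (2 * signOf σ) (mul_ne_zero two_ne_zero hσ)
    rw [residue_of_mul_eq (W := complexEval n v (σ, 0) (bubblePolynomial j p))
      (U := (constSeries 4 * PowerSeries.C RatFunc.X) * complexEval n v (σ, 0) (sqPolynomial p))]
    · rw [hU, hP]
      have e (l : Fin d) : (algebraMap ℂ Scalars (signOf σ * n l) * RatFunc.X
            - algebraMap ℂ Scalars ((0 : Spacetime d) l)) *
          (algebraMap ℂ Scalars (signOf σ * n l) * RatFunc.X
            - algebraMap ℂ Scalars ((0 : Spacetime d) l) + algebraMap ℂ Scalars (p l)) =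
          algebraMap ℂ Scalars (n l * n l) * RatFunc.X ^ 2 +
          algebraMap ℂ Scalars (n l * p l) * (algebraMap ℂ Scalars (signOf σ) * RatFunc.X) := by
        simp only [PiLp.zero_apply, Complex.ofReal_zero, map_zero, map_mul]
        linear_combination (algebraMap ℂ Scalars (n l) * algebraMap ℂ Scalars (n l) *
          RatFunc.X ^ 2) * hs
      simp only [e, Finset.sum_add_distrib, ← Finset.sum_mul, ← map_sum, h.left, hn, hj, hpj]
      simp only [PiLp.zero_apply, Complex.ofReal_zero, map_zero, map_one, map_mul, map_ofNat] at hU0 ⊢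
      field_simp
      ring
    · rw [hU]
      exact mul_ne_zero (mul_ne_zero h4 hX) hU0
    · rw [← mul_assoc, ← hdiag 0, ← hprod, mul_assoc]
      change _ * (_ * laurentEval n v _ _) = _
      rw [series_inv_mul_cancel (laurentEval_prod_ne_zero h _ _), mul_one]
      rfl
  · have hc := constantCoeff_complexEval h (σ, p) 0
    simp only [zero_sub, PiLp.neg_apply, Complex.ofReal_neg, hp', hn', map_one] at hc
    have hU : PowerSeries.constantCoeff ((constSeries 4 * PowerSeries.C RatFunc.X) *
        complexEval n v (σ, p) (sqPolynomial 0)) =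
        4 * RatFunc.X * (1 + algebraMap ℂ Scalars (2 * signOf σ * -1) * RatFunc.X) := by
      rw [map_mul, hc, map_mul, constantCoeff_constSeries, PowerSeries.constantCoeff_C, map_ofNat]
    have hU0 := hu (2 * signOf σ * -1) (by simpa using hσ)
    rw [residue_of_mul_eq (W := complexEval n v (σ, p) (bubblePolynomial j p))
      (U := (constSeries 4 * PowerSeries.C RatFunc.X) * complexEval n v (σ, p) (sqPolynomial 0))]
    · rw [hU, hP]
      have e (l : Fin d) : (algebraMap ℂ Scalars (signOf σ * n l) * RatFunc.X
            - algebraMap ℂ Scalars (p l)) *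
          (algebraMap ℂ Scalars (signOf σ * n l) * RatFunc.X
            - algebraMap ℂ Scalars (p l) + algebraMap ℂ Scalars (p l)) =
          algebraMap ℂ Scalars (n l * n l) * RatFunc.X ^ 2 -
          algebraMap ℂ Scalars (n l * p l) * (algebraMap ℂ Scalars (signOf σ) * RatFunc.X) := by
        simp only [map_mul]
        linear_combination (algebraMap ℂ Scalars (n l) * algebraMap ℂ Scalars (n l) *
          RatFunc.X ^ 2) * hs
      simp only [e, Finset.sum_sub_distrib, ← Finset.sum_mul, ← map_sum, h.left, hn, hj, hpj]
      simp only [Complex.ofReal_zero, map_zero, map_one, map_mul, map_ofNat, map_neg] at hU0 ⊢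
      have hU0' : 1 - 2 * algebraMap ℂ Scalars (signOf σ) * RatFunc.X ≠ 0 := by
        intro e; apply hU0; linear_combination e
      rw [show (1 + 2 * algebraMap ℂ Scalars (signOf σ) * -1 * RatFunc.X) =
        1 - 2 * algebraMap ℂ Scalars (signOf σ) * RatFunc.X by ring]
      field_simp
      ring
    · rw [hU]
      exact mul_ne_zero (mul_ne_zero h4 hX) hU0
    · rw [← mul_assoc, ← hdiag p, mul_comm (complexEval n v (σ, p) (sqPolynomial p)), ← hprod,
        mul_assoc]
      change _ * (_ * laurentEval n v _ _) = _
      rw [series_inv_mul_cancel (laurentEval_prod_ne_zero h _ _), mul_one]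
      rfl

/-- The four residues, two signs at each of two propagators, add up to `2 s / (1 - 4 s²)`. -/
lemma loopIntegral_bubble_ne_zero [NeZero d] {n v : Fin d → ℂ} (h : IsNullFrame n v) {j : Fin d}
    {p : Spacetime d} (hp : ∑ l, (p l : ℂ) * (p l : ℂ) = 1) (hn : ∑ l, n l * (p l : ℂ) = 1)
    (hj : n j = 0) (hpj : p j = 0) : loopIntegral d (bubble j p) ≠ 0 := by
  intro h0
  have h1 := finsum_residue_eq_zero h
    (isContinuation_basic h (bubblePolynomial j p) ({0, p} : Multiset (Spacetime d))) h0
  have hp0 : (0 : Spacetime d) ≠ p := by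
    rintro rfl
    simp at hp
  rw [finsum_eq_sum_of_support_subset
    (s := (Finset.univ : Finset ℤˣ) ×ˢ ({0, p} : Finset (Spacetime d))), Finset.sum_product] at h1
  · have hσ (σ : ℤˣ) := residue_bubble h hp hn hj hpj σ
    simp only [Finset.sum_pair hp0, (hσ _).1, (hσ _).2] at h1
    rw [show (Finset.univ : Finset ℤˣ) = {1, -1} from rfl, Finset.sum_pair (by decide)] at h1
    have u1 : (1 : Scalars) + 2 * RatFunc.X ≠ 0 := by
      have := linear_ne_zero (α := 1) (β := 2) (.inl one_ne_zero)
      rwa [map_one, map_ofNat] at this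
    have u2 : (1 : Scalars) - 2 * RatFunc.X ≠ 0 := by
      have := linear_ne_zero (α := 1) (β := -2) (.inl one_ne_zero)
      rwa [map_one, map_neg, map_ofNat, neg_mul, ← sub_eq_add_neg] at this
    have h4 : (4 : Scalars) ≠ 0 := by simp
    have s1 : signOf 1 = 1 := by simp [signOf]
    rw [signOf_neg, s1, map_neg, map_one, mul_one, mul_neg_one, neg_mul, ← sub_eq_add_neg,
      sub_neg_eq_add, neg_neg] at h1
    field_simp at h1
    have h2 : (RatFunc.X : Scalars) * 8 = 0 := by linear_combination h1
    refine mul_ne_zero RatFunc.X_ne_zero ?_ h2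
    rw [show (8 : Scalars) = 4 + 4 by norm_num, ← two_mul]
    refine mul_ne_zero ?_ h4
    intro e
    apply h4
    linear_combination 2 * e
  · intro i hi
    by_contra hi'
    exact hi (residue_eq_zero h _ (by simpa [Int.units_eq_one_or] using hi'))

variable {ι : Type*} [Fintype ι] [DecidableEq ι] {f : ι → ι → ι → ℝ} {N : ℝ}

/-- Two opposite plane waves. -/
def standingWave (p : Spacetime d) : PlaneWaves d :=
  AddMonoidAlgebra.single p 1 + AddMonoidAlgebra.single (-p) 1

/-- A standing wave with one colour and one polarisation. -/
def waveField (a₀ : ι) (j : Fin d) (p : Spacetime d) : GaugeField ι d (PlaneWaves d) := fun a μ =>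
  if μ = j then (Pi.single a₀ (standingWave p) : ι → PlaneWaves d) a else 0

lemma isLandauField_waveField (a₀ : ι) {j : Fin d} {p : Spacetime d} (hp : p ≠ 0) (hj : p j = 0) :
    IsLandauField (waveField a₀ j p) := by
  constructor
  · intro a
    rw [divergence, Finset.sum_eq_single j]
    · rw [waveField, if_pos rfl]
      change multiplier _ _ = 0
      by_cases ha : a = a₀
      · subst ha
        rw [Pi.single_eq_same, standingWave, map_add, multiplier_single, multiplier_single]
        simp [hj]
      · rw [Pi.single_eq_of_ne ha, map_zero]
    · intro μ _ hμ
      rw [waveField, if_neg hμ]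
      exact map_zero (multiplier fun p : Spacetime d => Complex.I * (p μ : ℂ))
    · simp
  · intro a μ
    rw [waveField]
    split_ifs
    · by_cases ha : a = a₀
      · subst ha
        rw [Pi.single_eq_same, standingWave]
        simp [hp]
      · rw [Pi.single_eq_of_ne ha]; rfl
    · rfl

lemma adjointOp_standingWave (a₀ : ι) (p : Spacetime d) (c : ι) (k : Spacetime d) (z : ℂ) :
    adjointOp f (Pi.single a₀ (standingWave p)) (Pi.single c (AddMonoidAlgebra.single k z)) =
      ∑ b, (f b a₀ c : ℂ) • (Pi.single b (AddMonoidAlgebra.single (p + k) z) +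
        Pi.single b (AddMonoidAlgebra.single (-p + k) z)) := by
  rw [adjointOp_apply]
  ext a : 1
  rw [bracket_apply, Finset.sum_apply, Finset.sum_eq_single a₀, Finset.sum_eq_single c,
    Finset.sum_eq_single a]
  · simp only [Pi.smul_apply, Pi.add_apply, Pi.single_eq_same, standingWave, add_mul,
      AddMonoidAlgebra.single_mul_single, one_mul]
    rw [Complex.coe_smul]
  · intro b _ hb
    simp [Pi.single_eq_of_ne hb.symm]
  · simp
  · intro b _ hb
    simp [Pi.single_eq_of_ne hb]
  · simp
  · intro b _ hb
    simp [Pi.single_eq_of_ne hb]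
  · simp

lemma sum_structureConstants_mul (hf : IsStructureConstants f N) (a₀ : ι) :
    ∑ c, ∑ b, (f c a₀ b : ℂ) * f b a₀ c = - N := by
  have h := hf.casimir a₀ a₀
  rw [if_pos rfl] at h
  rw [← h]
  push_cast
  rw [← Finset.sum_neg_distrib]
  refine Finset.sum_congr rfl fun c _ => ?_
  rw [← Finset.sum_neg_distrib]
  refine Finset.sum_congr rfl fun b _ => ?_
  rw [hf.antisymm_left a₀ c b, hf.antisymm_left a₀ b c, hf.antisymm_right a₀ c b]
  push_cast
  ring

/-- Since `2 p ≠ 0`, the momentum returns to `k` only if the two insertions transfer opposite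
momenta. The colour trace gives `-N`. -/
lemma diagonal_standingWave (hf : IsStructureConstants f N) (a₀ : ι) {p : Spacetime d} (hp : p ≠ 0)
    (m : Spacetime d → ℂ) (k : Spacetime d) :
    diagonal (multiplierOp ι m * (adjointOp f (Pi.single a₀ (standingWave p)) *
      (multiplierOp ι m * adjointOp f (Pi.single a₀ (standingWave p))))) k =
      - N * (m k * (m (k + p) + m (k + -p))) := by
  have h1 : p + (p + k) ≠ k := by
    intro e
    have : (2 : ℝ) • p = 0 := by rw [two_smul, ← add_right_cancel_iff (a := k), add_assoc, e, zero_add]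
    exact hp ((smul_eq_zero.1 this).resolve_left two_ne_zero)
  have h2 : -p + (-p + k) ≠ k := by
    intro e
    apply h1
    nth_rewrite 1 [← e]
    abel
  rw [diagonal_apply, ← sum_structureConstants_mul hf a₀, Finset.sum_mul]
  refine Finset.sum_congr rfl fun c _ => ?_
  simp only [Module.End.mul_apply, adjointOp_standingWave, map_sum, map_smul, map_add,
    multiplierOp_single, Finset.sum_apply, Pi.smul_apply, Pi.add_apply,
    Finset.sum_mul]
  rw [AddMonoidAlgebra.coeff_sum, Finsupp.finsetSum_apply]
  refine Finset.sum_congr rfl fun b _ => ?_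
  rw [AddMonoidAlgebra.coeff_smul, Finsupp.smul_apply, AddMonoidAlgebra.coeff_add, Finsupp.add_apply,
    AddMonoidAlgebra.coeff_sum, AddMonoidAlgebra.coeff_sum, Finsupp.finsetSum_apply,
    Finsupp.finsetSum_apply, Finset.sum_eq_single c, Finset.sum_eq_single c]
  · simp only [AddMonoidAlgebra.coeff_smul, AddMonoidAlgebra.coeff_add, Finsupp.smul_apply,
      Finsupp.add_apply, Pi.single_eq_same, AddMonoidAlgebra.coeff_single, Finsupp.single_apply,
      if_neg h1, if_neg h2, neg_add_cancel_left, add_neg_cancel_left, if_true, mul_one, zero_add,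
      add_zero, smul_eq_mul]
    rw [add_comm p k, add_comm (-p) k]
    ring
  · intro e _ he
    simp [Pi.single_eq_of_ne he.symm]
  · simp
  · intro e _ he
    simp [Pi.single_eq_of_ne he.symm]
  · simp

lemma toEnd_propagatorDeriv [NeZero d] (μ : Fin d) :
    (TraceCalculus.Background.p (planeTrace ι d) μ).toEnd =
      multiplierOp ι fun k => Complex.I * (k μ : ℂ) * (((‖k‖ ^ 2 : ℝ) : ℂ)⁻¹) := by
  rw [TraceCalculus.Background.p, map_mul]
  exact multiplierOp_mul _ _

lemma loopIntegral_bubble_neg (j : Fin d) (p : Spacetime d) :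
    loopIntegral d (bubble j (-p)) = loopIntegral d (bubble j p) :=
  (congrArg (loopIntegral d) (funext fun k => (bubble_neg j p k).symm)).trans
    (loopIntegral_neg (bubble_mem j p))

lemma loopIntegral_bubble_add (c : ℂ) (j : Fin d) (p : Spacetime d) :
    (2 * c : ℂ) • loopIntegral d (bubble j p) =
      loopIntegral d (c • (bubble j p + bubble j (-p))) := by
  rw [map_smul (loopIntegral d), map_add (loopIntegral d), loopIntegral_bubble_neg, ← two_smul ℂ,
    smul_smul, mul_comm]

/-- The two orders of the transfers `p` and `-p` give bubbles that agree by reflection, hence the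
`2`. The sign of the colour factor `-N` is compensated by `i²` from the two derivatives. -/
lemma spinorSquare_of_standingWave [NeZero d] (hf : IsStructureConstants f N) (a₀ : ι) {j : Fin d}
    {p : Spacetime d} (hp : p ≠ 0) {B : (planeTrace ι d).Background} (ha : ∀ μ ≠ j, B.a μ = 0)
    (haj : (B.a j).toEnd = adjointOp f (Pi.single a₀ (standingWave p))) :
    B.spinorSquare = (2 * N : ℂ) • loopIntegral d (bubble j p) := by
  have ht (μ : Fin d) : (planeTrace ι d).tr (TraceCalculus.Background.p (planeTrace ι d) μ *
      (B.a j * (TraceCalculus.Background.p (planeTrace ι d) μ * B.a j))) =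
      loopIntegral d fun k => N * (((k μ : ℂ) * (k + p) μ) *
        (((‖k‖ ^ 2 : ℝ) : ℂ)⁻¹ * ((‖k + p‖ ^ 2 : ℝ) : ℂ)⁻¹) + ((k μ : ℂ) * (k + -p) μ) *
        (((‖k‖ ^ 2 : ℝ) : ℂ)⁻¹ * ((‖k + -p‖ ^ 2 : ℝ) : ℂ)⁻¹)) := by
    change loopIntegral d (diagonal _) = _
    congr 1
    ext k
    rw [AlgHom.toLinearMap_apply, map_mul LoopAlgebra.toEnd, map_mul LoopAlgebra.toEnd,
      map_mul LoopAlgebra.toEnd, haj, toEnd_propagatorDeriv,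
      diagonal_standingWave hf a₀ hp]
    linear_combination (- N * ((k μ : ℂ) * (k + p) μ) *
        (((‖k‖ ^ 2 : ℝ) : ℂ)⁻¹ * ((‖k + p‖ ^ 2 : ℝ) : ℂ)⁻¹) - N * ((k μ : ℂ) * (k + -p) μ) *
        (((‖k‖ ^ 2 : ℝ) : ℂ)⁻¹ * ((‖k + -p‖ ^ 2 : ℝ) : ℂ)⁻¹)) * Complex.I_mul_I
  have hK : B.K = TraceCalculus.Background.p (planeTrace ι d) j * B.a j := by
    rw [TraceCalculus.Background.K, Finset.sum_eq_single j]
    · exact fun μ _ hμ => by rw [ha μ hμ, mul_zero]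
    · simp
  have hs (ρ : Fin d) : ∑ l, (planeTrace ι d).tr (TraceCalculus.Background.p (planeTrace ι d) ρ *
      (B.a l * (TraceCalculus.Background.p (planeTrace ι d) ρ * B.a l))) =
      (planeTrace ι d).tr (TraceCalculus.Background.p (planeTrace ι d) ρ *
      (B.a j * (TraceCalculus.Background.p (planeTrace ι d) ρ * B.a j))) := by
    rw [Finset.sum_eq_single j]
    · exact fun μ _ hμ => by rw [ha μ hμ, zero_mul, mul_zero, map_zero]
    · simp
  rw [TraceCalculus.Background.spinorSquare, hK, mul_assoc, loopIntegral_bubble_add]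
  simp only [hs, ht]
  rw [← map_smul (loopIntegral d), ← map_sum (loopIntegral d), ← map_sub (loopIntegral d)]
  refine congrArg (loopIntegral d) (funext fun k => ?_)
  simp only [Pi.sub_apply, Pi.smul_apply, Pi.add_apply, Finset.sum_apply, smul_eq_mul, bubble_eq,
    ← Finset.mul_sum, Finset.sum_add_distrib, ← Finset.sum_mul]
  ring

lemma spinorSquare_waveField [NeZero d] (hf : IsStructureConstants f N) (a₀ : ι) {j : Fin d}
    {p : Spacetime d} (hp : p ≠ 0) (hj : p j = 0) :
    (background hf (isLandauField_waveField a₀ hp hj)).spinorSquare =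
      (2 * N : ℂ) • loopIntegral d (bubble j p) := by
  exact spinorSquare_of_standingWave hf a₀ hp
    (fun μ hμ => by
      change ad f (fun a => waveField a₀ j p a μ) = 0
      simp only [waveField, if_neg hμ]
      exact map_zero (ad f))
    (by
      change adjointOp f (fun a => waveField a₀ j p a j) = _
      simp only [waveField, if_true])

lemma exists_isLandauField_spinorSquare_ne_zero [NeZero d] (hd : 3 ≤ d) (hf : IsStructureConstants f N)
    (hN : N ≠ 0) (a₀ : ι) :
    ∃ (A : GaugeField ι d (PlaneWaves d)) (hA : IsLandauField A),
      (background hf hA).spinorSquare ≠ 0 := by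
  -- The momentum points along the first axis, the polarisation along the second, and the null
  -- vectors are `e₀ ± i e₂`. The three directions needed are available because `3 ≤ d`.
  let i₀ : Fin d := ⟨0, by omega⟩
  let i₁ : Fin d := ⟨1, by omega⟩
  let i₂ : Fin d := ⟨2, by omega⟩
  have h01 : i₁ ≠ i₀ := by simp [i₀, i₁]
  have h02 : i₂ ≠ i₀ := by simp [i₀, i₂]
  have h12 : i₁ ≠ i₂ := by simp [i₁, i₂]
  let p : Spacetime d := EuclideanSpace.single i₀ 1
  have hp : p ≠ 0 := by simp [p]
  have hj : p i₁ = 0 := by simp [p, h01]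
  let n (s : ℂ) : Fin d → ℂ := Pi.single i₀ 1 + Pi.single i₂ s
  have hn (s t : ℂ) : ∑ j, n s j * n t j = 1 + s * t := by
    simp [n, add_mul, mul_add, Finset.sum_add_distrib, Pi.single_apply, h02, h02.symm]
  have hnp (s : ℂ) : ∑ l, n s l * (p l : ℂ) = 1 := by
    simp [n, p, add_mul, Finset.sum_add_distrib, Pi.single_apply, h02, h02.symm]
  refine ⟨_, isLandauField_waveField a₀ hp hj, ?_⟩
  rw [spinorSquare_waveField hf a₀ hp hj]
  refine smul_ne_zero (by simpa using hN)
    (loopIntegral_bubble_ne_zero (n := n Complex.I) (v := n (-Complex.I)) ⟨?_, ?_, ?_⟩ ?_ (hnp _)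
      ?_ hj)
  · rw [hn, Complex.I_mul_I]; ring
  · rw [hn, neg_mul_neg, Complex.I_mul_I]; ring
  · rw [hn, mul_neg, Complex.I_mul_I]; ring
  · simp [p, Pi.single_apply, apply_ite (fun x : ℝ => (x : ℂ))]
  · simp [n, h01, h12]

end VacuumPolarisation

end

end NicolaiMap

namespace NicolaiMap

noncomputable section

open scoped BigOperators

set_option linter.unusedSectionVars false

/-! ### The gauge condition and the action in an abstract calculus -/

/-- A multiplet calculus with submodules `N`, `H`, `B` of rapidly decaying, decaying and bounded
fields, and with an invariant pairing. -/
structure DecayCalculus (d : ℕ) (V : Type*) [AddCommGroup V] [Module ℝ V] extends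
    MultipletCalculus d V where
  N : Submodule ℝ V
  H : Submodule ℝ V
  B : Submodule ℝ V
  N_le : N ≤ H
  H_le : H ≤ B
  br_H : ∀ {X Y}, X ∈ H → Y ∈ H → br X Y ∈ N
  br_N : ∀ {X Y}, X ∈ B → Y ∈ N → br X Y ∈ N
  D_N : ∀ {X} μ, X ∈ N → D μ X ∈ N
  D_H : ∀ {X} μ, X ∈ H → D μ X ∈ H
  dG_mem : ∀ {X} μ, X ∈ N → dG μ X ∈ H
  G_mem : ∀ {X}, X ∈ N → G X ∈ B
  D_br : ∀ {X Y} μ, X ∈ B → Y ∈ B → D μ (br X Y) = br (D μ X) Y + br X (D μ Y)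
  D_comm : ∀ {X} μ ν, X ∈ B → D μ (D ν X) = D ν (D μ X)
  D_G : ∀ {X} μ, X ∈ N → D μ (G X) = dG μ X
  D_dG : ∀ {X} μ ν, X ∈ N → D μ (dG ν X) = dG ν (D μ X)
  laplace : ∀ {X}, X ∈ N → ∑ μ, D μ (dG μ X) = - X
  br_swap : ∀ X Y, br X Y = - br Y X
  jacobi : ∀ X Y Z, br X (br Y Z) + br Y (br Z X) + br Z (br X Y) = 0
  pair : V →ₗ[ℝ] V →ₗ[ℝ] ℝ
  pair_comm : ∀ X Y, pair X Y = pair Y X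
  pair_br : ∀ X Y Z, pair X (br Y Z) = pair (br X Y) Z
  pair_D : ∀ {X Y} μ, X ∈ H → Y ∈ H → pair (D μ X) Y = - pair X (D μ Y)

namespace DecayCalculus

variable {d : ℕ} {V : Type*} [AddCommGroup V] [Module ℝ V] (C : DecayCalculus d V)

/-- The pairing of two-forms. -/
def pair₂ : (Fin d → Fin d → V) →ₗ[ℝ] (Fin d → Fin d → V) →ₗ[ℝ] ℝ :=
  LinearMap.mk₂ ℝ (fun Y Z => ∑ μ, ∑ ν, C.pair (Y μ ν) (Z μ ν))
    (fun X X' Y => by simp [Finset.sum_add_distrib])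
    (fun r X Y => by simp [Finset.mul_sum])
    (fun X Y Y' => by simp [Finset.sum_add_distrib])
    (fun r X Y => by simp [Finset.mul_sum])

lemma pair₂_apply (Y Z : Fin d → Fin d → V) :
    C.pair₂ Y Z = ∑ μ, ∑ ν, C.pair (Y μ ν) (Z μ ν) := rfl

lemma pair₂_comm (Y Z : Fin d → Fin d → V) : C.pair₂ Y Z = C.pair₂ Z Y := by
  rw [pair₂_apply, pair₂_apply]
  exact Finset.sum_congr rfl fun μ _ => Finset.sum_congr rfl fun ν _ => C.pair_comm _ _

/-- The exterior derivative of a one-form. -/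
def ext (X : Fin d → V) (μ ν : Fin d) : V := C.D μ (X ν) - C.D ν (X μ)

/-- The one-form `dG · Z`. -/
def coexact (Z : Fin d → Fin d → V) (μ : Fin d) : V := ∑ ρ, C.dG ρ (Z ρ μ)

/-- The codifferential of a three-form. -/
def codiff (X : Fin d → Fin d → Fin d → V) (μ ν : Fin d) : V := ∑ ρ, C.D ρ (X ρ μ ν)

/-- The contraction of a three-form with a one-form. -/
def contract (X : Fin d → Fin d → Fin d → V) (a : Fin d → V) (ρ μ : Fin d) : V :=
  ∑ l, C.br (X ρ μ l) (a l)

/-- The two-form `[a, b]`. -/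
def wedge (a b : Fin d → V) (μ ν : Fin d) : V := C.br (a μ) (b ν) - C.br (a ν) (b μ)

variable {C}

lemma D_dG_comm {X : V} (hX : X ∈ C.N) (μ ν : Fin d) : C.D μ (C.dG ν X) = C.D ν (C.dG μ X) := by
  rw [← C.D_G ν hX, ← C.D_G μ hX, C.D_comm _ _ (C.G_mem hX)]

lemma sum_swap_eq_zero {W : Type*} [AddCommGroup W] [Module ℝ W] {Φ : Fin d → Fin d → W}
    (h : ∀ μ ν, Φ ν μ = - Φ μ ν) : ∑ μ, ∑ ν, Φ μ ν = 0 := by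
  apply MultipletCalculus.eq_zero_of_eq_neg_self
  refine Finset.sum_comm.trans ?_
  rw [← Finset.sum_neg_distrib]
  refine Finset.sum_congr rfl fun μ _ => ?_
  rw [← Finset.sum_neg_distrib]
  exact Finset.sum_congr rfl fun ν _ => h _ _

lemma sum_rotate {W : Type*} [AddCommMonoid W] (Φ : Fin d → Fin d → Fin d → W) :
    ∑ μ, ∑ ν, ∑ ρ, Φ μ ν ρ = ∑ ρ, ∑ μ, ∑ ν, Φ μ ν ρ := by
  rw [Finset.sum_congr rfl fun μ _ => Finset.sum_comm, Finset.sum_comm]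

section TwoForm

variable {Z W : Fin d → Fin d → V} (hZ : ∀ μ ν, Z μ ν ∈ C.N) (hZ' : ∀ μ ν, Z ν μ = - Z μ ν)
  (hW : ∀ μ ν, W μ ν ∈ C.N) (hW' : ∀ μ ν, W ν μ = - W μ ν)

include hZ in
lemma coexact_mem (μ : Fin d) : C.coexact Z μ ∈ C.H :=
  Submodule.sum_mem _ fun _ _ => C.dG_mem _ (hZ _ _)

include hZ hZ' in
-- `D_μ dG_ρ` is symmetric in its indices and `Z` antisymmetric. Every correction in the map has
-- this form, which is the gauge condition.
lemma sum_D_coexact : ∑ μ, C.D μ (C.coexact Z μ) = 0 := by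
  simp only [coexact, map_sum]
  refine sum_swap_eq_zero fun μ ν => ?_
  rw [hZ' ν μ, map_neg, map_neg, D_dG_comm (hZ _ _)]

include hZ in
lemma curl_mem (ρ μ l : Fin d) : C.curl Z ρ μ l ∈ C.H :=
  add_mem (add_mem (C.dG_mem _ (hZ _ _)) (C.dG_mem _ (hZ _ _))) (C.dG_mem _ (hZ _ _))

include hZ hZ' in
-- A Hodge decomposition: applied to `C * Z`, exterior derivative and codifferential combine to the
-- Laplacian, and `□ C = -δ`.
lemma ext_coexact (μ ν : Fin d) :
    C.ext (C.coexact Z) μ ν = - Z μ ν - C.codiff (C.curl Z) μ ν := by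
  simp only [ext, coexact, codiff, MultipletCalculus.curl, map_sum, map_add, Finset.sum_add_distrib,
    C.laplace (hZ _ _)]
  have h1 (ρ : Fin d) : C.D μ (C.dG ρ (Z ρ ν)) = - C.D ρ (C.dG μ (Z ν ρ)) := by
    rw [D_dG_comm (hZ _ _), hZ' ν ρ, map_neg, map_neg]
  have h2 (ρ : Fin d) : C.D ν (C.dG ρ (Z ρ μ)) = C.D ρ (C.dG ν (Z ρ μ)) := D_dG_comm (hZ _ _) _ _
  simp only [h1, h2, Finset.sum_neg_distrib]
  abel

/-- Exact and coexact two-forms are orthogonal: integration by parts leaves two commuting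
derivatives contracted with antisymmetric indices of `X`. -/
lemma pair₂_ext_codiff {a : Fin d → V} (ha : ∀ μ, a μ ∈ C.H) {X : Fin d → Fin d → Fin d → V}
    (hX : ∀ ρ μ l, X ρ μ l ∈ C.H) (h1 : ∀ ρ μ l, X μ ρ l = - X ρ μ l)
    (h2 : ∀ ρ μ l, X ρ l μ = - X ρ μ l) : C.pair₂ (C.ext a) (C.codiff X) = 0 := by
  have key (μ ν ρ : Fin d) : C.pair (C.D μ (a ν)) (C.D ρ (X ρ μ ν)) =
      - C.pair (C.D ρ (C.D μ (a ν))) (X ρ μ ν) := by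
    rw [C.pair_D ρ (C.D_H _ (ha _)) (hX _ _ _), neg_neg]
  have e : ∑ μ, ∑ ν, ∑ ρ, C.pair (C.D μ (a ν)) (C.D ρ (X ρ μ ν)) = 0 := by
    rw [Finset.sum_comm]
    refine Finset.sum_eq_zero fun ν _ => ?_
    refine sum_swap_eq_zero fun μ ρ => ?_
    rw [key, key, h1, map_neg, C.D_comm _ _ (C.H_le (ha _))]
  have e' : ∑ μ, ∑ ν, ∑ ρ, C.pair (C.D ν (a μ)) (C.D ρ (X ρ μ ν)) = 0 := by
    rw [Finset.sum_comm, ← neg_eq_zero, ← e]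
    simp only [← Finset.sum_neg_distrib]
    refine Finset.sum_congr rfl fun μ _ => Finset.sum_congr rfl fun ν _ =>
      Finset.sum_congr rfl fun ρ _ => ?_
    rw [h2, map_neg, map_neg, neg_neg]
  simp only [pair₂_apply, ext, codiff, map_sub, LinearMap.sub_apply, map_sum, Finset.sum_sub_distrib,
    e, e', sub_zero]

include hZ hZ' in
-- In `ext_coexact` the coexact part is orthogonal to `ext a`. The propagator in front of `Z`
-- thereby disappears, which is how a free action can reproduce a local interaction.
lemma pair₂_ext_coexact {a : Fin d → V} (ha : ∀ μ, a μ ∈ C.H) :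
    C.pair₂ (C.ext a) (C.ext (C.coexact Z)) = - C.pair₂ (C.ext a) Z := by
  have : C.ext (C.coexact Z) = - Z - C.codiff (C.curl Z) := by
    ext μ ν
    exact ext_coexact hZ hZ' μ ν
  rw [this, map_sub, pair₂_ext_codiff ha (curl_mem hZ) (C.curl_swap hZ') (C.curl_swap' hZ'), sub_zero,
    map_neg]

include hZ hZ' hW hW' in
-- By `ext_coexact` the operator is minus the identity minus `Z ↦ ext (coexact Z)`. By
-- `pair₂_ext_coexact` the pairing of the latter with `W` is minus that of `ext (coexact Z)` with
-- `ext (coexact W)`, which is symmetric.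
lemma pair₂_codiff_curl :
    C.pair₂ (C.codiff (C.curl Z)) W = C.pair₂ Z (C.codiff (C.curl W)) := by
  have e {Z : Fin d → Fin d → V} (hZ : ∀ μ ν, Z μ ν ∈ C.N) (hZ' : ∀ μ ν, Z ν μ = - Z μ ν) :
      C.codiff (C.curl Z) = - Z - C.ext (C.coexact Z) := by
    ext μ ν
    simp only [Pi.sub_apply, Pi.neg_apply, ext_coexact hZ hZ']
    abel
  have h1 := pair₂_ext_coexact hW hW' (coexact_mem hZ)
  have h2 := pair₂_ext_coexact hZ hZ' (coexact_mem hW)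
  rw [e hZ hZ', e hW hW']
  simp only [map_sub, map_neg, LinearMap.sub_apply, LinearMap.neg_apply]
  rw [C.pair₂_comm Z (C.ext _)]
  rw [C.pair₂_comm (C.ext (C.coexact W)) (C.ext _)] at h2
  linarith

end TwoForm

lemma pair_br_swap (X Y Z : V) : C.pair X (C.br Y Z) = - C.pair Y (C.br X Z) := by
  rw [C.pair_br, C.br_swap, map_neg, LinearMap.neg_apply, ← C.pair_br]

/-- Integrate by parts, apply Leibniz' rule to the bracket, and use the invariance of the pairing to
bracket the undifferentiated factor with `X`. The antisymmetry of `X` rebuilds the exterior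
derivatives. -/
lemma pair₂_codiff_wedge {a b : Fin d → V} (ha : ∀ μ, a μ ∈ C.N) (hb : ∀ μ, b μ ∈ C.H)
    {X : Fin d → Fin d → Fin d → V}
    (hX : ∀ ρ μ l, X ρ μ l ∈ C.H) (h1 : ∀ ρ μ l, X μ ρ l = - X ρ μ l)
    (h2 : ∀ ρ μ l, X ρ l μ = - X ρ μ l) :
    C.pair₂ (C.codiff X) (C.wedge a b) =
      C.pair₂ (C.ext a) (C.contract X b) + C.pair₂ (C.ext b) (C.contract X a) := by
  have haH (μ : Fin d) : a μ ∈ C.H := C.N_le (ha μ)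
  have s1 (Φ : Fin d → Fin d → V) :
      ∑ ρ, ∑ μ, ∑ ν, C.pair (Φ μ ρ) (C.br (X ρ μ ν) (b ν)) =
        - ∑ ρ, ∑ μ, ∑ ν, C.pair (Φ ρ μ) (C.br (X ρ μ ν) (b ν)) := by
    rw [Finset.sum_comm]
    simp only [← Finset.sum_neg_distrib]
    refine Finset.sum_congr rfl fun ρ _ => Finset.sum_congr rfl fun μ _ =>
      Finset.sum_congr rfl fun ν _ => ?_
    rw [h1, map_neg, LinearMap.neg_apply, map_neg]
  have s2 (Φ : Fin d → Fin d → V) :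
      ∑ ρ, ∑ μ, ∑ ν, C.pair (Φ μ ρ) (C.br (X ρ μ ν) (a ν)) =
        - ∑ ρ, ∑ μ, ∑ ν, C.pair (Φ ρ μ) (C.br (X ρ μ ν) (a ν)) := by
    rw [Finset.sum_comm]
    simp only [← Finset.sum_neg_distrib]
    refine Finset.sum_congr rfl fun ρ _ => Finset.sum_congr rfl fun μ _ =>
      Finset.sum_congr rfl fun ν _ => ?_
    rw [h1, map_neg, LinearMap.neg_apply, map_neg]
  have half : ∑ μ, ∑ ν, ∑ ρ, C.pair (C.D ρ (X ρ μ ν)) (C.br (a μ) (b ν)) =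
      (∑ ρ, ∑ μ, ∑ ν, C.pair (C.D ρ (a μ)) (C.br (X ρ μ ν) (b ν))) +
      ∑ ρ, ∑ μ, ∑ ν, C.pair (C.D ρ (b μ)) (C.br (X ρ μ ν) (a ν)) := by
    have e (ρ μ ν : Fin d) : C.pair (C.D ρ (X ρ μ ν)) (C.br (a μ) (b ν)) =
        C.pair (C.D ρ (a μ)) (C.br (X ρ μ ν) (b ν)) +
        C.pair (C.D ρ (b ν)) (C.br (X ρ ν μ) (a μ)) := by
      rw [C.pair_D _ (hX _ _ _) (C.N_le (C.br_H (haH _) (hb _))),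
        C.D_br _ (C.H_le (haH _)) (C.H_le (hb _)), map_add, pair_br_swap, C.br_swap (a μ), map_neg,
        pair_br_swap (X ρ μ ν) (C.D ρ (b ν)), h2 ρ μ ν, map_neg, LinearMap.neg_apply, map_neg]
      ring
    have r1 : ∑ μ, ∑ ν, ∑ ρ, C.pair (C.D ρ (X ρ μ ν)) (C.br (a μ) (b ν)) =
        ∑ ρ, ∑ μ, ∑ ν, C.pair (C.D ρ (X ρ μ ν)) (C.br (a μ) (b ν)) := sum_rotate _
    rw [r1]
    simp only [e, Finset.sum_add_distrib]
    congr 1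
    exact Finset.sum_congr rfl fun ρ _ => Finset.sum_comm
  have other : ∑ μ, ∑ ν, ∑ ρ, C.pair (C.D ρ (X ρ μ ν)) (C.br (a ν) (b μ)) =
      - ∑ μ, ∑ ν, ∑ ρ, C.pair (C.D ρ (X ρ μ ν)) (C.br (a μ) (b ν)) := by
    rw [Finset.sum_comm]
    simp only [← Finset.sum_neg_distrib]
    refine Finset.sum_congr rfl fun ρ _ => Finset.sum_congr rfl fun μ _ =>
      Finset.sum_congr rfl fun ν _ => ?_
    rw [h2, map_neg, map_neg, LinearMap.neg_apply]
  simp only [pair₂_apply, codiff, wedge, contract, ext, map_sub, map_sum, LinearMap.sub_apply,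
    LinearMap.sum_apply, Finset.sum_sub_distrib]
  rw [other, half, s1 fun μ ρ => C.D μ (a ρ), s2 fun μ ρ => C.D μ (b ρ)]
  ring

section Background

variable {A : Fin d → V} (hA : ∀ μ, A μ ∈ C.N)

lemma wedge_self (A : Fin d → V) : C.wedge A A = (2 : ℝ) • C.comm A := by
  ext μ ν
  simp only [wedge, MultipletCalculus.comm, Pi.smul_apply, C.br_swap (A ν) (A μ)]
  module

include hA in
lemma comm_mem (μ ν : Fin d) : C.comm A μ ν ∈ C.N := C.br_N (C.H_le (C.N_le (hA _))) (hA _)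

include hA in
lemma three_mem (ρ μ l : Fin d) : C.three A ρ μ l ∈ C.H := curl_mem (comm_mem hA) ρ μ l

include hA in
lemma first_mem (μ : Fin d) : C.first A μ ∈ C.H :=
  Submodule.sum_mem _ fun _ _ => C.dG_mem _ (comm_mem hA _ _)

include hA in
lemma br_mem {X : V} (hX : X ∈ C.H) (μ : Fin d) : C.br X (A μ) ∈ C.N := C.br_N (C.H_le hX) (hA μ)

include hA in
lemma contr_mem (μ l : Fin d) : C.contr A μ l ∈ C.N :=
  Submodule.sum_mem _ fun _ _ => br_mem hA (three_mem hA _ _ _) _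

include hA in
lemma comm'_mem (μ l : Fin d) : C.comm' A μ l ∈ C.N :=
  sub_mem (C.br_H (C.N_le (hA _)) (first_mem hA _)) (C.br_H (C.N_le (hA _)) (first_mem hA _))

include hA in
lemma four_mem (ρ μ l σ : Fin d) : C.four A ρ μ l σ ∈ C.N :=
  sub_mem (add_mem (add_mem (br_mem hA (three_mem hA _ _ _) _) (br_mem hA (three_mem hA _ _ _) _))
    (br_mem hA (three_mem hA _ _ _) _)) (br_mem hA (three_mem hA _ _ _) _)

include hA in
lemma divFour_mem (ρ μ l : Fin d) : C.divFour A ρ μ l ∈ C.H :=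
  Submodule.sum_mem _ fun _ _ => C.dG_mem _ (four_mem hA _ _ _ _)

include hA in
lemma source_mem : ∑ l, C.br (C.first A l) (A l) ∈ C.N :=
  Submodule.sum_mem _ fun _ _ => br_mem hA (first_mem hA _) _

include hA in
lemma scalar_mem : C.scalar A ∈ C.B := C.G_mem (source_mem hA)

lemma twoForm_eq (A : Fin d → V) : C.twoForm A =
    (1 / 6 : ℝ) • C.contract (C.three A) (C.first A) -
    (1 / 6 : ℝ) • C.contract (C.curl (C.comm' A)) A - (1 / 3 : ℝ) • C.contract (C.curl (C.contr A)) A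
    + (1 / 3 : ℝ) • C.contract (C.divFour A) A := by
  ext ρ μ
  simp only [MultipletCalculus.twoForm, contract, Pi.add_apply, Pi.sub_apply, Pi.smul_apply,
    Finset.sum_add_distrib, Finset.sum_sub_distrib, Finset.smul_sum]

include hA in
lemma twoForm_mem (ρ μ : Fin d) : C.twoForm A ρ μ ∈ C.N :=
  Submodule.sum_mem _ fun _ _ => add_mem (sub_mem (sub_mem
    (Submodule.smul_mem _ _ (C.br_H (three_mem hA _ _ _) (first_mem hA _)))
    (Submodule.smul_mem _ _ (br_mem hA (curl_mem (comm'_mem hA) _ _ _) _)))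
    (Submodule.smul_mem _ _ (br_mem hA (curl_mem (contr_mem hA) _ _ _) _)))
    (Submodule.smul_mem _ _ (br_mem hA (divFour_mem hA _ _ _) _))

lemma four_swap_left (ρ μ l σ : Fin d) : C.four A μ ρ l σ = - C.four A ρ μ l σ := by
  simp only [MultipletCalculus.four, MultipletCalculus.three_swap A C.br_swap ρ μ,
    MultipletCalculus.three_swap A C.br_swap ρ l, MultipletCalculus.three_swap A C.br_swap μ l,
    map_neg, LinearMap.neg_apply]
  abel

/-- The transposition of the alternating `four` that `codiff_divFour` requires. -/
lemma four_swap_outer (ρ μ l σ : Fin d) : C.four A σ μ l ρ = - C.four A ρ μ l σ := by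
  have e1 := MultipletCalculus.three_swap A C.br_swap
  have e2 := MultipletCalculus.three_swap' A C.br_swap
  have h1 : C.three A σ μ ρ = - C.three A ρ μ σ := by
    rw [e1 μ σ, e2 μ ρ, e1 ρ μ, neg_neg]
  have h2 : C.three A μ l ρ = C.three A ρ μ l := by rw [e2 μ ρ, e1 ρ μ, neg_neg]
  have h3 : C.three A σ μ l = C.three A μ l σ := by rw [e2 μ σ, e1 σ μ, neg_neg]
  simp only [MultipletCalculus.four, h1, h2, h3, e2 l ρ σ, map_neg, LinearMap.neg_apply]
  abel

lemma divFour_swap_left (ρ μ l : Fin d) : C.divFour A μ ρ l = - C.divFour A ρ μ l := by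
  simp only [MultipletCalculus.divFour, four_swap_left ρ μ, map_neg, Finset.sum_neg_distrib]

lemma twoForm_swap (ρ μ : Fin d) : C.twoForm A μ ρ = - C.twoForm A ρ μ := by
  simp only [MultipletCalculus.twoForm, MultipletCalculus.three_swap A C.br_swap ρ μ,
    C.curl_swap (MultipletCalculus.comm'_swap A) ρ μ,
    C.curl_swap (MultipletCalculus.contr_swap A C.br_swap) ρ μ,
    divFour_swap_left ρ μ, map_neg, LinearMap.neg_apply, ← Finset.sum_neg_distrib]
  exact Finset.sum_congr rfl fun l _ => by module

variable (C A) in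
/-- The two-form whose image under `coexact` is the third order of the Nicolai map. -/
def thirdForm : Fin d → Fin d → V :=
  C.twoForm A + (1 / 3 : ℝ) • fun ρ μ => C.br (C.scalar A) (C.ext A ρ μ)

include hA in
lemma ext_mem (μ ν : Fin d) : C.ext A μ ν ∈ C.N := sub_mem (C.D_N _ (hA _)) (C.D_N _ (hA _))

include hA in
lemma thirdForm_mem (ρ μ : Fin d) : C.thirdForm A ρ μ ∈ C.N :=
  add_mem (twoForm_mem hA _ _) (Submodule.smul_mem _ _ (C.br_N (scalar_mem hA) (ext_mem hA _ _)))

lemma thirdForm_swap (ρ μ : Fin d) : C.thirdForm A μ ρ = - C.thirdForm A ρ μ := by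
  simp only [thirdForm, Pi.add_apply, Pi.smul_apply, twoForm_swap ρ μ, ext, map_sub]
  module

lemma first_eq (A : Fin d → V) : C.first A = C.coexact (- C.comm A) := by
  ext μ
  simp only [MultipletCalculus.first, coexact, Pi.neg_apply,
    MultipletCalculus.comm_swap A C.br_swap _ μ]

lemma second_eq (A : Fin d → V) : C.second A = C.coexact ((1 / 2 : ℝ) • C.contr A) := by
  ext μ
  simp only [MultipletCalculus.second, coexact, Pi.smul_apply, map_smul, Finset.smul_sum]

include hA in
-- With `θ` the scalar, the local term `[θ, A_μ]` is written as minus a Laplacian of its convolution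
-- with `C`. All scalar terms then stand under `∑_ρ ∂_ρ C`, with argument `[∂_μ θ, A_ρ] - [∂_ρ θ,
-- A_μ] - ∂_μ [θ, A_ρ] + ∂_ρ [θ, A_μ]`. By Leibniz' rule the derivatives of `θ` cancel and the
-- antisymmetric `[θ, ∂_ρ A_μ - ∂_μ A_ρ]` remains.
lemma third_eq : C.third A = C.coexact (C.thirdForm A) := by
  ext μ
  set θ := C.scalar A
  have hθ : θ ∈ C.B := scalar_mem hA
  have hAB (ρ : Fin d) : A ρ ∈ C.B := C.H_le (C.N_le (hA ρ))
  have h1 (ρ : Fin d) : C.dG ρ (∑ l, C.br (C.first A l) (A l)) = C.D ρ θ := (C.D_G _ (source_mem hA)).symm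
  have hN (ρ : Fin d) : C.br θ (A ρ) ∈ C.N := C.br_N hθ (hA ρ)
  have h2 : - C.br θ (A μ) = ∑ ρ, C.dG ρ (C.D ρ (C.br θ (A μ))) := by
    rw [← C.laplace (hN μ)]
    exact Finset.sum_congr rfl fun ρ _ => C.D_dG _ _ (hN μ)
  have h3 : C.dG μ (∑ ρ, C.D ρ (C.br θ (A ρ))) = ∑ ρ, C.dG ρ (C.D μ (C.br θ (A ρ))) := by
    rw [map_sum]
    refine Finset.sum_congr rfl fun ρ _ => ?_
    rw [← C.D_dG _ _ (hN ρ), ← C.D_dG _ _ (hN ρ), D_dG_comm (hN ρ)]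
  rw [MultipletCalculus.third, MultipletCalculus.scalarPart]
  simp only [h1]
  rw [h3, sub_eq_add_neg _ ((1 / 3 : ℝ) • _), ← smul_neg, h2]
  simp only [coexact, thirdForm, Pi.add_apply, Pi.smul_apply, map_add, Finset.sum_add_distrib, map_smul,
    ← Finset.smul_sum]
  rw [← smul_sub, ← smul_add, ← Finset.sum_sub_distrib, ← Finset.sum_add_distrib]
  congr 2
  refine Finset.sum_congr rfl fun ρ _ => ?_
  rw [← map_sub, ← map_add, C.D_br _ hθ (hAB _), C.D_br _ hθ (hAB _), ext, map_sub]
  congr 1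
  abel

lemma neg_comm_swap (μ ν : Fin d) : (- C.comm A) ν μ = - (- C.comm A) μ ν := by
  simp only [Pi.neg_apply, MultipletCalculus.comm_swap A C.br_swap μ ν]

lemma half_contr_swap (μ ν : Fin d) :
    ((1 / 2 : ℝ) • C.contr A) ν μ = - ((1 / 2 : ℝ) • C.contr A) μ ν := by
  simp only [Pi.smul_apply, MultipletCalculus.contr_swap A C.br_swap μ ν, smul_neg]

include hA in
lemma neg_comm_mem (μ ν : Fin d) : (- C.comm A) μ ν ∈ C.N := neg_mem (comm_mem hA μ ν)

include hA in
lemma half_contr_mem (μ ν : Fin d) : ((1 / 2 : ℝ) • C.contr A) μ ν ∈ C.N :=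
  Submodule.smul_mem _ _ (contr_mem hA μ ν)

include hA in
lemma second_mem (μ : Fin d) : C.second A μ ∈ C.H := by
  rw [second_eq]
  exact coexact_mem (half_contr_mem hA) μ

include hA in
lemma third_mem (μ : Fin d) : C.third A μ ∈ C.H := by
  rw [third_eq hA]
  exact coexact_mem (thirdForm_mem hA) μ

include hA in
theorem sum_D_first : ∑ μ, C.D μ (C.first A μ) = 0 := by
  rw [first_eq]
  exact sum_D_coexact (neg_comm_mem hA) neg_comm_swap

include hA in
theorem sum_D_second : ∑ μ, C.D μ (C.second A μ) = 0 := by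
  rw [second_eq]
  exact sum_D_coexact (half_contr_mem hA) half_contr_swap

include hA in
theorem sum_D_third : ∑ μ, C.D μ (C.third A μ) = 0 := by
  rw [third_eq hA]
  exact sum_D_coexact (thirdForm_mem hA) thirdForm_swap

include hA in
theorem action_order_one : C.pair₂ (C.ext A) (C.ext (C.first A)) = C.pair₂ (C.ext A) (C.comm A) := by
  rw [first_eq, pair₂_ext_coexact (neg_comm_mem hA) neg_comm_swap fun μ => C.N_le (hA μ), map_neg,
    neg_neg]

include hA in
lemma ext_first : C.ext (C.first A) = C.comm A + C.codiff (C.three A) := by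
  rw [first_eq]
  ext μ ν
  rw [ext_coexact (neg_comm_mem hA) neg_comm_swap]
  simp only [Pi.add_apply, Pi.neg_apply, neg_neg, codiff, MultipletCalculus.three,
    MultipletCalculus.curl, map_neg, ← neg_add, Finset.sum_neg_distrib, sub_neg_eq_add]

include hA in
lemma pair₂_codiff_comm {X : Fin d → Fin d → Fin d → V}
    (hX : ∀ ρ μ l, X ρ μ l ∈ C.H) (h1 : ∀ ρ μ l, X μ ρ l = - X ρ μ l)
    (h2 : ∀ ρ μ l, X ρ l μ = - X ρ μ l) :
    C.pair₂ (C.codiff X) (C.comm A) = C.pair₂ (C.ext A) (C.contract X A) := by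
  have := pair₂_codiff_wedge hA (fun μ => C.N_le (hA μ)) hX h1 h2
  rw [wedge_self, map_smul, smul_eq_mul] at this
  linarith

include hA in
-- The square of `dA₁` is that of `[A, A]` plus the nonlocal `⟨dA, contr⟩`; the coefficient `1/2` in
-- the second order is the one that cancels this remainder.
theorem action_order_two :
    2 * C.pair₂ (C.ext A) (C.ext (C.second A)) + C.pair₂ (C.ext (C.first A)) (C.ext (C.first A)) =
      C.pair₂ (C.comm A) (C.comm A) := by
  have h1 : C.pair₂ (C.ext (C.first A)) (C.ext (C.first A)) =
      C.pair₂ (C.comm A) (C.comm A) + C.pair₂ (C.ext A) (C.contr A) := by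
    nth_rewrite 2 [first_eq]
    rw [pair₂_ext_coexact (neg_comm_mem hA) neg_comm_swap (first_mem hA), map_neg, neg_neg,
      ext_first hA, map_add, LinearMap.add_apply, pair₂_codiff_comm hA (three_mem hA)
      (MultipletCalculus.three_swap A C.br_swap) (MultipletCalculus.three_swap' A C.br_swap)]
    rfl
  rw [h1, second_eq, pair₂_ext_coexact (half_contr_mem hA) half_contr_swap fun μ => C.N_le (hA μ),
    map_smul, smul_eq_mul]
  ring

/-- Invariance turns the summand into the three-form paired with `[A_s, [A_μ, A_l]]`. The three-form
is invariant under cyclic rotation of its indices, so the sum over the three rotations contains the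
Jacobi identity. -/
lemma pair₂_comm_contr : C.pair₂ (C.comm A) (C.contr A) = 0 := by
  have e1 := MultipletCalculus.three_swap A C.br_swap
  have e2 := MultipletCalculus.three_swap' A C.br_swap
  have cyc (μ l s : Fin d) : C.three A l s μ = C.three A μ l s := by rw [e2 l μ, e1 μ l, neg_neg]
  let Φ (μ l s : Fin d) : ℝ := C.pair (C.three A μ l s) (C.br (A s) (C.br (A μ) (A l)))
  have h0 : C.pair₂ (C.comm A) (C.contr A) = ∑ μ, ∑ l, ∑ s, Φ μ l s := by
    simp only [pair₂_apply, MultipletCalculus.contr, map_sum]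
    refine Finset.sum_congr rfl fun μ _ => Finset.sum_congr rfl fun l _ =>
      Finset.sum_congr rfl fun s _ => ?_
    rw [C.pair_comm, ← C.pair_br]
    rfl
  have r1 : ∑ μ, ∑ l, ∑ s, Φ μ l s = ∑ μ, ∑ l, ∑ s, Φ l s μ := sum_rotate _
  have r2 : ∑ μ, ∑ l, ∑ s, Φ μ l s = ∑ μ, ∑ l, ∑ s, Φ s μ l := r1.trans (sum_rotate _)
  have h3 : (∑ μ, ∑ l, ∑ s, Φ μ l s) + (∑ μ, ∑ l, ∑ s, Φ l s μ) + (∑ μ, ∑ l, ∑ s, Φ s μ l) = 0 := by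
    simp only [← Finset.sum_add_distrib]
    refine Finset.sum_eq_zero fun μ _ => Finset.sum_eq_zero fun l _ =>
      Finset.sum_eq_zero fun s _ => ?_
    simp only [Φ]
    rw [cyc μ l s, ← cyc s μ l, ← map_add, ← map_add]
    rw [show C.br (A s) (C.br (A μ) (A l)) + C.br (A μ) (C.br (A l) (A s))
      + C.br (A l) (C.br (A s) (A μ)) = 0 from C.jacobi _ _ _, map_zero]
  rw [h0]
  rw [← r1, ← r2] at h3
  linarith

include hA in
-- The codifferential squares to zero: two symmetric derivative indices meet the alternating
-- four-form.
lemma codiff_divFour : C.codiff (C.divFour A) = 0 := by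
  ext μ l
  simp only [codiff, MultipletCalculus.divFour, map_sum]
  refine sum_swap_eq_zero fun ρ s => ?_
  rw [four_swap_outer ρ μ l s, map_neg, map_neg, D_dG_comm (four_mem hA _ _ _ _)]

include hA in
lemma pair₂_contract_curl {Z : Fin d → Fin d → V} (hZ : ∀ μ ν, Z μ ν ∈ C.N)
    (hZ' : ∀ μ ν, Z ν μ = - Z μ ν) :
    C.pair₂ (C.ext A) (C.contract (C.curl Z) A) = C.pair₂ Z (C.codiff (C.three A)) := by
  rw [← pair₂_codiff_comm hA (curl_mem hZ) (C.curl_swap hZ') (C.curl_swap' hZ'),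
    pair₂_codiff_curl hZ hZ' (comm_mem hA) (MultipletCalculus.comm_swap A C.br_swap)]
  rfl

/-- By invariance this reduces to `[F, F] = 0`. The scalar terms of third order therefore do not
affect the action; they matter for the Jacobian. -/
lemma pair₂_br_self (θ : V) (F : Fin d → Fin d → V) :
    C.pair₂ F (fun ρ μ => C.br θ (F ρ μ)) = 0 := by
  rw [pair₂_apply]
  refine Finset.sum_eq_zero fun ρ _ => Finset.sum_eq_zero fun μ _ => ?_
  have h := pair_br_swap (C := C) (F ρ μ) θ (F ρ μ)
  have h0 : C.br (F ρ μ) (F ρ μ) = 0 := MultipletCalculus.eq_zero_of_eq_neg_self (C.br_swap _ _)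
  rw [h, h0, map_zero, neg_zero]

include hA in
-- Let `δX` be the codifferential of the three-form. The Jacobi identity reduces `⟨dA₁, dA₂⟩` to
-- `-(1/2) ⟨δX, contr⟩`. In `⟨dA, dA₃⟩` the terms with `comm'` cancel by `pair₂_codiff_wedge`, which
-- leaves `1/6` of the same pairing from the product term and `1/3` from the curl of `contr`; the
-- four-form and the scalar contribute nothing. As `1/6 + 1/3 = 1/2`, the sum vanishes.
theorem action_order_three :
    C.pair₂ (C.ext (C.first A)) (C.ext (C.second A)) + C.pair₂ (C.ext A) (C.ext (C.third A)) = 0 := by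
  have hAH (μ : Fin d) : A μ ∈ C.H := C.N_le (hA μ)
  have hX := ext_first hA
  have hY : C.contract (C.three A) A = C.contr A := rfl
  have hB1 : C.wedge A (C.first A) = C.comm' A := rfl
  have h1 := pair₂_codiff_wedge hA (first_mem hA) (three_mem hA)
    (MultipletCalculus.three_swap A C.br_swap) (MultipletCalculus.three_swap' A C.br_swap)
  rw [hY, hB1] at h1
  have h2 := pair₂_contract_curl hA (comm'_mem hA) (MultipletCalculus.comm'_swap A)
  have h3 := pair₂_contract_curl hA (contr_mem hA) (MultipletCalculus.contr_swap A C.br_swap)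
  have h4 := pair₂_codiff_comm hA (divFour_mem hA) divFour_swap_left
    (MultipletCalculus.divFour_swap A C.br_swap)
  rw [codiff_divFour hA, map_zero, LinearMap.zero_apply] at h4
  have h5 : C.pair₂ (C.ext (C.first A)) (C.contr A) = C.pair₂ (C.codiff (C.three A)) (C.contr A) := by
    rw [hX, map_add, LinearMap.add_apply, pair₂_comm_contr, zero_add]
  rw [second_eq, third_eq hA, pair₂_ext_coexact (half_contr_mem hA) half_contr_swap (first_mem hA),
    pair₂_ext_coexact (thirdForm_mem hA) thirdForm_swap hAH, thirdForm, map_add, map_smul, map_smul,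
    pair₂_br_self, twoForm_eq]
  simp only [map_add, map_sub, map_smul, smul_eq_mul]
  rw [C.pair₂_comm (C.codiff _)] at h1 h5
  linarith

end Background

end DecayCalculus

end

end NicolaiMap

namespace NicolaiMap

noncomputable section

open scoped BigOperators
open MeasureTheory

set_option linter.unusedSectionVars false

/-! ### Smooth functions with decaying derivatives -/

section Decay

variable {d : ℕ}

/-- `|X x| ≤ C (1 + |x|)^(-s)`. -/
def HasDecay (s : ℕ) (X : Spacetime d → ℝ) : Prop := ∃ C, ∀ x, |X x| * (1 + ‖x‖) ^ s ≤ C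

/-- The partial derivatives of `X` up to order `n` exist and are bounded by `(1 + |x|)^(-s)`. -/
def DecaysUpTo (s : ℕ) : ℕ → (Spacetime d → ℝ) → Prop
  | 0, X => Continuous X ∧ HasDecay s X
  | n + 1, X => Differentiable ℝ X ∧ HasDecay s X ∧ ∀ μ, DecaysUpTo s n (partialDeriv μ X)

variable {s t n : ℕ} {X Y : Spacetime d → ℝ}

lemma HasDecay.add (hX : HasDecay s X) (hY : HasDecay s Y) : HasDecay s (X + Y) := by
  obtain ⟨C, hC⟩ := hX
  obtain ⟨C', hC'⟩ := hY
  refine ⟨C + C', fun x => ?_⟩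
  have h := abs_add_le (X x) (Y x)
  have := mul_le_mul_of_nonneg_right h (show 0 ≤ (1 + ‖x‖) ^ s by positivity)
  rw [Pi.add_apply]
  linarith [hC x, hC' x]

lemma HasDecay.smul (c : ℝ) (hX : HasDecay s X) : HasDecay s (c • X) := by
  obtain ⟨C, hC⟩ := hX
  refine ⟨|c| * C, fun x => ?_⟩
  rw [Pi.smul_apply, smul_eq_mul, abs_mul, mul_assoc]
  exact mul_le_mul_of_nonneg_left (hC x) (abs_nonneg c)

lemma HasDecay.mul (hX : HasDecay s X) (hY : HasDecay t Y) : HasDecay (s + t) (X * Y) := by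
  obtain ⟨C, hC⟩ := hX
  obtain ⟨C', hC'⟩ := hY
  refine ⟨C * C', fun x => ?_⟩
  rw [Pi.mul_apply, abs_mul, pow_add, mul_mul_mul_comm]
  exact mul_le_mul (hC x) (hC' x) (by positivity) ((by positivity : (0 : ℝ) ≤ _).trans (hC x))

lemma HasDecay.mono (hX : HasDecay s X) (h : t ≤ s) : HasDecay t X := by
  obtain ⟨C, hC⟩ := hX
  refine ⟨C, fun x => le_trans ?_ (hC x)⟩
  gcongr
  linarith [norm_nonneg x]

lemma DecaysUpTo.hasDecay (hX : DecaysUpTo s n X) : HasDecay s X := by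
  cases n with
  | zero => exact hX.2
  | succ n => exact hX.2.1

lemma DecaysUpTo.continuous (hX : DecaysUpTo s n X) : Continuous X := by
  cases n with
  | zero => exact hX.1
  | succ n => exact hX.1.continuous

lemma DecaysUpTo.of_succ (hX : DecaysUpTo s (n + 1) X) : DecaysUpTo s n X := by
  induction n generalizing X with
  | zero => exact ⟨hX.continuous, hX.hasDecay⟩
  | succ n ih => exact ⟨hX.1, hX.2.1, fun μ => ih (hX.2.2 μ)⟩

lemma sum_single_eq (v : Spacetime d) : ∑ μ, v μ • EuclideanSpace.single μ (1 : ℝ) = v := by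
  ext ν
  simp [Pi.single_apply]

lemma fderiv_apply_eq_sum (X : Spacetime d → ℝ) (x v : Spacetime d) :
    fderiv ℝ X x v = ∑ μ, v μ * partialDeriv μ X x := by
  nth_rewrite 1 [← sum_single_eq v]
  simp [partialDeriv]

lemma norm_fderiv_le (X : Spacetime d → ℝ) (x : Spacetime d) :
    ‖fderiv ℝ X x‖ ≤ ∑ μ, |partialDeriv μ X x| := by
  refine ContinuousLinearMap.opNorm_le_bound _ (Finset.sum_nonneg fun _ _ => abs_nonneg _) fun v => ?_
  rw [fderiv_apply_eq_sum, Finset.sum_mul]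
  refine (norm_sum_le _ _).trans (Finset.sum_le_sum fun μ _ => ?_)
  rw [norm_mul, mul_comm, Real.norm_eq_abs]
  exact mul_le_mul_of_nonneg_left (PiLp.norm_apply_le v μ) (abs_nonneg _)

lemma DecaysUpTo.contDiff (hX : DecaysUpTo s n X) : ContDiff ℝ n X := by
  induction n generalizing X with
  | zero => exact contDiff_zero.2 hX.1
  | succ n ih =>
    rw [Nat.cast_add, Nat.cast_one, contDiff_succ_iff_fderiv_apply]
    refine ⟨hX.1, fun h => absurd h (by simp), fun v => ?_⟩
    simp only [fderiv_apply_eq_sum]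
    exact ContDiff.sum fun μ _ => contDiff_const.mul (ih (hX.2.2 μ))

lemma partialDeriv_add (hX : Differentiable ℝ X) (hY : Differentiable ℝ Y) (μ : Fin d) :
    partialDeriv μ (X + Y) = partialDeriv μ X + partialDeriv μ Y := by
  ext x
  simp [partialDeriv, fderiv_add (hX x) (hY x)]

lemma partialDeriv_smul (c : ℝ) (X : Spacetime d → ℝ) (μ : Fin d) :
    partialDeriv μ (c • X) = c • partialDeriv μ X := by
  ext x
  simp [partialDeriv, fderiv_const_smul_field]

lemma partialDeriv_mul (hX : Differentiable ℝ X) (hY : Differentiable ℝ Y) (μ : Fin d) :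
    partialDeriv μ (X * Y) = partialDeriv μ X * Y + X * partialDeriv μ Y := by
  ext x
  simp only [partialDeriv, fderiv_mul (hX x) (hY x), Pi.add_apply, Pi.mul_apply,
    add_apply, smul_apply, smul_eq_mul]
  ring

lemma partialDeriv_comm (hX : ContDiff ℝ 2 X) (μ ν : Fin d) :
    partialDeriv μ (partialDeriv ν X) = partialDeriv ν (partialDeriv μ X) := by
  have h (μ ν : Fin d) (x : Spacetime d) : partialDeriv μ (partialDeriv ν X) x =
      fderiv ℝ (fderiv ℝ X) x (EuclideanSpace.single μ 1) (EuclideanSpace.single ν 1) := by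
    have h1 : DifferentiableAt ℝ (fderiv ℝ X) x :=
      (hX.fderiv_right (m := 1) (by norm_num)).differentiable one_ne_zero x
    unfold partialDeriv
    rw [fderiv_clm_apply h1 (differentiableAt_const _)]
    simp
  ext x
  rw [h, h]
  exact (hX.contDiffAt.isSymmSndFDerivAt (by simp)).eq _ _

lemma DecaysUpTo.add (hX : DecaysUpTo s n X) (hY : DecaysUpTo s n Y) : DecaysUpTo s n (X + Y) := by
  induction n generalizing X Y with
  | zero => exact ⟨hX.1.add hY.1, hX.2.add hY.2⟩
  | succ n ih =>
    refine ⟨hX.1.add hY.1, hX.2.1.add hY.2.1, fun μ => ?_⟩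
    rw [partialDeriv_add hX.1 hY.1]
    exact ih (hX.2.2 μ) (hY.2.2 μ)

lemma DecaysUpTo.smul (c : ℝ) (hX : DecaysUpTo s n X) : DecaysUpTo s n (c • X) := by
  induction n generalizing X with
  | zero => exact ⟨hX.1.const_smul c, hX.2.smul c⟩
  | succ n ih =>
    refine ⟨hX.1.const_smul c, hX.2.1.smul c, fun μ => ?_⟩
    rw [partialDeriv_smul]
    exact ih (hX.2.2 μ)

lemma DecaysUpTo.mul (hX : DecaysUpTo s n X) (hY : DecaysUpTo t n Y) :
    DecaysUpTo (s + t) n (X * Y) := by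
  induction n generalizing X Y with
  | zero => exact ⟨hX.1.mul hY.1, hX.2.mul hY.2⟩
  | succ n ih =>
    refine ⟨hX.1.mul hY.1, hX.2.1.mul hY.2.1, fun μ => ?_⟩
    rw [partialDeriv_mul hX.1 hY.1]
    exact (ih (hX.2.2 μ) hY.of_succ).add (ih hX.of_succ (hY.2.2 μ))

lemma DecaysUpTo.mono (hX : DecaysUpTo s n X) (h : t ≤ s) : DecaysUpTo t n X := by
  induction n generalizing X with
  | zero => exact ⟨hX.1, hX.2.mono h⟩
  | succ n ih => exact ⟨hX.1, hX.2.1.mono h, fun μ => ih (hX.2.2 μ)⟩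

lemma decaysUpTo_zero : DecaysUpTo s n (0 : Spacetime d → ℝ) := by
  have h0 : HasDecay s (0 : Spacetime d → ℝ) := ⟨0, fun x => by simp⟩
  induction n with
  | zero => exact ⟨continuous_zero, h0⟩
  | succ n ih =>
    refine ⟨differentiable_const 0, h0, fun μ => ?_⟩
    have : partialDeriv μ (0 : Spacetime d → ℝ) = 0 := by
      ext x
      simp [partialDeriv]
    rwa [this]

variable (d s) in
/-- The smooth functions whose partial derivatives are bounded by `(1 + |x|)^(-s)`. -/
def decaySpace : Submodule ℝ (Spacetime d → ℝ) where
  carrier := {X | ∀ n, DecaysUpTo s n X}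
  add_mem' hX hY n := (hX n).add (hY n)
  zero_mem' _ := decaysUpTo_zero
  smul_mem' c _ hX n := (hX n).smul c

lemma contDiff_of_mem (hX : X ∈ decaySpace d s) : ContDiff ℝ (⊤ : ℕ∞) X :=
  contDiff_infty.2 fun n => (hX n).contDiff

lemma differentiable_of_mem (hX : X ∈ decaySpace d s) : Differentiable ℝ X := (hX 1).1

lemma partialDeriv_mem (hX : X ∈ decaySpace d s) (μ : Fin d) : partialDeriv μ X ∈ decaySpace d s :=
  fun n => (hX (n + 1)).2.2 μ

lemma mul_mem_decaySpace (hX : X ∈ decaySpace d s) (hY : Y ∈ decaySpace d t) :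
    X * Y ∈ decaySpace d (s + t) := fun n => (hX n).mul (hY n)

lemma decaySpace_mono (h : t ≤ s) : decaySpace d s ≤ decaySpace d t := fun _ hX n => (hX n).mono h

lemma hasDecay_of_hasCompactSupport (hX : Continuous X) (h : HasCompactSupport X) : HasDecay s X := by
  have h1 : Continuous fun x => |X x| * (1 + ‖x‖) ^ s := by fun_prop
  have h2 : HasCompactSupport fun x => |X x| * (1 + ‖x‖) ^ s := by
    refine h.mono fun x hx => ?_
    rw [Function.mem_support] at hx ⊢
    intro h0
    simp [h0] at hx
  obtain ⟨C, hC⟩ := h2.exists_bound_of_continuous h1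
  exact ⟨C, fun x => (le_abs_self _).trans (hC x)⟩

lemma mem_decaySpace_of_hasCompactSupport (hX : ContDiff ℝ (⊤ : ℕ∞) X) (h : HasCompactSupport X) :
    X ∈ decaySpace d s := by
  intro n
  induction n generalizing X with
  | zero => exact ⟨hX.continuous, hasDecay_of_hasCompactSupport hX.continuous h⟩
  | succ n ih =>
    refine ⟨hX.differentiable (by simp), hasDecay_of_hasCompactSupport hX.continuous h, fun μ => ih ?_ ?_⟩
    · exact (hX.fderiv_right (m := (⊤ : ℕ∞)) le_rfl).clm_apply contDiff_const
    · exact h.fderiv_apply ℝ _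

end Decay

/-! ### Convolution with singular kernels -/

section Kernel

variable {d : ℕ}

/-- The singularity of the derivative of the propagator. -/
def singularPart (d : ℕ) (z : Spacetime d) : ℝ :=
  (Metric.ball (0 : Spacetime d) 1).indicator (fun z => (‖z‖ ^ (d - 1))⁻¹) z

/-- The weight `(1 + |y|)^(2 - 2d)`. -/
def decayWeight (d : ℕ) (y : Spacetime d) : ℝ := ((1 + ‖y‖) ^ (2 * d - 2))⁻¹

lemma singularPart_nonneg (z : Spacetime d) : 0 ≤ singularPart d z :=
  Set.indicator_nonneg (fun _ _ => by positivity) _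

lemma decayWeight_pos (z : Spacetime d) : 0 < decayWeight d z := by
  rw [decayWeight]; positivity

lemma decayWeight_le_one (z : Spacetime d) : decayWeight d z ≤ 1 :=
  inv_le_one_of_one_le₀ (one_le_pow₀ (by linarith [norm_nonneg z]))

/-- In polar coordinates the Jacobian `r^(d-1)` cancels the singularity exactly. -/
lemma integrable_singularPart (hd : 3 ≤ d) : Integrable (singularPart d) := by
  have : Nontrivial (Spacetime d) := by
    have : Nonempty (Fin d) := ⟨⟨0, by omega⟩⟩
    infer_instance
  have h : IntegrableOn (fun z : Spacetime d => (‖z‖ ^ (d - 1))⁻¹) (Metric.ball 0 1) := by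
    rw [integrableOn_fun_norm_addHaar volume (f := fun r => (r ^ (d - 1))⁻¹)]
    refine (integrableOn_const (C := (1 : ℝ)) (by simp)).congr_fun (fun r hr => ?_) measurableSet_Ioo
    have : r ^ (d - 1) ≠ 0 := pow_ne_zero _ hr.1.ne'
    simp [this]
  exact (integrable_indicator_iff measurableSet_ball).2 h

/-- The exponent `2d - 2` exceeds the dimension as soon as `d > 2`. -/
lemma integrable_decayWeight (hd : 3 ≤ d) : Integrable (decayWeight d) := by
  have h := integrable_one_add_norm (E := Spacetime d) (μ := volume) (r := ((2 * d - 2 : ℕ) : ℝ))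
    (by rw [finrank_euclideanSpace_fin]; exact_mod_cast (by omega))
  refine h.congr (.of_forall fun x => ?_)
  simp only
  rw [Real.rpow_neg (by positivity), Real.rpow_natCast, decayWeight]

/-- Kernels whose convolution with a function of decay `2d - 2` has decay `t`. -/
structure IsKernel (t : ℕ) (K : Spacetime d → ℝ) : Prop where
  measurable : Measurable K
  bound : ∃ c, 0 ≤ c ∧ ∀ z y, |K z| * decayWeight d y * (1 + ‖z + y‖) ^ t ≤
    c * (singularPart d z + decayWeight d z + decayWeight d y)

/-- Convolution. -/
def convolve (K Z : Spacetime d → ℝ) (x : Spacetime d) : ℝ := ∫ y, K (x - y) * Z y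

lemma convolve_eq (K Z : Spacetime d → ℝ) (x : Spacetime d) :
    convolve K Z x = ∫ z, K z * Z (x - z) := by
  rw [convolve, ← integral_sub_left_eq_self _ volume x]
  simp only [sub_sub_cancel]

variable {t : ℕ} {K Z : Spacetime d → ℝ}

lemma HasDecay.le_decayWeight (hZ : HasDecay (2 * d - 2) Z) :
    ∃ C, 0 ≤ C ∧ ∀ y, |Z y| ≤ C * decayWeight d y := by
  obtain ⟨C, hC⟩ := hZ
  refine ⟨C, (by positivity : (0 : ℝ) ≤ _).trans (hC 0), fun y => ?_⟩
  rw [decayWeight, ← div_eq_mul_inv, le_div_iff₀ (by positivity)]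
  exact hC y

lemma integrable_of_hasDecay (hd : 3 ≤ d) (hZc : Continuous Z) (hZ : HasDecay (2 * d - 2) Z) :
    Integrable Z := by
  obtain ⟨C, -, hC⟩ := hZ.le_decayWeight
  exact ((integrable_decayWeight hd).const_mul C).mono' hZc.aestronglyMeasurable (.of_forall hC)

section

variable (hd : 3 ≤ d) (hK : IsKernel t K)
include hd hK

lemma IsKernel.integrable_weight (x : Spacetime d) :
    Integrable fun z => |K z| * decayWeight d (x - z) := by
  obtain ⟨c, hc, h⟩ := hK.bound
  have hw := integrable_decayWeight hd
  refine ((((integrable_singularPart hd).add hw).add (hw.comp_sub_left x)).const_mul c).mono'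
    ?_ (.of_forall fun z => ?_)
  · refine ((continuous_abs.measurable.comp hK.measurable).mul ?_).aestronglyMeasurable
    unfold decayWeight
    fun_prop
  · have := decayWeight_pos (x - z)
    rw [Real.norm_eq_abs, abs_of_nonneg (by positivity)]
    refine le_trans ?_ (h z (x - z))
    exact le_mul_of_one_le_right (by positivity)
      (one_le_pow₀ (by linarith [norm_nonneg (z + (x - z))]))

lemma IsKernel.integrable' (hZc : Continuous Z) (hZ : HasDecay (2 * d - 2) Z) (x : Spacetime d) :
    Integrable fun z => K z * Z (x - z) := by
  obtain ⟨C, hC0, hC⟩ := hZ.le_decayWeight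
  refine ((hK.integrable_weight hd x).const_mul C).mono' ?_ (.of_forall fun z => ?_)
  · exact (hK.measurable.mul (hZc.measurable.comp (measurable_const.sub measurable_id))).aestronglyMeasurable
  · rw [norm_mul, Real.norm_eq_abs, Real.norm_eq_abs]
    have := mul_le_mul_of_nonneg_left (hC (x - z)) (abs_nonneg (K z))
    linarith

lemma IsKernel.integrable (hZc : Continuous Z) (hZ : HasDecay (2 * d - 2) Z) (x : Spacetime d) :
    Integrable fun y => K (x - y) * Z y := by
  have := (hK.integrable' hd hZc hZ x).comp_sub_left x
  simpa only [sub_sub_cancel] using this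

/-- The majorant in `IsKernel` is a sum of a function of `z` and a function of `x - z`, so its
integral over `z` does not depend on `x`. -/
lemma IsKernel.hasDecay (hZ : HasDecay (2 * d - 2) Z) :
    HasDecay t (convolve K Z) := by
  obtain ⟨C, hC0, hC⟩ := hZ.le_decayWeight
  obtain ⟨c, hc, h⟩ := hK.bound
  have hw := integrable_decayWeight hd
  have hs := integrable_singularPart hd
  refine ⟨C * c * ((∫ z, singularPart d z) + (∫ z, decayWeight d z) + ∫ z, decayWeight d z), fun x => ?_⟩
  rw [convolve_eq, ← abs_of_nonneg (show 0 ≤ (1 + ‖x‖) ^ t by positivity), ← abs_mul, ← integral_mul_const,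
    ← Real.norm_eq_abs]
  have e : (∫ z, singularPart d z) + (∫ z, decayWeight d z) + ∫ z, decayWeight d z =
      ∫ z, (singularPart d + decayWeight d) z + decayWeight d (x - z) := by
    rw [integral_add (hs.add hw) (hw.comp_sub_left x), integral_sub_left_eq_self _ volume x]
    simp only [Pi.add_apply]
    rw [integral_add hs hw]
  rw [e, ← integral_const_mul]
  refine norm_integral_le_of_norm_le (((hs.add hw).add (hw.comp_sub_left x)).const_mul _)
    (.of_forall fun z => ?_)
  have h1 := h z (x - z)
  rw [add_sub_cancel] at h1
  rw [norm_mul, norm_mul, Real.norm_eq_abs, Real.norm_eq_abs, Real.norm_eq_abs,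
    abs_of_nonneg (show 0 ≤ (1 + ‖x‖) ^ t by positivity)]
  calc |K z| * |Z (x - z)| * (1 + ‖x‖) ^ t ≤ |K z| * (C * decayWeight d (x - z)) * (1 + ‖x‖) ^ t := by
        gcongr
        exact hC _
    _ = C * (|K z| * decayWeight d (x - z) * (1 + ‖x‖) ^ t) := by ring
    _ ≤ C * (c * (singularPart d z + decayWeight d z + decayWeight d (x - z))) := by gcongr
    _ = _ := by simp only [Pi.add_apply]; ring

omit hd hK in
lemma decayWeight_le {x x₀ z : Spacetime d} (hx : dist x x₀ < 1) :
    decayWeight d (x - z) ≤ 2 ^ (2 * d - 2) * decayWeight d (x₀ - z) := by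
  rw [decayWeight, decayWeight, ← div_eq_mul_inv, le_div_iff₀ (by positivity), ← div_eq_inv_mul,
    div_le_iff₀ (by positivity), ← mul_pow]
  gcongr
  have : ‖x₀ - z‖ ≤ ‖x - z‖ + dist x x₀ := by
    rw [dist_comm, dist_eq_norm]
    calc ‖x₀ - z‖ = ‖(x - z) + (x₀ - x)‖ := by congr 1; abel
      _ ≤ _ := norm_add_le _ _
  linarith [norm_nonneg (x - z)]

/-- The kernel is singular, so `x` is kept in the smooth factor and the derivative falls on `Z`. The
majorant that is uniform on the unit ball around `x₀` comes from `decayWeight_le`. -/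
lemma IsKernel.hasFDerivAt (hZ : DecaysUpTo (2 * d - 2) 1 Z) (x₀ : Spacetime d) :
    Integrable (fun z => K z • fderiv ℝ Z (x₀ - z)) ∧
    HasFDerivAt (convolve K Z) (∫ z, K z • fderiv ℝ Z (x₀ - z)) x₀ := by
  have hcd : ContDiff ℝ 1 Z := by exact_mod_cast hZ.contDiff
  have hdec (μ : Fin d) := (hZ.2.2 μ).2.le_decayWeight
  choose C hC0 hC using hdec
  have hb (y : Spacetime d) : ‖fderiv ℝ Z y‖ ≤ (∑ μ, C μ) * decayWeight d y := by
    refine (norm_fderiv_le Z y).trans ?_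
    rw [Finset.sum_mul]
    exact Finset.sum_le_sum fun μ _ => hC μ y
  have hC' : 0 ≤ ∑ μ, C μ := Finset.sum_nonneg fun μ _ => hC0 μ
  have hmeas : AEStronglyMeasurable (fun z => K z • fderiv ℝ Z (x₀ - z)) :=
    hK.measurable.aestronglyMeasurable.smul
      ((hcd.continuous_fderiv one_ne_zero).comp (continuous_const.sub continuous_id)).aestronglyMeasurable
  have hbound (x : Spacetime d) (hx : dist x x₀ < 1) (z : Spacetime d) :
      ‖K z • fderiv ℝ Z (x - z)‖ ≤
        (∑ μ, C μ) * 2 ^ (2 * d - 2) * (|K z| * decayWeight d (x₀ - z)) := by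
    rw [norm_smul, Real.norm_eq_abs]
    calc |K z| * ‖fderiv ℝ Z (x - z)‖ ≤ |K z| * ((∑ μ, C μ) * decayWeight d (x - z)) := by
          gcongr; exact hb _
      _ ≤ |K z| * ((∑ μ, C μ) * (2 ^ (2 * d - 2) * decayWeight d (x₀ - z))) := by
          gcongr; exact decayWeight_le hx
      _ = _ := by ring
  have hint := (hK.integrable_weight hd x₀).const_mul ((∑ μ, C μ) * 2 ^ (2 * d - 2))
  refine ⟨hint.mono' hmeas (.of_forall (hbound x₀ (by simp))), ?_⟩
  have : convolve K Z = fun x => ∫ z, K z * Z (x - z) := funext (convolve_eq K Z)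
  rw [this]
  refine hasFDerivAt_integral_of_dominated_of_fderiv_le (F' := fun x z => K z • fderiv ℝ Z (x - z))
    (Metric.ball_mem_nhds x₀ one_pos) (.of_forall fun x => ?_)
    (hK.integrable' hd hZ.continuous hZ.hasDecay x₀) hmeas
    (.of_forall fun z x hx => hbound x hx z) hint (.of_forall fun z x _ => ?_)
  · exact (hK.integrable' hd hZ.continuous hZ.hasDecay x).aestronglyMeasurable
  · have h1 : HasFDerivAt (fun x => Z (x - z)) (fderiv ℝ Z (x - z)) x := by
      have := (hZ.1 (x - z)).hasFDerivAt.comp x ((hasFDerivAt_id x).sub_const z)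
      simpa [Function.comp_def] using this
    exact h1.const_mul (K z)

lemma IsKernel.differentiable (hZ : DecaysUpTo (2 * d - 2) 1 Z) : Differentiable ℝ (convolve K Z) :=
  fun x => (hK.hasFDerivAt hd hZ x).2.differentiableAt

lemma IsKernel.partialDeriv (hZ : DecaysUpTo (2 * d - 2) 1 Z) (μ : Fin d) :
    partialDeriv μ (convolve K Z) = convolve K (partialDeriv μ Z) := by
  ext x
  obtain ⟨h1, h2⟩ := hK.hasFDerivAt hd hZ x
  rw [NicolaiMap.partialDeriv, h2.fderiv, ContinuousLinearMap.integral_apply h1, convolve_eq]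
  rfl

lemma IsKernel.convolve_mem (hZ : Z ∈ decaySpace d (2 * d - 2)) : convolve K Z ∈ decaySpace d t := by
  intro n
  induction n generalizing Z with
  | zero => exact ⟨(hK.differentiable hd (hZ 1)).continuous, hK.hasDecay hd (hZ 0).2⟩
  | succ n ih =>
    refine ⟨hK.differentiable hd (hZ 1), hK.hasDecay hd (hZ 0).2, fun μ => ?_⟩
    rw [hK.partialDeriv hd (hZ 1)]
    exact ih (partialDeriv_mem hZ μ)

end

end Kernel

end

end NicolaiMap

namespace NicolaiMap

noncomputable section

open scoped BigOperators
open MeasureTheory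

set_option linter.unusedSectionVars false

/-! ### The propagator -/

section Propagator

variable {d : ℕ}

lemma decayWeight_eq (y : Spacetime d) :
    decayWeight d y = ((1 + ‖y‖) ^ (d - 1))⁻¹ * ((1 + ‖y‖) ^ (d - 1))⁻¹ := by
  rw [decayWeight, ← mul_inv, ← pow_add]
  congr 2
  omega

/-- Up to a constant, `(1 + |z + y|)^(d-1)` is at most the sum of the same powers of `1 + |z|` and
`1 + |y|`. For `|z| < 1` the first is bounded and the weight absorbs the second. For `|z| ≥ 1`
either the kernel or the weight absorbs one power, and the product `p q` that is left over is
bounded by `p² + q²`. -/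
lemma isKernel_of_le {K : Spacetime d → ℝ} (hK : Measurable K) {c : ℝ} (hc : 0 ≤ c)
    (h : ∀ z ≠ 0, |K z| ≤ c * (‖z‖ ^ (d - 1))⁻¹) : IsKernel (d - 1) K := by
  refine ⟨hK, c * (2 ^ (d - 1 - 1) * (2 ^ (d - 1) + 1)) + c * (2 ^ (d - 1) * 2 ^ (d - 1 - 1) * 2) + |K 0|,
    by positivity, fun z y => ?_⟩
  have hs := singularPart_nonneg z
  have hwz := (decayWeight_pos z).le
  have hwy := (decayWeight_pos y).le
  set a := (1 + ‖z‖) with ha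
  set b := (1 + ‖y‖) with hb
  have ha1 : 1 ≤ a := by linarith [norm_nonneg z]
  have hb1 : 1 ≤ b := by linarith [norm_nonneg y]
  have hq : decayWeight d y = (b ^ (d - 1))⁻¹ * (b ^ (d - 1))⁻¹ := decayWeight_eq y
  have hp : decayWeight d z = (a ^ (d - 1))⁻¹ * (a ^ (d - 1))⁻¹ := decayWeight_eq z
  set q := (b ^ (d - 1))⁻¹
  set p := (a ^ (d - 1))⁻¹
  have hp0 : 0 < p := by positivity
  have hq0 : 0 < q := by positivity
  have hq1 : q ≤ 1 := inv_le_one_of_one_le₀ (one_le_pow₀ hb1)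
  have hbq : b ^ (d - 1) * q = 1 := mul_inv_cancel₀ (by positivity)
  have hap : a ^ (d - 1) * p = 1 := mul_inv_cancel₀ (by positivity)
  have hxy : (1 + ‖z + y‖) ^ (d - 1) ≤ 2 ^ (d - 1 - 1) * (a ^ (d - 1) + b ^ (d - 1)) := by
    refine le_trans ?_ (add_pow_le (by linarith) (by linarith) _)
    refine pow_le_pow_left₀ (by positivity) ?_ _
    linarith [norm_add_le z y]
  -- At `z = 0` the bound on `K` is not available; the value `|K 0|` is part of the constant.
  rcases eq_or_ne z 0 with rfl | hz
  · have ha' : a = 1 := by simp [ha]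
    have hp1 : p = 1 := by simp [p, ha']
    have h1 : decayWeight d y * (1 + ‖0 + y‖) ^ (d - 1) ≤ 1 := by
      rw [zero_add, hq, ← hb, mul_assoc, mul_comm q (b ^ _), hbq, mul_one]
      exact hq1
    calc |K 0| * decayWeight d y * (1 + ‖0 + y‖) ^ (d - 1) =
          |K 0| * (decayWeight d y * (1 + ‖0 + y‖) ^ (d - 1)) := by ring
      _ ≤ |K 0| * 1 := by gcongr
      _ ≤ (c * (2 ^ (d - 1 - 1) * (2 ^ (d - 1) + 1)) + c * (2 ^ (d - 1) * 2 ^ (d - 1 - 1) * 2) + |K 0|) *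
          1 := by
        gcongr
        have : 0 ≤ c * (2 ^ (d - 1 - 1) * (2 ^ (d - 1) + 1)) + c * (2 ^ (d - 1) * 2 ^ (d - 1 - 1) * 2) := by
          positivity
        linarith
      _ ≤ _ := by
        gcongr
        rw [hp, hp1]
        linarith
  · have hKz := h z hz
    have hz0 : 0 < ‖z‖ := norm_pos_iff.2 hz
    rcases lt_or_ge ‖z‖ 1 with hz1 | hz1
    · have hsz : singularPart d z = (‖z‖ ^ (d - 1))⁻¹ := by
        rw [singularPart, Set.indicator_of_mem (by simpa using hz1)]
      rw [← hsz] at hKz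
      have h2 : decayWeight d y * (1 + ‖z + y‖) ^ (d - 1) ≤ 2 ^ (d - 1 - 1) * (2 ^ (d - 1) + 1) := by
        calc decayWeight d y * (1 + ‖z + y‖) ^ (d - 1) ≤
              decayWeight d y * (2 ^ (d - 1 - 1) * (a ^ (d - 1) + b ^ (d - 1))) := by gcongr
          _ = 2 ^ (d - 1 - 1) * (a ^ (d - 1) * (q * q) + (b ^ (d - 1) * q) * q) := by rw [hq]; ring
          _ ≤ 2 ^ (d - 1 - 1) * (2 ^ (d - 1) * (1 * 1) + 1 * 1) := by
              rw [hbq]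
              gcongr
              linarith
          _ = _ := by ring
      calc |K z| * decayWeight d y * (1 + ‖z + y‖) ^ (d - 1) =
            |K z| * (decayWeight d y * (1 + ‖z + y‖) ^ (d - 1)) := by ring
        _ ≤ (c * singularPart d z) * (2 ^ (d - 1 - 1) * (2 ^ (d - 1) + 1)) := by gcongr
        _ = (c * (2 ^ (d - 1 - 1) * (2 ^ (d - 1) + 1)) + 0 + 0) * (singularPart d z + 0 + 0) := by ring
        _ ≤ _ := by gcongr <;> positivity
    · have h3 : (‖z‖ ^ (d - 1))⁻¹ ≤ 2 ^ (d - 1) * p := by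
        rw [← div_eq_mul_inv, inv_eq_one_div, div_le_div_iff₀ (by positivity) (by positivity), one_mul,
          ← mul_pow]
        gcongr
        linarith
      calc |K z| * decayWeight d y * (1 + ‖z + y‖) ^ (d - 1) ≤
            (c * (2 ^ (d - 1) * p)) * (q * q) * (2 ^ (d - 1 - 1) * (a ^ (d - 1) + b ^ (d - 1))) := by
              rw [← hq]
              gcongr
              exact hKz.trans (by gcongr)
        _ = c * (2 ^ (d - 1) * 2 ^ (d - 1 - 1)) *
            ((a ^ (d - 1) * p) * (q * q) + (b ^ (d - 1) * q) * (p * q)) := by ring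
        _ ≤ c * (2 ^ (d - 1) * 2 ^ (d - 1 - 1)) * (2 * (p * p + q * q)) := by
              rw [hap, hbq]
              gcongr
              nlinarith [sq_nonneg (p - q)]
        _ = (0 + c * (2 ^ (d - 1) * 2 ^ (d - 1 - 1) * 2) + 0) *
            (0 + decayWeight d z + decayWeight d y) := by rw [hp, hq]; ring
        _ ≤ _ := by gcongr <;> positivity

/-- Boundedness of the convolution suffices for `C` itself, because in the map such a convolution is
always multiplied by a field, which restores the decay. -/
lemma isKernel_zero_of_le {K : Spacetime d → ℝ} (hd : 3 ≤ d) (hK : Measurable K) {c : ℝ} (hc : 0 ≤ c)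
    (h : ∀ z, |K z| ≤ c * (‖z‖ ^ (d - 2))⁻¹) : IsKernel 0 K := by
  refine ⟨hK, c, hc, fun z y => ?_⟩
  have hs := singularPart_nonneg z
  have hwz := (decayWeight_pos z).le
  have hwy := (decayWeight_pos y).le
  have hwy1 := decayWeight_le_one y
  rw [pow_zero, mul_one]
  rcases lt_or_ge ‖z‖ 1 with hz1 | hz1
  · have hsz : singularPart d z = (‖z‖ ^ (d - 1))⁻¹ := by
      rw [singularPart, Set.indicator_of_mem (by simpa using hz1)]
    have h1 : (‖z‖ ^ (d - 2))⁻¹ ≤ (‖z‖ ^ (d - 1))⁻¹ := by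
      rcases eq_or_ne z 0 with rfl | hz
      · simp [show d - 2 ≠ 0 by omega, show d - 1 ≠ 0 by omega]
      · have hz0 : 0 < ‖z‖ := norm_pos_iff.2 hz
        gcongr ?_⁻¹
        exact pow_le_pow_of_le_one hz0.le hz1.le (by omega)
    calc |K z| * decayWeight d y ≤ (c * singularPart d z) * 1 := by
          rw [hsz]
          gcongr
          exact (h z).trans (by gcongr)
      _ = c * (singularPart d z + 0 + 0) := by ring
      _ ≤ _ := by gcongr
  · have h1 : (‖z‖ ^ (d - 2))⁻¹ ≤ 1 := inv_le_one_of_one_le₀ (one_le_pow₀ hz1)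
    calc |K z| * decayWeight d y ≤ (c * 1) * decayWeight d y := by
          gcongr
          exact (h z).trans (by gcongr)
      _ = c * (0 + 0 + decayWeight d y) := by ring
      _ ≤ _ := by gcongr

/-- The constant `Γ(d/2 - 1) / (4 π^{d/2})`. -/
def propagatorConst (d : ℕ) : ℝ :=
  Real.Gamma ((d : ℝ) / 2 - 1) / (4 * Real.pi ^ ((d : ℝ) / 2))

/-- The propagator with `|x|²` replaced by `|x|² + e`. -/
def regularized (d : ℕ) (e : ℝ) (z : Spacetime d) : ℝ :=
  propagatorConst d * (‖z‖ ^ 2 + e) ^ ((2 - (d : ℝ)) / 2)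

lemma propagator_eq : propagator d = regularized d 0 := by
  ext z
  rw [propagator, regularized, add_zero, ← Real.rpow_natCast, ← Real.rpow_mul (norm_nonneg z)]
  congr 2
  push_cast
  ring

lemma partialDeriv_regularized {e : ℝ} {z : Spacetime d} (h : 0 < ‖z‖ ^ 2 + e) (μ : Fin d) :
    DifferentiableAt ℝ (regularized d e) z ∧ partialDeriv μ (regularized d e) z =
      propagatorConst d * (2 - d) * ((‖z‖ ^ 2 + e) ^ (-(d : ℝ) / 2) * z μ) := by
  have h1 : HasFDerivAt (fun z : Spacetime d => ‖z‖ ^ 2 + e) (2 • innerSL ℝ z) z :=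
    (hasStrictFDerivAt_norm_sq z).hasFDerivAt.add_const e
  have h2 : HasFDerivAt (regularized d e) _ z :=
    (h1.rpow_const (p := (2 - (d : ℝ)) / 2) (.inl h.ne')).const_mul (propagatorConst d)
  refine ⟨h2.differentiableAt, ?_⟩
  rw [partialDeriv, h2.fderiv]
  have h3 : (2 - (d : ℝ)) / 2 - 1 = -(d : ℝ) / 2 := by ring
  simp only [smul_apply, innerSL_apply_apply, smul_eq_mul, nsmul_eq_mul, h3]
  rw [EuclideanSpace.inner_single_right]
  simp
  ring

lemma partialDeriv_propagator {z : Spacetime d} (hz : z ≠ 0) (μ : Fin d) :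
    partialDeriv μ (propagator d) z =
      propagatorConst d * (2 - d) * ((‖z‖ ^ d)⁻¹ * z μ) := by
  rw [propagator_eq, (partialDeriv_regularized (by rw [add_zero]; positivity) μ).2,
    add_zero]
  congr 2
  rw [← Real.rpow_natCast, ← Real.rpow_mul (norm_nonneg z), ← Real.rpow_natCast,
    ← Real.rpow_neg (norm_nonneg z)]
  congr 1
  push_cast
  ring

lemma abs_coord_le (z : Spacetime d) (μ : Fin d) : |z μ| ≤ ‖z‖ := PiLp.norm_apply_le z μ

lemma measurable_regularized (e : ℝ) : Measurable (regularized d e) := by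
  unfold regularized
  fun_prop

lemma isKernel_propagator (hd : 3 ≤ d) : IsKernel 0 (propagator d) := by
  refine isKernel_zero_of_le hd (propagator_eq ▸ measurable_regularized 0)
    (abs_nonneg (propagatorConst d)) fun z => ?_
  rw [propagator, ← propagatorConst, abs_mul, abs_of_nonneg (Real.rpow_nonneg (norm_nonneg z) _),
    show 2 - (d : ℝ) = -((d - 2 : ℕ) : ℝ) by rw [Nat.cast_sub (by omega)]; push_cast; ring,
    Real.rpow_neg (norm_nonneg z), Real.rpow_natCast]

lemma isKernel_partialDeriv_propagator (hd : 3 ≤ d) (μ : Fin d) :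
    IsKernel (d - 1) (partialDeriv μ (propagator d)) := by
  refine isKernel_of_le (measurable_fderiv_apply_const ℝ _ _)
    (abs_nonneg (propagatorConst d * (2 - d))) fun z hz => ?_
  have hz0 : 0 < ‖z‖ := norm_pos_iff.2 hz
  rw [partialDeriv_propagator hz, abs_mul, abs_mul ((‖z‖ ^ d)⁻¹), abs_of_nonneg (by positivity : 0 ≤ (‖z‖ ^ d)⁻¹)]
  gcongr
  rw [inv_mul_le_iff₀ (by positivity)]
  have e : ‖z‖ ^ d = ‖z‖ ^ (d - 1) * ‖z‖ := by
    rw [← pow_succ]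
    congr 1
    omega
  rw [e, mul_right_comm, mul_inv_cancel₀ (by positivity), one_mul]
  exact abs_coord_le z μ

lemma ae_ne_zero (hd : 3 ≤ d) : ∀ᵐ z : Spacetime d, z ≠ 0 := by
  have : Nontrivial (Spacetime d) := by
    have : Nonempty (Fin d) := ⟨⟨0, by omega⟩⟩
    infer_instance
  simp [ae_iff]

lemma rpow_le_rpow_of_nonneg_add {a e s : ℝ} (ha : 0 < a) (he : 0 ≤ e) (hs : s ≤ 0) :
    (a + e) ^ s ≤ a ^ s := Real.rpow_le_rpow_of_nonpos ha (by linarith) hs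

lemma abs_regularized_le (hd : 3 ≤ d) {e : ℝ} (he : 0 ≤ e) {z : Spacetime d} (hz : z ≠ 0) :
    |regularized d e z| ≤ |propagator d z| := by
  have hz0 : 0 < ‖z‖ ^ 2 := by positivity
  rw [propagator_eq, regularized, regularized, abs_mul, abs_mul, add_zero,
    abs_of_nonneg (by positivity : 0 ≤ (‖z‖ ^ 2 + e) ^ ((2 - (d : ℝ)) / 2)),
    abs_of_nonneg (by positivity : 0 ≤ (‖z‖ ^ 2) ^ ((2 - (d : ℝ)) / 2))]
  have : (3 : ℝ) ≤ d := by exact_mod_cast hd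
  exact mul_le_mul_of_nonneg_left (rpow_le_rpow_of_nonneg_add hz0 he (by linarith)) (abs_nonneg _)

lemma abs_partialDeriv_regularized_le {e : ℝ} (he : 0 ≤ e) {z : Spacetime d}
    (hz : z ≠ 0) (μ : Fin d) :
    |partialDeriv μ (regularized d e) z| ≤ |partialDeriv μ (propagator d) z| := by
  have hz0 : 0 < ‖z‖ ^ 2 := by positivity
  rw [propagator_eq, (partialDeriv_regularized (add_pos_of_pos_of_nonneg hz0 he) μ).2,
    (partialDeriv_regularized (add_pos_of_pos_of_nonneg hz0 le_rfl) μ).2, abs_mul, abs_mul _ (_ * z μ),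
    abs_mul (_ ^ _), abs_mul (_ ^ _), add_zero,
    abs_of_nonneg (by positivity : 0 ≤ (‖z‖ ^ 2 + e) ^ (-(d : ℝ) / 2)),
    abs_of_nonneg (by positivity : 0 ≤ (‖z‖ ^ 2) ^ (-(d : ℝ) / 2))]
  have : (0 : ℝ) ≤ d := by positivity
  have h := rpow_le_rpow_of_nonneg_add (s := -(d : ℝ) / 2) hz0 he (by linarith)
  exact mul_le_mul_of_nonneg_left (mul_le_mul_of_nonneg_right h (abs_nonneg _)) (abs_nonneg _)

lemma tendsto_regularized {z : Spacetime d} (hz : z ≠ 0) (s : ℝ) :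
    Filter.Tendsto (fun n : ℕ => (‖z‖ ^ 2 + 1 / ((n : ℝ) + 1)) ^ s) Filter.atTop
      (nhds ((‖z‖ ^ 2 + 0) ^ s)) := by
  have h1 : Filter.Tendsto (fun n : ℕ => ‖z‖ ^ 2 + 1 / ((n : ℝ) + 1)) Filter.atTop
      (nhds (‖z‖ ^ 2 + 0)) := tendsto_one_div_add_atTop_nhds_zero_nat.const_add _
  exact (Real.continuousAt_rpow_const _ _ (.inl (by simpa using hz))).tendsto.comp h1

section

variable (hd : 3 ≤ d) {X : Spacetime d → ℝ} (hX : X ∈ decaySpace d (2 * d - 2))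
include hd hX

/-- Integration by parts is applied to the kernel with `|z|²` replaced by `|z|² + 1/(n+1)`, which is
differentiable everywhere. The regularisation only decreases the absolute values of the kernel and
of its derivative off the origin, so dominated convergence removes it. -/
lemma convolve_partialDeriv (μ : Fin d) :
    convolve (propagator d) (partialDeriv μ X) = convolve (partialDeriv μ (propagator d)) X := by
  ext x
  rw [convolve_eq, convolve_eq]
  have hC := isKernel_propagator hd
  have hK := isKernel_partialDeriv_propagator hd μ
  have hX' := partialDeriv_mem hX μ
  have i1 := hC.integrable' hd (hX' 0).1 (hX' 0).2 x
  have i2 := hK.integrable' hd (hX 0).1 (hX 0).2 x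
  have i3 := hC.integrable' hd (hX 0).1 (hX 0).2 x
  have hcX : Continuous fun z => X (x - z) := (hX 0).1.comp (continuous_const.sub continuous_id)
  have hcX' : Continuous fun z => partialDeriv μ X (x - z) :=
    (hX' 0).1.comp (continuous_const.sub continuous_id)
  have hder (z : Spacetime d) : HasFDerivAt (fun z => X (x - z)) (- fderiv ℝ X (x - z)) z := by
    have := (differentiable_of_mem hX (x - z)).hasFDerivAt.comp z ((hasFDerivAt_id z).const_sub x)
    simpa [Function.comp_def] using this
  have hderμ (z : Spacetime d) : fderiv ℝ (fun z => X (x - z)) z (EuclideanSpace.single μ 1) =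
      - partialDeriv μ X (x - z) := by
    rw [(hder z).fderiv]; rfl
  let e (n : ℕ) : ℝ := 1 / ((n : ℝ) + 1)
  have he (n : ℕ) : 0 < e n := by positivity
  have b1 (n : ℕ) : ∀ᵐ z : Spacetime d, ‖regularized d (e n) z * partialDeriv μ X (x - z)‖ ≤
      ‖propagator d z * partialDeriv μ X (x - z)‖ := by
    filter_upwards [ae_ne_zero hd] with z hz
    rw [norm_mul, norm_mul]
    exact mul_le_mul_of_nonneg_right (abs_regularized_le hd (he n).le hz) (norm_nonneg _)
  have b2 (n : ℕ) : ∀ᵐ z : Spacetime d, ‖partialDeriv μ (regularized d (e n)) z * X (x - z)‖ ≤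
      ‖partialDeriv μ (propagator d) z * X (x - z)‖ := by
    filter_upwards [ae_ne_zero hd] with z hz
    rw [norm_mul, norm_mul]
    exact mul_le_mul_of_nonneg_right (abs_partialDeriv_regularized_le (he n).le hz μ) (norm_nonneg _)
  have b3 (n : ℕ) : ∀ᵐ z : Spacetime d, ‖regularized d (e n) z * X (x - z)‖ ≤
      ‖propagator d z * X (x - z)‖ := by
    filter_upwards [ae_ne_zero hd] with z hz
    rw [norm_mul, norm_mul]
    exact mul_le_mul_of_nonneg_right (abs_regularized_le hd (he n).le hz) (norm_nonneg _)
  have m0 (n : ℕ) : Measurable (partialDeriv μ (regularized d (e n))) := measurable_fderiv_apply_const ℝ _ _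
  have m1 (n : ℕ) : AEStronglyMeasurable fun z : Spacetime d =>
      regularized d (e n) z * partialDeriv μ X (x - z) :=
    ((measurable_regularized _).mul hcX'.measurable).aestronglyMeasurable
  have m2 (n : ℕ) : AEStronglyMeasurable fun z : Spacetime d =>
      partialDeriv μ (regularized d (e n)) z * X (x - z) :=
    ((m0 n).mul hcX.measurable).aestronglyMeasurable
  have m3 (n : ℕ) : AEStronglyMeasurable fun z : Spacetime d => regularized d (e n) z * X (x - z) :=
    ((measurable_regularized _).mul hcX.measurable).aestronglyMeasurable
  have key (n : ℕ) : ∫ z, regularized d (e n) z * partialDeriv μ X (x - z) =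
      ∫ z, partialDeriv μ (regularized d (e n)) z * X (x - z) := by
    have := integral_mul_fderiv_eq_neg_fderiv_mul_of_integrable (𝕜 := ℝ) (μ := volume)
      (f := regularized d (e n)) (g := fun z => X (x - z)) (v := EuclideanSpace.single μ 1)
      (i2.norm.mono' (m2 n) (b2 n))
      (by
        simp only [hderμ, mul_neg]
        exact (i1.norm.mono' (m1 n) (b1 n)).neg)
      (i3.norm.mono' (m3 n) (b3 n))
      (fun z _ => (partialDeriv_regularized (add_pos_of_nonneg_of_pos (by positivity) (he n)) μ).1)
      (fun z _ => (hder z).differentiableAt)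
    simp only [hderμ, mul_neg, integral_neg, neg_inj] at this
    exact this
  have t1 := tendsto_integral_of_dominated_convergence _ m1 i1.norm b1
    (f := fun z => propagator d z * partialDeriv μ X (x - z)) (by
      filter_upwards [ae_ne_zero hd] with z hz
      rw [propagator_eq]
      exact ((tendsto_regularized hz _).const_mul _).mul_const _)
  have t2 := tendsto_integral_of_dominated_convergence _ m2 i2.norm b2
    (f := fun z => partialDeriv μ (propagator d) z * X (x - z)) (by
      filter_upwards [ae_ne_zero hd] with z hz
      have hz0 : 0 < ‖z‖ ^ 2 := by positivity
      rw [propagator_eq, (partialDeriv_regularized (add_pos_of_pos_of_nonneg hz0 le_rfl) μ).2]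
      have e1 (n : ℕ) : partialDeriv μ (regularized d (e n)) z = _ :=
        (partialDeriv_regularized (add_pos hz0 (he n)) μ).2
      simp only [e1]
      exact (((tendsto_regularized hz _).mul_const _).const_mul _).mul_const _)
  simp only [key] at t1
  exact tendsto_nhds_unique t1 t2

lemma partialDeriv_convolve_propagator (μ : Fin d) :
    partialDeriv μ (convolve (propagator d) X) = convolve (partialDeriv μ (propagator d)) X := by
  rw [(isKernel_propagator hd).partialDeriv hd (hX 1), convolve_partialDeriv hd hX]

lemma partialDeriv_convolve (μ ν : Fin d) :
    partialDeriv μ (convolve (partialDeriv ν (propagator d)) X) =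
      convolve (partialDeriv ν (propagator d)) (partialDeriv μ X) :=
  (isKernel_partialDeriv_propagator hd ν).partialDeriv hd (hX 1) μ

end

end Propagator

end

end NicolaiMap

namespace NicolaiMap

noncomputable section

open scoped BigOperators
open MeasureTheory

set_option linter.unusedSectionVars false

/-! ### The Green function property -/

section Polar

variable {E : Type*} [NormedAddCommGroup E] [NormedSpace ℝ E] [FiniteDimensional ℝ E]
  [MeasurableSpace E] [BorelSpace E] [Nontrivial E] (μ : Measure E) [μ.IsAddHaarMeasure]

lemma integrable_volumeIoiPow_iff (n : ℕ) (F : ℝ → ℝ) :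
    Integrable (fun r : Set.Ioi (0 : ℝ) => F r) (Measure.volumeIoiPow n) ↔
      IntegrableOn (fun r => r ^ n * F r) (Set.Ioi 0) := by
  simp only [Measure.volumeIoiPow, ENNReal.ofReal]
  rw [integrable_withDensity_iff_integrable_smul
    (measurable_subtype_coe.pow_const n).real_toNNReal,
    integrableOn_iff_comap_subtypeVal measurableSet_Ioi]
  refine integrable_congr (.of_forall fun r => ?_)
  simp [NNReal.smul_def, pow_nonneg r.2.out.le]

lemma integral_volumeIoiPow (n : ℕ) (F : ℝ → ℝ) :
    ∫ r : Set.Ioi (0 : ℝ), F r ∂(Measure.volumeIoiPow n) = ∫ r in Set.Ioi 0, r ^ n * F r := by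
  simp only [Measure.volumeIoiPow, ENNReal.ofReal]
  rw [integral_withDensity_eq_integral_smul (measurable_subtype_coe.pow_const n).real_toNNReal,
    integral_subtype_comap measurableSet_Ioi fun a ↦ Real.toNNReal (a ^ n) • F a]
  refine setIntegral_congr_fun measurableSet_Ioi fun r hr => ?_
  simp [NNReal.smul_def, pow_nonneg hr.out.le]

/-- Polar coordinates identify the punctured space with sphere times half-line as measure spaces.
Fubini's theorem then yields the iterated integral together with integrability along almost every
ray, which the radial integration below relies on. -/
lemma integral_eq_integral_toSphere {F : E → ℝ} (hF : Integrable F μ) :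
    (∀ᵐ u : Metric.sphere (0 : E) 1 ∂μ.toSphere, IntegrableOn
      (fun r : ℝ => r ^ (Module.finrank ℝ E - 1) * F (r • (u : E))) (Set.Ioi 0)) ∧
    ∫ x, F x ∂μ = ∫ u, (∫ r in Set.Ioi (0 : ℝ),
      r ^ (Module.finrank ℝ E - 1) * F (r • (u : E))) ∂μ.toSphere := by
  have hm := μ.measurePreserving_homeomorphUnitSphereProd
  have he := (homeomorphUnitSphereProd E).measurableEmbedding
  let Φ : Metric.sphere (0 : E) 1 × Set.Ioi (0 : ℝ) → ℝ := fun p => F ((p.2 : ℝ) • (p.1 : E))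
  have hΦ : Φ ∘ homeomorphUnitSphereProd E = fun x => F x.1 := by
    ext x
    simp only [Φ, Function.comp_apply]
    congr 1
    have : ‖(x : E)‖ ≠ 0 := norm_ne_zero_iff.2 x.2
    simp [smul_smul, this]
  have hi : Integrable Φ (μ.toSphere.prod (.volumeIoiPow (Module.finrank ℝ E - 1))) := by
    rw [← hm.integrable_comp_emb he, hΦ]
    exact (integrableOn_iff_comap_subtypeVal (measurableSet_singleton _).compl).1 hF.integrableOn
  have h1 : ∫ x, F x ∂μ = ∫ p, Φ p ∂(μ.toSphere.prod (.volumeIoiPow (Module.finrank ℝ E - 1))) := by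
    rw [← hm.integral_comp he Φ]
    change _ = ∫ x, (Φ ∘ homeomorphUnitSphereProd E) x ∂_
    rw [hΦ, integral_subtype_comap (measurableSet_singleton _).compl F, restrict_compl_singleton]
  refine ⟨?_, ?_⟩
  · filter_upwards [hi.prod_right_ae] with u hu
    exact (integrable_volumeIoiPow_iff _ fun r => F (r • (u : E))).1 hu
  · rw [h1, integral_prod _ hi]
    exact integral_congr_ae (.of_forall fun u =>
      integral_volumeIoiPow _ fun r => F (r • (u : E)))

end Polar

section Laplace

variable {d : ℕ}

/-- The normalisation of `C`: the flux of its gradient through the unit sphere is `-1`. It rests on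
`Γ(d/2 + 1) = (d/2) (d/2 - 1) Γ(d/2 - 1)`. -/
lemma propagatorConst_mul (hd : 3 ≤ d) :
    propagatorConst d * (2 - d) *
      (volume : Measure (Spacetime d)).toSphere.real Set.univ = -1 := by
  have : Nonempty (Fin d) := ⟨⟨0, by omega⟩⟩
  have h3 : (3 : ℝ) ≤ d := by exact_mod_cast hd
  rw [Measure.toSphere_real_apply_univ, finrank_euclideanSpace_fin, measureReal_def,
    EuclideanSpace.volume_ball, ENNReal.ofReal_one, one_pow, one_mul, Fintype.card_fin,
    ENNReal.toReal_ofReal (by have := Real.Gamma_pos_of_pos (s := (d : ℝ) / 2 + 1) (by positivity); positivity),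
    Real.Gamma_add_one (by positivity),
    show (d : ℝ) / 2 = (d / 2 - 1) + 1 by ring, Real.Gamma_add_one (by linarith), propagatorConst]
  rw [show (d : ℝ) / 2 - 1 + 1 = d / 2 by ring]
  have h1 : (0 : ℝ) < Real.Gamma ((d : ℝ) / 2 - 1) := Real.Gamma_pos_of_pos (by linarith)
  have h2 : √Real.pi ^ d = Real.pi ^ ((d : ℝ) / 2) := by
    rw [Real.sqrt_eq_rpow, ← Real.rpow_natCast, ← Real.rpow_mul Real.pi_pos.le]
    congr 1
    ring
  have h4 : (0 : ℝ) < Real.pi ^ ((d : ℝ) / 2) := by positivity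
  have h5 : (d : ℝ) - 2 ≠ 0 := by linarith
  rw [h2]
  generalize Real.Gamma ((d : ℝ) / 2 - 1) = G at h1 ⊢
  field_simp
  ring

variable (hd : 3 ≤ d) {X : Spacetime d → ℝ} (hX : X ∈ decaySpace d (2 * d - 2))
include hd hX

/-- The fundamental theorem of calculus along the ray; decay removes the contribution from infinity.
-/
lemma integral_radial (x : Spacetime d) {u : Spacetime d} (hu : ‖u‖ = 1)
    (hi : IntegrableOn (fun r : ℝ => fderiv ℝ X (x - r • u) u) (Set.Ioi 0)) :
    ∫ r in Set.Ioi (0 : ℝ), fderiv ℝ X (x - r • u) u = X x := by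
  have hder (r : ℝ) : HasDerivAt (fun r : ℝ => - X (x - r • u)) (fderiv ℝ X (x - r • u) u) r := by
    have h1 : HasDerivAt (fun r : ℝ => x - r • u) (-u) r := by
      simpa using ((hasDerivAt_id r).smul_const u).const_sub x
    have := ((differentiable_of_mem hX (x - r • u)).hasFDerivAt.comp_hasDerivAt r h1).fun_neg
    simpa [Function.comp_def] using this
  have hlim : Filter.Tendsto (fun r : ℝ => - X (x - r • u)) Filter.atTop (nhds 0) := by
    obtain ⟨C, hC⟩ := (hX 0).2
    have hb (r : ℝ) (hr : ‖x‖ + 1 ≤ r) : ‖- X (x - r • u)‖ ≤ C * (r - ‖x‖)⁻¹ := by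
      have h1 : r - ‖x‖ ≤ 1 + ‖x - r • u‖ := by
        have := norm_sub_norm_le (r • u) x
        rw [norm_smul, hu, mul_one, norm_sub_rev, Real.norm_eq_abs] at this
        linarith [le_abs_self r]
      have h2 : r - ‖x‖ ≤ (1 + ‖x - r • u‖) ^ (2 * d - 2) :=
        h1.trans (le_self_pow₀ (by linarith [norm_nonneg (x - r • u)]) (by omega))
      rw [← div_eq_mul_inv, le_div_iff₀ (by linarith), norm_neg, Real.norm_eq_abs]
      exact (mul_le_mul_of_nonneg_left h2 (abs_nonneg _)).trans (hC _)
    refine squeeze_zero_norm' (Filter.eventually_atTop.2 ⟨‖x‖ + 1, hb⟩) ?_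
    have : Filter.Tendsto (fun r : ℝ => r - ‖x‖) Filter.atTop Filter.atTop :=
      Filter.tendsto_atTop_add_const_right _ _ Filter.tendsto_id
    simpa using this.inv_tendsto_atTop.const_mul C
  have := integral_Ioi_of_hasDerivAt_of_tendsto' (a := 0) (fun r _ => hder r) hi hlim
  simpa using this

/-- With the outer derivatives moved onto `X`, the weight `r^(d-1)` cancels the homogeneity of `∂C`,
and on each ray a constant times the radial derivative of `X` is left. Every ray integrates to the
same multiple of `X x`, and `propagatorConst_mul` normalises the total to `-X x`. -/
lemma sum_partialDeriv_convolve :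
    ∑ μ, partialDeriv μ (convolve (partialDeriv μ (propagator d)) X) = -X := by
  have : Nonempty (Fin d) := ⟨⟨0, by omega⟩⟩
  have : Nontrivial (Spacetime d) := inferInstance
  ext x
  have hi (μ : Fin d) : Integrable fun z =>
      partialDeriv μ (propagator d) z * partialDeriv μ X (x - z) :=
    (isKernel_partialDeriv_propagator hd μ).integrable' hd (partialDeriv_mem hX μ 0).1
      (partialDeriv_mem hX μ 0).2 x
  let F (z : Spacetime d) : ℝ := ∑ μ, partialDeriv μ (propagator d) z * partialDeriv μ X (x - z)
  have hF : Integrable F := integrable_finsetSum _ fun μ _ => hi μ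
  have hFr (u : Spacetime d) (hu : ‖u‖ = 1) (r : ℝ) (hr : 0 < r) :
      r ^ (Module.finrank ℝ (Spacetime d) - 1) * F (r • u) =
        propagatorConst d * (2 - d) * fderiv ℝ X (x - r • u) u := by
    have hne : r • u ≠ 0 := by
      rw [← norm_ne_zero_iff, norm_smul, hu]
      simpa using hr.ne'
    have hn : ‖r • u‖ = r := by rw [norm_smul, hu, mul_one, Real.norm_of_nonneg hr.le]
    have hr' : r ^ (d - 1) * ((r ^ d)⁻¹ * r) = 1 := by
      rw [mul_left_comm, ← pow_succ, show d - 1 + 1 = d by omega, inv_mul_cancel₀ (by positivity)]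
    rw [fderiv_apply_eq_sum, finrank_euclideanSpace_fin, Finset.mul_sum, Finset.mul_sum]
    refine Finset.sum_congr rfl fun μ _ => ?_
    rw [partialDeriv_propagator hne, hn]
    simp only [PiLp.smul_apply, smul_eq_mul]
    linear_combination (propagatorConst d * (2 - d) * u μ * partialDeriv μ X (x - r • u)) * hr'
  obtain ⟨h1, h2⟩ := integral_eq_integral_toSphere volume hF
  calc (∑ μ, partialDeriv μ (convolve (partialDeriv μ (propagator d)) X)) x
      = ∫ z, F z := by
        rw [Finset.sum_apply, integral_finsetSum _ fun μ _ => hi μ]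
        refine Finset.sum_congr rfl fun μ _ => ?_
        rw [partialDeriv_convolve hd hX, convolve_eq]
    _ = ∫ u : Metric.sphere (0 : Spacetime d) 1, propagatorConst d * (2 - d) * X x
          ∂(volume : Measure (Spacetime d)).toSphere := by
        rw [h2]
        refine integral_congr_ae ?_
        filter_upwards [h1] with u hu
        have hu1 : ‖(u : Spacetime d)‖ = 1 := by simp
        -- A nonzero constant lets integrability pass from the product to the radial derivative
        -- alone.
        have hκ : propagatorConst d * (2 - d) ≠ 0 := by
          intro h
          have := propagatorConst_mul hd
          rw [h] at this
          simp at this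
        rw [setIntegral_congr_fun measurableSet_Ioi fun r hr => hFr u hu1 r hr,
          integral_const_mul, integral_radial hd hX x hu1]
        have := hu.congr_fun (fun r hr => hFr u hu1 r hr) measurableSet_Ioi
        exact (integrable_const_mul_iff hκ.isUnit _).1 this
    _ = _ := by
        rw [integral_const, smul_eq_mul, Pi.neg_apply]
        linear_combination X x * propagatorConst_mul hd

end Laplace

end

end NicolaiMap

namespace NicolaiMap

noncomputable section

open scoped BigOperators
open MeasureTheory

set_option linter.unusedSectionVars false

/-! ### The position space calculus -/

/-- Differentiation and convolution are additive only where they make sense. Extending them linearly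
from a space of decaying functions gives total linear operators, to which the multiplet algebra
applies; their values elsewhere are arbitrary. -/
lemma exists_linearMap_eqOn {V W : Type*} [AddCommGroup V] [Module ℝ V] [AddCommGroup W]
    [Module ℝ W] (p : Submodule ℝ V) (T : V → W)
    (hadd : ∀ X ∈ p, ∀ Y ∈ p, T (X + Y) = T X + T Y)
    (hsmul : ∀ (c : ℝ), ∀ X ∈ p, T (c • X) = c • T X) :
    ∃ T' : V →ₗ[ℝ] W, ∀ X ∈ p, T' X = T X := by
  let T₀ : p →ₗ[ℝ] W :=
    { toFun := fun X => T X
      map_add' := fun X Y => hadd X X.2 Y Y.2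
      map_smul' := fun c X => hsmul c X X.2 }
  obtain ⟨T', hT'⟩ := T₀.exists_extend
  exact ⟨T', fun X hX => LinearMap.congr_fun hT' ⟨X, hX⟩⟩

/-- Linear operations on all functions that agree with those of position space, and a linear
functional that agrees with the integral, on functions of sufficient decay. -/
structure PositionCalculus (d : ℕ) extends LinearCalculus d (Spacetime d → ℝ) where
  int : (Spacetime d → ℝ) →ₗ[ℝ] ℝ
  D_eq : ∀ μ, ∀ X ∈ decaySpace d 0, D μ X = partialDeriv μ X
  G_eq : ∀ X ∈ decaySpace d (2 * d - 2), G X = convolve (propagator d) X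
  dG_eq : ∀ μ, ∀ X ∈ decaySpace d (2 * d - 2), dG μ X = convolve (partialDeriv μ (propagator d)) X
  int_eq : ∀ X ∈ decaySpace d (2 * d - 2), int X = ∫ x, X x

section

variable {d : ℕ}

lemma exists_convolve {t : ℕ} {K : Spacetime d → ℝ} (hd : 3 ≤ d) (hK : IsKernel t K) :
    ∃ T : (Spacetime d → ℝ) →ₗ[ℝ] (Spacetime d → ℝ),
      ∀ X ∈ decaySpace d (2 * d - 2), T X = convolve K X := by
  have hi {X : Spacetime d → ℝ} (hX : X ∈ decaySpace d (2 * d - 2)) (x : Spacetime d) :=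
    hK.integrable hd (hX 0).1 (hX 0).2 x
  refine exists_linearMap_eqOn _ _ (fun X hX Y hY => ?_) fun c X hX => ?_
  · ext x
    simp only [convolve, Pi.add_apply, mul_add]
    exact integral_add (hi hX x) (hi hY x)
  · ext x
    simp only [convolve, Pi.smul_apply, smul_eq_mul, mul_left_comm _ c, integral_const_mul]

theorem nonempty_positionCalculus (hd : 3 ≤ d) : Nonempty (PositionCalculus d) := by
  have h1 (μ : Fin d) := exists_linearMap_eqOn (decaySpace d 0) (partialDeriv μ)
    (fun X hX Y hY => partialDeriv_add (differentiable_of_mem hX) (differentiable_of_mem hY) μ)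
    fun c X _ => partialDeriv_smul c X μ
  have h3 (μ : Fin d) := exists_convolve hd (isKernel_partialDeriv_propagator hd μ)
  have hi {X : Spacetime d → ℝ} (hX : X ∈ decaySpace d (2 * d - 2)) : Integrable X :=
    integrable_of_hasDecay hd (hX 0).1 (hX 0).2
  obtain ⟨int, hint⟩ := exists_linearMap_eqOn (decaySpace d (2 * d - 2)) (fun X => ∫ x, X x)
    (fun X hX Y hY => integral_add (hi hX) (hi hY)) fun c X _ => integral_const_mul c X
  obtain ⟨G, hG⟩ := exists_convolve hd (isKernel_propagator hd)
  choose D hD using h1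
  choose dG hdG using h3
  exact ⟨⟨⟨D, G, dG⟩, int, hD, hG, hdG, hint⟩⟩

lemma mul_mem_decay {X Y : Spacetime d → ℝ} (hX : X ∈ decaySpace d (d - 1))
    (hY : Y ∈ decaySpace d (d - 1)) : X * Y ∈ decaySpace d (2 * d - 2) := by
  have := mul_mem_decaySpace hX hY
  rwa [show d - 1 + (d - 1) = 2 * d - 2 by omega] at this

lemma mul_mem_decay' {X Y : Spacetime d → ℝ} (hX : X ∈ decaySpace d (2 * d - 2))
    (hY : Y ∈ decaySpace d 0) : X * Y ∈ decaySpace d (2 * d - 2) := mul_mem_decaySpace hX hY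

/-- The multiplets with components in `decaySpace`. -/
def multipletSpace (ι : Type*) (d s : ℕ) : Submodule ℝ (ι → Spacetime d → ℝ) where
  carrier := {X | ∀ a, X a ∈ decaySpace d s}
  add_mem' hX hY a := add_mem (hX a) (hY a)
  zero_mem' _ := zero_mem _
  smul_mem' c _ hX a := Submodule.smul_mem _ c (hX a)

lemma multipletSpace_mono {ι : Type*} {s t : ℕ} (h : t ≤ s) :
    multipletSpace ι d s ≤ multipletSpace ι d t := fun _ hX a => decaySpace_mono h (hX a)

variable {ι : Type*} [Fintype ι] [DecidableEq ι] {f : ι → ι → ι → ℝ} {N : ℝ}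

lemma bracket_mem {X Y : ι → Spacetime d → ℝ} {s : ℕ}
    (h : ∀ b c, X b * Y c ∈ decaySpace d s) : bracket f X Y ∈ multipletSpace ι d s := fun a => by
  rw [bracket_apply]
  exact Submodule.sum_mem _ fun b _ => Submodule.sum_mem _ fun c _ => Submodule.smul_mem _ _ (h b c)

namespace PositionCalculus

variable (P : PositionCalculus d)

/-- The pairing `∫ X^a Y^a`. -/
def pair : (ι → Spacetime d → ℝ) →ₗ[ℝ] (ι → Spacetime d → ℝ) →ₗ[ℝ] ℝ :=
  LinearMap.mk₂ ℝ (fun X Y => P.int (∑ a, X a * Y a))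
    (fun X X' Y => by simp [add_mul, Finset.sum_add_distrib])
    (fun r X Y => by simp [← Finset.smul_sum])
    (fun X Y Y' => by simp [mul_add, Finset.sum_add_distrib])
    (fun r X Y => by simp [← Finset.smul_sum])

lemma pair_apply (X Y : ι → Spacetime d → ℝ) : P.pair X Y = P.int (∑ a, X a * Y a) := rfl

lemma pair_bracket (hf : IsStructureConstants f N) (X Y Z : ι → Spacetime d → ℝ) :
    P.pair X (bracket f Y Z) = P.pair (bracket f X Y) Z := by
  have cyc (x y z : ι) : f z x y = f x y z := by
    rw [hf.antisymm_left, hf.antisymm_right, neg_neg]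
  rw [pair_apply, pair_apply]
  congr 1
  simp only [bracket_apply, Finset.mul_sum, Finset.sum_mul]
  rw [Finset.sum_congr rfl fun a _ => Finset.sum_comm, Finset.sum_comm]
  refine Finset.sum_congr rfl fun c _ => Finset.sum_congr rfl fun a _ =>
    Finset.sum_congr rfl fun b _ => ?_
  rw [cyc a b c, mul_smul_comm, smul_mul_assoc, mul_assoc]

lemma int_mul_D (hd : 3 ≤ d) {X Y : Spacetime d → ℝ} (hX : X ∈ decaySpace d (d - 1))
    (hY : Y ∈ decaySpace d (d - 1)) (μ : Fin d) :
    P.int (P.D μ X * Y) = - P.int (X * P.D μ Y) := by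
  have hi {Z : Spacetime d → ℝ} (hZ : Z ∈ decaySpace d (2 * d - 2)) : Integrable Z :=
    integrable_of_hasDecay hd (hZ 0).1 (hZ 0).2
  have h1 := mul_mem_decay (partialDeriv_mem hX μ) hY
  have h2 := mul_mem_decay hX (partialDeriv_mem hY μ)
  rw [P.D_eq μ X (decaySpace_mono (Nat.zero_le _) hX), P.D_eq μ Y (decaySpace_mono (Nat.zero_le _) hY),
    P.int_eq _ h1, P.int_eq _ h2, eq_comm, neg_eq_iff_eq_neg]
  exact integral_mul_fderiv_eq_neg_fderiv_mul_of_integrable (hi h1) (hi h2)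
    (hi (mul_mem_decay hX hY)) (fun x _ => differentiable_of_mem hX x)
    (fun x _ => differentiable_of_mem hY x)

/-- The calculus of multiplets of functions on space-time. -/
def decayCalculus (hd : 3 ≤ d) (hf : IsStructureConstants f N) :
    DecayCalculus d (ι → Spacetime d → ℝ) where
  toMultipletCalculus := P.multiplet f
  N := multipletSpace ι d (2 * d - 2)
  H := multipletSpace ι d (d - 1)
  B := multipletSpace ι d 0
  N_le := multipletSpace_mono (by omega)
  H_le := multipletSpace_mono (Nat.zero_le _)
  br_H hX hY := bracket_mem fun b c => mul_mem_decay (hX b) (hY c)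
  br_N hX hY := bracket_mem fun b c => mul_comm (_ : Spacetime d → ℝ) _ ▸ mul_mem_decay' (hY c) (hX b)
  D_N μ hX a := by
    change P.D μ _ ∈ _
    rw [P.D_eq μ _ (decaySpace_mono (Nat.zero_le _) (hX a))]
    exact partialDeriv_mem (hX a) μ
  D_H μ hX a := by
    change P.D μ _ ∈ _
    rw [P.D_eq μ _ (decaySpace_mono (Nat.zero_le _) (hX a))]
    exact partialDeriv_mem (hX a) μ
  dG_mem μ hX a := by
    change P.dG μ _ ∈ _
    rw [P.dG_eq μ _ (hX a)]
    exact (isKernel_partialDeriv_propagator hd μ).convolve_mem hd (hX a)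
  G_mem hX a := by
    change P.G _ ∈ _
    rw [P.G_eq _ (hX a)]
    exact (isKernel_propagator hd).convolve_mem hd (hX a)
  D_br {X Y} μ hX hY := by
    ext1 a
    have h (b c : ι) : P.D μ (X b * Y c) = P.D μ (X b) * Y c + X b * P.D μ (Y c) := by
      rw [P.D_eq μ _ (mul_mem_decaySpace (hX b) (hY c)), P.D_eq μ _ (hX b), P.D_eq μ _ (hY c),
        partialDeriv_mul (differentiable_of_mem (hX b)) (differentiable_of_mem (hY c))]
    simp only [multiplet_br, multiplet_D, LinearMap.compLeft_apply, Function.comp_apply,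
      bracket_apply, map_sum, map_smul, h, smul_add, Finset.sum_add_distrib, Pi.add_apply]
  D_comm {X} μ ν hX := by
    ext1 a
    change P.D μ (P.D ν (X a)) = P.D ν (P.D μ (X a))
    rw [P.D_eq ν _ (hX a), P.D_eq μ _ (hX a), P.D_eq μ _ (partialDeriv_mem (hX a) ν),
      P.D_eq ν _ (partialDeriv_mem (hX a) μ)]
    exact partialDeriv_comm (contDiff_infty.1 (contDiff_of_mem (hX a)) 2) μ ν
  D_G {X} μ hX := by
    ext1 a
    change P.D μ (P.G (X a)) = P.dG μ (X a)
    rw [P.G_eq _ (hX a), P.dG_eq μ _ (hX a),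
      P.D_eq μ _ ((isKernel_propagator hd).convolve_mem hd (hX a)),
      partialDeriv_convolve_propagator hd (hX a)]
  D_dG {X} μ ν hX := by
    ext1 a
    change P.D μ (P.dG ν (X a)) = P.dG ν (P.D μ (X a))
    rw [P.dG_eq ν _ (hX a), P.D_eq μ (X a) (decaySpace_mono (Nat.zero_le _) (hX a)),
      P.dG_eq ν _ (partialDeriv_mem (hX a) μ), P.D_eq μ _ (decaySpace_mono (Nat.zero_le _)
        ((isKernel_partialDeriv_propagator hd ν).convolve_mem hd (hX a))),
      partialDeriv_convolve hd (hX a)]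
  laplace {X} hX := by
    ext1 a
    rw [Finset.sum_apply]
    change ∑ μ, P.D μ (P.dG μ (X a)) = - X a
    rw [← sum_partialDeriv_convolve hd (hX a)]
    refine Finset.sum_congr rfl fun μ _ => ?_
    rw [P.dG_eq μ _ (hX a), P.D_eq μ _ (decaySpace_mono (Nat.zero_le _)
        ((isKernel_partialDeriv_propagator hd μ).convolve_mem hd (hX a)))]
  br_swap X Y := bracket_antisymm f hf.antisymm_right X Y
  jacobi X Y Z := by
    have h := bracket_jacobi hf X Y Z
    have anti := bracket_antisymm (R := Spacetime d → ℝ) f hf.antisymm_right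
    rw [anti (bracket f X Y) Z] at h
    change bracket f X (bracket f Y Z) + bracket f Y (bracket f Z X) + bracket f Z (bracket f X Y) = 0
    rw [anti Z X, map_neg, neg_eq_iff_eq_neg.1 h]
    abel
  pair := P.pair
  pair_comm X Y := by simp only [pair_apply, mul_comm]
  pair_br := P.pair_bracket hf
  pair_D {X Y} μ hX hY := by
    rw [pair_apply, pair_apply, map_sum, map_sum, ← Finset.sum_neg_distrib]
    exact Finset.sum_congr rfl fun a _ => P.int_mul_D hd (hX a) (hY a) μ

end PositionCalculus

end

end

end NicolaiMap

namespace NicolaiMap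

noncomputable section

open scoped BigOperators
open MeasureTheory

set_option linter.unusedSectionVars false

/-! ### The Nicolai map on test fields -/

namespace PositionCalculus

variable {d : ℕ} (P : PositionCalculus d)

section Transfer

lemma alt2_mem {p : Submodule ℝ (Spacetime d → ℝ)} {X : Fin d → Fin d → Spacetime d → ℝ}
    (h : ∀ μ ν, X μ ν ∈ p) (μ ν : Fin d) : alt2 X μ ν ∈ p :=
  Submodule.smul_mem _ _ (sub_mem (h _ _) (h _ _))

lemma alt3_mem {p : Submodule ℝ (Spacetime d → ℝ)} {X : Fin d → Fin d → Fin d → Spacetime d → ℝ}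
    (h : ∀ μ ν ρ, X μ ν ρ ∈ p) (μ ν ρ : Fin d) : alt3 X μ ν ρ ∈ p :=
  Submodule.smul_mem _ _ (sub_mem (sub_mem (sub_mem (add_mem (add_mem (h _ _ _) (h _ _ _))
    (h _ _ _)) (h _ _ _)) (h _ _ _)) (h _ _ _))

lemma positionSpace_D {X : Spacetime d → ℝ} (hX : X ∈ decaySpace d 0) (μ : Fin d) :
    (positionSpace d).D μ X = P.D μ X := (P.D_eq μ X hX).symm

lemma positionSpace_G {X : Spacetime d → ℝ} (hX : X ∈ decaySpace d (2 * d - 2)) :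
    (positionSpace d).G X = P.G X := (P.G_eq X hX).symm

lemma positionSpace_dG {X : Spacetime d → ℝ} (hX : X ∈ decaySpace d (2 * d - 2)) (μ : Fin d) :
    (positionSpace d).dG μ X = P.dG μ X := (P.dG_eq μ X hX).symm

variable {ι : Type*} [Fintype ι] [DecidableEq ι] {f : ι → ι → ι → ℝ} {N : ℝ}
  {A : GaugeField ι d (Spacetime d → ℝ)}
  (hd : 3 ≤ d) (hA : ∀ a μ, A a μ ∈ decaySpace d (2 * d - 2))

include hd in
lemma dG_mem {X : Spacetime d → ℝ} (hX : X ∈ decaySpace d (2 * d - 2)) (μ : Fin d) :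
    P.dG μ X ∈ decaySpace d (d - 1) := by
  rw [P.dG_eq μ _ hX]
  exact (isKernel_partialDeriv_propagator hd μ).convolve_mem hd hX

include hd in
lemma dG_mem_zero {X : Spacetime d → ℝ} (hX : X ∈ decaySpace d (2 * d - 2)) (μ : Fin d) :
    P.dG μ X ∈ decaySpace d 0 := decaySpace_mono (Nat.zero_le _) (P.dG_mem hd hX μ)

include hd in
lemma G_mem {X : Spacetime d → ℝ} (hX : X ∈ decaySpace d (2 * d - 2)) :
    P.G X ∈ decaySpace d 0 := by
  rw [P.G_eq _ hX]
  exact (isKernel_propagator hd).convolve_mem hd hX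

lemma D_mem {s : ℕ} {X : Spacetime d → ℝ} (hX : X ∈ decaySpace d s) (μ : Fin d) :
    P.D μ X ∈ decaySpace d s := by
  rw [P.D_eq μ _ (decaySpace_mono (Nat.zero_le _) hX)]
  exact partialDeriv_mem hX μ

include hA in
lemma field_mul_mem {Y : Spacetime d → ℝ} (hY : Y ∈ decaySpace d 0) (a : ι) (μ : Fin d) :
    A a μ * Y ∈ decaySpace d (2 * d - 2) := mul_mem_decay' (hA a μ) hY

include hA in
lemma field_mem_zero (a : ι) (μ : Fin d) : A a μ ∈ decaySpace d 0 :=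
  decaySpace_mono (Nat.zero_le _) (hA a μ)

include hA in
lemma field_mul_field_mem (a b : ι) (μ ν : Fin d) : A a μ * A b ν ∈ decaySpace d (2 * d - 2) :=
  field_mul_mem hA (field_mem_zero hA b ν) a μ

include hd hA

lemma tripleAlt_eq (a b : ι) (ρ μ l : Fin d) :
    tripleAlt (positionSpace d) A a b ρ μ l = tripleAlt P.toCalculus A a b ρ μ l := by
  simp only [tripleAlt, P.positionSpace_dG (field_mul_field_mem hA _ _ _ _),
    LinearCalculus.toCalculus_dG]

lemma tripleAlt_mem (a b : ι) (ρ μ l : Fin d) :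
    tripleAlt P.toCalculus A a b ρ μ l ∈ decaySpace d (d - 1) :=
  alt3_mem (fun ρ μ l => P.dG_mem hd (field_mul_field_mem hA a b μ l) ρ) ρ μ l

lemma field_mul_tripleAlt_mem (c a b : ι) (σ ρ μ l : Fin d) :
    A c σ * tripleAlt P.toCalculus A a b ρ μ l ∈ decaySpace d (2 * d - 2) :=
  field_mul_mem hA (decaySpace_mono (Nat.zero_le _) (P.tripleAlt_mem hd hA a b ρ μ l)) c σ

lemma field_mul_dG_mem {X : Spacetime d → ℝ} (hX : X ∈ decaySpace d (2 * d - 2)) (a : ι)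
    (μ ν : Fin d) : A a μ * P.dG ν X ∈ decaySpace d (2 * d - 2) :=
  field_mul_mem hA (P.dG_mem_zero hd hX ν) a μ

lemma tailTerm_mem (a b c : ι) : tailTerm P.toCalculus A a b c ∈ decaySpace d (2 * d - 2) :=
  Submodule.sum_mem _ fun _ _ => Submodule.sum_mem _ fun _ _ =>
    P.field_mul_dG_mem hd hA (field_mul_field_mem hA _ _ _ _) _ _ _

lemma tailTerm_eq (a b c : ι) : tailTerm (positionSpace d) A a b c = tailTerm P.toCalculus A a b c := by
  simp only [tailTerm, P.positionSpace_dG (field_mul_field_mem hA _ _ _ _),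
    LinearCalculus.toCalculus_dG]

lemma nicolai₁_positionSpace : nicolai₁ f (positionSpace d) A = nicolai₁ f P.toCalculus A := by
  ext1 a
  ext1 μ
  simp only [nicolai₁, P.positionSpace_dG (field_mul_field_mem hA _ _ _ _),
    LinearCalculus.toCalculus_dG]

lemma nicolai₂_positionSpace : nicolai₂ f (positionSpace d) A = nicolai₂ f P.toCalculus A := by
  ext1 a
  ext1 μ
  simp only [nicolai₂, P.tripleAlt_eq hd hA,
    P.positionSpace_dG (P.field_mul_tripleAlt_mem hd hA _ _ _ _ _ _ _), LinearCalculus.toCalculus_dG]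

/-- The integrals agree with their linear extensions only on functions of sufficient decay. The
facts `e1` to `e11` establish this decay for each argument in the formula, so the operations can be
exchanged from the inside outwards. -/
lemma nicolai₃_positionSpace : nicolai₃ f (positionSpace d) A = nicolai₃ f P.toCalculus A := by
  have e1 (a b : ι) (μ ν ρ : Fin d) := P.positionSpace_dG (field_mul_field_mem hA a b μ ν) ρ
  have e2 (a b c e : ι) (μ ν ρ σ τ υ φ : Fin d) := P.positionSpace_dG (mul_mem_decay
    (P.dG_mem hd (field_mul_field_mem hA a b μ ν) ρ) (P.tripleAlt_mem hd hA c e σ τ υ)) φ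
  have e3 (c a b : ι) (σ ρ μ l φ : Fin d) :=
    P.positionSpace_dG (P.field_mul_tripleAlt_mem hd hA c a b σ ρ μ l) φ
  have e4 (a b c : ι) (μ ν ρ σ τ : Fin d) :=
    P.positionSpace_dG (P.field_mul_dG_mem hd hA (field_mul_field_mem hA a b μ ν) c ρ σ) τ
  have e5 (a b c e : ι) (ρ μ l φ : Fin d) := P.positionSpace_dG (field_mul_mem hA (add_mem
    (neg_mem (Submodule.sum_mem _ fun σ (_ : σ ∈ Finset.univ) =>
      P.dG_mem_zero hd (P.field_mul_tripleAlt_mem hd hA a b c σ ρ μ l) σ))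
    (Submodule.sum_mem _ fun σ (_ : σ ∈ Finset.univ) => alt3_mem (fun ρ μ l =>
      P.dG_mem_zero hd (P.field_mul_dG_mem hd hA (field_mul_field_mem hA b c l σ) a μ σ) ρ)
      ρ μ l)) e l) φ
  have e6 (c e a b : ι) (l ρ σ φ μ ν τ : Fin d) :=
    P.positionSpace_dG (field_mul_mem hA (alt2_mem (fun x y =>
      P.dG_mem_zero hd (P.field_mul_tripleAlt_mem hd hA e a b y μ ν τ) x) ρ σ) c l) φ
  have e7 (a b c e : ι) (ρ μ φ : Fin d) := P.positionSpace_dG (alt2_mem (fun ρ μ =>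
    P.field_mul_dG_mem hd hA (P.tailTerm_mem hd hA a b c) e ρ μ) ρ μ) φ
  have e8 (a b c : ι) (ρ : Fin d) := P.positionSpace_dG (P.tailTerm_mem hd hA a b c) ρ
  have e9 (a b c : ι) := P.positionSpace_G (P.tailTerm_mem hd hA a b c)
  have e10 (a b c e : ι) (μ ρ : Fin d) := P.positionSpace_D (decaySpace_mono (Nat.zero_le _)
    (field_mul_mem hA (P.G_mem hd (P.tailTerm_mem hd hA a b c)) e μ)) ρ
  have e11 (a b c e : ι) (φ : Fin d) := P.positionSpace_dG (Submodule.sum_mem _ fun ρ (_ : ρ ∈ Finset.univ) =>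
    P.D_mem (field_mul_mem hA (P.G_mem hd (P.tailTerm_mem hd hA a b c)) e ρ) ρ) φ
  ext1 a
  ext1 μ
  have t1 : tripleAlt (positionSpace d) A = tripleAlt P.toCalculus A := by
    funext a b ρ μ l
    exact P.tripleAlt_eq hd hA a b ρ μ l
  have t2 : tailTerm (positionSpace d) A = tailTerm P.toCalculus A := by
    funext a b c
    exact P.tailTerm_eq hd hA a b c
  unfold nicolai₃
  rw [t1, t2]
  refine congrArg₂ _ (congrArg₂ _ (congrArg₂ _ (congrArg _ ?_) ?_) (congrArg _ ?_)) (congrArg _ ?_)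
  · simp only [e1]
    simp only [e2]
    rfl
  · simp only [e1]
    simp only [e3, e4]
    simp only [e5]
    rfl
  · refine Finset.sum_congr rfl fun b _ => Finset.sum_congr rfl fun c _ =>
      Finset.sum_congr rfl fun d' _ => Finset.sum_congr rfl fun e _ =>
      Finset.sum_congr rfl fun f' _ => Finset.sum_congr rfl fun g' _ => congrArg _ ?_
    refine congrArg₂ _ (congrArg₂ _ (congrArg₂ _ (congrArg₂ _ (congrArg _ ?_) (congrArg _ ?_))
      (congrArg _ ?_)) (congrArg _ ?_)) ?_
    · simp only [e3]
      simp only [e6]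
      rfl
    · simp only [e3]
      simp only [e6]
      rfl
    · simp only [e3]
      simp only [e6]
      rfl
    · simp only [e8]
      simp only [e7]
      rfl
    · simp only [e9]
      simp only [e10]
      rw [e11]
      rfl
  · simp only [e9]
    rfl

end Transfer

end PositionCalculus

end

end NicolaiMap

namespace NicolaiMap

noncomputable section

open scoped BigOperators
open MeasureTheory

set_option linter.unusedSectionVars false

/-! ### The gauge condition and the action on decaying fields -/

namespace DecayCalculus

variable {d : ℕ} {V : Type*} [AddCommGroup V] [Module ℝ V] (C : DecayCalculus d V)

/-- The free action is the square of the exterior derivative. -/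
lemma pair_free {X : Fin d → V} (hX : ∀ μ, X μ ∈ C.H) :
    ∑ μ, C.pair (X μ) ((∑ ν, C.D ν (C.D ν (X μ))) - C.D μ (∑ ν, C.D ν (X ν))) =
      - (1 / 2) * C.pair₂ (C.ext X) (C.ext X) := by
  have h1 (μ : Fin d) : (∑ ν, C.D ν (C.D ν (X μ))) - C.D μ (∑ ν, C.D ν (X ν)) =
      ∑ ν, C.D ν (C.ext X ν μ) := by
    simp only [ext, map_sub, map_sum, Finset.sum_sub_distrib]
    congr 1
    exact Finset.sum_congr rfl fun ν _ => C.D_comm _ _ (C.H_le (hX ν))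
  have h2 (μ ν : Fin d) : C.pair (X μ) (C.D ν (C.ext X ν μ)) =
      - C.pair (C.D ν (X μ)) (C.ext X ν μ) := by
    have hE : C.ext X ν μ ∈ C.H := sub_mem (C.D_H _ (hX _)) (C.D_H _ (hX _))
    rw [C.pair_D ν (hX μ) hE, neg_neg]
  have h3 : C.pair₂ (C.ext X) (C.ext X) =
      2 * ∑ μ, ∑ ν, C.pair (C.D ν (X μ)) (C.ext X ν μ) := by
    have e (μ ν : Fin d) : C.pair (C.ext X μ ν) (C.ext X μ ν) =
        C.pair (C.D μ (X ν)) (C.ext X μ ν) + C.pair (C.D ν (X μ)) (C.ext X ν μ) := by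
      simp only [ext, map_sub, LinearMap.sub_apply]
      ring
    rw [pair₂_apply, Finset.sum_congr rfl fun μ _ => Finset.sum_congr rfl fun ν _ => e μ ν]
    simp only [Finset.sum_add_distrib]
    rw [Finset.sum_comm, two_mul]
  rw [h3, Finset.sum_congr rfl fun μ _ => congrArg (C.pair (X μ)) (h1 μ)]
  simp only [map_sum, h2, Finset.sum_neg_distrib]
  ring

end DecayCalculus

namespace PositionCalculus

variable {d : ℕ} (P : PositionCalculus d) (hd : 3 ≤ d)
variable {ι : Type*} [Fintype ι] [DecidableEq ι] {f : ι → ι → ι → ℝ} {N : ℝ}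
  (hf : IsStructureConstants f N)

/-- The coefficient of `g^n` in the Nicolai map, as a one-form with values in multiplets. -/
def order (f : ι → ι → ι → ℝ) (A : GaugeField ι d (Spacetime d → ℝ)) :
    ℕ → Fin d → ι → Spacetime d → ℝ
  | 0 => fun μ a => A a μ
  | 1 => (P.multiplet f).first fun μ a => A a μ
  | 2 => (P.multiplet f).second fun μ a => A a μ
  | 3 => (P.multiplet f).third fun μ a => A a μ
  | _ => 0

/-- The Nicolai map as a one-form with values in multiplets. -/
def image (f : ι → ι → ι → ℝ) (A : GaugeField ι d (Spacetime d → ℝ)) (g : ℝ) :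
    Fin d → ι → Spacetime d → ℝ :=
  P.order f A 0 + g • P.order f A 1 + g ^ 2 • P.order f A 2 + g ^ 3 • P.order f A 3

section

variable {A : GaugeField ι d (Spacetime d → ℝ)} (hA : ∀ a μ, A a μ ∈ decaySpace d (2 * d - 2))
include P hd hf hA

lemma nicolaiMap_eq (g : ℝ) (a : ι) (μ : Fin d) :
    nicolaiMap f (positionSpace d) g A a μ = P.image f A g μ a := by
  simp only [nicolaiMap, Finset.sum_range_succ, Finset.sum_range_zero, zero_add, nicolaiCoeff,
    P.nicolai₁_positionSpace hd hA, P.nicolai₂_positionSpace hd hA, P.nicolai₃_positionSpace hd hA,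
    Pi.add_apply, Pi.smul_apply, nicolai₁_eq, nicolai₂_eq f _ A hf.antisymm_right,
    nicolai₃_eq f _ A hf.antisymm_right, pow_zero, pow_one, one_smul, image, order]

lemma image_mem (g : ℝ) (μ : Fin d) : P.image f A g μ ∈ (P.decayCalculus hd hf).H := by
  have hA' (μ : Fin d) : (fun a => A a μ) ∈ (P.decayCalculus hd hf).N := fun a => hA a μ
  refine add_mem (add_mem (add_mem ?_ (Submodule.smul_mem _ _ ?_)) (Submodule.smul_mem _ _ ?_))
    (Submodule.smul_mem _ _ ?_)
  · exact (P.decayCalculus hd hf).N_le (hA' μ)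
  · exact DecayCalculus.first_mem hA' μ
  · exact DecayCalculus.second_mem hA' μ
  · exact DecayCalculus.third_mem hA' μ

lemma contDiff_nicolaiMap (g : ℝ) (a : ι) (μ : Fin d) :
    ContDiff ℝ (⊤ : ℕ∞) (nicolaiMap f (positionSpace d) g A a μ) := by
  rw [P.nicolaiMap_eq hd hf hA]
  exact contDiff_of_mem (P.image_mem hd hf hA g μ a)

lemma divergence_nicolaiMap (g : ℝ) :
    divergence (positionSpace d) (nicolaiMap f (positionSpace d) g A) =
      divergence (positionSpace d) A := by
  have hA' (μ : Fin d) : (fun a => A a μ) ∈ (P.decayCalculus hd hf).N := fun a => hA a μ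
  have h1 : ∑ μ, (P.decayCalculus hd hf).D μ (P.order f A 1 μ) = 0 := DecayCalculus.sum_D_first hA'
  have h2 : ∑ μ, (P.decayCalculus hd hf).D μ (P.order f A 2 μ) = 0 := DecayCalculus.sum_D_second hA'
  have h3 : ∑ μ, (P.decayCalculus hd hf).D μ (P.order f A 3 μ) = 0 := DecayCalculus.sum_D_third hA'
  have h : ∑ μ, (P.decayCalculus hd hf).D μ (P.image f A g μ) =
      ∑ μ, (P.decayCalculus hd hf).D μ (fun a => A a μ) := by
    simp only [image, Pi.add_apply, Pi.smul_apply, map_add, map_smul, Finset.sum_add_distrib,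
      ← Finset.smul_sum, h1, h2, h3, smul_zero, add_zero]
    rfl
  ext1 a
  have ha := congrFun h a
  rw [Finset.sum_apply, Finset.sum_apply] at ha
  simp only [divergence, P.nicolaiMap_eq hd hf hA]
  rw [Finset.sum_congr rfl fun μ _ => P.positionSpace_D
      (decaySpace_mono (Nat.zero_le _) (P.image_mem hd hf hA g μ a)) μ,
    Finset.sum_congr rfl fun μ _ => P.positionSpace_D (field_mem_zero hA a μ) μ]
  exact ha

end

section Action

variable {A : GaugeField ι d (Spacetime d → ℝ)}

include hd in
lemma integrable_of_mem {X : Spacetime d → ℝ} (hX : X ∈ decaySpace d (2 * d - 2)) : Integrable X :=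
  integrable_of_hasDecay hd (hX 0).1 (hX 0).2

lemma freeLagrangian_eq {s : ℕ} (hA : ∀ a μ, A a μ ∈ decaySpace d s) :
    freeLagrangian (positionSpace d) A = freeLagrangian P.toCalculus A := by
  have hA0 (a : ι) (μ : Fin d) : A a μ ∈ decaySpace d 0 := decaySpace_mono (Nat.zero_le _) (hA a μ)
  have h1 (a : ι) (μ ν : Fin d) := P.positionSpace_D (hA0 a μ) ν
  have h2 (a : ι) (μ ν ρ : Fin d) := P.positionSpace_D (P.D_mem (hA0 a μ) ν) ρ
  have h3 (a : ι) (μ : Fin d) := P.positionSpace_D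
    (Submodule.sum_mem _ fun ν (_ : ν ∈ Finset.univ) => P.D_mem (hA0 a ν) ν) μ
  simp only [freeLagrangian, h1, h2, h3, LinearCalculus.toCalculus_D]

lemma freeLagrangian_mem (hA : ∀ a μ, A a μ ∈ decaySpace d (d - 1)) :
    freeLagrangian P.toCalculus A ∈ decaySpace d (2 * d - 2) :=
  Submodule.smul_mem _ _ (Submodule.sum_mem _ fun a _ => Submodule.sum_mem _ fun μ _ =>
    mul_mem_decay (hA a μ) (sub_mem (Submodule.sum_mem _ fun ν _ => P.D_mem (P.D_mem (hA a μ) ν) ν)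
      (P.D_mem (Submodule.sum_mem _ fun ν _ => P.D_mem (hA a ν) ν) μ)))

lemma int_freeLagrangian (hA : ∀ a μ, A a μ ∈ decaySpace d (d - 1)) :
    P.int (freeLagrangian P.toCalculus A) = - (1 / 4) *
      (P.decayCalculus hd hf).pair₂ ((P.decayCalculus hd hf).ext fun μ a => A a μ)
        ((P.decayCalculus hd hf).ext fun μ a => A a μ) := by
  have h := (P.decayCalculus hd hf).pair_free (X := fun μ a => A a μ) fun μ a => hA a μ
  have e : P.int (freeLagrangian P.toCalculus A) = (1 / 2) * ∑ μ, (P.decayCalculus hd hf).pair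
      (fun a => A a μ) ((∑ ν, (P.decayCalculus hd hf).D ν ((P.decayCalculus hd hf).D ν fun a => A a μ))
        - (P.decayCalculus hd hf).D μ (∑ ν, (P.decayCalculus hd hf).D ν fun a => A a ν)) := by
    rw [freeLagrangian, map_smul, smul_eq_mul, Finset.sum_comm, map_sum]
    congr 1
    refine Finset.sum_congr rfl fun μ _ => ?_
    change _ = P.int _
    congr 1
    refine Finset.sum_congr rfl fun a _ => ?_
    congr 1
    change _ = (∑ ν, (P.decayCalculus hd hf).D ν ((P.decayCalculus hd hf).D ν fun a => A a μ)) a -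
      P.D μ ((∑ ν, (P.decayCalculus hd hf).D ν fun a => A a ν) a)
    rw [Finset.sum_apply, Finset.sum_apply]
    rfl
  rw [e, h]
  ring

lemma fieldStrength_eq (hA : ∀ a μ, A a μ ∈ decaySpace d (2 * d - 2)) (g : ℝ) (a : ι) (μ ν : Fin d) :
    fieldStrength f (positionSpace d) g A a μ ν =
      ((P.decayCalculus hd hf).ext (fun μ a => A a μ) +
        g • (P.decayCalculus hd hf).comm fun μ a => A a μ) μ ν a := by
  simp only [fieldStrength, P.positionSpace_D (field_mem_zero hA _ _)]
  rfl

variable (hA : ∀ a μ, A a μ ∈ decaySpace d (2 * d - 2))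
include hA

lemma fieldStrength_mem (g : ℝ) (μ ν : Fin d) : ((P.decayCalculus hd hf).ext (fun μ a => A a μ) +
    g • (P.decayCalculus hd hf).comm fun μ a => A a μ) μ ν ∈ (P.decayCalculus hd hf).N := by
  have hA' (μ : Fin d) : (fun a => A a μ) ∈ (P.decayCalculus hd hf).N := fun a => hA a μ
  exact add_mem (DecayCalculus.ext_mem hA' μ ν)
    (Submodule.smul_mem _ _ (DecayCalculus.comm_mem hA' μ ν))

include P hd hf in
lemma yangMillsLagrangian_mem (g : ℝ) :
    yangMillsLagrangian f (positionSpace d) g A ∈ decaySpace d (2 * d - 2) := by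
  unfold yangMillsLagrangian
  simp only [P.fieldStrength_eq hd hf hA]
  refine Submodule.smul_mem _ _ (Submodule.sum_mem _ fun a _ => Submodule.sum_mem _ fun μ _ =>
    Submodule.sum_mem _ fun ν _ => ?_)
  have := P.fieldStrength_mem hd hf hA g μ ν a
  exact mul_mem_decay' this (decaySpace_mono (Nat.zero_le _) this)

lemma int_yangMillsLagrangian (g : ℝ) :
    P.int (yangMillsLagrangian f (positionSpace d) g A) = - (1 / 4) *
      (P.decayCalculus hd hf).pair₂
        ((P.decayCalculus hd hf).ext (fun μ a => A a μ) +
          g • (P.decayCalculus hd hf).comm fun μ a => A a μ)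
        ((P.decayCalculus hd hf).ext (fun μ a => A a μ) +
          g • (P.decayCalculus hd hf).comm fun μ a => A a μ) := by
  unfold yangMillsLagrangian
  simp only [P.fieldStrength_eq hd hf hA]
  rw [map_smul, smul_eq_mul, Finset.sum_comm,
    Finset.sum_congr rfl fun μ _ => Finset.sum_comm, map_sum, DecayCalculus.pair₂_apply]
  congr 1
  refine Finset.sum_congr rfl fun μ _ => ?_
  rw [map_sum]
  rfl

include P hd hf in
lemma integrable_freeLagrangian (g : ℝ) :
    Integrable (freeLagrangian (positionSpace d) (nicolaiMap f (positionSpace d) g A)) := by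
  have h (a : ι) (μ : Fin d) : nicolaiMap f (positionSpace d) g A a μ ∈ decaySpace d (d - 1) := by
    rw [P.nicolaiMap_eq hd hf hA]
    exact P.image_mem hd hf hA g μ a
  rw [P.freeLagrangian_eq h]
  exact integrable_of_mem hd (P.freeLagrangian_mem h)

include P hd hf in
lemma integrable_yangMillsLagrangian (g : ℝ) :
    Integrable (yangMillsLagrangian f (positionSpace d) g A) :=
  integrable_of_mem hd (P.yangMillsLagrangian_mem hd hf hA g)

include P hd hf in
-- Both actions are polynomials in `g`. The coefficients of the free one are the pairings `q m n` of
-- the exterior derivatives of the orders of the map, and the three action identities match the two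
-- polynomials through order three. The difference is `g⁴` times a polynomial, hence `O(g⁴)`.
theorem action_nicolaiMap :
    (fun g : ℝ => (∫ x, freeLagrangian (positionSpace d) (nicolaiMap f (positionSpace d) g A) x) -
      ∫ x, yangMillsLagrangian f (positionSpace d) g A x) =O[nhds 0] fun g : ℝ => g ^ 4 := by
  have hA' (μ : Fin d) : (fun a => A a μ) ∈ (P.decayCalculus hd hf).N := fun a => hA a μ
  let C := P.decayCalculus hd hf
  have hm (g : ℝ) (a : ι) (μ : Fin d) :
      nicolaiMap f (positionSpace d) g A a μ ∈ decaySpace d (d - 1) := by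
    rw [P.nicolaiMap_eq hd hf hA]
    exact P.image_mem hd hf hA g μ a
  let E (n : ℕ) : Fin d → Fin d → ι → Spacetime d → ℝ := C.ext (P.order f A n)
  let q (m n : ℕ) : ℝ := C.pair₂ (E m) (E n)
  have hq (m n : ℕ) : q m n = q n m := C.pair₂_comm _ _
  have h1 : q 0 1 = C.pair₂ (E 0) (C.comm fun μ a => A a μ) := DecayCalculus.action_order_one hA'
  have h2 : 2 * q 0 2 + q 1 1 = C.pair₂ (C.comm fun μ a => A a μ) (C.comm fun μ a => A a μ) :=
    DecayCalculus.action_order_two hA'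
  have h3 : q 1 2 + q 0 3 = 0 := DecayCalculus.action_order_three hA'
  have key (g : ℝ) : (∫ x, freeLagrangian (positionSpace d) (nicolaiMap f (positionSpace d) g A) x) -
      ∫ x, yangMillsLagrangian f (positionSpace d) g A x =
      g ^ 4 * (- (1 / 4) * (2 * q 1 3 + q 2 2 + 2 * g * q 2 3 + g ^ 2 * q 3 3)) := by
    have hE : C.ext (P.image f A g) = E 0 + g • E 1 + g ^ 2 • E 2 + g ^ 3 • E 3 := by
      funext μ ν
      simp only [E, DecayCalculus.ext, image, Pi.add_apply, Pi.smul_apply, map_add, map_smul]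
      module
    rw [P.freeLagrangian_eq (hm g), ← P.int_eq _ (P.freeLagrangian_mem (hm g)),
      ← P.int_eq _ (P.yangMillsLagrangian_mem hd hf hA g), P.int_yangMillsLagrangian hd hf hA,
      P.int_freeLagrangian hd hf (hm g)]
    simp only [P.nicolaiMap_eq hd hf hA]
    change - (1 / 4) * C.pair₂ (C.ext (P.image f A g)) (C.ext (P.image f A g)) - - (1 / 4) *
      C.pair₂ (E 0 + g • C.comm fun μ a => A a μ) (E 0 + g • C.comm fun μ a => A a μ) = _
    rw [hE]
    simp only [map_add, map_smul, LinearMap.add_apply, LinearMap.smul_apply, smul_eq_mul]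
    rw [C.pair₂_comm (C.comm _) (E 0), ← h1, ← h2]
    change - (1 / 4) * (q 0 0 + g * q 1 0 + g ^ 2 * q 2 0 + g ^ 3 * q 3 0 +
      g * (q 0 1 + g * q 1 1 + g ^ 2 * q 2 1 + g ^ 3 * q 3 1) +
      g ^ 2 * (q 0 2 + g * q 1 2 + g ^ 2 * q 2 2 + g ^ 3 * q 3 2) +
      g ^ 3 * (q 0 3 + g * q 1 3 + g ^ 2 * q 2 3 + g ^ 3 * q 3 3)) -
      - (1 / 4) * (q 0 0 + g * q 0 1 + g * (q 0 1 + g * (2 * q 0 2 + q 1 1))) = _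
    rw [hq 1 0, hq 2 0, hq 3 0, hq 2 1, hq 3 1, hq 3 2]
    linear_combination (- (1 / 2) * g ^ 3) * h3
  simp only [key]
  have hc : Continuous fun g : ℝ =>
      - (1 / 4) * (2 * q 1 3 + q 2 2 + 2 * g * q 2 3 + g ^ 2 * q 3 3) := by fun_prop
  simpa using (Asymptotics.isBigO_refl (fun g : ℝ => g ^ 4) (nhds 0)).mul
    (hc.continuousAt.isBigO_one ℝ)

end Action

end PositionCalculus

/-! ### Absolute convergence of the integrals -/

section Convergence

variable {d : ℕ} (hd : 3 ≤ d) {ι : Type*} {A : GaugeField ι d (Spacetime d → ℝ)}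

lemma IsTestField.mem (hA : IsTestField A) (a : ι) (μ : Fin d) (s : ℕ) : A a μ ∈ decaySpace d s :=
  mem_decaySpace_of_hasCompactSupport (hA a μ).1 (hA a μ).2

include hd

lemma convergesDG_of_mem {X : Spacetime d → ℝ} (hX : X ∈ decaySpace d (2 * d - 2)) :
    ConvergesDG X := fun μ =>
  (isKernel_partialDeriv_propagator hd μ).integrable hd (hX 0).1 (hX 0).2

lemma convergesG_of_mem {X : Spacetime d → ℝ} (hX : X ∈ decaySpace d (2 * d - 2)) : ConvergesG X :=
  (isKernel_propagator hd).integrable hd (hX 0).1 (hX 0).2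

lemma IsTestField.integralsConverge (hA : IsTestField A) : IntegralsConverge A := by
  have hN (a : ι) (μ : Fin d) {Y : Spacetime d → ℝ} (hY : Y ∈ decaySpace d 0) :
      A a μ * Y ∈ decaySpace d (2 * d - 2) := mul_mem_decay' (hA.mem a μ _) hY
  have hG {X : Spacetime d → ℝ} (hX : X ∈ decaySpace d (2 * d - 2)) :
      (positionSpace d).G X ∈ decaySpace d 0 := (isKernel_propagator hd).convolve_mem hd hX
  have hdG {X : Spacetime d → ℝ} (μ : Fin d) (hX : X ∈ decaySpace d (2 * d - 2)) :
      (positionSpace d).dG μ X ∈ decaySpace d (d - 1) :=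
    (isKernel_partialDeriv_propagator hd μ).convolve_mem hd hX
  have h1 (a b : ι) (α β : Fin d) := hN a α (hA.mem b β 0)
  have h2 (a b c : ι) (α β γ μ : Fin d) :=
    hN a α (decaySpace_mono (Nat.zero_le _) (hdG μ (h1 b c β γ)))
  exact
    { level₁ := fun a b α β => convergesDG_of_mem hd (h1 a b α β)
      level₂ := fun a b c α β γ μ => convergesDG_of_mem hd (h2 a b c α β γ μ)
      level₂G := fun a b c α β γ μ => convergesG_of_mem hd (h2 a b c α β γ μ)
      level₃ := fun a b c e α β γ δ μ ν => convergesDG_of_mem hd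
        (hN a α (decaySpace_mono (Nat.zero_le _) (hdG μ (h2 b c e β γ δ ν))))
      level₃_prod := fun a b c e α β γ δ μ ν => convergesDG_of_mem hd
        (mul_mem_decay (hdG μ (h1 a b α β)) (hdG ν (h1 c e γ δ)))
      level₃_deriv := fun a b c e α β γ δ μ ν => convergesDG_of_mem hd
        (partialDeriv_mem (hN a α (hG (h2 b c e β γ δ ν))) μ) }

end Convergence

end

end NicolaiMap

theorem mainTheorem2 {ι : Type*} [Fintype ι] [DecidableEq ι] [Nonempty ι]
    (d : ℕ) (hd : 3 ≤ d)
    (f : ι → ι → ι → ℝ) (N : ℝ) (hN : 0 < N) (hf : NicolaiMap.IsStructureConstants f N) :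
    -- the map is well defined on test fields
    (∀ A : NicolaiMap.GaugeField ι d (NicolaiMap.Spacetime d → ℝ), NicolaiMap.IsTestField A →
      NicolaiMap.IntegralsConverge A ∧
      ∀ (g : ℝ) (a : ι) (μ : Fin d), ContDiff ℝ (⊤ : ℕ∞)
        (NicolaiMap.nicolaiMap f (NicolaiMap.positionSpace d) g A a μ)) ∧
    -- the gauge condition
    (∀ A : NicolaiMap.GaugeField ι d (NicolaiMap.Spacetime d → ℝ), NicolaiMap.IsTestField A →
      ∀ g : ℝ, NicolaiMap.divergence (NicolaiMap.positionSpace d)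
          (NicolaiMap.nicolaiMap f (NicolaiMap.positionSpace d) g A) =
        NicolaiMap.divergence (NicolaiMap.positionSpace d) A) ∧
    -- the free action
    (∀ A : NicolaiMap.GaugeField ι d (NicolaiMap.Spacetime d → ℝ), NicolaiMap.IsTestField A →
      (∀ g : ℝ, MeasureTheory.Integrable
        (NicolaiMap.freeLagrangian (NicolaiMap.positionSpace d)
          (NicolaiMap.nicolaiMap f (NicolaiMap.positionSpace d) g A))) ∧
      (∀ g : ℝ, MeasureTheory.Integrable
        (NicolaiMap.yangMillsLagrangian f (NicolaiMap.positionSpace d) g A)) ∧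
      (fun g : ℝ =>
        (∫ x, NicolaiMap.freeLagrangian (NicolaiMap.positionSpace d)
          (NicolaiMap.nicolaiMap f (NicolaiMap.positionSpace d) g A) x) -
        ∫ x, NicolaiMap.yangMillsLagrangian f (NicolaiMap.positionSpace d) g A x)
        =O[nhds 0] fun g : ℝ => g ^ 4) ∧
    -- the determinants
    (∀ (m : ℕ) (_ : 0 < m) (γ : Fin d → Matrix (Fin m) (Fin m) ℂ)
      (_ : NicolaiMap.IsGammaMatrices γ) (r : ℝ),
      (∀ n ∈ ({1, 2, 3} : Finset ℕ),
        ∀ A : NicolaiMap.GaugeField ι d (NicolaiMap.PlaneWaves d), NicolaiMap.IsLandauField A →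
          NicolaiMap.LoopEq (NicolaiMap.logJacobian f A n)
            (NicolaiMap.logMSS γ r f A n + NicolaiMap.logFP f A n)) ↔
      r = 2 * ((d : ℝ) - 2)) := by 
  have : NeZero d := ⟨by omega⟩
  obtain ⟨P⟩ := NicolaiMap.nonempty_positionCalculus hd
  refine ⟨fun A hA => ⟨hA.integralsConverge hd, fun g a μ =>
      P.contDiff_nicolaiMap hd hf (fun a μ => hA.mem a μ _) g a μ⟩,
    fun A hA g => P.divergence_nicolaiMap hd hf (fun a μ => hA.mem a μ _) g,
    fun A hA => ⟨P.integrable_freeLagrangian hd hf fun a μ => hA.mem a μ _,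
      P.integrable_yangMillsLagrangian hd hf fun a μ => hA.mem a μ _,
      P.action_nicolaiMap hd hf fun a μ => hA.mem a μ _⟩,
    fun m hm γ hγ r => ⟨fun h => ?_, ?_⟩⟩
  -- Order two alone forces the value of `r`, tested on a standing wave of nonzero vacuum
  -- polarisation.
  · obtain ⟨A, hA, hne⟩ := NicolaiMap.exists_isLandauField_spinorSquare_ne_zero hd hf hN.ne'
      (Classical.arbitrary ι)
    have h2 := (NicolaiMap.loopEq_iff_order_two hf hA hm hγ r).1 (h 2 (by simp) A hA)
    rw [smul_eq_zero_iff_left hne] at h2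
    exact sub_eq_zero.1 (by exact_mod_cast h2)
  · rintro rfl n hn A hA
    exact NicolaiMap.loopEq_logJacobian hf hA hm hγ hn
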